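/- **Setting.** A quantum Markov chain (QMC) $\mathcal G=(\mathcal H,\mathcal E,\rho_0)$ consists of $\mathcal H=\mathbb C^d$, a super-operator $\mathcal E(\rho)=\sum_{k<r}E_k\rho E_k^\dagger$ with $r\le d^2$ and $\sum_kE_k^\dagger E_k=I$, and a density matrix $\rho_0$. It is *periodically stable* if for some integer $\theta>0$ the sequence $\mathcal E^{n\theta}(\rho_0)$ converges to a density matrix as $n\to\infty$; the least such $\theta$ is its period $p(\mathcal G)$. An atomic proposition $\langle M,\mathcal I\rangle$ consists of an operator $0\le M\le I$ and an interval $\mathcal I\subseteq[0,1]$; a state $\rho$ satisfies it if $\operatorname{tr}(M\rho)\in\mathcal I$. Let $AP$ be a finite family of atomic propositions, let $L(\rho)$ be the set of those that $\rho$ satisfies, and let $\varphi$ be an MLTL formula over $AP$ (built from $\mathbf{true}$, atoms, $\neg,\lor,\bigcirc,U$, with the usual LTL semantics), with $|\varphi|$ nodes and language $\mathcal L_\omega(\varphi)\subseteq(2^{AP})^\omega$. Write $\mathcal G\models\varphi$ if the word $L(\rho_0)L(\mathcal E(\rho_0))L(\mathcal E^2(\rho_0))\cdots$ is in $\mathcal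 L_\omega(\varphi)$. Let $\|A\|=\sqrt{\operatorname{tr}(A^\dagger A)}$ and $\varepsilon>0$. The $\varepsilon$-neighborhood of a state is $N_\varepsilon(\rho)=\{L(\rho'):\rho'\text{ a density matrix},\ \|\rho-\rho'\|<\varepsilon\}$. Let $\mathcal M_{\mathcal E}=\sum_kE_k\otimes E_k^*=SJS^{-1}$ be a Jordan decomposition. Let $J_\phi$ be the diagonal $0/1$ matrix that marks the diagonal entries of $J$ of modulus $1$, let $\mathcal E_\phi$ be the map with matrix $SJ_\phi S^{-1}$, and let $\eta_k=\mathcal E_\phi(\mathcal E^k(\rho_0))$. An integer $K>0$ is *admissible* if $L(\mathcal E^n(\rho_0))\in N_\varepsilon(\eta_{n\bmod p(\mathcal G)})$ for all $n\ge K$. For such $K$, let $N_\varepsilon^K(\sigma(\mathcal G))$ be the set of words $\xi\in(2^{AP})^\omega$ with $\xi[n]=L(\mathcal E^n(\rho_0))$ for $n<K$ and $\xi[n]\in N_\varepsilon(\eta_{n\bmod p(\mathcal G)})$ for $n\ge K$. Let $K^\varepsilon$ be the least $K>0$ with $\|S\|\,\|S^{-1}\|\,\|J_<^{\,n}\|<\min(\varepsilon,1)$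 for all $n\ge K$, where $J_<$ is obtained from $J$ by keeping the rows whose diagonal entry has modulus $<1$ and replacing the others by zero. **Cost model.** Programs run on a random access machine with registers for natural numbers and for exact complex numbers. A step is one assignment of an expression of the program ($+$ and truncated $-$ on natural numbers; $+,-,\times,{}^{-1}$ and conjugation on complex numbers), or one test ($\le$ on natural numbers or on real parts). The following operations on $d\times d$ operators also count one step each: applying a stored $d^2\times d^2$ matrix, viewed as a linear map on operators, to an operator; deciding whether a state satisfies a given atomic proposition; deciding a semi-definite feasibility query, i.e. whether some state at distance less than $\varepsilon$ from a given state satisfies all atomic propositions of one list and violates all of another. A Jordan decomposition of an $n\times n$ matrix (returning $S$, $J$, $S^{-1}$) counts $n^4+1$ steps; any procedure that returns Jordan decompositions may be used, and $S,J$ above are those it returns for $\mathcal M_{\mathcal E}$. The input consists of $d$, the $E_k$, $\rho_0$, $\varepsilon$ and a code of $\varphi$; the atomic propositions are accessed only through the operations above. **Theorem.** There are a program (the same for all inputs) and a constant $c$ such that for every periodically stable QMC $\mathcal G$, every $AP$, $\varphi$ and $\varepsilon>0$, with $K=K^\varepsilon$: the number $K$ is admissible, and the program halts within $$c\,\bigl(2^{c|\varphi|}\,(K+p(\mathcal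 G))+d^8\bigr)$$ steps with an answer in $\{\mathbf{true},\mathbf{false},\mathbf{unknown}\}$ such that 1. the answer is not $\mathbf{false}$ if and only if $N_\varepsilon^K(\sigma(\mathcal G))\cap\mathcal L_\omega(\varphi)\neq\emptyset$; 2. the answer is $\mathbf{true}$ if and only if $N_\varepsilon^K(\sigma(\mathcal G))\subseteq\mathcal L_\omega(\varphi)$; 3. if the answer is $\mathbf{true}$, then $\mathcal G\models\varphi$; if it is $\mathbf{false}$, then $\mathcal G\not\models\varphi$. The same, with the same time bound, holds for every admissible $K$, for a program that receives $K$ as an additional input. -/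

import Mathlib

open Matrix Filter Topology
open scoped ComplexOrder

namespace QMC

noncomputable section

/-! ### Quantum states and quantum Markov chains -/

/-- Operators on the `d`-dimensional Hilbert space `ℂ^d`, in the computational basis. -/
abbrev Op (d : ℕ) : Type := Matrix (Fin d) (Fin d) ℂ

/-- Quantum (mixed) states: positive semi-definite operators of unit trace. -/
def IsDensity {d : ℕ} (ρ : Op d) : Prop := ρ.PosSemidef ∧ ρ.trace = 1

/-- The Schatten 2-norm (Hilbert-Schmidt norm) `√ tr (A† A)`. -/
def hsNorm {d : ℕ} (A : Op d) : ℝ := √ (Aᴴ * A).trace.re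

/-- A quantum Markov chain on `ℂ^d`: a trace-preserving super-operator, presented by at most `d ^ 2`
Kraus operators, and an initial state. -/
structure Chain (d : ℕ) where
  numKraus : ℕ
  numKraus_le : numKraus ≤ d ^ 2
  kraus : Fin numKraus → Op d
  trace_preserving : ∑ k, (kraus k)ᴴ * kraus k = 1
  init : Op d
  init_density : IsDensity init

namespace Chain

variable {d : ℕ} (G : Chain d)

/-- The super-operator `ρ ↦ ∑ k, E_k ρ E_k†`. -/
def superOp (ρ : Op d) : Op d := ∑ k, G.kraus k * ρ * (G.kraus k)ᴴ

/-- The trajectory `ρ₀, 𝓔 ρ₀, 𝓔² ρ₀, …`. -/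
def traj (n : ℕ) : Op d := G.superOp^[n] G.init

/-- The positive integer `θ` is such that `𝓔^(n θ) ρ₀` converges to a quantum state. -/
def ConvergesAlong (θ : ℕ) : Prop :=
  0 < θ ∧ ∃ ρ : Op d, IsDensity ρ ∧ Tendsto (fun n : ℕ => G.traj (n * θ)) atTop (𝓝 ρ)

def PeriodicallyStable : Prop := ∃ θ, G.ConvergesAlong θ

/-- The period: the smallest `θ > 0` along which the trajectory converges. -/
def period : ℕ := sInf {θ | G.ConvergesAlong θ}

/-- The matrix representation `∑ k, E_k ⊗ E_k^*` of the super-operator, with row (and column)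
`(i, j)` of the tensor product at position `d * i + j`. -/
def matrixRep : Op (d * d) :=
  (∑ k, kroneckerMap (fun x y => x * y) (G.kraus k) ((G.kraus k).map star)).submatrix
    finProdFinEquiv.symm finProdFinEquiv.symm

end Chain

/-- The vectorization `(A ⊗ I) ∑ k, |k⟩|k⟩`: the entry `A i j` is at position `d * i + j`. -/
def vectorize {d : ℕ} (A : Op d) : Fin (d * d) → ℂ :=
  fun x => A (finProdFinEquiv.symm x).1 (finProdFinEquiv.symm x).2

def unvectorize {d : ℕ} (v : Fin (d * d) → ℂ) : Op d := of fun i j => v (finProdFinEquiv (i, j))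

/-- The linear map on operators represented by a `d² × d²` matrix. -/
def applyRep {d : ℕ} (N : Op (d * d)) (A : Op d) : Op d := unvectorize (N *ᵥ vectorize A)

/-! ### Jordan decompositions -/

/-- Jordan normal form: upper bidiagonal, with ones above the diagonal only inside blocks with a
constant diagonal and zeros above the diagonal otherwise. -/
def IsJordanForm {n : ℕ} (J : Op n) : Prop :=
  ∀ i j : Fin n, j ≠ i →
    J i j = 0 ∨ ((j : ℕ) = i + 1 ∧ J i j = 1 ∧ J i i = J j j)

/-- A Jordan decomposition `A = S J S⁻¹`. -/
structure JordanDecomposition {n : ℕ} (A : Op n) where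
  S : Op n
  J : Op n
  isUnit_det : IsUnit S.det
  isJordanForm : IsJordanForm J
  eq : A = S * J * S⁻¹

/-- A Jordan decomposition procedure: it returns a Jordan decomposition of each square matrix. -/
abbrev JordanProcedure : Type := ∀ (n : ℕ) (A : Op n), JordanDecomposition A

/-! Every square complex matrix has a Jordan decomposition, so Jordan decomposition procedures
exist. -/

section JordanExists

open Polynomial
open scoped DirectSum

theorem exists_jordan_basis_quotient (r : ℂ) (e : ℕ) :
    ∃ b : Module.Basis (Fin e) ℂ (ℂ[X] ⧸ Ideal.span {(X - C r) ^ e}),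
      ∀ k : Fin e, (X : ℂ[X]) • b k =
        r • b k + if h : 0 < (k : ℕ) then b ⟨k - 1, by omega⟩ else 0 := by
  have hm : ((X - C r) ^ e).Monic := (monic_X_sub_C r).pow e
  have hli : LinearIndependent ℂ (fun k : Fin e =>
      (Ideal.Quotient.mk (Ideal.span {(X - C r) ^ e}) ((X - C r) ^ (e - 1 - (k : ℕ))))) := by
    rw [Fintype.linearIndependent_iff]
    intro g hg
    have h1 : Ideal.Quotient.mk (Ideal.span {(X - C r) ^ e})
        (∑ k : Fin e, C (g k) * (X - C r) ^ (e - 1 - (k : ℕ))) = 0 := by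
      rw [← hg, map_sum]
      refine Finset.sum_congr rfl fun k _ => ?_
      rw [← smul_eq_C_mul]; rfl
    rw [Ideal.Quotient.eq_zero_iff_mem, Ideal.mem_span_singleton] at h1
    have h2 : (∑ k : Fin e, C (g k) * (X - C r) ^ (e - 1 - (k : ℕ))) = 0 := by
      by_contra hne
      have := Polynomial.degree_le_of_dvd h1 hne
      rw [degree_pow, degree_X_sub_C] at this
      have h3 : (∑ k : Fin e, C (g k) * (X - C r) ^ (e - 1 - (k : ℕ))).degree < (e : WithBot ℕ) := by
        rw [← mem_degreeLT]
        refine Submodule.sum_mem _ fun k _ => ?_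
        rw [mem_degreeLT]
        rw [← smul_eq_C_mul]
        refine (degree_smul_le _ _).trans_lt ?_
        rw [degree_pow, degree_X_sub_C]
        simp only [nsmul_eq_mul, mul_one]
        have := k.2
        exact_mod_cast (by omega : e - 1 - (k : ℕ) < e)
      simp only [nsmul_eq_mul, mul_one] at this
      exact absurd h3 (not_lt.mpr this)
    have h3 : ∑ k : Fin e, C (g k) * (X : ℂ[X]) ^ (e - 1 - (k : ℕ)) = 0 := by
      have := congrArg (compRingHom (X + C r)) h2
      simpa [map_sum] using this
    intro k
    have h4 := congrArg (fun q => q.coeff (e - 1 - (k : ℕ))) h3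
    simp only [finsetSum_coeff, coeff_C_mul, coeff_X_pow, coeff_zero] at h4
    rw [Finset.sum_eq_single k] at h4
    · simpa using h4
    · intro j _ hjk
      have h5 : (j : ℕ) ≠ k := fun h => hjk (Fin.ext h)
      have := j.2
      have := k.2
      rw [if_neg (by omega), mul_zero]
    · simp
  have hcard : Fintype.card (Fin e) = Module.finrank ℂ (ℂ[X] ⧸ Ideal.span {(X - C r) ^ e}) := by
    rw [finrank_quotient_span_eq_natDegree]
    simp [natDegree_pow]
  rcases Nat.eq_zero_or_pos e with rfl | he
  · have : Subsingleton (ℂ[X] ⧸ Ideal.span {(X - C r) ^ 0}) := by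
      rw [Ideal.Quotient.subsingleton_iff]; simp
    exact ⟨Module.Basis.empty _, fun k => k.elim0⟩
  have : Nonempty (Fin e) := ⟨⟨0, he⟩⟩
  refine ⟨basisOfLinearIndependentOfCardEqFinrank hli hcard, fun k => ?_⟩
  simp only [coe_basisOfLinearIndependentOfCardEqFinrank]
  have hk := k.2
  have key : ∀ q : ℂ[X], (X : ℂ[X]) • (Ideal.Quotient.mk (Ideal.span {(X - C r) ^ e}) q)
      = r • (Ideal.Quotient.mk (Ideal.span {(X - C r) ^ e}) q)
        + Ideal.Quotient.mk (Ideal.span {(X - C r) ^ e}) ((X - C r) * q) := by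
    intro q
    have : (X : ℂ[X]) * q = r • q + (X - C r) * q := by rw [smul_eq_C_mul]; ring
    calc _ = Ideal.Quotient.mk (Ideal.span {(X - C r) ^ e}) ((X : ℂ[X]) * q) := rfl
      _ = _ := by rw [this, map_add]; rfl
  rw [key, ← pow_succ']
  congr 1
  split_ifs with h
  · congr 2; omega
  · rw [Ideal.Quotient.eq_zero_iff_mem, Ideal.mem_span_singleton]
    exact pow_dvd_pow _ (by omega)

theorem dfinsupp_basis_apply {ι : Type} [DecidableEq ι] {M : ι → Type}
    [∀ i, AddCommGroup (M i)] [∀ i, Module ℂ (M i)] {η : ι → Type}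
    (b : ∀ i, Module.Basis (η i) ℂ (M i)) (i : ι) (k : η i) :
    DFinsupp.basis b ⟨i, k⟩ = DFinsupp.single i (b i k) := by
  classical
  apply (DFinsupp.basis b).repr.injective
  rw [Module.Basis.repr_self]
  symm
  change sigmaFinsuppEquivDFinsupp.symm (DFinsupp.mapRange (fun i => (b i).repr)
    (fun i ↦ map_zero _) (DFinsupp.single i (b i k))) = _
  rw [Equiv.symm_apply_eq, DFinsupp.mapRange_single]
  simp

theorem exists_jordan_basis {V : Type} [AddCommGroup V] [Module ℂ V] [Module.Finite ℂ V]
    (f : V →ₗ[ℂ] V) :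
    ∃ (m : ℕ) (e : Fin m → ℕ) (r : Fin m → ℂ) (b : Module.Basis (Σ i, Fin (e i)) ℂ V),
      ∀ (i : Fin m) (k : Fin (e i)), f (b ⟨i, k⟩) =
        r i • b ⟨i, k⟩ + if h : 0 < (k : ℕ) then b ⟨i, ⟨k - 1, by omega⟩⟩ else 0 := by
  classical
  obtain ⟨ι, _, p, hp, e, ⟨φ⟩⟩ := Module.equiv_directSum_of_isTorsion
    (Module.AEval.isTorsion_of_finiteDimensional ℂ V f)
  have hr : ∀ i, ∃ r : ℂ, Ideal.span {p i ^ e i} = Ideal.span {(X - C r) ^ e i} := by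
    intro i
    obtain ⟨r, hr⟩ := IsAlgClosed.exists_root (p i)
      (degree_pos_of_irreducible (hp i)).ne'
    refine ⟨r, ?_⟩
    rw [Ideal.span_singleton_eq_span_singleton]
    exact ((irreducible_X_sub_C r).associated_of_dvd (hp i) (dvd_iff_isRoot.mpr hr)).symm.pow_pow
  choose r hr using hr
  choose b hb using fun i => exists_jordan_basis_quotient (r i) (e i)
  let ψ : (⨁ i, ℂ[X] ⧸ Ideal.span {p i ^ e i}) ≃ₗ[ℂ[X]]
      (⨁ i, ℂ[X] ⧸ Ideal.span {(X - C (r i)) ^ e i}) :=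
    DFinsupp.mapRange.linearEquiv fun i => Submodule.quotEquivOfEq _ _ (hr i)
  let χ := (φ.trans ψ)
  let B : Module.Basis (Σ i, Fin (e i)) ℂ (⨁ i, ℂ[X] ⧸ Ideal.span {(X - C (r i)) ^ e i}) :=
    DFinsupp.basis b
  let B' : Module.Basis (Σ i, Fin (e i)) ℂ V :=
    B.map ((χ.restrictScalars ℂ).symm.trans (Module.AEval'.of f).symm)
  have hB' : ∀ (i : ι) (k : Fin (e i)), f (B' ⟨i, k⟩) =
      r i • B' ⟨i, k⟩ + if h : 0 < (k : ℕ) then B' ⟨i, ⟨k - 1, by omega⟩⟩ else 0 := by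
    intro i k
    have hval : ∀ k : Fin (e i), Module.AEval'.of f (B' ⟨i, k⟩) =
        χ.symm (DirectSum.lof ℂ[X] ι (fun i => ℂ[X] ⧸ Ideal.span {(X - C (r i)) ^ e i}) i
          (b i k)) := by
      intro k
      simp only [B', Module.Basis.map_apply, LinearEquiv.trans_apply,
        LinearEquiv.apply_symm_apply]
      have : B ⟨i, k⟩ = DirectSum.lof ℂ[X] ι
          (fun i => ℂ[X] ⧸ Ideal.span {(X - C (r i)) ^ e i}) i (b i k) :=
        dfinsupp_basis_apply b i k
      rw [this]; rfl
    apply (Module.AEval'.of f).injective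
    have hb' : (X : ℂ[X]) • b i k = (C (r i) : ℂ[X]) • b i k +
        if h : 0 < (k : ℕ) then b i ⟨k - 1, by omega⟩ else 0 := by
      rw [hb]; congr 1
      exact (IsScalarTower.algebraMap_smul ℂ[X] (r i) (b i k)).symm
    rw [← Module.AEval'.X_smul_of, hval, ← map_smul, ← map_smul, hb', map_add, map_add,
      map_add, map_smul, map_smul, map_smul, ← hval, Module.AEval.C_smul]
    congr 1
    split_ifs
    · rw [hval]
    · simp
  let q := Fintype.equivFin ι
  exact ⟨Fintype.card ι, fun j => e (q.symm j), fun j => r (q.symm j),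
    B'.reindex (q.symm.sigmaCongrLeft (β := fun i => Fin (e i))).symm, fun j k => by
      simpa using hB' (q.symm j) k⟩

theorem exists_jordan (n : ℕ) (A : Matrix (Fin n) (Fin n) ℂ) : ∃ S J : Matrix (Fin n) (Fin n) ℂ,
    IsUnit S.det ∧ (∀ i j : Fin n, j ≠ i →
    J i j = 0 ∨ ((j : ℕ) = i + 1 ∧ J i j = 1 ∧ J i i = J j j)) ∧ A = S * J * S⁻¹ := by
  classical
  obtain ⟨m, e, r, b, hb⟩ := exists_jordan_basis (Matrix.toLin' A)
  have hcard : ∑ i, e i = n := by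
    have := Module.finrank_eq_card_basis b
    simpa using this.symm
  let τ : (Σ i, Fin (e i)) ≃ Fin n := finSigmaFinEquiv.trans (finCongr hcard)
  have hτ : ∀ (i : Fin m) (k l : Fin (e i)), (k : ℕ) = l + 1 →
      ((τ ⟨i, k⟩ : Fin n) : ℕ) = τ ⟨i, l⟩ + 1 := by
    intro i k l h
    simp [τ, h, add_assoc]
  let B := b.reindex τ
  let P := Pi.basisFun ℂ (Fin n)
  have hS : P.toMatrix B * B.toMatrix P = 1 := P.toMatrix_mul_toMatrix_flip B
  have hS' : (P.toMatrix B)⁻¹ = B.toMatrix P := Matrix.inv_eq_right_inv hS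
  have hJ : ∀ (i : Fin n) (l : Fin m) (k : Fin (e l)),
      LinearMap.toMatrix B B (Matrix.toLin' A) i (τ ⟨l, k⟩) =
        r l * (if τ ⟨l, k⟩ = i then 1 else 0) +
          if h : 0 < (k : ℕ) then (if τ ⟨l, ⟨k - 1, by omega⟩⟩ = i then 1 else 0) else 0 := by
    intro i l k
    rw [LinearMap.toMatrix_apply]
    have hBb : ∀ x, b x = B (τ x) := fun x => by simp [B]
    have : B (τ ⟨l, k⟩) = b ⟨l, k⟩ := (hBb _).symm
    rw [this, hb]
    by_cases h0 : 0 < (k : ℕ)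
    · rw [dif_pos h0, dif_pos h0, hBb, hBb]
      simp only [map_add, map_smul, Module.Basis.repr_self, Finsupp.add_apply,
        Finsupp.smul_apply, Finsupp.single_apply, smul_eq_mul]
    · rw [dif_neg h0, dif_neg h0, hBb]
      simp only [add_zero, map_smul, Module.Basis.repr_self,
        Finsupp.smul_apply, Finsupp.single_apply, smul_eq_mul]
  refine ⟨P.toMatrix B, LinearMap.toMatrix B B (Matrix.toLin' A), ?_, ?_, ?_⟩
  · have := congrArg Matrix.det hS
    rw [Matrix.det_mul, Matrix.det_one] at this
    exact IsUnit.of_mul_eq_one _ this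
  · intro i j hij
    obtain ⟨⟨l, k⟩, rfl⟩ := τ.surjective j
    rw [hJ, if_neg hij, mul_zero, zero_add]
    split_ifs with h h'
    · right
      have h1 := hτ l k ⟨k - 1, by omega⟩ (by simp; omega)
      refine ⟨by rw [h1, h'], rfl, ?_⟩
      rw [hJ, if_pos rfl, ← h', hJ, if_pos rfl]
      have hne : ∀ (x : Fin (e l)) (y : Fin (e l)), (x : ℕ) < y → τ ⟨l, x⟩ ≠ τ ⟨l, y⟩ := by
        intro x y hxy h
        have := τ.injective h
        simp only [Sigma.mk.injEq, heq_eq_eq, true_and] at this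
        rw [this] at hxy
        exact lt_irrefl _ hxy
      congr 1
      rw [dif_pos h, if_neg (hne _ _ (by simp; omega))]
      split_ifs with h2 h3
      · refine absurd h3 (hne _ _ ?_)
        simp only at h2 ⊢
        omega
      · rfl
      · rfl
    · left; rfl
    · left; rfl
  · rw [hS', basis_toMatrix_mul_linearMap_toMatrix_mul_basis_toMatrix,
      show P = Pi.basisFun ℂ (Fin n) from rfl, LinearMap.toMatrix_eq_toMatrix', LinearMap.toMatrix'_toLin']

end JordanExists

instance : Nonempty JordanProcedure :=
  ⟨fun n A =>
    let h := exists_jordan n A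
    ⟨h.choose, h.choose_spec.choose, h.choose_spec.choose_spec.1,
      h.choose_spec.choose_spec.2.1, h.choose_spec.choose_spec.2.2⟩⟩

namespace JordanDecomposition

variable {n : ℕ} {A : Op n} (D : JordanDecomposition A)

/-- `S J_φ S⁻¹`, with `J_φ` the projector onto the coordinates of the eigenvalues of modulus one. -/
def stabilizer : Op n :=
  D.S * diagonal (fun i => if ‖D.J i i‖ = 1 then 1 else 0) * D.S⁻¹

/-- The part of `J` that consists of the blocks whose eigenvalues have modulus less than one. -/
def decayingPart : Op n := of fun i j => if ‖D.J i i‖ < 1 then D.J i j else 0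

/-- The bound `‖S‖ ‖S⁻¹‖ ‖J_<^k‖` on the distance of `A^k` from its peripheral part. -/
def decayBound (k : ℕ) : ℝ := hsNorm D.S * hsNorm D.S⁻¹ * hsNorm (D.decayingPart ^ k)

/-- The truncation number `K^ε`: the least positive integer from which on the bound is below
`min ε 1`. -/
def truncation (ε : ℝ) : ℕ := sInf {K | 0 < K ∧ ∀ k, K ≤ k → D.decayBound k < min ε 1}

end JordanDecomposition

/-! ### Measurement-based linear-time temporal logic -/

/-- An atomic proposition: a measurement operator `0 ≤ M ≤ I` and an interval in `[0, 1]`. -/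
structure AtomicProp (d : ℕ) where
  op : Op d
  posSemidef : op.PosSemidef
  le_one : (1 - op).PosSemidef
  interval : Set ℝ
  ordConnected : interval.OrdConnected
  subset_unit : interval ⊆ Set.Icc 0 1

/-- `ρ` satisfies `⟨M, I⟩` if `tr (M ρ) ∈ I`. -/
def AtomicProp.Sat {d : ℕ} (a : AtomicProp d) (ρ : Op d) : Prop :=
  (a.op * ρ).trace.re ∈ a.interval

/-- Formulas over atomic propositions indexed by `ι`. -/
inductive Formula (ι : Type) : Type
  | tt : Formula ι
  | atom : ι → Formula ι
  | neg : Formula ι → Formula ι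
  | or : Formula ι → Formula ι → Formula ι
  | next : Formula ι → Formula ι
  | until : Formula ι → Formula ι → Formula ι

namespace Formula

variable {ι : Type}

def size : Formula ι → ℕ
  | tt => 1
  | atom _ => 1
  | neg φ => φ.size + 1
  | or φ ψ => φ.size + ψ.size + 1
  | next φ => φ.size + 1
  | .until φ ψ => φ.size + ψ.size + 1

/-- Satisfaction of a formula by an infinite word over sets of atomic propositions. -/
def Sat : (ℕ → Set ι) → Formula ι → Prop
  | _, tt => True
  | ξ, atom a => a ∈ ξ 0
  | ξ, neg φ => ¬ Sat ξ φ
  | ξ, or φ ψ => Sat ξ φ ∨ Sat ξ ψ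
  | ξ, next φ => Sat (fun n => ξ (n + 1)) φ
  | ξ, .until φ ψ =>
      ∃ k, Sat (fun n => ξ (n + k)) ψ ∧ ∀ j, j < k → Sat (fun n => ξ (n + j)) φ

/-- The language of all words that satisfy a formula. -/
def language (φ : Formula ι) : Set (ℕ → Set ι) := {ξ | Sat ξ φ}

/-- Postfix code, one natural number for each node. -/
def code {m : ℕ} : Formula (Fin m) → List ℕ
  | tt => [0]
  | neg φ => φ.code ++ [1]
  | or φ ψ => φ.code ++ ψ.code ++ [2]
  | next φ => φ.code ++ [3]
  | .until φ ψ => φ.code ++ ψ.code ++ [4]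
  | atom a => [5 + a]

end Formula

/-! ### The approximate model-checking problem -/

/-- An instance: a quantum Markov chain, finitely many atomic propositions, a formula over them
and a precision. -/
structure Instance (d m : ℕ) where
  chain : Chain d
  AP : Fin m → AtomicProp d
  formula : Formula (Fin m)
  ε : ℝ
  ε_pos : 0 < ε

namespace Instance

variable {d m : ℕ} (I : Instance d m)

/-- The labeling function `L`. -/
def label (ρ : Op d) : Set (Fin m) := {a | (I.AP a).Sat ρ}

/-- The symbolic `ε`-neighborhood of a state. -/
def nbhd (ρ : Op d) : Set (Set (Fin m)) :=
  {s | ∃ ρ' : Op d, IsDensity ρ' ∧ hsNorm (ρ - ρ') < I.ε ∧ s = I.label ρ'}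

/-- `G ⊨ φ`: the labeled trajectory satisfies the formula. -/
def Models : Prop := (fun n => I.label (I.chain.traj n)) ∈ I.formula.language

variable (D : JordanDecomposition I.chain.matrixRep)

/-- The periodically stable states `η_k = 𝓔_φ (𝓔^k ρ₀)`. -/
def stableState (k : ℕ) : Op d := applyRep D.stabilizer (I.chain.traj k)

/-- The property required of a truncation number `K`: from time `K` on, the label of each state of
the trajectory is in the symbolic neighborhood of the corresponding periodically stable state. -/
def Admissible (K : ℕ) : Prop :=
  0 < K ∧ ∀ n, K ≤ n →
    I.label (I.chain.traj n) ∈ I.nbhd (I.stableState D (n % I.chain.period))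

/-- The symbolic `ε`-neighborhood of the trajectory, for the truncation number `K`. -/
def nbhdLanguage (K : ℕ) : Set (ℕ → Set (Fin m)) :=
  {ξ | (∀ n, n < K → ξ n = I.label (I.chain.traj n)) ∧
    ∀ n, K ≤ n → ξ n ∈ I.nbhd (I.stableState D (n % I.chain.period))}

/-- `ε`-approximate satisfaction from below. -/
def ModelsBelow (K : ℕ) : Prop := (I.nbhdLanguage D K ∩ I.formula.language).Nonempty

/-- `ε`-approximate satisfaction from above. -/
def ModelsAbove (K : ℕ) : Prop := I.nbhdLanguage D K ⊆ I.formula.language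

end Instance

/-! ### The machine model

A random access machine with integer registers `int a i`, complex registers `cplx a i j`
(the matrix with name `a`), structured control flow, exact complex arithmetic, a Jordan
decomposition instruction, and three instructions that act on operators on the state space. -/

structure Mem where
  int : ℕ → ℕ → ℕ
  cplx : ℕ → ℕ → ℕ → ℂ

/-- Integer expressions. -/
inductive IntExpr : Type
  | const : ℕ → IntExpr
  | get : IntExpr → IntExpr → IntExpr
  | add : IntExpr → IntExpr → IntExpr
  | sub : IntExpr → IntExpr → IntExpr

def IntExpr.eval (M : Mem) : IntExpr → ℕ
  | const c => c
  | get a i => M.int (a.eval M) (i.eval M)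
  | add x y => x.eval M + y.eval M
  | sub x y => x.eval M - y.eval M

/-- Complex expressions. -/
inductive CplxExpr : Type
  | get : IntExpr → IntExpr → IntExpr → CplxExpr
  | ofInt : IntExpr → CplxExpr
  | imag : CplxExpr
  | add : CplxExpr → CplxExpr → CplxExpr
  | sub : CplxExpr → CplxExpr → CplxExpr
  | mul : CplxExpr → CplxExpr → CplxExpr
  | inv : CplxExpr → CplxExpr
  | conj : CplxExpr → CplxExpr

def CplxExpr.eval (M : Mem) : CplxExpr → ℂ
  | get a i j => M.cplx (a.eval M) (i.eval M) (j.eval M)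
  | ofInt e => (e.eval M : ℂ)
  | imag => Complex.I
  | add x y => x.eval M + y.eval M
  | sub x y => x.eval M - y.eval M
  | mul x y => x.eval M * y.eval M
  | inv x => (x.eval M)⁻¹
  | conj x => star (x.eval M)

/-- Tests: comparison of integers, and of the real parts of complex numbers. -/
inductive Test : Type
  | intLe : IntExpr → IntExpr → Test
  | reLe : CplxExpr → CplxExpr → Test

def Test.Holds (M : Mem) : Test → Prop
  | intLe x y => x.eval M ≤ y.eval M
  | reLe x y => (x.eval M).re ≤ (y.eval M).re

inductive Program : Type
  /-- `int a i := e` -/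
  | setInt (a i e : IntExpr) : Program
  /-- `cplx a i j := e` -/
  | setCplx (a i j : IntExpr) (e : CplxExpr) : Program
  /-- Jordan decomposition `S J S⁻¹` of the `n × n` matrix `src`: the matrices `S`, `J`, `S⁻¹` are
  stored under the names `dst`, `dst + 1`, `dst + 2`. -/
  | jordan (n src dst : IntExpr) : Program
  /-- The `d² × d²` matrix `rep` is applied to the operator `src`; the result is stored in `dst`. -/
  | apply (rep src dst : IntExpr) : Program
  /-- `int a i := 1` if the state `src` satisfies the atomic proposition with number `q`, and
  `0` otherwise. -/
  | label (src q a i : IntExpr) : Program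
  /-- Semi-definite feasibility: `int a i := 1` if some state within distance less than `ε` of `src`
  satisfies every atomic proposition `q` with `int pat q = 1` and violates every one with
  `int pat q = 2`, and `0` otherwise. -/
  | feasible (src pat a i : IntExpr) : Program
  | seq : Program → Program → Program
  | ite : Test → Program → Program → Program
  | while : Test → Program → Program

namespace Mem

def setInt (M : Mem) (a i v : ℕ) : Mem :=
  { M with int := fun a' i' => if a' = a ∧ i' = i then v else M.int a' i' }

def setCplx (M : Mem) (a i j : ℕ) (v : ℂ) : Mem :=
  { M with cplx := fun a' i' j' => if a' = a ∧ i' = i ∧ j' = j then v else M.cplx a' i' j' }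

/-- The `n × n` matrix stored under the name `a`. -/
def readOp (M : Mem) (n a : ℕ) : Op n := of fun i j => M.cplx a i j

/-- Store an `n × n` matrix under the name `a`. -/
def writeOp (M : Mem) {n : ℕ} (a : ℕ) (A : Op n) : Mem :=
  { M with
    cplx := fun a' i j =>
      if h : a' = a ∧ i < n ∧ j < n then A ⟨i, h.2.1⟩ ⟨j, h.2.2⟩ else M.cplx a' i j }

end Mem

open Classical in
/-- `Exec JD I P M t M'`: for the instance `I` and the Jordan decomposition procedure `JD`, the
program `P` started in memory `M` halts in memory `M'` after `t` steps. The Jordan decomposition of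
an `n × n` matrix counts `n ^ 4` steps (and one step for the call); every other instruction and
every test of a condition counts one step. -/
inductive Exec (JD : JordanProcedure) {d m : ℕ} (I : Instance d m) :
    Program → Mem → ℕ → Mem → Prop
  | setInt (M : Mem) (a i e : IntExpr) :
      Exec JD I (.setInt a i e) M 1 (M.setInt (a.eval M) (i.eval M) (e.eval M))
  | setCplx (M : Mem) (a i j : IntExpr) (e : CplxExpr) :
      Exec JD I (.setCplx a i j e) M 1
        (M.setCplx (a.eval M) (i.eval M) (j.eval M) (e.eval M))
  | jordan (M : Mem) (n src dst : IntExpr) :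
      Exec JD I (.jordan n src dst) M ((n.eval M) ^ 4 + 1)
        (((M.writeOp (dst.eval M) (JD _ (M.readOp (n.eval M) (src.eval M))).S).writeOp
            (dst.eval M + 1) (JD _ (M.readOp (n.eval M) (src.eval M))).J).writeOp
          (dst.eval M + 2) (JD _ (M.readOp (n.eval M) (src.eval M))).S⁻¹)
  | apply (M : Mem) (rep src dst : IntExpr) :
      Exec JD I (.apply rep src dst) M 1
        (M.writeOp (dst.eval M)
          (applyRep (M.readOp (d * d) (rep.eval M)) (M.readOp d (src.eval M))))
  | label (M : Mem) (src q a i : IntExpr) :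
      Exec JD I (.label src q a i) M 1
        (M.setInt (a.eval M) (i.eval M)
          (if ∃ b : Fin m, (b : ℕ) = q.eval M ∧ b ∈ I.label (M.readOp d (src.eval M))
            then 1 else 0))
  | feasible (M : Mem) (src pat a i : IntExpr) :
      Exec JD I (.feasible src pat a i) M 1
        (M.setInt (a.eval M) (i.eval M)
          (if ∃ s ∈ I.nbhd (M.readOp d (src.eval M)), ∀ b : Fin m,
              (M.int (pat.eval M) b = 1 → b ∈ s) ∧ (M.int (pat.eval M) b = 2 → b ∉ s)
            then 1 else 0))
  | seq {M₁ M₂ M₃ : Mem} {P Q : Program} {t u : ℕ} :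
      Exec JD I P M₁ t M₂ → Exec JD I Q M₂ u M₃ → Exec JD I (.seq P Q) M₁ (t + u) M₃
  | iteTrue {M M' : Mem} {b : Test} {P Q : Program} {t : ℕ} :
      b.Holds M → Exec JD I P M t M' → Exec JD I (.ite b P Q) M (t + 1) M'
  | iteFalse {M M' : Mem} {b : Test} {P Q : Program} {t : ℕ} :
      ¬ b.Holds M → Exec JD I Q M t M' → Exec JD I (.ite b P Q) M (t + 1) M'
  | whileTrue {M₁ M₂ M₃ : Mem} {b : Test} {P : Program} {t u : ℕ} :
      b.Holds M₁ → Exec JD I P M₁ t M₂ → Exec JD I (.while b P) M₂ u M₃ →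
        Exec JD I (.while b P) M₁ (t + u + 1) M₃
  | whileFalse {M : Mem} {b : Test} {P : Program} :
      ¬ b.Holds M → Exec JD I (.while b P) M 1 M

/-- The initial memory. Integers: row `0` holds the dimension, the number of Kraus operators, the
size of the formula and an additional integer `K`; row `1` holds the code of the formula. Complex numbers: `ε` is stored under
the name `0`, the initial state under the name `1` and the `k`-th Kraus operator under the name
`k + 2`. All other registers are zero. The atomic propositions are accessible only through the
instructions `label` and `feasible`. -/
def Instance.input {d m : ℕ} (I : Instance d m) (K : ℕ) : Mem where
  int := fun a i =>
    if a = 0 then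
      (if i = 0 then d else if i = 1 then I.chain.numKraus
        else if i = 2 then I.formula.size else if i = 3 then K else 0)
    else if a = 1 then I.formula.code.getD i 0
    else 0
  cplx := fun a i j =>
    if a = 0 then (if i = 0 ∧ j = 0 then (I.ε : ℂ) else 0)
    else if h : i < d ∧ j < d then
      (if a = 1 then I.chain.init ⟨i, h.1⟩ ⟨j, h.2⟩
        else if h' : a - 2 < I.chain.numKraus then I.chain.kraus ⟨a - 2, h'⟩ ⟨i, h.1⟩ ⟨j, h.2⟩
        else 0)
    else 0

/-- The possible answers, with their codes `0`, `1`, `2`. -/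
inductive Verdict : Type
  | false
  | true
  | unknown

def Verdict.toNat : Verdict → ℕ
  | .false => 0
  | .true => 1
  | .unknown => 2

/-- The answer is read off the integer register `int 0 0`. -/
def Answers (M : Mem) (v : Verdict) : Prop := M.int 0 0 = v.toNat

/-- Started in memory `M₀`, the program `P` halts after at most `T` steps and solves the approximate
model-checking problem for the truncation number `K`: its answer is `false` exactly if the formula
is not approximately satisfied from below, and `true` exactly if it is approximately satisfied from
above; the answers `false` and `true` are also correct for exact satisfaction. -/
def Instance.SolvedBy {d m : ℕ} (I : Instance d m) (JD : JordanProcedure) (P : Program) (M₀ : Mem)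
    (K T : ℕ) : Prop :=
  ∃ (t : ℕ) (M : Mem) (v : Verdict), Exec JD I P M₀ t M ∧ Answers M v ∧ t ≤ T ∧
    (v ≠ .false ↔ I.ModelsBelow (JD _ I.chain.matrixRep) K) ∧
    (v = .true ↔ I.ModelsAbove (JD _ I.chain.matrixRep) K) ∧
    (v = .false → ¬ I.Models) ∧ (v = .true → I.Models)

end

end QMC

/-!
# Approximate model checking of quantum Markov chains

**The trajectory.** A super-operator that preserves positivity and the trace has bounded orbits, so
in a Jordan form of its matrix no eigenvalue has modulus greater than one and the blocks of the
eigenvalues of modulus one have size one (`Chain.powerBounded`). The trajectory is therefore the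
stable part `Chain.stable`, a combination of the sequences `z ^ k` with `‖z‖ = 1`, plus a remainder
of norm at most `decayBound` (`Chain.hsNorm_stable_sub_traj_le`). Hence `K^ε` is admissible
(`Instance.admissible_truncation`), and the trajectory converges along the multiples of `θ` exactly
if `θ` is a period of the stable part (`Chain.convergesAlong_iff`).

**The period.** Comparing stable states entry by entry would cost `d²` steps for each candidate. By
the equality case of the Cauchy-Schwarz inequality one linear functional of `𝓔^θ(ρ₀)` suffices: its
real part is maximal exactly if `θ` is a period (`Chain.stable_eq_iff_functional`). The functional
is one row of a stored matrix, so each candidate costs a constant number of steps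
(`runs_progFindPeriod`).

**Model checking.** The words of the approximating language are those with letters from a sequence
of alphabets that is periodic from time `K` on. Call a set of nodes of the formula a type. The words
over these alphabets that satisfy the formula correspond to the fair paths, in a graph of the
`2 ^ |φ|` types, from a type that contains the root, and those that violate it to the fair paths
from the other types (`Formula.exists_word_iff`). From time `K` on, a fair path from a type exists exactly if
a recurrent type can be reached, and by the pigeonhole principle `2 * 2 ^ |φ|` periods are enough to
search for it (`fairFrom_iff_recurrent`). The program computes reachability backwards in time, at a
cost of `2 ^ O(|φ|)` steps for each of the `K + p` times (`runs_progDecide`). Which types agree with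
some letter of a neighborhood is decided by semi-definite feasibility queries
(`exists_atomsAgree_iff`).

**The truncation number.** Computing the powers of `J_<` entry by entry takes a number of steps per
exponent that grows with `d`. But the entries of the powers are exponential polynomials, so the
squared norms `‖J_<^k‖²` satisfy a linear recurrence of order `2 d²`
(`IsJordanForm.sqNorm_recurrence`). Iterating it expresses the next `d²` values by the last `2 d²`
values through two `d² × d²` matrices, that is, through two steps of the machine; the amortized cost
of one value is constant (`runs_progScan`). As the decay bound is submultiplicative, a candidate `K`
for which it is small on `[K, 2 K)` is correct (`JordanDecomposition.decayBound_lt_of_window`), so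
the search examines no exponent beyond `2 K^ε`. The preparations cost `O(d⁸)` steps.

**Programs.** `Runs` is a total-correctness statement with a time bound. Frame conditions come from
`SameOff`: a syntactic check shows which registers a program does not change. Row `0` of the integer
registers holds the scalar variables: `0` the dimension and finally the answer, `2` the size of the
formula, `3` the truncation number, `4` the square of the dimension, `5` the number of types, `6`
the period; counters are in `7`, `8`, `9`, `13`, `14`, `16` and `17`. The other integer rows are
arrays and the complex names are matrices; the docstrings of the programs say what they hold. A
truth value is stored as `0` or `1`.
-/

namespace QMC

noncomputable section

/-! ### Vectorization -/

theorem vectorize_unvectorize {d : ℕ} (v : Fin (d * d) → ℂ) : vectorize (unvectorize v) = v := by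
  ext x
  exact congrArg v (finProdFinEquiv.apply_symm_apply x)

theorem unvectorize_vectorize {d : ℕ} (A : Op d) : unvectorize (vectorize A) = A := by
  ext i j
  simp [vectorize, unvectorize]

theorem vectorize_injective {d : ℕ} : Function.Injective (vectorize (d := d)) :=
  Function.LeftInverse.injective unvectorize_vectorize

theorem vectorize_applyRep {d : ℕ} (N : Op (d * d)) (A : Op d) :
    vectorize (applyRep N A) = N *ᵥ vectorize A := vectorize_unvectorize _

theorem vectorize_sub {d : ℕ} (A B : Op d) : vectorize (A - B) = vectorize A - vectorize B := rfl

/-! ### The Hilbert-Schmidt norm -/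

theorem hsNorm_sq {n : ℕ} (A : Op n) : hsNorm A ^ 2 = ∑ i, ∑ j, ‖A i j‖ ^ 2 := by
  have h : (Aᴴ * A).trace.re = ∑ i, ∑ j, ‖A i j‖ ^ 2 := by
    rw [Finset.sum_comm]
    simp only [trace, diag_apply, mul_apply, conjTranspose_apply, Complex.re_sum]
    refine Finset.sum_congr rfl fun i _ => Finset.sum_congr rfl fun j _ => ?_
    rw [Complex.star_def, ← Complex.normSq_eq_conj_mul_self, Complex.ofReal_re,
      Complex.normSq_eq_norm_sq]
  rw [hsNorm, Real.sq_sqrt (by rw [h]; positivity), h]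

theorem hsNorm_nonneg {n : ℕ} (A : Op n) : 0 ≤ hsNorm A := Real.sqrt_nonneg _

section Frobenius

attribute [local instance] Matrix.frobeniusNormedAddCommGroup Matrix.frobeniusNormedSpace
  Matrix.frobeniusNormedRing

theorem frobenius_norm_sq {m n : Type} [Fintype m] [Fintype n] (A : Matrix m n ℂ) :
    ‖A‖ ^ 2 = ∑ i, ∑ j, ‖A i j‖ ^ 2 := by
  rw [frobenius_norm_def, ← Real.rpow_natCast, ← Real.rpow_mul (by positivity)]
  norm_num

theorem hsNorm_eq_frobenius {n : ℕ} (A : Op n) : hsNorm A = ‖A‖ := by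
  have := hsNorm_sq A
  rw [← frobenius_norm_sq] at this
  exact (sq_eq_sq₀ (hsNorm_nonneg A) (norm_nonneg A)).1 this

theorem hsNorm_mul_le {n : ℕ} (A B : Op n) : hsNorm (A * B) ≤ hsNorm A * hsNorm B := by
  simpa only [hsNorm_eq_frobenius] using frobenius_norm_mul A B

theorem norm_apply_le_hsNorm {n : ℕ} (A : Op n) (i j : Fin n) : ‖A i j‖ ≤ hsNorm A := by
  refine le_of_sq_le_sq ?_ (hsNorm_nonneg A)
  rw [hsNorm_sq]
  exact (Finset.single_le_sum (f := fun j => ‖A i j‖ ^ 2) (fun _ _ => by positivity)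
    (Finset.mem_univ j)).trans (Finset.single_le_sum (f := fun i => ∑ j, ‖A i j‖ ^ 2)
    (fun _ _ => by positivity) (Finset.mem_univ i))

theorem one_le_hsNorm_one {n : ℕ} (hn : 0 < n) : 1 ≤ hsNorm (1 : Op n) := by
  simpa using norm_apply_le_hsNorm (1 : Op n) ⟨0, hn⟩ ⟨0, hn⟩

theorem continuous_hsNorm {n : ℕ} : Continuous (hsNorm : Op n → ℝ) := by
  unfold hsNorm
  fun_prop

/-- The Hilbert-Schmidt norm of an operator is the Frobenius norm of its vectorization as a
one-column matrix. -/
theorem norm_replicateCol_vectorize {d : ℕ} (A : Op d) :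
    ‖replicateCol Unit (vectorize A)‖ = hsNorm A := by
  rw [← sq_eq_sq₀ (norm_nonneg _) (hsNorm_nonneg _), hsNorm_sq, frobenius_norm_sq]
  simp only [replicateCol_apply, Finset.univ_unique, Finset.sum_singleton]
  rw [← finProdFinEquiv.sum_comp, Fintype.sum_prod_type]
  simp [vectorize]

theorem hsNorm_applyRep_le {d : ℕ} (N : Op (d * d)) (A : Op d) :
    hsNorm (applyRep N A) ≤ hsNorm N * hsNorm A := by
  rw [← norm_replicateCol_vectorize, vectorize_applyRep, ← norm_replicateCol_vectorize A,
    hsNorm_eq_frobenius,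
    replicateCol_mulVec]
  exact frobenius_norm_mul _ _

open scoped MatrixOrder in
/-- The Hilbert-Schmidt norm of a positive operator is at most its trace. -/
theorem hsNorm_le_trace {n : ℕ} {A : Op n} (hA : A.PosSemidef) : hsNorm A ≤ A.trace.re := by
  obtain ⟨X, hX⟩ := CStarAlgebra.nonneg_iff_eq_star_mul_self.1 hA.nonneg
  have h : A.trace.re = hsNorm X ^ 2 := by
    rw [hsNorm, Real.sq_sqrt, hX, star_eq_conjTranspose]
    have := (posSemidef_conjTranspose_mul_self X).trace_nonneg
    exact (Complex.le_def.1 this).1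
  rw [h, hX, hsNorm_eq_frobenius, hsNorm_eq_frobenius, sq, star_eq_conjTranspose]
  exact (frobenius_norm_mul _ _).trans_eq (by rw [frobenius_norm_conjTranspose])

end Frobenius

/-! ### The trajectory -/

theorem isClosed_isDensity {d : ℕ} : IsClosed {ρ : Op d | IsDensity ρ} := by
  simp only [IsDensity, posSemidef_iff_dotProduct_mulVec, IsHermitian, Set.ofPred_and,
    Set.ofPred_forall]
  refine ((isClosed_eq (by fun_prop) (by fun_prop)).inter (isClosed_iInter fun x => ?_)).inter
    (isClosed_eq (by fun_prop) (by fun_prop))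
  exact isClosed_le (by fun_prop) (by fun_prop)

namespace Chain

variable {d : ℕ} (G : Chain d)

theorem dim_pos {d : ℕ} (G : Chain d) : 0 < d := by
  rcases Nat.eq_zero_or_pos d with rfl | h
  · have := G.init_density.2
    simp [trace] at this
  · exact h

theorem applyRep_matrixRep (A : Op d) : applyRep G.matrixRep A = G.superOp A := by
  ext i j
  have h : ∀ a b : Fin d, G.matrixRep (finProdFinEquiv (i, j)) (finProdFinEquiv (a, b)) =
      ∑ k, G.kraus k i a * star (G.kraus k j b) := by
    intro a b
    rw [matrixRep, submatrix_apply, Equiv.symm_apply_apply, Equiv.symm_apply_apply,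
      Matrix.sum_apply]
    rfl
  calc applyRep G.matrixRep A i j
      = ∑ a, ∑ b, ∑ k, G.kraus k i a * A a b * star (G.kraus k j b) := by
        rw [applyRep, unvectorize, of_apply, mulVec, dotProduct, ← finProdFinEquiv.sum_comp,
          Fintype.sum_prod_type]
        refine Finset.sum_congr rfl fun a _ => Finset.sum_congr rfl fun b _ => ?_
        rw [h, vectorize, Equiv.symm_apply_apply, Finset.sum_mul]
        exact Finset.sum_congr rfl fun k _ => by ring
    _ = ∑ k, ∑ b, ∑ a, G.kraus k i a * A a b * star (G.kraus k j b) := by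
        rw [Finset.sum_congr rfl fun a _ => Finset.sum_comm, Finset.sum_comm]
        exact Finset.sum_congr rfl fun k _ => Finset.sum_comm
    _ = G.superOp A i j := by
        simp only [superOp, Matrix.sum_apply, mul_apply, conjTranspose_apply, Finset.sum_mul]

theorem vectorize_superOp_iterate (A : Op d) (n : ℕ) :
    vectorize (G.superOp^[n] A) = G.matrixRep ^ n *ᵥ vectorize A := by
  induction n with
  | zero => simp
  | succ n ih =>
    rw [Function.iterate_succ_apply', ← applyRep_matrixRep, vectorize_applyRep, ih, mulVec_mulVec,
      pow_succ']

theorem vectorize_traj (n : ℕ) : vectorize (G.traj n) = G.matrixRep ^ n *ᵥ vectorize G.init :=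
  G.vectorize_superOp_iterate _ n

theorem traj_succ (n : ℕ) : G.traj (n + 1) = applyRep G.matrixRep (G.traj n) := by
  rw [applyRep_matrixRep, traj, Function.iterate_succ_apply']
  rfl

theorem superOp_posSemidef {A : Op d} (hA : A.PosSemidef) : (G.superOp A).PosSemidef :=
  posSemidef_sum _ fun _ _ => hA.mul_mul_conjTranspose_same _

theorem trace_superOp (A : Op d) : (G.superOp A).trace = A.trace := by
  simp only [superOp, trace_sum]
  rw [Finset.sum_congr rfl fun k _ => trace_mul_cycle (G.kraus k) A (G.kraus k)ᴴ, ← trace_sum,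
    ← Finset.sum_mul, G.trace_preserving, one_mul]

theorem iterate_posSemidef {A : Op d} (hA : A.PosSemidef) (n : ℕ) :
    (G.superOp^[n] A).PosSemidef ∧ (G.superOp^[n] A).trace = A.trace := by
  induction n with
  | zero => exact ⟨hA, rfl⟩
  | succ n ih =>
    rw [Function.iterate_succ_apply', trace_superOp]
    exact ⟨G.superOp_posSemidef ih.1, ih.2⟩

theorem isDensity_traj (n : ℕ) : IsDensity (G.traj n) := by
  obtain ⟨h, h'⟩ := G.iterate_posSemidef G.init_density.1 n
  exact ⟨h, h'.trans G.init_density.2⟩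

theorem superOp_iterate_add (n : ℕ) (A B : Op d) :
    G.superOp^[n] (A + B) = G.superOp^[n] A + G.superOp^[n] B := by
  apply vectorize_injective
  have h : ∀ A B : Op d, vectorize (A + B) = vectorize A + vectorize B := fun _ _ => rfl
  rw [h, vectorize_superOp_iterate, vectorize_superOp_iterate, vectorize_superOp_iterate, h,
    mulVec_add]

theorem superOp_iterate_smul (n : ℕ) (c : ℂ) (A : Op d) :
    G.superOp^[n] (c • A) = c • G.superOp^[n] A := by
  apply vectorize_injective
  have h : ∀ A : Op d, vectorize (c • A) = c • vectorize A := fun _ => rfl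
  rw [h, vectorize_superOp_iterate, vectorize_superOp_iterate, h, mulVec_smul]

open scoped MatrixOrder Matrix.Norms.L2Operator in
/-- Orbits of the super-operator are bounded: every operator is a linear combination of positive
operators, and on those the trace, which bounds the norm, is preserved. -/
theorem exists_bound_iterate (A : Op d) : ∃ C, ∀ n i j, ‖(G.superOp^[n] A) i j‖ ≤ C := by
  have hA : A ∈ Submodule.span ℂ {a : Op d | 0 ≤ a} := by
    rw [CStarAlgebra.span_nonneg]; trivial
  induction hA using Submodule.span_induction with
  | mem x hx =>
    refine ⟨x.trace.re, fun n i j => (norm_apply_le_hsNorm _ i j).trans ?_⟩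
    obtain ⟨h, h'⟩ := G.iterate_posSemidef (nonneg_iff_posSemidef.1 hx) n
    exact (hsNorm_le_trace h).trans_eq (by rw [h'])
  | zero =>
    refine ⟨0, fun n i j => ?_⟩
    have := G.superOp_iterate_smul n 0 0
    simp only [zero_smul] at this
    simp [this]
  | add x y _ _ hx hy =>
    obtain ⟨C, hC⟩ := hx
    obtain ⟨C', hC'⟩ := hy
    refine ⟨C + C', fun n i j => ?_⟩
    rw [superOp_iterate_add]
    exact (norm_add_le _ _).trans (add_le_add (hC n i j) (hC' n i j))
  | smul c x _ hx =>
    obtain ⟨C, hC⟩ := hx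
    refine ⟨‖c‖ * C, fun n i j => ?_⟩
    rw [superOp_iterate_smul, Matrix.smul_apply, norm_smul]
    exact mul_le_mul_of_nonneg_left (hC n i j) (norm_nonneg _)

end Chain

/-! ### Powers of matrices in Jordan normal form -/

namespace IsJordanForm

variable {n : ℕ} {J : Op n}

theorem mul_apply_of_last (hJ : IsJordanForm J) {i : Fin n} (hi : (i : ℕ) + 1 = n) (B : Op n)
    (j : Fin n) : (J * B) i j = J i i * B i j := by
  rw [mul_apply, Finset.sum_eq_single i]
  · intro k _ hk
    rcases hJ i k hk with h | ⟨h, -⟩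
    · rw [h, zero_mul]
    · omega
  · simp

theorem mul_apply_of_lt (hJ : IsJordanForm J) {i : Fin n} (hi : (i : ℕ) + 1 < n) (B : Op n)
    (j : Fin n) :
    (J * B) i j = J i i * B i j + J i ⟨i + 1, hi⟩ * B ⟨i + 1, hi⟩ j := by
  have hne : i ≠ ⟨i + 1, hi⟩ := fun h => by simpa using congrArg Fin.val h
  rw [mul_apply, ← Finset.sum_pair (f := fun k => J i k * B k j) hne]
  refine (Finset.sum_subset (Finset.subset_univ _) fun k _ hk => ?_).symm
  simp only [Finset.mem_insert, Finset.mem_singleton, not_or] at hk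
  rcases hJ i k hk.1 with h | ⟨h, -⟩
  · rw [h, zero_mul]
  · exact absurd (Fin.ext h) hk.2

theorem pow_apply_of_lt (hJ : IsJordanForm J) (k : ℕ) {i j : Fin n} (hij : j < i) :
    (J ^ k) i j = 0 := by
  induction k generalizing i with
  | zero => simp [one_apply, hij.ne']
  | succ k ih =>
    rw [pow_succ']
    by_cases hi : (i : ℕ) + 1 < n
    · rw [hJ.mul_apply_of_lt hi, ih hij,
        ih (hij.trans (show i < ⟨i + 1, hi⟩ from Nat.lt_succ_self (i : ℕ)))]
      simp
    · rw [hJ.mul_apply_of_last (by omega), ih hij, mul_zero]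

theorem pow_apply_self (hJ : IsJordanForm J) (k : ℕ) (i : Fin n) : (J ^ k) i i = J i i ^ k := by
  induction k with
  | zero => simp
  | succ k ih =>
    rw [pow_succ', pow_succ']
    by_cases hi : (i : ℕ) + 1 < n
    · rw [hJ.mul_apply_of_lt hi, ih,
        hJ.pow_apply_of_lt k (show i < ⟨i + 1, hi⟩ from Nat.lt_succ_self (i : ℕ))]
      simp
    · rw [hJ.mul_apply_of_last (by omega), ih]

/-- Above the diagonal, a Jordan block with eigenvalue `z` has powers with entries `k z^(k-1)`. -/
theorem pow_apply_succ (hJ : IsJordanForm J) (k : ℕ) {i j : Fin n} (hij : j ≠ i)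
    (h : J i j ≠ 0) : (J ^ (k + 1)) i j = (k + 1 : ℕ) * J i i ^ k := by
  obtain ⟨h1, h2, h3⟩ := (hJ i j hij).resolve_left h
  have hi : (i : ℕ) + 1 < n := h1 ▸ j.2
  obtain rfl : j = ⟨i + 1, hi⟩ := Fin.ext h1
  induction k with
  | zero => simp [h2]
  | succ k ih =>
    rw [pow_succ', hJ.mul_apply_of_lt hi, ih, hJ.pow_apply_self, h2, ← h3]
    push_cast
    ring

/-- If the powers of a matrix in Jordan normal form are bounded, its eigenvalues have modulus at
most one. -/
theorem norm_diag_le_one (hJ : IsJordanForm J) {C : ℝ} (i : Fin n)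
    (hC : ∀ k, ‖(J ^ k) i i‖ ≤ C) : ‖J i i‖ ≤ 1 := by
  by_contra h
  push Not at h
  obtain ⟨k, hk⟩ := pow_unbounded_of_one_lt C h
  have := hC k
  rw [hJ.pow_apply_self, norm_pow] at this
  exact absurd this (not_le.2 hk)

/-- If the powers of a matrix in Jordan normal form are bounded, then the blocks of eigenvalues of
modulus one have size one. -/
theorem apply_eq_zero_of_norm_eq_one (hJ : IsJordanForm J) {C : ℝ} {i j : Fin n} (hij : j ≠ i)
    (hC : ∀ k, ‖(J ^ k) i j‖ ≤ C) (h1 : ‖J i i‖ = 1) : J i j = 0 := by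
  by_contra h
  obtain ⟨k, hk⟩ := exists_nat_gt C
  have := hC (k + 1)
  rw [hJ.pow_apply_succ k hij h, norm_mul, norm_pow, h1, one_pow, mul_one, Complex.norm_natCast]
    at this
  push_cast at this
  linarith

end IsJordanForm

/-- A contraction with a perturbation that tends to zero tends to zero. -/
theorem tendsto_zero_of_recurrence {x y : ℕ → ℂ} {z : ℂ} (hz : ‖z‖ < 1)
    (hxy : ∀ n, x (n + 1) = z * x n + y n) (hy : Tendsto y atTop (𝓝 0)) :
    Tendsto x atTop (𝓝 0) := by
  rw [Metric.tendsto_atTop] at hy ⊢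
  simp only [dist_zero_right] at hy ⊢
  intro ε hε
  have hq : 0 < 1 - ‖z‖ := by linarith
  obtain ⟨N, hN⟩ := hy (ε / 2 * (1 - ‖z‖)) (by positivity)
  have hb : ∀ k, ‖x (N + k)‖ ≤ ε / 2 + ‖z‖ ^ k * ‖x N‖ := by
    intro k
    induction k with
    | zero => simp; positivity
    | succ k ih =>
      rw [← add_assoc, hxy]
      have h1 := hN (N + k) (by omega)
      have h2 : ‖z‖ * ‖x (N + k)‖ ≤ ‖z‖ * (ε / 2 + ‖z‖ ^ k * ‖x N‖) :=
        mul_le_mul_of_nonneg_left ih (norm_nonneg _)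
      calc _ ≤ ‖z‖ * ‖x (N + k)‖ + ‖y (N + k)‖ := by rw [← norm_mul]; exact norm_add_le _ _
        _ ≤ ‖z‖ * (ε / 2 + ‖z‖ ^ k * ‖x N‖) + ε / 2 * (1 - ‖z‖) := by linarith
        _ = _ := by ring
  have ht : Tendsto (fun k => ‖z‖ ^ k * ‖x N‖) atTop (𝓝 0) := by
    simpa using (tendsto_pow_atTop_nhds_zero_of_lt_one (norm_nonneg z) hz).mul_const ‖x N‖
  obtain ⟨K, hK⟩ := (ht.eventually (gt_mem_nhds (half_pos hε))).exists_forall_of_atTop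
  refine ⟨N + K, fun n hn => ?_⟩
  obtain ⟨k, rfl⟩ : ∃ k, n = N + k := ⟨n - N, by omega⟩
  have := hb k
  have := hK k (by omega)
  linarith

theorem IsJordanForm.tendsto_pow_zero {n : ℕ} {J : Op n} (hJ : IsJordanForm J)
    (h : ∀ i, ‖J i i‖ < 1) : Tendsto (fun k => J ^ k) atTop (𝓝 0) := by
  -- Row `i` of the powers is contracted and perturbed by row `i + 1`: induction from the last row.
  have key : ∀ t, ∀ i : Fin n, n - i = t → ∀ j, Tendsto (fun k => (J ^ k) i j) atTop (𝓝 0) := by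
    intro t
    induction t using Nat.strong_induction_on with
    | _ t ih =>
      intro i hi j
      by_cases hi' : (i : ℕ) + 1 < n
      · refine tendsto_zero_of_recurrence (h i)
          (y := fun k => J i ⟨i + 1, hi'⟩ * (J ^ k) ⟨i + 1, hi'⟩ j)
          (fun k => by rw [pow_succ', hJ.mul_apply_of_lt hi']) ?_
        simpa using (ih (n - (i + 1)) (by omega) ⟨i + 1, hi'⟩ rfl j).const_mul _
      · exact tendsto_zero_of_recurrence (h i) (y := 0)
          (fun k => by rw [pow_succ', hJ.mul_apply_of_last (by omega)]; simp) tendsto_const_nhds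
  exact tendsto_pi_nhds.2 fun i => tendsto_pi_nhds.2 fun j => key _ i rfl j

/-! ### The peripheral part of a Jordan decomposition -/

namespace JordanDecomposition

variable {n : ℕ} {A : Op n} (D : JordanDecomposition A)

theorem S_mul_inv : D.S * D.S⁻¹ = 1 := mul_nonsing_inv _ D.isUnit_det

theorem inv_mul_S : D.S⁻¹ * D.S = 1 := nonsing_inv_mul _ D.isUnit_det

theorem pow_eq (k : ℕ) : A ^ k = D.S * D.J ^ k * D.S⁻¹ := by
  induction k with
  | zero => simp [D.S_mul_inv]
  | succ k ih =>
    have hA : ∀ X : Op n, X * A = X * (D.S * D.J * D.S⁻¹) := fun X => congrArg (X * ·) D.eq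
    rw [pow_succ, hA, ih, pow_succ]
    calc D.S * D.J ^ k * D.S⁻¹ * (D.S * D.J * D.S⁻¹)
        = D.S * D.J ^ k * (D.S⁻¹ * D.S) * D.J * D.S⁻¹ := by noncomm_ring
      _ = _ := by rw [D.inv_mul_S]; noncomm_ring

/-- The indicator of the eigenvalues of modulus one. -/
def peripheral (i : Fin n) : ℂ := if ‖D.J i i‖ = 1 then 1 else 0

theorem diagonal_mul_J : diagonal D.peripheral * D.J = D.J * diagonal D.peripheral := by
  ext i j
  rw [diagonal_mul, mul_diagonal]
  by_cases hij : j = i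
  · rw [hij, mul_comm]
  · rcases D.isJordanForm i j hij with h | ⟨-, -, h⟩
    · simp [h]
    · simp [peripheral, h, mul_comm]

theorem stabilizer_eq : D.stabilizer = D.S * diagonal D.peripheral * D.S⁻¹ := rfl

/-- The consequences for a Jordan decomposition of the boundedness of the powers: no eigenvalue of
modulus more than one, and diagonal rows for those of modulus one. -/
structure PowerBounded : Prop where
  le_one : ∀ i, ‖D.J i i‖ ≤ 1
  diag : ∀ i, ‖D.J i i‖ = 1 → ∀ j, j ≠ i → D.J i j = 0

variable {D}

theorem powerBounded_of_bound (h : ∀ v : Fin n → ℂ, ∃ C, ∀ k i, ‖(A ^ k *ᵥ v) i‖ ≤ C) :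
    D.PowerBounded := by
  have hb : ∀ i j, ∃ C, ∀ k, ‖(D.J ^ k) i j‖ ≤ C := by
    intro i j
    obtain ⟨C, hC⟩ := h (D.S.col j)
    refine ⟨∑ x, ‖D.S⁻¹ i x‖ * C, fun k => ?_⟩
    have hJ : D.J ^ k = D.S⁻¹ * (A ^ k * D.S) := by
      rw [D.pow_eq]
      calc D.J ^ k = (D.S⁻¹ * D.S) * D.J ^ k * (D.S⁻¹ * D.S) := by rw [D.inv_mul_S]; simp
        _ = _ := by noncomm_ring
    rw [hJ, mul_apply]
    refine (norm_sum_le _ _).trans (Finset.sum_le_sum fun x _ => ?_)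
    rw [norm_mul]
    exact mul_le_mul_of_nonneg_left (hC k x) (norm_nonneg _)
  refine ⟨fun i => ?_, fun i hi j hij => ?_⟩
  · obtain ⟨C, hC⟩ := hb i i
    exact D.isJordanForm.norm_diag_le_one i hC
  · obtain ⟨C, hC⟩ := hb i j
    exact D.isJordanForm.apply_eq_zero_of_norm_eq_one hij hC hi

theorem PowerBounded.diagonal_mul_pow (hD : D.PowerBounded) (k : ℕ) :
    diagonal D.peripheral * D.J ^ k = diagonal fun i => D.peripheral i * D.J i i ^ k := by
  induction k with
  | zero => simp
  | succ k ih =>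
    rw [pow_succ, ← mul_assoc, ih]
    ext i j
    rw [diagonal_mul, diagonal_apply]
    by_cases hi : ‖D.J i i‖ = 1
    · by_cases hij : i = j
      · subst hij; simp [pow_succ, mul_assoc]
      · rw [hD.diag i hi j (Ne.symm hij)]; simp [hij]
    · simp [peripheral, hi]

theorem PowerBounded.decayingPart_eq (hD : D.PowerBounded) :
    D.decayingPart = (1 - diagonal D.peripheral) * D.J := by
  ext i j
  rw [sub_mul, one_mul, Matrix.sub_apply, diagonal_mul, decayingPart, of_apply, peripheral]
  rcases (hD.le_one i).lt_or_eq with h | h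
  · simp [h, h.ne]
  · simp [h]

theorem PowerBounded.decayingPart_pow (hD : D.PowerBounded) (k : ℕ) :
    D.decayingPart ^ (k + 1) = (1 - diagonal D.peripheral) * D.J ^ (k + 1) := by
  have hc : Commute (1 - diagonal D.peripheral) D.J := by
    refine (Commute.one_left _).sub_left ?_
    exact D.diagonal_mul_J
  have hi : (1 - diagonal D.peripheral) * (1 - diagonal D.peripheral) =
      1 - diagonal D.peripheral := by
    have : diagonal D.peripheral * diagonal D.peripheral = diagonal D.peripheral := by
      rw [diagonal_mul_diagonal]
      congr 1
      ext i
      unfold peripheral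
      split_ifs <;> simp
    simp [sub_mul, mul_sub, this]
  have hp : ∀ k, (1 - diagonal D.peripheral) ^ (k + 1) = 1 - diagonal D.peripheral := by
    intro k
    induction k with
    | zero => simp
    | succ k ih => rw [pow_succ, ih, hi]
  rw [hD.decayingPart_eq, hc.mul_pow, hp]

theorem isJordanForm_decayingPart (D : JordanDecomposition A) :
    IsJordanForm D.decayingPart := by
  intro i j hij
  simp only [decayingPart, of_apply]
  by_cases hi : ‖D.J i i‖ < 1
  · simp only [hi, if_true]
    rcases D.isJordanForm i j hij with h | ⟨h1, h2, h3⟩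
    · exact Or.inl h
    · rw [← h3]
      simp only [hi, if_true]
      exact Or.inr ⟨h1, h2, trivial⟩
  · simp [hi]

theorem norm_decayingPart_diag_lt (D : JordanDecomposition A) (i : Fin n) :
    ‖D.decayingPart i i‖ < 1 := by
  simp only [decayingPart, of_apply]
  split_ifs with h
  · exact h
  · simp

theorem tendsto_decayBound (D : JordanDecomposition A) :
    Tendsto D.decayBound atTop (𝓝 0) := by
  have h := (continuous_hsNorm.tendsto 0).comp
    (D.isJordanForm_decayingPart.tendsto_pow_zero D.norm_decayingPart_diag_lt)
  have h0 : hsNorm (0 : Op n) = 0 := by simp [hsNorm]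
  rw [h0] at h
  have h' := h.const_mul (hsNorm D.S * hsNorm D.S⁻¹)
  rw [mul_zero] at h'
  exact h'

theorem truncation_spec (D : JordanDecomposition A) {ε : ℝ} (hε : 0 < ε) :
    0 < D.truncation ε ∧ ∀ k, D.truncation ε ≤ k → D.decayBound k < min ε 1 := by
  refine Nat.sInf_mem (s := {K | 0 < K ∧ ∀ k, K ≤ k → D.decayBound k < min ε 1}) ?_
  obtain ⟨K, hK⟩ := (D.tendsto_decayBound.eventually
    (gt_mem_nhds (show (0 : ℝ) < min ε 1 by positivity))).exists_forall_of_atTop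
  exact ⟨K + 1, Nat.succ_pos _, fun k hk => hK k (by omega)⟩

theorem decayBound_nonneg (D : JordanDecomposition A) (k : ℕ) : 0 ≤ D.decayBound k :=
  mul_nonneg (mul_nonneg (hsNorm_nonneg _) (hsNorm_nonneg _)) (hsNorm_nonneg _)

theorem decayBound_add_le (D : JordanDecomposition A) (hn : 0 < n) (k l : ℕ) :
    D.decayBound (k + l) ≤ D.decayBound k * D.decayBound l := by
  have h1 : 1 ≤ hsNorm D.S * hsNorm D.S⁻¹ := by
    refine (one_le_hsNorm_one hn).trans ?_
    rw [← D.S_mul_inv]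
    exact hsNorm_mul_le _ _
  have h2 : hsNorm (D.decayingPart ^ (k + l)) ≤
      hsNorm (D.decayingPart ^ k) * hsNorm (D.decayingPart ^ l) := by
    rw [pow_add]; exact hsNorm_mul_le _ _
  have h3 := hsNorm_nonneg (D.decayingPart ^ k)
  have h4 := hsNorm_nonneg (D.decayingPart ^ l)
  unfold decayBound
  calc _ ≤ hsNorm D.S * hsNorm D.S⁻¹ *
        (hsNorm (D.decayingPart ^ k) * hsNorm (D.decayingPart ^ l)) :=
        mul_le_mul_of_nonneg_left h2 (by linarith)
    _ ≤ hsNorm D.S * hsNorm D.S⁻¹ * (hsNorm D.S * hsNorm D.S⁻¹ *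
        (hsNorm (D.decayingPart ^ k) * hsNorm (D.decayingPart ^ l))) := by
        refine mul_le_mul_of_nonneg_left ?_ (by linarith)
        exact le_mul_of_one_le_left (mul_nonneg h3 h4) h1
    _ = _ := by ring

/-- The decay bound is submultiplicative, so it stays small for good as soon as it is small on a
window `[K, 2 K)`. -/
theorem decayBound_lt_of_window (D : JordanDecomposition A) (hn : 0 < n) {ε : ℝ} {K : ℕ}
    (hK : 0 < K) (h : ∀ k, K ≤ k → k < 2 * K → D.decayBound k < min ε 1) (k : ℕ) (hk : K ≤ k) :
    D.decayBound k < min ε 1 := by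
  induction k using Nat.strong_induction_on with
  | _ k ih =>
    by_cases hk' : k < 2 * K
    · exact h k hk hk'
    · obtain ⟨l, rfl⟩ : ∃ l, k = K + l := ⟨k - K, by omega⟩
      have hl := ih l (by omega) (by omega)
      have hK1 := (h K le_rfl (by omega)).trans_le (min_le_right _ _)
      refine (D.decayBound_add_le hn K l).trans_lt (lt_of_le_of_lt ?_ hl)
      exact mul_le_of_le_one_left (D.decayBound_nonneg l) hK1.le

end JordanDecomposition

/-! ### Periodically stable states and the period -/

namespace Chain

variable {d : ℕ} (G : Chain d)

theorem powerBounded (D : JordanDecomposition G.matrixRep) : D.PowerBounded := by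
  refine JordanDecomposition.powerBounded_of_bound fun v => ?_
  obtain ⟨C, hC⟩ := G.exists_bound_iterate (unvectorize v)
  refine ⟨C, fun k i => ?_⟩
  have h := G.vectorize_superOp_iterate (unvectorize v) k
  rw [vectorize_unvectorize] at h
  rw [← h]
  exact hC k _ _

/-- The coordinates of the initial state with respect to the Jordan basis, restricted to the
eigenvalues of modulus one. -/
def peripheralCoord (D : JordanDecomposition G.matrixRep) (z : Fin (d * d)) : ℂ :=
  D.peripheral z * (D.S⁻¹ *ᵥ vectorize G.init) z

/-- The periodically stable states `S J_φ S⁻¹ (𝓔^k ρ₀)`. -/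
def stable (D : JordanDecomposition G.matrixRep) (k : ℕ) : Op d :=
  applyRep D.stabilizer (G.traj k)

variable {G} (D : JordanDecomposition G.matrixRep)

theorem inv_mulVec_traj (k : ℕ) : D.S⁻¹ *ᵥ vectorize (G.traj k) =
    D.J ^ k *ᵥ (D.S⁻¹ *ᵥ vectorize G.init) := by
  rw [vectorize_traj, D.pow_eq, mulVec_mulVec, mulVec_mulVec, ← mul_assoc, ← mul_assoc,
    D.inv_mul_S, one_mul]

theorem peripheral_mul_coord (k : ℕ) (z : Fin (d * d)) :
    D.peripheral z * (D.S⁻¹ *ᵥ vectorize (G.traj k)) z =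
      D.J z z ^ k * G.peripheralCoord D z := by
  have h : D.peripheral z * (D.S⁻¹ *ᵥ vectorize (G.traj k)) z =
      (diagonal D.peripheral *ᵥ (D.S⁻¹ *ᵥ vectorize (G.traj k))) z :=
    (mulVec_diagonal D.peripheral _ z).symm
  rw [h, inv_mulVec_traj, mulVec_mulVec, (G.powerBounded D).diagonal_mul_pow, mulVec_diagonal,
    peripheralCoord]
  ring

theorem vectorize_stable (k : ℕ) : vectorize (G.stable D k) =
    D.S *ᵥ fun z => D.J z z ^ k * G.peripheralCoord D z := by
  rw [stable, vectorize_applyRep, D.stabilizer_eq, ← mulVec_mulVec, ← mulVec_mulVec]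
  congr 1
  ext z
  rw [mulVec_diagonal, peripheral_mul_coord]

/-- Equality of stable states is equality of the coordinates with eigenvalues of modulus one. -/
theorem stable_eq_iff (k l : ℕ) : G.stable D k = G.stable D l ↔
    ∀ z, D.J z z ^ k * G.peripheralCoord D z = D.J z z ^ l * G.peripheralCoord D z := by
  have hinj : Function.Injective D.S.mulVec :=
    mulVec_injective_of_isUnit ((isUnit_iff_isUnit_det _).2 D.isUnit_det)
  rw [← vectorize_injective.eq_iff, vectorize_stable, vectorize_stable, hinj.eq_iff, funext_iff]

/-- The time `0` is excluded: `J_<^0` is the identity matrix, while the bound comes from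
`J^k - J_φ J^k = J_<^k`, which holds for `k > 0` only. -/
theorem hsNorm_stable_sub_traj_le {k : ℕ} (hk : 0 < k) :
    hsNorm (G.stable D k - G.traj k) ≤ D.decayBound k := by
  obtain ⟨k, rfl⟩ : ∃ l, k = l + 1 := ⟨k - 1, by omega⟩
  have h : G.traj (k + 1) - G.stable D (k + 1) =
      applyRep (D.S * D.decayingPart ^ (k + 1) * D.S⁻¹) G.init := by
    apply vectorize_injective
    rw [vectorize_sub, stable, vectorize_applyRep, vectorize_applyRep,
      (G.powerBounded D).decayingPart_pow, D.stabilizer_eq, vectorize_traj, mulVec_mulVec,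
      ← sub_mulVec]
    congr 1
    rw [D.pow_eq]
    calc D.S * D.J ^ (k + 1) * D.S⁻¹ -
          D.S * diagonal D.peripheral * D.S⁻¹ * (D.S * D.J ^ (k + 1) * D.S⁻¹)
        = D.S * D.J ^ (k + 1) * D.S⁻¹ -
          D.S * diagonal D.peripheral * (D.S⁻¹ * D.S) * D.J ^ (k + 1) * D.S⁻¹ := by noncomm_ring
      _ = _ := by rw [D.inv_mul_S]; noncomm_ring
  have hneg : hsNorm (G.stable D (k + 1) - G.traj (k + 1)) =
      hsNorm (G.traj (k + 1) - G.stable D (k + 1)) := by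
    rw [← neg_sub, hsNorm, hsNorm, conjTranspose_neg, neg_mul_neg]
  rw [hneg, h]
  refine (hsNorm_applyRep_le _ _).trans ?_
  have h1 : hsNorm G.init ≤ 1 := by
    refine (hsNorm_le_trace G.init_density.1).trans_eq ?_
    rw [G.init_density.2, Complex.one_re]
  refine (mul_le_of_le_one_right (hsNorm_nonneg _) h1).trans ?_
  refine (hsNorm_mul_le _ _).trans ?_
  refine (mul_le_mul_of_nonneg_right (hsNorm_mul_le _ _) (hsNorm_nonneg _)).trans_eq ?_
  rw [JordanDecomposition.decayBound]
  ring

theorem tendsto_stable_sub_traj :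
    Tendsto (fun k => G.stable D k - G.traj k) atTop (𝓝 0) := by
  have h : Tendsto (fun k => hsNorm (G.stable D k - G.traj k)) atTop (𝓝 0) := by
    refine tendsto_of_tendsto_of_tendsto_of_le_of_le' tendsto_const_nhds
      D.tendsto_decayBound (Eventually.of_forall fun k => hsNorm_nonneg _) ?_
    filter_upwards [eventually_gt_atTop 0] with k hk using hsNorm_stable_sub_traj_le D hk
  refine tendsto_pi_nhds.2 fun i => tendsto_pi_nhds.2 fun j => ?_
  exact squeeze_zero_norm (fun k => norm_apply_le_hsNorm _ i j) h

theorem stable_mul {θ : ℕ} (h : G.stable D θ = G.stable D 0) (n k : ℕ) :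
    G.stable D (k + n * θ) = G.stable D k := by
  rw [stable_eq_iff] at h ⊢
  intro z
  have hz : D.J z z ^ θ * G.peripheralCoord D z = G.peripheralCoord D z := by simpa using h z
  induction n with
  | zero => simp
  | succ n ih => rw [Nat.succ_mul, ← add_assoc, pow_add, mul_assoc, hz, ih]

/-- The trajectory converges along the multiples of `θ` exactly if `θ` is a period of the stable
states: a sequence `z ^ n` with `‖z‖ = 1` converges only if `z = 1`. -/
theorem convergesAlong_iff {θ : ℕ} (hθ : 0 < θ) :
    G.ConvergesAlong θ ↔ G.stable D θ = G.stable D 0 := by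
  have hmul : Tendsto (fun n : ℕ => n * θ) atTop atTop :=
    tendsto_id.atTop_mul_const' hθ
  constructor
  · rintro ⟨-, ρ, -, hρ⟩
    have h1 : Tendsto (fun n : ℕ => G.stable D (n * θ)) atTop (𝓝 ρ) := by
      have := ((tendsto_stable_sub_traj D).comp hmul).add hρ
      simpa [Function.comp_def] using this
    have h2 : Tendsto (fun n : ℕ => D.S⁻¹ *ᵥ vectorize (G.stable D (n * θ))) atTop
        (𝓝 (D.S⁻¹ *ᵥ vectorize ρ)) := by
      have hc : Continuous fun A : Op d => D.S⁻¹ *ᵥ vectorize A := by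
        unfold vectorize
        fun_prop
      exact (hc.tendsto ρ).comp h1
    rw [stable_eq_iff]
    intro z
    have h3 := (tendsto_pi_nhds.1 h2 z)
    simp only [vectorize_stable, mulVec_mulVec, D.inv_mul_S, one_mulVec] at h3
    have h4 : Tendsto (fun n : ℕ => D.J z z ^ ((n + 1) * θ) * G.peripheralCoord D z -
        D.J z z ^ (n * θ) * G.peripheralCoord D z) atTop (𝓝 0) := by
      have := (h3.comp (tendsto_add_atTop_nat 1)).sub h3
      rwa [sub_self] at this
    rw [pow_zero, one_mul]
    by_cases hz : ‖D.J z z‖ = 1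
    · have h5 : ∀ n : ℕ, ‖D.J z z ^ ((n + 1) * θ) * G.peripheralCoord D z -
          D.J z z ^ (n * θ) * G.peripheralCoord D z‖ =
          ‖D.J z z ^ θ * G.peripheralCoord D z - G.peripheralCoord D z‖ := by
        intro n
        -- The differences have constant modulus, and they tend to zero.
        have : D.J z z ^ ((n + 1) * θ) * G.peripheralCoord D z -
          D.J z z ^ (n * θ) * G.peripheralCoord D z = D.J z z ^ (n * θ) *
            (D.J z z ^ θ * G.peripheralCoord D z - G.peripheralCoord D z) := by
          rw [Nat.succ_mul, pow_add]; ring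
        rw [this, norm_mul, norm_pow, hz, one_pow, one_mul]
      have h6 := h4.norm
      simp only [h5, norm_zero] at h6
      exact sub_eq_zero.1 (norm_eq_zero.1 (tendsto_nhds_unique tendsto_const_nhds h6))
    · simp [peripheralCoord, JordanDecomposition.peripheral, hz]
  · intro h
    have h1 : ∀ n, G.stable D (n * θ) = G.stable D 0 := fun n => by
      simpa using stable_mul D h n 0
    have h2 : Tendsto (fun n : ℕ => G.traj (n * θ)) atTop (𝓝 (G.stable D 0)) := by
      have := (((tendsto_stable_sub_traj D).comp hmul).neg).add_const (G.stable D 0)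
      simpa [Function.comp_def, h1] using this
    exact ⟨hθ, _, isClosed_isDensity.mem_of_tendsto h2
      (Eventually.of_forall fun n => G.isDensity_traj _), h2⟩

theorem period_spec (hG : G.PeriodicallyStable) :
    0 < G.period ∧ G.stable D G.period = G.stable D 0 := by
  have h : G.ConvergesAlong G.period := Nat.sInf_mem hG
  exact ⟨h.1, (convergesAlong_iff D h.1).1 h⟩

theorem period_le {θ : ℕ} (hθ : 0 < θ) (h : G.stable D θ = G.stable D 0) : G.period ≤ θ :=
  Nat.sInf_le ((convergesAlong_iff D hθ).2 h)

theorem stable_mod_period (hG : G.PeriodicallyStable) (n : ℕ) :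
    G.stable D (n % G.period) = G.stable D n := by
  have := stable_mul D (period_spec D hG).2 (n / G.period) (n % G.period)
  rw [mul_comm, Nat.mod_add_div] at this
  exact this.symm

theorem stable_add_period (hG : G.PeriodicallyStable) (n : ℕ) :
    G.stable D (n + G.period) = G.stable D n := by
  simpa using stable_mul D (period_spec D hG).2 1 n

/-- Whether `θ` is a period of the stable states can be read off one linear functional of the state
at time `θ`: by the equality case of the Cauchy-Schwarz inequality it attains its maximal value
only where all phases `z ^ θ` are trivial. -/
theorem stable_eq_iff_functional (θ : ℕ) : G.stable D θ = G.stable D 0 ↔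
    (∑ z, star (G.peripheralCoord D z) * G.peripheralCoord D z).re ≤
      (∑ z, star (G.peripheralCoord D z) * (D.S⁻¹ *ᵥ vectorize (G.traj θ)) z).re := by
  have hval : ∀ z, star (G.peripheralCoord D z) * (D.S⁻¹ *ᵥ vectorize (G.traj θ)) z =
      D.J z z ^ θ * (star (G.peripheralCoord D z) * G.peripheralCoord D z) := by
    intro z
    have h1 : star (G.peripheralCoord D z) = star (G.peripheralCoord D z) * D.peripheral z := by
      unfold peripheralCoord JordanDecomposition.peripheral
      split_ifs <;> simp
    rw [h1, mul_assoc, peripheral_mul_coord]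
    unfold peripheralCoord JordanDecomposition.peripheral
    split_ifs <;> simp
    ring
  have hsq : ∀ z, star (G.peripheralCoord D z) * G.peripheralCoord D z =
      ((‖G.peripheralCoord D z‖ ^ 2 : ℝ) : ℂ) := by
    intro z
    rw [Complex.star_def, Complex.conj_mul']
    push_cast; rfl
  have hre : ∀ z, (star (G.peripheralCoord D z) * (D.S⁻¹ *ᵥ vectorize (G.traj θ)) z).re =
      (D.J z z ^ θ).re * ‖G.peripheralCoord D z‖ ^ 2 := by
    intro z
    rw [hval, hsq, Complex.re_mul_ofReal]
  have hle : ∀ z, (D.J z z ^ θ).re * ‖G.peripheralCoord D z‖ ^ 2 ≤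
      ‖G.peripheralCoord D z‖ ^ 2 := by
    intro z
    refine mul_le_of_le_one_left (by positivity) ((Complex.re_le_norm _).trans ?_)
    rw [norm_pow]
    exact pow_le_one₀ (norm_nonneg _) ((G.powerBounded D).le_one z)
  rw [Complex.re_sum, Complex.re_sum, Finset.sum_congr rfl fun z _ => hre z,
    Finset.sum_congr rfl fun z _ => congrArg Complex.re (hsq z), stable_eq_iff]
  simp only [Complex.ofReal_re, pow_zero, one_mul]
  constructor
  · intro h
    refine Finset.sum_le_sum fun z _ => ?_
    by_cases hz : G.peripheralCoord D z = 0
    · simp [hz]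
    · rw [mul_eq_right₀ hz |>.1 (h z)]
      simp
  · intro h z
    have heq := (Finset.sum_eq_sum_iff_of_le fun z _ => hle z).1
      (le_antisymm (Finset.sum_le_sum fun z _ => hle z) h) z (Finset.mem_univ z)
    by_cases hz : G.peripheralCoord D z = 0
    · simp [hz]
    · have hz' : ‖G.peripheralCoord D z‖ ^ 2 ≠ 0 := by simpa using hz
      have h1 : (D.J z z ^ θ).re = 1 := (mul_eq_right₀ hz').1 heq
      have h2 : ‖D.J z z ^ θ‖ ≤ 1 := by
        rw [norm_pow]
        exact pow_le_one₀ (norm_nonneg _) ((G.powerBounded D).le_one z)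
      have h3 : D.J z z ^ θ = 1 := by
        have h4 := Complex.sq_norm_sub_sq_re (D.J z z ^ θ)
        rw [h1] at h4
        have h5 : (D.J z z ^ θ).im ^ 2 ≤ 0 := by
          rw [← h4]
          nlinarith [norm_nonneg (D.J z z ^ θ)]
        exact Complex.ext h1 ((pow_eq_zero_iff two_ne_zero).1 (le_antisymm h5 (sq_nonneg _)))
      rw [h3, one_mul]

end Chain

namespace Instance

variable {d m : ℕ} (I : Instance d m) (D : JordanDecomposition I.chain.matrixRep)

theorem stableState_mod (h : I.chain.PeriodicallyStable) (n : ℕ) :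
    I.stableState D (n % I.chain.period) = I.chain.stable D n :=
  Chain.stable_mod_period D h n

theorem admissible_truncation (h : I.chain.PeriodicallyStable) :
    I.Admissible D (D.truncation I.ε) := by
  obtain ⟨h0, hb⟩ := D.truncation_spec I.ε_pos
  refine ⟨h0, fun n hn => ?_⟩
  rw [I.stableState_mod D h]
  exact ⟨_, I.chain.isDensity_traj n, (Chain.hsNorm_stable_sub_traj_le D (h0.trans_le hn)).trans_lt
    ((hb n hn).trans_le (min_le_left _ _)), rfl⟩

end Instance

/-! ### The linear recurrence of the squared norms of the powers -/

section Recurrence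

open Polynomial

/-- The shift operator on complex sequences. -/
def shift : Module.End ℂ (ℕ → ℂ) where
  toFun x n := x (n + 1)
  map_add' _ _ := rfl
  map_smul' _ _ := rfl

/-- The polynomial `q` in the shift operator annihilates the sequence `x`. -/
def Annihilates (q : ℂ[X]) (x : ℕ → ℂ) : Prop := aeval shift q x = 0

theorem shift_pow_apply (k : ℕ) (x : ℕ → ℂ) (n : ℕ) : (shift ^ k) x n = x (n + k) := by
  induction k generalizing n with
  | zero => rfl
  | succ k ih =>
    rw [pow_succ', Module.End.mul_apply]
    change (shift ^ k) x (n + 1) = _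
    rw [ih]
    congr 1
    omega

theorem aeval_shift_apply (q : ℂ[X]) (x : ℕ → ℂ) (n : ℕ) :
    aeval shift q x n = ∑ k ∈ Finset.range (q.natDegree + 1), q.coeff k * x (n + k) := by
  rw [aeval_eq_sum_range, LinearMap.sum_apply, Finset.sum_apply]
  refine Finset.sum_congr rfl fun k _ => ?_
  rw [LinearMap.smul_apply, Pi.smul_apply, shift_pow_apply, smul_eq_mul]

theorem annihilates_sum {ι : Type} (s : Finset ι) {q : ℂ[X]} {x : ι → ℕ → ℂ}
    (h : ∀ i ∈ s, Annihilates q (x i)) : Annihilates q (∑ i ∈ s, x i) := by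
  unfold Annihilates at *
  rw [map_sum]
  exact Finset.sum_eq_zero h

theorem Annihilates.of_dvd {q r : ℂ[X]} {x : ℕ → ℂ} (h : Annihilates q x) (hd : q ∣ r) :
    Annihilates r x := by
  obtain ⟨s, rfl⟩ := hd
  unfold Annihilates at *
  rw [mul_comm, map_mul, Module.End.mul_apply, h, map_zero]

theorem Annihilates.add {q : ℂ[X]} {x y : ℕ → ℂ} (h : Annihilates q x) (h' : Annihilates q y) :
    Annihilates q (x + y) := by
  unfold Annihilates at *
  rw [map_add, h, h', add_zero]

theorem Annihilates.smul {q : ℂ[X]} {x : ℕ → ℂ} (h : Annihilates q x) (c : ℂ) :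
    Annihilates q (c • x) := by
  unfold Annihilates at *
  rw [map_smul, h, smul_zero]

theorem annihilates_mul_iff {q r : ℂ[X]} {x : ℕ → ℂ} :
    Annihilates (q * r) x ↔ Annihilates q (aeval shift r x) := by
  unfold Annihilates
  rw [map_mul, Module.End.mul_apply]

theorem aeval_shift_X_sub_C (z : ℂ) (x : ℕ → ℂ) (n : ℕ) :
    aeval shift (X - C z) x n = x (n + 1) - z * x n := by
  simp [shift, Algebra.algebraMap_eq_smul_one]

/-- The product of exponential polynomials with bases `z` and `w` is an exponential polynomial with
base `z * w`. -/
theorem Annihilates.mul {z w : ℂ} {s t : ℕ} {x y : ℕ → ℂ} (hx : Annihilates ((X - C z) ^ s) x)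
    (hy : Annihilates ((X - C w) ^ t) y) : Annihilates ((X - C (z * w)) ^ (s + t)) (x * y) := by
  induction h : s + t generalizing s t x y with
  | zero =>
    obtain rfl : s = 0 := by omega
    have : x = 0 := by simpa [Annihilates] using hx
    simp [this, Annihilates]
  | succ k ih =>
    rcases s with _ | s
    · have : x = 0 := by simpa [Annihilates] using hx
      simp [this, Annihilates]
    rcases t with _ | t
    · have : y = 0 := by simpa [Annihilates] using hy
      simp [this, Annihilates]
    rw [pow_succ, annihilates_mul_iff]
    have hx' := annihilates_mul_iff.1 (pow_succ (X - C z) s ▸ hx)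
    have hy' := annihilates_mul_iff.1 (pow_succ (X - C w) t ▸ hy)
    set x' := aeval shift (X - C z) x with hx'_def
    set y' := aeval shift (X - C w) y with hy'_def
    have hxy : aeval shift (X - C (z * w)) (x * y) = z • (x * y') + w • (x' * y) + x' * y' := by
      ext n
      simp only [hx'_def, hy'_def, aeval_shift_X_sub_C, Pi.add_apply, Pi.mul_apply, Pi.smul_apply,
        smul_eq_mul]
      ring
    rw [hxy]
    refine (((ih hx hy' (by omega)).smul z).add ((ih hx' hy (by omega)).smul w)).add ?_
    exact ih (hx'.of_dvd (pow_dvd_pow _ (Nat.le_succ s))) hy' (by omega)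

/-- The conjugate of an exponential polynomial has the conjugate base. -/
theorem Annihilates.star {z : ℂ} {t : ℕ} {x : ℕ → ℂ} (hx : Annihilates ((X - C z) ^ t) x) :
    Annihilates ((X - C (star z)) ^ t) (fun n => star (x n)) := by
  induction t generalizing x with
  | zero =>
    have : x = 0 := by simpa [Annihilates] using hx
    subst this
    simp only [Annihilates, pow_zero, map_one, Module.End.one_apply, Pi.zero_apply, star_zero]
    rfl
  | succ t ih =>
    rw [pow_succ, annihilates_mul_iff] at hx ⊢
    convert ih hx using 1
    ext n
    rw [aeval_shift_X_sub_C, aeval_shift_X_sub_C, star_sub, star_mul']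

/-- The entries of the powers of a Jordan block are exponential polynomials, of a degree bounded by
the number of the following rows with the same eigenvalue. -/
theorem IsJordanForm.exists_annihilates {n : ℕ} {J : Op n} (hJ : IsJordanForm J) (i : Fin n) :
    ∃ t, (i : ℕ) + t ≤ n ∧ (∀ z : Fin n, i ≤ z → (z : ℕ) < i + t → J z z = J i i) ∧
      ∀ j, Annihilates ((X - C (J i i)) ^ t) (fun k => (J ^ k) i j) := by
  have hone : ∀ i : Fin n, (∀ j k, (J ^ (k + 1)) i j = J i i * (J ^ k) i j) →
      ∃ t, (i : ℕ) + t ≤ n ∧ (∀ z : Fin n, i ≤ z → (z : ℕ) < i + t → J z z = J i i) ∧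
      ∀ j, Annihilates ((X - C (J i i)) ^ t) (fun k => (J ^ k) i j) := by
    intro i h
    refine ⟨1, i.2, fun z hz hz' => ?_, fun j => ?_⟩
    · have hz : (i : ℕ) ≤ z := hz
      rw [Fin.ext (show (z : ℕ) = i by omega)]
    · rw [pow_one, Annihilates]
      ext k
      rw [aeval_shift_X_sub_C, h, sub_self]
      rfl
  induction h : n - i generalizing i with
  | zero => omega
  | succ k ih =>
    by_cases hi : (i : ℕ) + 1 < n
    · by_cases h0 : J i ⟨i + 1, hi⟩ = 0
      · exact hone i fun j k => by rw [pow_succ', hJ.mul_apply_of_lt hi, h0]; simp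
      · have hne : (⟨i + 1, hi⟩ : Fin n) ≠ i := fun h => by simpa using congrArg Fin.val h
        obtain ⟨-, h1, h2⟩ := (hJ i _ hne).resolve_left h0
        obtain ⟨t, ht, hz, hj⟩ := ih ⟨i + 1, hi⟩ (by simp; omega)
        simp only at ht hz
        refine ⟨t + 1, by omega, fun z hiz hzt => ?_, fun j => ?_⟩
        · rcases eq_or_lt_of_le hiz with rfl | hlt
          · rfl
          · rw [hz z hlt (by omega), ← h2]
        · rw [pow_succ, annihilates_mul_iff]
          convert h2 ▸ hj j using 1
          ext k
          rw [aeval_shift_X_sub_C, pow_succ', hJ.mul_apply_of_lt hi, h1]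
          ring
    · exact hone i fun j k => by rw [pow_succ', hJ.mul_apply_of_last (by omega)]

/-- The polynomial `∏ z, (X - |J z z|²)²`. -/
def normPoly {n : ℕ} (J : Op n) : ℂ[X] := ∏ z, (X - C (J z z * star (J z z))) ^ 2

/-- The sequence of the squared Hilbert-Schmidt norms of the powers. -/
def sqNorm {n : ℕ} (J : Op n) (k : ℕ) : ℂ := ∑ i, ∑ j, (J ^ k) i j * star ((J ^ k) i j)

theorem sqNorm_eq {n : ℕ} (J : Op n) (k : ℕ) : sqNorm J k = ((hsNorm (J ^ k) ^ 2 : ℝ) : ℂ) := by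
  rw [hsNorm_sq, sqNorm]
  push_cast
  refine Finset.sum_congr rfl fun i _ => Finset.sum_congr rfl fun j _ => ?_
  rw [Complex.star_def, Complex.mul_conj']

theorem IsJordanForm.annihilates_sqNorm {n : ℕ} {J : Op n} (hJ : IsJordanForm J) :
    Annihilates (normPoly J) (sqNorm J) := by
  have h : sqNorm J = ∑ i, ∑ j, (fun k => (J ^ k) i j) * fun k => star ((J ^ k) i j) := by
    ext k
    simp [sqNorm, Finset.sum_apply]
  rw [h]
  refine annihilates_sum _ fun i _ => annihilates_sum _ fun j _ => ?_
  obtain ⟨t, ht, hz, hj⟩ := hJ.exists_annihilates i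
  refine ((hj j).mul (hj j).star).of_dvd ?_
  -- The chain of the rows `i, …, i + t - 1` alone contributes the factor `(X - |J i i|²) ^ (2 t)`.
  let s : Finset (Fin n) := Finset.univ.filter fun z => i ≤ z ∧ (z : ℕ) < i + t
  have hs : ∏ z ∈ s, (X - C (J z z * Star.star (J z z))) ^ 2 =
      (X - C (J i i * Star.star (J i i))) ^ (t + t) := by
    have hcard : s.card = t := by
      have : s.map Fin.valEmbedding = Finset.Ico (i : ℕ) (i + t) := by
        ext x
        simp only [s, Finset.mem_map, Finset.mem_filter, Finset.mem_univ, true_and,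
          Fin.valEmbedding_apply, Finset.mem_Ico]
        constructor
        · rintro ⟨z, ⟨h1, h2⟩, rfl⟩
          exact ⟨h1, h2⟩
        · rintro ⟨h1, h2⟩
          exact ⟨⟨x, by omega⟩, ⟨h1, h2⟩, rfl⟩
      rw [← Finset.card_map Fin.valEmbedding, this, Nat.card_Ico]
      omega
    rw [Finset.prod_congr rfl (g := fun _ => (X - C (J i i * Star.star (J i i))) ^ 2),
      Finset.prod_const, hcard, ← pow_mul, two_mul]
    intro z hzs
    simp only [s, Finset.mem_filter] at hzs
    rw [hz z hzs.2.1 hzs.2.2]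
  rw [← hs]
  exact Finset.prod_dvd_prod_of_subset _ _ _ (Finset.subset_univ s)

theorem monic_normPoly {n : ℕ} (J : Op n) : (normPoly J).Monic :=
  monic_prod_of_monic _ _ fun _ _ => (monic_X_sub_C _).pow 2

theorem natDegree_normPoly {n : ℕ} (J : Op n) : (normPoly J).natDegree = 2 * n := by
  rw [normPoly, natDegree_prod_of_monic _ _ fun _ _ => (monic_X_sub_C _).pow 2]
  simp only [natDegree_pow, natDegree_X_sub_C, Finset.sum_const, Finset.card_univ, Fintype.card_fin,
    smul_eq_mul]
  ring

/-- The squared norms of the powers satisfy the linear recurrence of order `2 n` with characteristic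
polynomial `normPoly J`. -/
theorem IsJordanForm.sqNorm_recurrence {n : ℕ} {J : Op n} (hJ : IsJordanForm J) (k : ℕ) :
    sqNorm J (k + 2 * n) = ∑ j ∈ Finset.range (2 * n),
      -(normPoly J).coeff j * sqNorm J (k + j) := by
  have h := congrFun hJ.annihilates_sqNorm k
  rw [aeval_shift_apply, natDegree_normPoly, Finset.sum_range_succ] at h
  have h1 : (normPoly J).coeff (2 * n) = 1 := by
    rw [← natDegree_normPoly J]
    exact monic_normPoly J
  rw [h1, one_mul] at h
  simp only [neg_mul, Finset.sum_neg_distrib]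
  exact eq_neg_of_add_eq_zero_right h

/-- The coefficients that express the value at `k + N + i` of a sequence with a linear recurrence of
order `N` by the values at `k, …, k + N - 1`. -/
def recCoeff (N : ℕ) (r : ℕ → ℂ) : ℕ → ℕ → ℂ
  | 0, j => r j
  | i + 1, j => (if j = 0 then 0 else recCoeff N r i (j - 1)) + recCoeff N r i (N - 1) * r j

theorem recCoeff_spec {N : ℕ} (hN : 0 < N) {r : ℕ → ℂ} {x : ℕ → ℂ}
    (h : ∀ k, x (k + N) = ∑ j ∈ Finset.range N, r j * x (k + j)) (i k : ℕ) :
    x (k + N + i) = ∑ j ∈ Finset.range N, recCoeff N r i j * x (k + j) := by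
  induction i generalizing k with
  | zero => exact h k
  | succ i ih =>
    obtain ⟨M, rfl⟩ : ∃ M, N = M + 1 := ⟨N - 1, by omega⟩
    have h1 : k + (M + 1) + (i + 1) = (k + 1) + (M + 1) + i := by omega
    rw [h1, ih (k + 1), Finset.sum_range_succ]
    simp only [recCoeff, add_mul, Finset.sum_add_distrib, Nat.add_sub_cancel, mul_assoc,
      ← Finset.mul_sum]
    rw [← h k, Finset.sum_range_succ' (n := M)]
    simp only [Nat.add_sub_cancel, if_true, zero_mul, add_zero, Nat.succ_ne_zero, if_false]
    congr 1
    · exact Finset.sum_congr rfl fun j _ => by rw [show k + 1 + j = k + (j + 1) by omega]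
    · rw [show k + 1 + M = k + (M + 1) by omega]

end Recurrence

/-! ### Fair paths in periodic graphs -/

section Graph

/-- There is a path of length `l` from the vertex `T`, starting at time `n`, to a vertex in `Y`;
the vertices are the numbers below `N`, and `E n` is the edge relation at time `n`. The recursion
adds the edges at the beginning of the path. -/
def Path (E : ℕ → ℕ → ℕ → Prop) (N : ℕ) : ℕ → ℕ → (ℕ → Prop) → ℕ → Prop
  | _, 0, Y, T => Y T
  | n, l + 1, Y, T => ∃ T' < N, E n T T' ∧ Path E N (n + 1) l Y T'

/-- A path as in `Path` that visits a vertex in `F` before its end. -/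
def FPath (E : ℕ → ℕ → ℕ → Prop) (F : ℕ → Prop) (N : ℕ) : ℕ → ℕ → (ℕ → Prop) → ℕ → Prop
  | _, 0, _, _ => False
  | n, l + 1, Y, T => ∃ T' < N, E n T T' ∧
      (FPath E F N (n + 1) l Y T' ∨ F T ∧ Path E N (n + 1) l Y T')

/-- There is an infinite path from the vertex `T`, starting at time `n`, that visits each of the
sets `F i`, `i < s`, infinitely often. -/
def FairFrom (E : ℕ → ℕ → ℕ → Prop) (F : ℕ → ℕ → Prop) (N s n T : ℕ) : Prop :=
  ∃ t : ℕ → ℕ, t 0 = T ∧ (∀ k, t k < N) ∧ (∀ k, E (n + k) (t k) (t (k + 1))) ∧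
    ∀ i < s, ∀ k, ∃ l ≥ k, F i (t l)

variable {E : ℕ → ℕ → ℕ → Prop} {N : ℕ}

theorem path_iff {n l : ℕ} {Y : ℕ → Prop} {T : ℕ} : Path E N n l Y T ↔ ∃ t : ℕ → ℕ, t 0 = T ∧
    (∀ k < l, E (n + k) (t k) (t (k + 1)) ∧ t (k + 1) < N) ∧ Y (t l) := by
  induction l generalizing n T with
  | zero => exact ⟨fun h => ⟨fun _ => T, rfl, by simp, h⟩, by rintro ⟨t, rfl, -, h⟩; exact h⟩
  | succ l ih =>
    simp only [Path, ih]
    constructor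
    · rintro ⟨T', hT', hE, t, rfl, ht, hY⟩
      refine ⟨fun k => if k = 0 then T else t (k - 1), by simp, fun k hk => ?_, by simpa using hY⟩
      rcases k with _ | k
      · simpa using ⟨hE, hT'⟩
      · have := ht k (by omega)
        rw [show n + 1 + k = n + (k + 1) by omega] at this
        simpa using this
    · rintro ⟨t, rfl, ht, hY⟩
      refine ⟨t 1, (ht 0 (by omega)).2, by simpa using (ht 0 (by omega)).1,
        fun k => t (k + 1), rfl, fun k hk => ?_, hY⟩
      have := ht (k + 1) (by omega)
      rwa [show n + 1 + k = n + (k + 1) by omega]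

theorem fPath_iff {F : ℕ → Prop} {n l : ℕ} {Y : ℕ → Prop} {T : ℕ} :
    FPath E F N n l Y T ↔ ∃ t : ℕ → ℕ, t 0 = T ∧
    (∀ k < l, E (n + k) (t k) (t (k + 1)) ∧ t (k + 1) < N) ∧ (∃ k < l, F (t k)) ∧ Y (t l) := by
  induction l generalizing n T with
  | zero => simp [FPath]
  | succ l ih =>
    simp only [FPath, ih, path_iff]
    constructor
    · rintro ⟨T', hT', hE, h⟩
      have key : ∀ t : ℕ → ℕ, t 0 = T' →
          (∀ k < l, E (n + 1 + k) (t k) (t (k + 1)) ∧ t (k + 1) < N) → ∀ k < l + 1,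
          E (n + k) ((fun k => if k = 0 then T else t (k - 1)) k)
            ((fun k => if k = 0 then T else t (k - 1)) (k + 1)) ∧
            (fun k => if k = 0 then T else t (k - 1)) (k + 1) < N := by
        rintro t rfl ht k hk
        rcases k with _ | k
        · simpa using ⟨hE, hT'⟩
        · have := ht k (by omega)
          rw [show n + 1 + k = n + (k + 1) by omega] at this
          simpa using this
      rcases h with ⟨t, h0, ht, ⟨k, hk, hF⟩, hY⟩ | ⟨hF, t, h0, ht, hY⟩
      · exact ⟨_, by simp, key t h0 ht, ⟨k + 1, by omega, by simpa using hF⟩, by simpa using hY⟩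
      · exact ⟨_, by simp, key t h0 ht, ⟨0, by omega, by simpa using hF⟩, by simpa using hY⟩
    · rintro ⟨t, rfl, ht, ⟨k, hk, hF⟩, hY⟩
      have ht' : ∀ k < l, E (n + 1 + k) (t (k + 1)) (t (k + 1 + 1)) ∧ t (k + 1 + 1) < N := by
        intro k hk
        have := ht (k + 1) (by omega)
        rwa [show n + 1 + k = n + (k + 1) by omega]
      refine ⟨t 1, (ht 0 (by omega)).2, by simpa using (ht 0 (by omega)).1, ?_⟩
      rcases k with _ | k
      · exact Or.inr ⟨hF, fun k => t (k + 1), rfl, ht', hY⟩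
      · exact Or.inl ⟨fun k => t (k + 1), rfl, ht', ⟨k, by omega, hF⟩, hY⟩

theorem fairFrom_step_iff {F : ℕ → ℕ → Prop} {s n T : ℕ} (hT : T < N) : FairFrom E F N s n T ↔
    ∃ T' < N, E n T T' ∧ FairFrom E F N s (n + 1) T' := by
  constructor
  · rintro ⟨t, rfl, hN, hE, hF⟩
    refine ⟨t 1, hN 1, hE 0, fun k => t (k + 1), rfl, fun k => hN _, fun k => ?_, fun i hi k => ?_⟩
    · rw [show n + 1 + k = n + (k + 1) by omega]
      exact hE (k + 1)
    · obtain ⟨l, hl, h⟩ := hF i hi (k + 1)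
      refine ⟨l - 1, by omega, ?_⟩
      change F i (t (l - 1 + 1))
      rwa [Nat.sub_add_cancel (by omega)]
  · rintro ⟨T', hT', hE0, t, rfl, hN, hE, hF⟩
    refine ⟨fun k => if k = 0 then T else t (k - 1), by simp, fun k => ?_, fun k => ?_,
      fun i hi k => ?_⟩
    · rcases k with _ | k
      · simpa using hT
      · simpa using hN k
    · rcases k with _ | k
      · simpa using hE0
      · have := hE k
        rw [show n + 1 + k = n + (k + 1) by omega] at this
        simpa using this
    · obtain ⟨l, hl, h⟩ := hF i hi k
      exact ⟨l + 1, by omega, by simpa using h⟩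

/-- Fairness concerns the tail only: the first `l` steps of a fair path are arbitrary. -/
theorem fairFrom_iff_path {F : ℕ → ℕ → Prop} {s n l T : ℕ} (hT : T < N) :
    FairFrom E F N s n T ↔ Path E N n l (FairFrom E F N s (n + l)) T := by
  induction l generalizing n T with
  | zero => rfl
  | succ l ih =>
    rw [fairFrom_step_iff hT, Path]
    refine exists_congr fun T' => and_congr_right fun hT' => and_congr_right fun _ => ?_
    rw [ih hT', show n + 1 + l = n + (l + 1) by omega]

theorem path_mono {n l T : ℕ} {Y Y' : ℕ → Prop} (h : ∀ T < N, Y T → Y' T) (hT : T < N)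
    (hp : Path E N n l Y T) : Path E N n l Y' T := by
  induction l generalizing n T with
  | zero => exact h T hT hp
  | succ l ih =>
    obtain ⟨T', hT', hE, hp⟩ := hp
    exact ⟨T', hT', hE, ih hT' hp⟩

variable {F : ℕ → ℕ → Prop} {K p s : ℕ}

theorem edge_periodic (hper : ∀ n, K ≤ n → E (n + p) = E n) (j n : ℕ) (hn : K ≤ n) :
    E (n + j * p) = E n := by
  induction j with
  | zero => simp
  | succ j ih => rw [Nat.succ_mul, ← add_assoc, hper _ (by omega), ih]

theorem path_periodic (hper : ∀ n, K ≤ n → E (n + p) = E n) {n l : ℕ} (hn : K ≤ n) {Y : ℕ → Prop}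
    {T : ℕ} : Path E N (n + p) l Y T ↔ Path E N n l Y T := by
  induction l generalizing n T with
  | zero => rfl
  | succ l ih =>
    simp only [Path]
    rw [hper n hn, show n + p + 1 = n + 1 + p by omega]
    exact exists_congr fun T' => and_congr_right fun _ => and_congr_right fun _ => ih (by omega)

theorem fPath_periodic {F : ℕ → Prop} (hper : ∀ n, K ≤ n → E (n + p) = E n) {n l : ℕ}
    (hn : K ≤ n) {Y : ℕ → Prop} {T : ℕ} :
    FPath E F N (n + p) l Y T ↔ FPath E F N n l Y T := by
  induction l generalizing n T with
  | zero => rfl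
  | succ l ih =>
    simp only [FPath]
    rw [hper n hn, show n + p + 1 = n + 1 + p by omega]
    exact exists_congr fun T' => and_congr_right fun _ => and_congr_right fun _ =>
      or_congr (ih (by omega)) (and_congr_right fun _ => path_periodic hper (by omega))

theorem fairFrom_periodic (hper : ∀ n, K ≤ n → E (n + p) = E n) (j T : ℕ) :
    FairFrom E F N s (K + j * p) T ↔ FairFrom E F N s K T := by
  have : ∀ k, E (K + j * p + k) = E (K + k) := fun k => by
    rw [show K + j * p + k = K + k + j * p by omega, edge_periodic hper j (K + k) (by omega)]
  simp only [FairFrom, this]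

/-- A path through more than `2 N` periods can be shortened: it is in the same vertex at the
beginning of two periods, with the same answer to the question whether `F` has been visited. -/
theorem fPath_shorten {F : ℕ → Prop} (hper : ∀ n, K ≤ n → E (n + p) = E n) {j : ℕ}
    {Y : ℕ → Prop} {T : ℕ} (hj : 1 ≤ j) (h : FPath E F N K (j * p) Y T) :
    ∃ j', 1 ≤ j' ∧ j' ≤ 2 * N ∧ FPath E F N K (j' * p) Y T := by
  classical
  induction j using Nat.strong_induction_on with
  | _ j ih =>
    by_cases hjN : j ≤ 2 * N
    · exact ⟨j, hj, hjN, h⟩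
    obtain ⟨t, h0, ht, ⟨k, hk, hF⟩, hY⟩ := fPath_iff.1 h
    have hp : 0 < p := Nat.pos_of_ne_zero fun hp => by simp [hp] at hk
    -- Pigeonhole: there are `2 N` pairs of a vertex and a flag for a past visit to `F`.
    obtain ⟨a, ha, b, hb, hab, heq⟩ := Finset.exists_ne_map_eq_of_card_lt_of_maps_to
      (s := Finset.Icc 1 j) (t := Finset.range N ×ˢ (Finset.univ : Finset Bool))
      (f := fun a => (t (a * p), decide (∃ k < a * p, F (t k))))
      (by simp; omega) (by
        intro a ha
        simp only [Finset.coe_Icc, Set.mem_Icc] at ha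
        simp only [Finset.coe_product, Set.mem_prod, Finset.coe_range, Set.mem_Iio]
        refine ⟨?_, Finset.mem_univ _⟩
        have h1 : 1 * p ≤ a * p := Nat.mul_le_mul_right p ha.1
        have h2 : a * p ≤ j * p := Nat.mul_le_mul_right p ha.2
        have := (ht (a * p - 1) (by omega)).2
        rwa [Nat.sub_add_cancel (by omega)] at this)
    wlog hlt : a < b generalizing a b
    · exact this b hb a ha hab.symm heq.symm (by omega)
    simp only [Finset.mem_Icc] at ha hb
    simp only [Prod.mk.injEq, decide_eq_decide] at heq
    -- The segment from the period `a` to the period `b = a + c` is cut out.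
    obtain ⟨c, rfl⟩ : ∃ c, b = a + c := ⟨b - a, by omega⟩
    have hshift : ∀ k, a * p ≤ k → E (K + (k + c * p)) = E (K + k) := fun k _ => by
      rw [show K + (k + c * p) = K + k + c * p by omega, edge_periodic hper c _ (by omega)]
    have hacp : (a + c) * p = a * p + c * p := Nat.add_mul _ _ _
    have hjc : (j - c) * p + c * p = j * p := by rw [← Nat.add_mul]; congr 1; omega
    have hlast : a * p + c * p ≤ j * p := by
      rw [← hacp]; exact Nat.mul_le_mul_right p hb.2
    refine ih (j - c) (by omega) (by omega) (fPath_iff.2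
      ⟨fun k => if k ≤ a * p then t k else t (k + c * p), by simpa using h0, fun k hk => ?_, ?_,
        ?_⟩)
    · by_cases hka : k + 1 ≤ a * p
      · simp only [hka, if_true, show k ≤ a * p by omega]
        exact ht k (by omega)
      · by_cases hka' : k ≤ a * p
        · obtain rfl : k = a * p := by omega
          simp only [le_refl, if_true, hka, if_false]
          have := ht (a * p + c * p) (by omega)
          rw [hshift _ le_rfl, ← hacp, ← heq.1, hacp,
            show a * p + c * p + 1 = a * p + 1 + c * p by omega] at this
          exact this
        · simp only [hka, if_false, hka']
          have := ht (k + c * p) (by omega)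
          rwa [hshift _ (by omega), show k + c * p + 1 = k + 1 + c * p by omega] at this
    · by_cases hbk : k < (a + c) * p
      · obtain ⟨k', hk', hF'⟩ := heq.2.2 ⟨k, hbk, hF⟩
        exact ⟨k', by omega, by simpa [hk'.le] using hF'⟩
      · refine ⟨k - c * p, by omega, ?_⟩
        by_cases hka : k - c * p ≤ a * p
        · have : k = (a + c) * p := by omega
          rw [this, ← heq.1] at hF
          simpa [this, hacp] using hF
        · simpa [hka, Nat.sub_add_cancel (show c * p ≤ k by omega)] using hF
    · by_cases hja : (j - c) * p ≤ a * p
      · have : j * p = (a + c) * p := by omega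
        rw [this, ← heq.1] at hY
        simpa [hja, show (j - c) * p = a * p by omega] using hY
      · simpa [hja, hjc] using hY

/-- The case of `fPath_shorten` in which every vertex counts as visited. -/
theorem path_shorten (hper : ∀ n, K ≤ n → E (n + p) = E n) (hp : 0 < p) {j : ℕ} {Y : ℕ → Prop}
    {T : ℕ} (h : Path E N K (j * p) Y T) : ∃ j' ≤ 2 * N, Path E N K (j' * p) Y T := by
  rcases Nat.eq_zero_or_pos j with rfl | hj
  · exact ⟨0, Nat.zero_le _, h⟩
  · have hpos : ∀ j, 1 ≤ j → 0 < j * p := fun j hj => Nat.mul_pos hj hp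
    obtain ⟨t, h0, ht, hY⟩ := path_iff.1 h
    obtain ⟨j', -, hj', h'⟩ := fPath_shorten (F := fun _ => True) hper hj
      (fPath_iff.2 ⟨t, h0, ht, ⟨0, hpos j hj, trivial⟩, hY⟩)
    obtain ⟨t, h0, ht, -, hY⟩ := fPath_iff.1 h'
    exact ⟨j', hj', path_iff.2 ⟨t, h0, ht, hY⟩⟩

/-- The vertex `T` lies at time `K` on closed paths of whole periods through each of the sets
`F i`. The bound `2 N` on the number of periods is no restriction, by `fPath_shorten`. -/
def Recurrent (E : ℕ → ℕ → ℕ → Prop) (F : ℕ → ℕ → Prop) (N s K p T : ℕ) : Prop :=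
  ∀ i < s, ∃ j, 1 ≤ j ∧ j ≤ 2 * N ∧ FPath E (F i) N K (j * p) (fun U => U = T) T

/-- The closed paths of a recurrent vertex are concatenated to one and repeated forever. -/
theorem Recurrent.fairFrom (hper : ∀ n, K ≤ n → E (n + p) = E n) (hp : 0 < p) (hs : 0 < s)
    {T : ℕ} (hT : T < N) (h : Recurrent E F N s K p T) : FairFrom E F N s K T := by
  have key : ∀ r ≤ s, ∃ j, 1 ≤ j ∧ ∃ t : ℕ → ℕ, t 0 = T ∧ t (j * p) = T ∧
      (∀ k < j * p, E (K + k) (t k) (t (k + 1)) ∧ t (k + 1) < N) ∧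
      ∀ i < r, ∃ k < j * p, F i (t k) := by
    intro r hr
    induction r with
    | zero =>
      obtain ⟨j, hj, -, hj'⟩ := h 0 hs
      obtain ⟨t, h0, ht, -, hY⟩ := fPath_iff.1 hj'
      exact ⟨j, hj, t, h0, hY, ht, by simp⟩
    | succ r ih =>
      obtain ⟨j, hj, t, h0, h1, ht, hF⟩ := ih (by omega)
      obtain ⟨j', hj', -, h'⟩ := h r (by omega)
      obtain ⟨t', h0', ht', ⟨k', hk', hF'⟩, h1'⟩ := fPath_iff.1 h'
      have hadd : (j + j') * p = j * p + j' * p := Nat.add_mul _ _ _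
      have hglue : ∀ k, j * p ≤ k → (fun k => if k < j * p then t k else t' (k - j * p)) k =
          t' (k - j * p) := fun k hk => by simp [not_lt.2 hk]
      refine ⟨j + j', by omega, fun k => if k < j * p then t k else t' (k - j * p), ?_, ?_, ?_, ?_⟩
      · simp [Nat.mul_pos hj hp, h0]
      · rw [hglue _ (by omega), hadd, Nat.add_sub_cancel_left]
        exact h1'
      · intro k hk
        by_cases hk1 : k + 1 < j * p
        · simp only [hk1, show k < j * p by omega, if_true]
          exact ht k (by omega)
        · by_cases hk2 : k < j * p
          · have hkj : k + 1 = j * p := by omega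
            simp only [hk2, if_true, hkj, lt_irrefl, if_false, Nat.sub_self, h0']
            have := ht k hk2
            rw [hkj, h1] at this
            exact this
          · simp only [hk1, hk2, if_false]
            have := ht' (k - j * p) (by omega)
            rw [← edge_periodic hper j (K + (k - j * p)) (by omega),
              show K + (k - j * p) + j * p = K + k by omega,
              show k - j * p + 1 = k + 1 - j * p by omega] at this
            exact this
      · intro i hi
        rcases Nat.lt_succ_iff_lt_or_eq.1 hi with hi | rfl
        · obtain ⟨k, hk, hFk⟩ := hF i hi
          exact ⟨k, by omega, by simpa [hk] using hFk⟩
        · refine ⟨j * p + k', by omega, ?_⟩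
          simpa using hF'
  obtain ⟨j, hj, t, h0, h1, ht, hF⟩ := key s le_rfl
  have hL : 0 < j * p := Nat.mul_pos hj hp
  refine ⟨fun k => t (k % (j * p)), by simpa using h0, fun k => ?_, fun k => ?_, fun i hi k => ?_⟩
  · have hk := Nat.mod_lt k hL
    rcases Nat.eq_zero_or_pos (k % (j * p)) with h' | h'
    · simpa [h', h0] using hT
    · have := (ht (k % (j * p) - 1) (by omega)).2
      rwa [Nat.sub_add_cancel h'] at this
  · have hk := Nat.mod_lt k hL
    have hE : E (K + k) = E (K + k % (j * p)) := by
      rw [← edge_periodic hper (k / (j * p) * j) (K + k % (j * p)) (by omega)]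
      congr 1
      have h2 := Nat.mod_add_div k (j * p)
      have h3 : k / (j * p) * j * p = j * p * (k / (j * p)) := by ring
      rw [h3]
      omega
    have hs' : t ((k + 1) % (j * p)) = t (k % (j * p) + 1) := by
      rw [Nat.add_mod]
      by_cases hlast : k % (j * p) + 1 = j * p
      · rw [hlast, h1]
        by_cases hone : j * p = 1
        · rw [hone, Nat.mod_one, h0]
        · rw [Nat.mod_eq_of_lt (show 1 < j * p by omega), hlast, Nat.mod_self, h0]
      · rw [Nat.mod_eq_of_lt (show 1 < j * p by omega), Nat.mod_eq_of_lt (by omega)]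
    simp only [hE, hs']
    exact (ht _ hk).1
  · obtain ⟨l, hl, hFl⟩ := hF i hi
    refine ⟨l + j * p * k, ?_, ?_⟩
    · have : k ≤ j * p * k := Nat.le_mul_of_pos_left k hL
      omega
    · simpa [Nat.mod_eq_of_lt hl] using hFl

/-- In a graph that is periodic from time `K` on, fair infinite paths exist exactly from those
vertices from which a recurrent vertex can be reached. -/
theorem fairFrom_iff_recurrent (hper : ∀ n, K ≤ n → E (n + p) = E n) (hp : 0 < p) (hs : 0 < s)
    {T : ℕ} (hT : T < N) : FairFrom E F N s K T ↔
      ∃ j ≤ 2 * N, Path E N K (j * p) (Recurrent E F N s K p) T := by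
  constructor
  · rintro ⟨t, rfl, hN, hE, hF⟩
    -- Some vertex `U` recurs at infinitely many beginnings of periods.
    obtain ⟨⟨U, hU⟩, hinf⟩ := Finite.exists_infinite_fiber fun j : ℕ => (⟨t (j * p), hN _⟩ : Fin N)
    have hinf : ∀ n, ∃ j, n < j ∧ t (j * p) = U := by
      intro n
      obtain ⟨j, hj, hn⟩ := (Set.infinite_coe_iff.1 hinf).exists_gt n
      exact ⟨j, hn, congrArg Fin.val hj⟩
    obtain ⟨j, -, hj⟩ := hinf 0
    refine path_shorten hper hp (path_iff.2 ⟨t, rfl, fun k _ => ⟨hE k, hN _⟩, ?_⟩) (j := j)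
    intro i hi
    obtain ⟨l, hl, hFl⟩ := hF i hi (j * p)
    obtain ⟨j', hj', hU'⟩ := hinf (max j l)
    have hl' : l < j' * p := (le_max_right j l).trans_lt
      (hj'.trans_le (Nat.le_mul_of_pos_right j' hp))
    obtain ⟨c, rfl⟩ : ∃ c, j' = j + c := ⟨j' - j, by omega⟩
    have hadd : (j + c) * p = j * p + c * p := Nat.add_mul _ _ _
    refine fPath_shorten hper (show 1 ≤ c by omega) (fPath_iff.2
      ⟨fun k => t (k + j * p), by simp, fun k hk => ⟨?_, hN _⟩, ⟨l - j * p, by omega, ?_⟩, ?_⟩)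
    · have := hE (k + j * p)
      rw [show K + (k + j * p) = K + k + j * p by omega, edge_periodic hper j (K + k) (by omega),
        show k + j * p + 1 = k + 1 + j * p by omega] at this
      exact this
    · simpa [Nat.sub_add_cancel hl] using hFl
    · change t (c * p + j * p) = t (j * p)
      rw [add_comm, ← hadd, hU', hj]
  · rintro ⟨j, -, h⟩
    rw [fairFrom_iff_path (l := j * p) hT]
    exact path_mono (fun U hU hrec => (fairFrom_periodic hper j U).2
      (hrec.fairFrom hper hp hs hU)) hT h

end Graph

/-! ### The nodes of a formula -/

namespace Formula

theorem size_pos {ι : Type} (φ : Formula ι) : 0 < φ.size := by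
  cases φ <;> simp [size]

/-- The subformula whose root has position `i` in the postfix code. -/
def nodeAt {ι : Type} : Formula ι → ℕ → Formula ι
  | tt, _ => tt
  | atom a, _ => atom a
  | neg φ, i => if i < φ.size then φ.nodeAt i else neg φ
  | next φ, i => if i < φ.size then φ.nodeAt i else next φ
  | or φ ψ, i => if i < φ.size then φ.nodeAt i else
      if i < φ.size + ψ.size then ψ.nodeAt (i - φ.size) else or φ ψ
  | .until φ ψ, i => if i < φ.size then φ.nodeAt i else
      if i < φ.size + ψ.size then ψ.nodeAt (i - φ.size) else .until φ ψ

theorem nodeAt_last {ι : Type} (φ : Formula ι) : φ.nodeAt (φ.size - 1) = φ := by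
  cases φ <;> simp [nodeAt, size]

theorem size_nodeAt_le {ι : Type} (φ : Formula ι) {i : ℕ} (hi : i < φ.size) :
    (φ.nodeAt i).size ≤ i + 1 := by
  induction φ generalizing i with
  | tt => simp [nodeAt, size]
  | atom a => simp [nodeAt, size]
  | neg φ ih =>
    simp only [nodeAt, size] at hi ⊢
    split_ifs with h
    · exact ih h
    · simp only [size]; omega
  | next φ ih =>
    simp only [nodeAt, size] at hi ⊢
    split_ifs with h
    · exact ih h
    · simp only [size]; omega
  | or φ ψ ih ih' =>
    simp only [nodeAt, size] at hi ⊢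
    split_ifs with h h'
    · exact ih h
    · have := ih' (i := i - φ.size) (by omega); omega
    · simp only [size]; omega
  | _ φ ψ ih ih' =>
    simp only [nodeAt, size] at hi ⊢
    split_ifs with h h'
    · exact ih h
    · have := ih' (i := i - φ.size) (by omega); omega
    · simp only [size]; omega

/-- The nodes of a subformula occupy a segment of the postfix code. -/
theorem nodeAt_nodeAt {ι : Type} (φ : Formula ι) {i : ℕ} (hi : i < φ.size) {k : ℕ}
    (hk : k < (φ.nodeAt i).size) :
    φ.nodeAt (i + 1 - (φ.nodeAt i).size + k) = (φ.nodeAt i).nodeAt k := by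
  have whole : ∀ (i : ℕ) (ψ : Formula ι), i + 1 = ψ.size →
      ψ.nodeAt (i + 1 - ψ.size + k) = ψ.nodeAt k := by
    intro i ψ h
    rw [h, Nat.sub_self, Nat.zero_add]
  have left : ∀ (i : ℕ) (ψ : Formula ι), i < ψ.size → k < (ψ.nodeAt i).size →
      i + 1 - (ψ.nodeAt i).size + k < ψ.size := by
    intro i ψ h h'
    have := ψ.size_nodeAt_le h
    omega
  induction φ generalizing i with
  | tt => simp [nodeAt]
  | atom a => simp [nodeAt]
  | neg φ ih =>
    by_cases h : i < φ.size
    · simp only [nodeAt, h, if_true] at hk ⊢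
      simp only [left i φ h hk, if_true]
      exact ih h hk
    · have : i + 1 = (neg φ).size := by simp only [size] at hi ⊢; omega
      have hn : (neg φ).nodeAt i = neg φ := by simp [nodeAt, h]
      rw [hn]
      exact whole i _ this
  | next φ ih =>
    by_cases h : i < φ.size
    · simp only [nodeAt, h, if_true] at hk ⊢
      simp only [left i φ h hk, if_true]
      exact ih h hk
    · have : i + 1 = (next φ).size := by simp only [size] at hi ⊢; omega
      have hn : (next φ).nodeAt i = next φ := by simp [nodeAt, h]
      rw [hn]
      exact whole i _ this
  | or φ ψ ih ih' =>
    by_cases h : i < φ.size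
    · simp only [nodeAt, h, if_true] at hk ⊢
      simp only [left i φ h hk, if_true]
      exact ih h hk
    · by_cases h' : i < φ.size + ψ.size
      · simp only [nodeAt, h, if_false, h', if_true] at hk ⊢
        have h1 := ψ.size_nodeAt_le (i := i - φ.size) (by omega)
        rw [if_neg (by omega), if_pos (by omega)]
        rw [← ih' (i := i - φ.size) (by omega) hk]
        congr 1
        omega
      · have : i + 1 = (or φ ψ).size := by simp only [size] at hi ⊢; omega
        have hn : (or φ ψ).nodeAt i = or φ ψ := by simp [nodeAt, h, h']
        rw [hn]
        exact whole i _ this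
  | _ φ ψ ih ih' =>
    by_cases h : i < φ.size
    · simp only [nodeAt, h, if_true] at hk ⊢
      simp only [left i φ h hk, if_true]
      exact ih h hk
    · by_cases h' : i < φ.size + ψ.size
      · simp only [nodeAt, h, if_false, h', if_true] at hk ⊢
        have h1 := ψ.size_nodeAt_le (i := i - φ.size) (by omega)
        rw [if_neg (by omega), if_pos (by omega)]
        rw [← ih' (i := i - φ.size) (by omega) hk]
        congr 1
        omega
      · have : i + 1 = (Formula.until φ ψ).size := by simp only [size] at hi ⊢; omega
        have hn : (Formula.until φ ψ).nodeAt i = .until φ ψ := by simp [nodeAt, h, h']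
        rw [hn]
        exact whole i _ this

/-- The code of the root symbol, as in `Formula.code`. -/
def head {m : ℕ} : Formula (Fin m) → ℕ
  | tt => 0
  | neg _ => 1
  | or _ _ => 2
  | next _ => 3
  | .until _ _ => 4
  | atom a => 5 + a

theorem length_code {m : ℕ} (φ : Formula (Fin m)) : φ.code.length = φ.size := by
  induction φ <;> simp_all [code, size, add_assoc]

theorem getD_code {m : ℕ} (φ : Formula (Fin m)) {i : ℕ} (hi : i < φ.size) :
    φ.code.getD i 0 = (φ.nodeAt i).head := by
  induction φ generalizing i with
  | tt => simp only [size] at hi; obtain rfl : i = 0 := by omega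
          rfl
  | atom a => simp only [size] at hi; obtain rfl : i = 0 := by omega
              rfl
  | neg φ ih =>
    simp only [size] at hi
    by_cases h : i < φ.size
    · simp only [code, nodeAt, h, if_true]
      rw [List.getD_append _ _ _ _ (by rwa [length_code]), ih h]
    · obtain rfl : i = φ.size := by omega
      simp only [code, nodeAt, h, if_false]
      rw [List.getD_append_right _ _ _ _ (by rw [length_code]), length_code]
      simp [head]
  | next φ ih =>
    simp only [size] at hi
    by_cases h : i < φ.size
    · simp only [code, nodeAt, h, if_true]
      rw [List.getD_append _ _ _ _ (by rwa [length_code]), ih h]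
    · obtain rfl : i = φ.size := by omega
      simp only [code, nodeAt, h, if_false]
      rw [List.getD_append_right _ _ _ _ (by rw [length_code]), length_code]
      simp [head]
  | or φ ψ ih ih' =>
    simp only [size] at hi
    by_cases h : i < φ.size
    · simp only [code, nodeAt, h, if_true]
      rw [List.append_assoc, List.getD_append _ _ _ _ (by rwa [length_code]), ih h]
    · simp only [code, nodeAt, h, if_false]
      rw [List.append_assoc, List.getD_append_right _ _ _ _ (by rw [length_code]; omega),
        length_code]
      split_ifs with h'
      · rw [List.getD_append _ _ _ _ (by rw [length_code]; omega), ih' (by omega)]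
      · rw [List.getD_append_right _ _ _ _ (by rw [length_code]; omega), length_code,
          show i - φ.size - ψ.size = 0 by omega]
        simp [head]
  | _ φ ψ ih ih' =>
    simp only [size] at hi
    by_cases h : i < φ.size
    · simp only [code, nodeAt, h, if_true]
      rw [List.append_assoc, List.getD_append _ _ _ _ (by rwa [length_code]), ih h]
    · simp only [code, nodeAt, h, if_false]
      rw [List.append_assoc, List.getD_append_right _ _ _ _ (by rw [length_code]; omega),
        length_code]
      split_ifs with h'
      · rw [List.getD_append _ _ _ _ (by rw [length_code]; omega), ih' (by omega)]
      · rw [List.getD_append_right _ _ _ _ (by rw [length_code]; omega), length_code,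
          show i - φ.size - ψ.size = 0 by omega]
        simp [head]

variable {m : ℕ} (φ : Formula (Fin m))

/-- The size of the subformula with root `i`. -/
def nodeSize (i : ℕ) : ℕ := (φ.nodeAt i).size

/-- The position of the left child of a binary node. -/
def leftChild (i : ℕ) : ℕ := i - 1 - φ.nodeSize (i - 1)

theorem nodeAt_child {i k : ℕ} (hi : i < φ.size) (hk : k < (φ.nodeAt i).size) {χ : Formula (Fin m)}
    (hχ : (φ.nodeAt i).nodeAt k = χ) :
    φ.nodeAt (i + 1 - (φ.nodeAt i).size + k) = χ := (φ.nodeAt_nodeAt hi hk).trans hχ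

theorem nodeAt_neg {i : ℕ} (hi : i < φ.size) {χ : Formula (Fin m)} (h : φ.nodeAt i = neg χ) :
    1 ≤ i ∧ φ.nodeAt (i - 1) = χ := by
  have h1 := φ.size_nodeAt_le hi
  have h2 := χ.size_pos
  have h3 := φ.nodeAt_child hi (k := χ.size - 1) (χ := χ) (by rw [h, size]; omega)
    (by rw [h, nodeAt, if_pos (by omega), nodeAt_last])
  rw [h, size] at h1 h3
  rw [← h3]
  exact ⟨by omega, by congr 1; omega⟩

theorem nodeAt_next {i : ℕ} (hi : i < φ.size) {χ : Formula (Fin m)} (h : φ.nodeAt i = next χ) :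
    1 ≤ i ∧ φ.nodeAt (i - 1) = χ := by
  have h1 := φ.size_nodeAt_le hi
  have h2 := χ.size_pos
  have h3 := φ.nodeAt_child hi (k := χ.size - 1) (χ := χ) (by rw [h, size]; omega)
    (by rw [h, nodeAt, if_pos (by omega), nodeAt_last])
  rw [h, size] at h1 h3
  rw [← h3]
  exact ⟨by omega, by congr 1; omega⟩

theorem nodeAt_or {i : ℕ} (hi : i < φ.size) {ψ χ : Formula (Fin m)} (h : φ.nodeAt i = or ψ χ) :
    1 + χ.size ≤ i ∧ φ.nodeAt (i - 1) = χ ∧ φ.nodeAt (φ.leftChild i) = ψ := by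
  have h1 := φ.size_nodeAt_le hi
  have h2 := χ.size_pos
  have h2' := ψ.size_pos
  have h3 := φ.nodeAt_child hi (k := ψ.size + χ.size - 1) (χ := χ) (by rw [h, size]; omega)
    (by rw [h, nodeAt, if_neg (by omega), if_pos (by omega),
      show ψ.size + χ.size - 1 - ψ.size = χ.size - 1 by omega, nodeAt_last])
  have h4 := φ.nodeAt_child hi (k := ψ.size - 1) (χ := ψ) (by rw [h, size]; omega)
    (by rw [h, nodeAt, if_pos (by omega), nodeAt_last])
  rw [h, size] at h1 h3 h4
  have h5 : φ.nodeAt (i - 1) = χ := by rw [← h3]; congr 1; omega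
  refine ⟨by omega, h5, ?_⟩
  rw [leftChild, nodeSize, h5, ← h4]
  congr 1
  omega

theorem nodeAt_until {i : ℕ} (hi : i < φ.size) {ψ χ : Formula (Fin m)}
    (h : φ.nodeAt i = .until ψ χ) :
    1 + χ.size ≤ i ∧ φ.nodeAt (i - 1) = χ ∧ φ.nodeAt (φ.leftChild i) = ψ := by
  have h1 := φ.size_nodeAt_le hi
  have h2 := χ.size_pos
  have h2' := ψ.size_pos
  have h3 := φ.nodeAt_child hi (k := ψ.size + χ.size - 1) (χ := χ) (by rw [h, size]; omega)
    (by rw [h, nodeAt, if_neg (by omega), if_pos (by omega),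
      show ψ.size + χ.size - 1 - ψ.size = χ.size - 1 by omega, nodeAt_last])
  have h4 := φ.nodeAt_child hi (k := ψ.size - 1) (χ := ψ) (by rw [h, size]; omega)
    (by rw [h, nodeAt, if_pos (by omega), nodeAt_last])
  rw [h, size] at h1 h3 h4
  have h5 : φ.nodeAt (i - 1) = χ := by rw [← h3]; congr 1; omega
  refine ⟨by omega, h5, ?_⟩
  rw [leftChild, nodeSize, h5, ← h4]
  congr 1
  omega

/-! ### Types of words -/

/-- The truth value of node `i` that the semantics dictates, in terms of the truth values `b` of
the nodes at the present and `b'` at the next position. -/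
def Expected (b b' : ℕ → Prop) (i : ℕ) : Prop :=
  φ.code.getD i 0 = 0 ∨ (φ.code.getD i 0 = 1 ∧ ¬ b (i - 1)) ∨
  (φ.code.getD i 0 = 2 ∧ (b (φ.leftChild i) ∨ b (i - 1))) ∨ (φ.code.getD i 0 = 3 ∧ b' (i - 1)) ∨
  (φ.code.getD i 0 = 4 ∧ (b (i - 1) ∨ (b (φ.leftChild i) ∧ b' i))) ∨
  (5 ≤ φ.code.getD i 0 ∧ b i)

/-- Sets of nodes are encoded as binary numbers. The sets `T` and `T'` are locally consistent as
the sets of the nodes that hold at two consecutive positions of a word. -/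
def Consistent (T T' : ℕ) : Prop :=
  ∀ i < φ.size, (T.testBit i ↔ φ.Expected (fun j => T.testBit j) (fun j => T'.testBit j) i)

/-- The atoms in the set `T` of nodes agree with the letter `a`. -/
def AtomsAgree (T : ℕ) (a : Set (Fin m)) : Prop :=
  ∀ i < φ.size, ∀ q : Fin m, φ.code.getD i 0 = 5 + q → (T.testBit i ↔ q ∈ a)

/-- If node `i` is an until-formula in `T`, then its right child is in `T`. -/
def Fulfilled (i T : ℕ) : Prop := φ.code.getD i 0 = 4 → T.testBit i → T.testBit (i - 1)

/-- A locally consistent and fair sequence of sets of nodes is the sequence of the sets of the nodes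
that hold. Fairness is needed for the until-formulas: local consistency alone would allow their
right-hand side to be postponed forever. -/
theorem testBit_iff_sat {t : ℕ → ℕ} {ξ : ℕ → Set (Fin m)} (hc : ∀ n, φ.Consistent (t n) (t (n + 1)))
    (ha : ∀ n, φ.AtomsAgree (t n) (ξ n)) (hf : ∀ i < φ.size, ∀ n, ∃ k ≥ n, φ.Fulfilled i (t k))
    {i : ℕ} (hi : i < φ.size) (n : ℕ) :
    (t n).testBit i ↔ Sat (fun k => ξ (k + n)) (φ.nodeAt i) := by
  induction hψ : φ.nodeAt i generalizing i n with
  | tt =>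
    have := hc n i hi
    simp only [Expected, getD_code φ hi, hψ, head] at this
    simpa [Sat] using this
  | atom a =>
    have := ha n i hi a (by rw [getD_code φ hi, hψ, head])
    simpa [Sat] using this
  | neg χ ih =>
    obtain ⟨h1, h2⟩ := φ.nodeAt_neg hi hψ
    have := hc n i hi
    simp only [Expected, getD_code φ hi, hψ, head] at this
    rw [Sat, ← ih (by omega) n h2]
    simpa using this
  | next χ ih =>
    obtain ⟨h1, h2⟩ := φ.nodeAt_next hi hψ
    have := hc n i hi
    simp only [Expected, getD_code φ hi, hψ, head] at this
    have h3 := ih (by omega) (n + 1) h2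
    rw [Sat]
    simp only [show ∀ k, k + 1 + n = k + (n + 1) by intro k; omega, ← h3]
    simpa using this
  | or ψ χ ih ih' =>
    obtain ⟨h1, h2, h3⟩ := φ.nodeAt_or hi hψ
    have := hc n i hi
    simp only [Expected, getD_code φ hi, hψ, head] at this
    rw [Sat, ← ih (show φ.leftChild i < φ.size by unfold leftChild; omega) n h3,
      ← ih' (show i - 1 < φ.size by omega) n h2]
    simpa using this
  | _ ψ χ ih ih' =>
    obtain ⟨h1, h2, h3⟩ := φ.nodeAt_until hi hψ
    have hL := fun n => ih (show φ.leftChild i < φ.size by unfold leftChild; omega) n h3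
    have hR := fun n => ih' (show i - 1 < φ.size by omega) n h2
    have hU : ∀ n, (t n).testBit i ↔ (t n).testBit (i - 1) ∨
        (t n).testBit (φ.leftChild i) ∧ (t (n + 1)).testBit i := by
      intro n
      have := hc n i hi
      simp only [Expected, getD_code φ hi, hψ, head] at this
      simpa using this
    rw [Sat]
    simp only [add_assoc]
    simp only [← add_comm n, ← hL, ← hR]
    constructor
    · intro h
      obtain ⟨k, hk, hfk⟩ := hf i hi n
      replace hfk := hfk (by rw [getD_code φ hi, hψ, head])
      obtain ⟨l, rfl⟩ : ∃ l, k = n + l := ⟨k - n, by omega⟩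
      clear hk
      induction l generalizing n with
      | zero => exact ⟨0, by simpa using hfk h, by simp⟩
      | succ l ihl =>
        rcases (hU n).1 h with h | ⟨h, h'⟩
        · exact ⟨0, by simpa using h, by simp⟩
        · obtain ⟨k, hk, hj⟩ := ihl (n + 1) h' (by
            rwa [show n + 1 + l = n + (l + 1) by omega])
          refine ⟨k + 1, by rwa [show n + (k + 1) = n + 1 + k by omega], fun j hjk => ?_⟩
          rcases j with _ | j
          · exact h
          · rw [show n + (j + 1) = n + 1 + j by omega]
            exact hj j (by omega)
    · rintro ⟨k, hk, hj⟩
      induction k generalizing n with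
      | zero => exact (hU n).2 (Or.inl hk)
      | succ k ihk =>
        refine (hU n).2 (Or.inr ⟨hj 0 (by omega), ihk (n + 1) ?_ fun j hjk => ?_⟩)
        · rwa [show n + 1 + k = n + (k + 1) by omega]
        · rw [show n + 1 + j = n + (j + 1) by omega]
          exact hj (j + 1) (by omega)

/-- Conversely, every word is the word of a locally consistent and fair sequence. -/
theorem exists_types (ξ : ℕ → Set (Fin m)) : ∃ t : ℕ → ℕ, (∀ n, t n < 2 ^ φ.size) ∧
    (∀ n, φ.Consistent (t n) (t (n + 1))) ∧ (∀ n, φ.AtomsAgree (t n) (ξ n)) ∧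
    ∀ i < φ.size, ∀ n, ∃ k ≥ n, φ.Fulfilled i (t k) := by
  classical
  let b : ℕ → Fin φ.size → Bool := fun n i => decide (Sat (fun k => ξ (k + n)) (φ.nodeAt i))
  have hb : ∀ n, ∀ i < φ.size, ((Nat.ofBits (b n)).testBit i ↔
      Sat (fun k => ξ (k + n)) (φ.nodeAt i)) := by
    intro n i hi
    rw [Nat.testBit_ofBits_lt _ _ hi]
    simp [b]
  have huntil : ∀ (ψ χ : Formula (Fin m)) (n : ℕ), Sat (fun k => ξ (k + n)) (.until ψ χ) →
      ∃ k, Sat (fun j => ξ (j + (n + k))) χ := by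
    rintro ψ χ n ⟨k, hk, -⟩
    simp only [add_assoc] at hk
    exact ⟨k, by simpa [add_comm, add_left_comm] using hk⟩
  refine ⟨fun n => Nat.ofBits (b n), fun n => Nat.ofBits_lt_two_pow _, fun n i hi => ?_,
    fun n i hi q hq => ?_, fun i hi n => ?_⟩
  · rw [hb n i hi, Expected, getD_code φ hi]
    cases hψ : φ.nodeAt i with
    | tt => simp [Sat, head]
    | atom a =>
      simp only [head, hb n i hi, hψ]
      constructor
      · intro h
        simp [h]
      · rintro (h | ⟨h, -⟩ | ⟨h, -⟩ | ⟨h, -⟩ | ⟨h, -⟩ | ⟨-, h⟩)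
        all_goals first | exact h | omega
    | neg χ =>
      obtain ⟨h1, h2⟩ := φ.nodeAt_neg hi hψ
      simp [Sat, head, hb n (i - 1) (by omega), h2]
    | next χ =>
      obtain ⟨h1, h2⟩ := φ.nodeAt_next hi hψ
      simp [Sat, head, hb (n + 1) (i - 1) (by omega), h2, add_comm, add_left_comm]
    | or ψ χ =>
      obtain ⟨h1, h2, h3⟩ := φ.nodeAt_or hi hψ
      simp [Sat, head, hb n (i - 1) (by omega), h2, h3,
        hb n (φ.leftChild i) (by unfold leftChild; omega)]
    | _ ψ χ =>
      obtain ⟨h1, h2, h3⟩ := φ.nodeAt_until hi hψ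
      simp only [head, hb n (i - 1) (by omega), h2, h3, hψ, hb (n + 1) i hi,
        hb n (φ.leftChild i) (by unfold leftChild; omega)]
      simp only [Sat]
      norm_num
      constructor
      · rintro ⟨k, hk, hj⟩
        rcases k with _ | k
        · left; simpa using hk
        · right
          refine ⟨by simpa using hj 0 (by omega), k, ?_, fun j hjk => ?_⟩
          · simpa [add_assoc, add_comm, add_left_comm] using hk
          · simpa [add_assoc, add_comm, add_left_comm] using hj (j + 1) (by omega)
      · rintro (h | ⟨h, k, hk, hj⟩)
        · exact ⟨0, by simpa using h, by simp⟩
        · refine ⟨k + 1, by simpa [add_assoc, add_comm, add_left_comm] using hk, fun j hjk => ?_⟩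
          rcases j with _ | j
          · simpa using h
          · simpa [add_assoc, add_comm, add_left_comm] using hj j (by omega)
  · rw [hb n i hi]
    rw [getD_code φ hi] at hq
    cases hψ : φ.nodeAt i <;> rw [hψ] at hq <;> simp only [head] at hq
    case atom a =>
      obtain rfl : a = q := Fin.ext (by omega)
      simp [Sat]
    all_goals omega
  · by_cases h4 : φ.code.getD i 0 = 4
    · by_cases hU : (Nat.ofBits (b n)).testBit i
      · rw [getD_code φ hi] at h4
        cases hψ : φ.nodeAt i <;> rw [hψ] at h4 <;> simp only [head] at h4 <;> try omega
        rename_i ψ χ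
        obtain ⟨h1, h2, h3⟩ := φ.nodeAt_until hi hψ
        rw [hb n i hi, hψ] at hU
        obtain ⟨k, hk⟩ := huntil ψ χ n hU
        refine ⟨n + k, by omega, fun _ _ => ?_⟩
        rw [hb (n + k) (i - 1) (by omega), h2]
        exact hk
      · exact ⟨n, le_rfl, fun _ h => absurd h hU⟩
    · exact ⟨n, le_rfl, fun h => absurd h h4⟩

/-- The graph of the types: at time `n` the letter is chosen in `A n`. -/
def typeGraph (A : ℕ → Set (Set (Fin m))) (n T T' : ℕ) : Prop :=
  (∃ a ∈ A n, φ.AtomsAgree T a) ∧ φ.Consistent T T'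

/-- The words over the alphabets `A n` that satisfy `φ`, or its negation, correspond to the fair
paths in the graph of the types. -/
theorem exists_word_iff (A : ℕ → Set (Set (Fin m))) (v : Prop) :
    (∃ ξ : ℕ → Set (Fin m), (∀ n, ξ n ∈ A n) ∧ (Sat ξ φ ↔ v)) ↔
      ∃ T < 2 ^ φ.size, (T.testBit (φ.size - 1) ↔ v) ∧
        FairFrom (φ.typeGraph A) φ.Fulfilled (2 ^ φ.size) φ.size 0 T := by
  have hs := φ.size_pos
  constructor
  · rintro ⟨ξ, hξ, hv⟩
    obtain ⟨t, ht, hc, ha, hf⟩ := φ.exists_types ξ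
    have := φ.testBit_iff_sat hc ha hf (i := φ.size - 1) (by omega) 0
    rw [nodeAt_last] at this
    exact ⟨t 0, ht 0, this.trans hv, t, rfl, ht,
      fun k => by rw [zero_add]; exact ⟨⟨_, hξ k, ha k⟩, hc k⟩, hf⟩
  · rintro ⟨T, hT, hv, t, rfl, ht, hE, hf⟩
    simp only [zero_add] at hE
    choose ξ hξ ha using fun k => (hE k).1
    have := φ.testBit_iff_sat (fun k => (hE k).2) ha hf (i := φ.size - 1) (by omega) 0
    rw [nodeAt_last] at this
    exact ⟨ξ, hξ, this.symm.trans hv⟩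

end Formula
end
end QMC

namespace QMC

noncomputable section

/-! ### Registers that a program leaves unchanged -/

/-- The address is a literal different from `a`. -/
def IntExpr.avoids : IntExpr → ℕ → Bool
  | .const c, a => c != a
  | _, _ => false

theorem IntExpr.avoids_spec {e : IntExpr} {a : ℕ} (h : e.avoids a = true) (M : Mem) :
    e.eval M ≠ a := by
  cases e <;> simp_all [IntExpr.avoids, IntExpr.eval]

namespace Program

/-- A syntactic sufficient condition for the integer row `a` to be left unchanged: every integer
assignment goes to a literal row different from `a`. -/
def keepsRow : Program → ℕ → Bool
  | .setInt a' _ _, a => a'.avoids a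
  | .setCplx _ _ _ _, _ => true
  | .jordan _ _ _, _ => true
  | .apply _ _ _, _ => true
  | .label _ _ a' _, a => a'.avoids a
  | .feasible _ _ a' _, a => a'.avoids a
  | .seq P Q, a => P.keepsRow a && Q.keepsRow a
  | .ite _ P Q, a => P.keepsRow a && Q.keepsRow a
  | .while _ P, a => P.keepsRow a

/-- A syntactic sufficient condition for the integer register `int a i` to be left unchanged. -/
def keepsReg : Program → ℕ → ℕ → Bool
  | .setInt a' i' _, a, i => a'.avoids a || i'.avoids i
  | .setCplx _ _ _ _, _, _ => true
  | .jordan _ _ _, _, _ => true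
  | .apply _ _ _, _, _ => true
  | .label _ _ a' i', a, i => a'.avoids a || i'.avoids i
  | .feasible _ _ a' i', a, i => a'.avoids a || i'.avoids i
  | .seq P Q, a, i => P.keepsReg a i && Q.keepsReg a i
  | .ite _ P Q, a, i => P.keepsReg a i && Q.keepsReg a i
  | .while _ P, a, i => P.keepsReg a i

/-- A syntactic sufficient condition for the complex matrix with name `a` to be left unchanged. -/
def keepsName : Program → ℕ → Bool
  | .setInt _ _ _, _ => true
  | .setCplx a' _ _ _, a => a'.avoids a
  | .jordan _ _ (.const c), a => (c != a) && (c + 1 != a) && (c + 2 != a)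
  | .jordan _ _ _, _ => false
  | .apply _ _ a', a => a'.avoids a
  | .label _ _ _ _, _ => true
  | .feasible _ _ _ _, _ => true
  | .seq P Q, a => P.keepsName a && Q.keepsName a
  | .ite _ P Q, a => P.keepsName a && Q.keepsName a
  | .while _ P, a => P.keepsName a

end Program

section MemLemmas

variable (M : Mem)

@[simp] theorem setInt_int (a i v a' i' : ℕ) :
    (M.setInt a i v).int a' i' = if a' = a ∧ i' = i then v else M.int a' i' := rfl

@[simp] theorem setInt_cplx (a i v : ℕ) : (M.setInt a i v).cplx = M.cplx := rfl

@[simp] theorem setCplx_cplx (a i j : ℕ) (v : ℂ) (a' i' j' : ℕ) :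
    (M.setCplx a i j v).cplx a' i' j' =
      if a' = a ∧ i' = i ∧ j' = j then v else M.cplx a' i' j' := rfl

@[simp] theorem writeOp_int {n : ℕ} (a : ℕ) (A : Op n) : (M.writeOp a A).int = M.int := rfl

theorem writeOp_cplx_ne {n : ℕ} {a a' : ℕ} (h : a' ≠ a) (A : Op n) (i j : ℕ) :
    (M.writeOp a A).cplx a' i j = M.cplx a' i j := by
  simp [Mem.writeOp, h]

theorem writeOp_cplx_fin {n : ℕ} (a : ℕ) (A : Op n) (i j : Fin n) :
    (M.writeOp a A).cplx a i j = A i j := by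
  simp [Mem.writeOp]

theorem readOp_writeOp {n : ℕ} (a : ℕ) (A : Op n) : (M.writeOp a A).readOp n a = A := by
  ext i j
  simp [Mem.readOp, writeOp_cplx_fin]

end MemLemmas

/-- `M'` agrees with `M` on all registers that `P` syntactically leaves unchanged. -/
structure SameOff (P : Program) (M M' : Mem) : Prop where
  row : ∀ a, P.keepsRow a = true → ∀ i, M'.int a i = M.int a i
  reg : ∀ a i, P.keepsReg a i = true → M'.int a i = M.int a i
  name : ∀ a, P.keepsName a = true → ∀ i j, M'.cplx a i j = M.cplx a i j

theorem SameOff.refl (P : Program) (M : Mem) : SameOff P M M :=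
  ⟨fun _ _ _ => rfl, fun _ _ _ => rfl, fun _ _ _ _ => rfl⟩

theorem SameOff.trans {P : Program} {M₁ M₂ M₃ : Mem} (h : SameOff P M₁ M₂) (h' : SameOff P M₂ M₃) :
    SameOff P M₁ M₃ :=
  ⟨fun a ha i => (h'.row a ha i).trans (h.row a ha i),
    fun a i ha => (h'.reg a i ha).trans (h.reg a i ha),
    fun a ha i j => (h'.name a ha i j).trans (h.name a ha i j)⟩

/-- `Q` leaves at least those registers unchanged that `P` leaves unchanged. -/
structure Program.Within (Q P : Program) : Prop where
  row : ∀ a, P.keepsRow a = true → Q.keepsRow a = true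
  reg : ∀ a i, P.keepsReg a i = true → Q.keepsReg a i = true
  name : ∀ a, P.keepsName a = true → Q.keepsName a = true

theorem SameOff.within {P Q : Program} {M M' : Mem} (h : SameOff Q M M') (hQ : Q.Within P) :
    SameOff P M M' :=
  ⟨fun a ha => h.row a (hQ.row a ha), fun a i ha => h.reg a i (hQ.reg a i ha),
    fun a ha => h.name a (hQ.name a ha)⟩

theorem Program.Within.trans {P Q R : Program} (h : P.Within Q) (h' : Q.Within R) : P.Within R :=
  ⟨fun a ha => h.row a (h'.row a ha), fun a i ha => h.reg a i (h'.reg a i ha),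
    fun a ha => h.name a (h'.name a ha)⟩

theorem Program.within_seq_left {P Q : Program} : P.Within (.seq P Q) := by
  constructor <;> simp +contextual [keepsRow, keepsReg, keepsName]

theorem Program.within_seq_right {P Q : Program} : Q.Within (.seq P Q) := by
  constructor <;> simp +contextual [keepsRow, keepsReg, keepsName]

theorem Program.within_ite_left {b : Test} {P Q : Program} : P.Within (.ite b P Q) := by
  constructor <;> simp +contextual [keepsRow, keepsReg, keepsName]

theorem Program.within_ite_right {b : Test} {P Q : Program} : Q.Within (.ite b P Q) := by
  constructor <;> simp +contextual [keepsRow, keepsReg, keepsName]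

theorem Program.within_while {b : Test} {P : Program} : P.Within (.while b P) := by
  constructor <;> simp +contextual [keepsRow, keepsReg, keepsName]

section Hoare

variable {JD : JordanProcedure} {d m : ℕ} {I : Instance d m}

theorem sameOff_setInt (M : Mem) (a i e : IntExpr) (v : ℕ) :
    SameOff (.setInt a i e) M (M.setInt (a.eval M) (i.eval M) v) := by
  refine ⟨fun a' h j => ?_, fun a' j h => ?_, fun _ _ _ _ => rfl⟩
  · simp [(IntExpr.avoids_spec h M).symm]
  · simp only [Program.keepsReg, Bool.or_eq_true] at h
    rcases h with h | h <;> simp [(IntExpr.avoids_spec h M).symm]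

/-- The syntactic check is sound for every run. -/
theorem Exec.sameOff {P : Program} {M M' : Mem} {t : ℕ} (h : Exec JD I P M t M') :
    SameOff P M M' := by
  induction h with
  | setInt M a i e => exact sameOff_setInt M a i e _
  | setCplx M a i j e =>
    refine ⟨fun _ _ _ => rfl, fun _ _ _ => rfl, fun a' h i' j' => ?_⟩
    simp [(IntExpr.avoids_spec h M).symm]
  | jordan M n src dst =>
    refine ⟨fun _ _ _ => rfl, fun _ _ _ => rfl, fun a' h i' j' => ?_⟩
    cases dst with
    | const c =>
      simp only [Program.keepsName, Bool.and_eq_true, bne_iff_ne, ne_eq] at h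
      simp only [IntExpr.eval]
      rw [writeOp_cplx_ne _ (Ne.symm h.2), writeOp_cplx_ne _ (Ne.symm h.1.2),
        writeOp_cplx_ne _ (Ne.symm h.1.1)]
    | get _ _ => simp [Program.keepsName] at h
    | add _ _ => simp [Program.keepsName] at h
    | sub _ _ => simp [Program.keepsName] at h
  | apply M rep src dst =>
    refine ⟨fun _ _ _ => rfl, fun _ _ _ => rfl, fun a' h i' j' => ?_⟩
    exact writeOp_cplx_ne _ (IntExpr.avoids_spec h M).symm _ _ _
  | label M src q a i => exact (sameOff_setInt M a i (.const 0) _).within ⟨fun _ h => h,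
    fun _ _ h => h, fun _ h => h⟩
  | feasible M src pat a i => exact
    (sameOff_setInt M a i (.const 0) _).within ⟨fun _ h => h, fun _ _ h => h, fun _ h => h⟩
  | seq _ _ ih₁ ih₂ =>
    exact (ih₁.within Program.within_seq_left).trans (ih₂.within Program.within_seq_right)
  | iteTrue _ _ ih => exact ih.within Program.within_ite_left
  | iteFalse _ _ ih => exact ih.within Program.within_ite_right
  | whileTrue _ _ _ ih₁ ih₂ => exact (ih₁.within Program.within_while).trans ih₂
  | whileFalse _ => exact SameOff.refl _ _

/-! ### Total correctness with a time bound -/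

variable (JD I)

/-- Started in `M`, the program `P` halts within `T` steps in a memory that satisfies `Q`. -/
def Runs (P : Program) (M : Mem) (T : ℕ) (Q : Mem → Prop) : Prop :=
  ∃ t M', Exec JD I P M t M' ∧ t ≤ T ∧ Q M'

variable {JD I}

theorem Runs.imp {P : Program} {M : Mem} {T T' : ℕ} {Q Q' : Mem → Prop} (h : Runs JD I P M T Q)
    (hT : T ≤ T') (hQ : ∀ M', SameOff P M M' → Q M' → Q' M') : Runs JD I P M T' Q' := by
  obtain ⟨t, M', hE, ht, hM⟩ := h
  exact ⟨t, M', hE, ht.trans hT, hQ M' hE.sameOff hM⟩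

theorem Runs.seq {P P' : Program} {M : Mem} {T T' : ℕ} {Q R : Mem → Prop}
    (h : Runs JD I P M T Q) (h' : ∀ M', SameOff P M M' → Q M' → Runs JD I P' M' T' R) :
    Runs JD I (.seq P P') M (T + T') R := by
  obtain ⟨t, M', hE, ht, hM⟩ := h
  obtain ⟨t', M'', hE', ht', hM'⟩ := h' M' hE.sameOff hM
  exact ⟨t + t', M'', .seq hE hE', by omega, hM'⟩

theorem Runs.ite {b : Test} {P P' : Program} {M : Mem} {T : ℕ} {Q : Mem → Prop}
    (h : b.Holds M → Runs JD I P M T Q) (h' : ¬ b.Holds M → Runs JD I P' M T Q) :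
    Runs JD I (.ite b P P') M (T + 1) Q := by
  by_cases hb : b.Holds M
  · obtain ⟨t, M', hE, ht, hM⟩ := h hb
    exact ⟨t + 1, M', .iteTrue hb hE, by omega, hM⟩
  · obtain ⟨t, M', hE, ht, hM⟩ := h' hb
    exact ⟨t + 1, M', .iteFalse hb hE, by omega, hM⟩

theorem Runs.setInt {a i e : IntExpr} {M : Mem} {Q : Mem → Prop}
    (h : Q (M.setInt (a.eval M) (i.eval M) (e.eval M))) : Runs JD I (.setInt a i e) M 1 Q :=
  ⟨1, _, .setInt M a i e, le_rfl, h⟩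

theorem Runs.setCplx {a i j : IntExpr} {e : CplxExpr} {M : Mem} {Q : Mem → Prop}
    (h : Q (M.setCplx (a.eval M) (i.eval M) (j.eval M) (e.eval M))) :
    Runs JD I (.setCplx a i j e) M 1 Q :=
  ⟨1, _, .setCplx M a i j e, le_rfl, h⟩

theorem Runs.apply {rep src dst : IntExpr} {M : Mem} {Q : Mem → Prop}
    (h : Q (M.writeOp (dst.eval M)
          (applyRep (M.readOp (d * d) (rep.eval M)) (M.readOp d (src.eval M))))) :
    Runs JD I (.apply rep src dst) M 1 Q :=
  ⟨1, _, .apply M rep src dst, le_rfl, h⟩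

/-- A while loop whose condition and time are controlled by a decreasing measure: while the loop
runs, the accumulated time is paid for by the decrease of the potential `pot`. -/
theorem Runs.while {b : Test} {P : Program} (Inv : Mem → Prop) (pot : Mem → ℕ) {Q : Mem → Prop}
    (hexit : ∀ M, Inv M → ¬ b.Holds M → Q M)
    (hstep : ∀ M, Inv M → b.Holds M → ∃ T, Runs JD I P M T
      (fun M' => Inv M' ∧ pot M' + T + 1 ≤ pot M)) {M : Mem} (hM : Inv M) :
    Runs JD I (.while b P) M (pot M + 1) Q := by
  induction hn : pot M using Nat.strong_induction_on generalizing M with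
  | _ n ih =>
    by_cases hb : b.Holds M
    · obtain ⟨T, t, M', hE, ht, hI, hp⟩ := hstep M hM hb
      obtain ⟨t', M'', hE', ht', hQ⟩ := ih (pot M') (by omega) hI rfl
      exact ⟨t + t' + 1, M'', .whileTrue hb hE hE', by omega, hQ⟩
    · exact ⟨1, M, .whileFalse hb, by omega, hexit M hM hb⟩

end Hoare

/-! ### Derived statements -/

/-- The scalar `int 0 k`. -/
abbrev iv (k : ℕ) : IntExpr := .get (.const 0) (.const k)

/-- The entry of the integer array `r` at the given index. -/
abbrev ia (r : ℕ) (e : IntExpr) : IntExpr := .get (.const r) e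

/-- Assignment to the scalar `int 0 k`. -/
abbrev setS (k : ℕ) (e : IntExpr) : Program := .setInt (.const 0) (.const k) e

/-- Assignment to an entry of the integer array `r`. -/
abbrev setA (r : ℕ) (i e : IntExpr) : Program := .setInt (.const r) i e

/-- The entry of the complex matrix `a` at the given indices. -/
abbrev ca (a : ℕ) (i j : IntExpr) : CplxExpr := .get (.const a) i j

/-- Assignment to an entry of the complex matrix `a`. -/
abbrev setC (a : ℕ) (i j : IntExpr) (e : CplxExpr) : Program := .setCplx (.const a) i j e

/-- `for v < b do P`, with the counter in the scalar `v`. -/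
def forLoop (v : ℕ) (b : IntExpr) (P : Program) : Program :=
  .seq (setS v (.const 0))
    (.while (.intLe (.add (iv v) (.const 1)) b) (.seq P (setS v (.add (iv v) (.const 1)))))

/-- `acc := ∑ v < b, e` for integers. -/
def sumS (v : ℕ) (b : IntExpr) (acc : ℕ) (e : IntExpr) : Program :=
  .seq (setS acc (.const 0)) (forLoop v b (setS acc (.add (iv acc) e)))

/-- `cplx a 0 0 := ∑ v < b, e` for complex numbers. -/
def sumC (v : ℕ) (b : IntExpr) (a : ℕ) (e : CplxExpr) : Program :=
  .seq (setC a (.const 0) (.const 0) (.ofInt (.const 0)))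
    (forLoop v b (setC a (.const 0) (.const 0) (.add (ca a (.const 0) (.const 0)) e)))

/-- `for v < b do { P; row r at v := e }`. -/
def fillRow (r v : ℕ) (b : IntExpr) (P : Program) (e : IntExpr) : Program :=
  forLoop v b (.seq P (setA r (iv v) e))

/-- `for v < b, w < b' do { P; row r at (ix + w) := e }`; the expression `ix` gives the start of
the `v`-th segment of the flattened two-dimensional table. -/
def fillTab (r v : ℕ) (b : IntExpr) (w : ℕ) (b' : IntExpr) (ix : IntExpr) (P : Program)
    (e : IntExpr) : Program :=
  forLoop v b (forLoop w b' (.seq P (setA r (.add ix (iv w)) e)))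

/-- `for v < b, w < b' do { P; cplx a v w := e }`. -/
def fillMat (a v : ℕ) (b : IntExpr) (w : ℕ) (b' : IntExpr) (P : Program) (e : CplxExpr) : Program :=
  forLoop v b (forLoop w b' (.seq P (setC a (iv v) (iv w) e)))

/-- An assignment to a scalar that is never read. -/
def skip : Program := setS 63 (.const 0)

theorem Program.within_forLoop {v : ℕ} {b : IntExpr} {P : Program} :
    P.Within (forLoop v b P) :=
  Program.within_seq_left.trans (Program.within_while.trans Program.within_seq_right)

section Rules

variable {JD : JordanProcedure} {d m : ℕ} {I : Instance d m}

theorem Runs.skip {M : Mem} {Q : Mem → Prop} (h : Q (M.setInt 0 63 0)) :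
    Runs JD I skip M 1 Q := Runs.setInt h

/-- The rule for counting loops: the body must not change the counter, and the bound is evaluated
anew in every round, so it must not change either. -/
theorem Runs.forLoop {v : ℕ} {b : IntExpr} {P : Program} {M : Mem} {n τ : ℕ}
    (Inv : ℕ → Mem → Prop) (hv : P.keepsReg 0 v = true)
    (hb : ∀ M', SameOff (forLoop v b P) M M' → b.eval M' = n)
    (h0 : Inv 0 (M.setInt 0 v 0))
    (hstep : ∀ k < n, ∀ M', SameOff (QMC.forLoop v b P) M M' → M'.int 0 v = k → Inv k M' →
      Runs JD I P M' τ (fun M'' => Inv (k + 1) (M''.setInt 0 v (k + 1)))) :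
    Runs JD I (QMC.forLoop v b P) M (n * (τ + 2) + 2) (fun M' => Inv n M' ∧ M'.int 0 v = n) := by
  have hinit : SameOff (QMC.forLoop v b P) M (M.setInt 0 v 0) :=
    (sameOff_setInt M (.const 0) (.const v) (.const 0) 0).within Program.within_seq_left
  have hcount : ∀ M' x, SameOff (QMC.forLoop v b P) M M' →
      SameOff (QMC.forLoop v b P) M (M'.setInt 0 v x) := fun M' x h =>
    h.trans ((sameOff_setInt M' (.const 0) (.const v) (.const 0) x).within Program.within_seq_left)
  refine (Runs.seq (T := 1) (T' := n * (τ + 2) + 1) (Q := fun M' => M' = M.setInt 0 v 0)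
    (Runs.setInt rfl) ?_).imp (by omega) (fun _ _ h => h)
  rintro M' - rfl
  refine (Runs.while
    (fun M' => ∃ k ≤ n, M'.int 0 v = k ∧ Inv k M' ∧ SameOff (QMC.forLoop v b P) M M')
    (fun M' => (n - M'.int 0 v) * (τ + 2)) ?_ ?_ ⟨0, Nat.zero_le n, by simp, h0, hinit⟩).imp
    (by simp) (fun _ _ h => h)
  · rintro M' ⟨k, hk, hvk, hI, hs⟩ hn
    simp only [Test.Holds, IntExpr.eval, hvk, hb M' hs] at hn
    obtain rfl : k = n := by omega
    exact ⟨hI, hvk⟩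
  · rintro M' ⟨k, hk, hvk, hI, hs⟩ hn
    simp only [Test.Holds, IntExpr.eval, hvk, hb M' hs] at hn
    refine ⟨τ + 1, Runs.seq (hstep k hn M' hs hvk hI) fun M'' hs' hI' => Runs.setInt ?_⟩
    have hvk' : M''.int 0 v = k := (hs'.reg 0 v hv).trans hvk
    simp only [IntExpr.eval, hvk']
    refine ⟨⟨k + 1, hn, by simp, hI', hcount _ _ (hs.trans (hs'.within Program.within_forLoop))⟩,
      ?_⟩
    simp only [setInt_int, and_self, if_true, hvk]
    obtain ⟨j, rfl⟩ : ∃ j, n = k + 1 + j := ⟨n - (k + 1), by omega⟩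
    rw [show k + 1 + j - (k + 1) = j by omega, show k + 1 + j - k = j + 1 by omega]
    ring_nf
    omega

theorem Runs.sumS {v acc : ℕ} {b e : IntExpr} {M : Mem} {n : ℕ} (F : ℕ → ℕ)
    (hva : acc ≠ v) (hb : ∀ M', SameOff (sumS v b acc e) M M' → b.eval M' = n)
    (he : ∀ k < n, ∀ M', SameOff (QMC.sumS v b acc e) M M' → M'.int 0 v = k → e.eval M' = F k) :
    Runs JD I (QMC.sumS v b acc e) M (n * 3 + 3)
      (fun M' => M'.int 0 acc = ∑ k ∈ Finset.range n, F k) := by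
  have hw : (QMC.forLoop v b (setS acc (.add (iv acc) e))).Within (QMC.sumS v b acc e) :=
    Program.within_seq_right
  refine (Runs.seq (T := 1) (T' := n * (1 + 2) + 2)
    (Q := fun M' => M'.int 0 acc = 0) (Runs.setInt (by simp [IntExpr.eval])) ?_).imp
    (by omega) (fun _ _ h => h)
  intro M₁ hs₁ h₁
  have hs₁ := hs₁.within (P := QMC.sumS v b acc e) Program.within_seq_left
  refine (Runs.forLoop (fun k M' => M'.int 0 acc = ∑ k ∈ Finset.range k, F k)
    (by simp [Program.keepsReg, IntExpr.avoids, hva])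
    (fun M' hs => hb M' (hs₁.trans (hs.within hw))) (by simp [hva, h₁]) ?_).imp le_rfl
    (fun _ _ h => h.1)
  intro k hk M' hs hvk hI
  refine Runs.setInt ?_
  simp [IntExpr.eval, hva, hI, Finset.sum_range_succ, he k hk M' (hs₁.trans (hs.within hw)) hvk]

theorem Runs.sumC {v a : ℕ} {b : IntExpr} {e : CplxExpr} {M : Mem} {n : ℕ} (F : ℕ → ℂ)
    (hb : ∀ M', SameOff (sumC v b a e) M M' → b.eval M' = n)
    (he : ∀ k < n, ∀ M', SameOff (QMC.sumC v b a e) M M' → M'.int 0 v = k → e.eval M' = F k) :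
    Runs JD I (QMC.sumC v b a e) M (n * 3 + 3)
      (fun M' => M'.cplx a 0 0 = ∑ k ∈ Finset.range n, F k) := by
  have hw : (QMC.forLoop v b (setC a (.const 0) (.const 0)
      (.add (ca a (.const 0) (.const 0)) e))).Within (QMC.sumC v b a e) :=
    Program.within_seq_right
  refine (Runs.seq (T := 1) (T' := n * (1 + 2) + 2)
    (Q := fun M' => M'.cplx a 0 0 = 0)
    (Runs.setCplx (by simp [IntExpr.eval, CplxExpr.eval])) ?_).imp
    (by omega) (fun _ _ h => h)
  intro M₁ hs₁ h₁
  have hs₁ := hs₁.within (P := QMC.sumC v b a e) Program.within_seq_left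
  refine (Runs.forLoop (fun k M' => M'.cplx a 0 0 = ∑ k ∈ Finset.range k, F k)
    (by simp [Program.keepsReg])
    (fun M' hs => hb M' (hs₁.trans (hs.within hw))) (by simp [h₁]) ?_).imp le_rfl
    (fun _ _ h => h.1)
  intro k hk M' hs hvk hI
  refine Runs.setCplx ?_
  simp [IntExpr.eval, CplxExpr.eval, hI, Finset.sum_range_succ,
    he k hk M' (hs₁.trans (hs.within hw)) hvk]

theorem Runs.fillRow {r v : ℕ} {b : IntExpr} {P : Program} {e : IntExpr} {M : Mem} {n τ : ℕ}
    (F : ℕ → ℕ) (hr : r ≠ 0) (hv : P.keepsReg 0 v = true) (hP : P.keepsRow r = true)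
    (hb : ∀ M', SameOff (fillRow r v b P e) M M' → b.eval M' = n)
    (h : ∀ k < n, ∀ M', SameOff (QMC.fillRow r v b P e) M M' → M'.int 0 v = k →
      (∀ j < k, M'.int r j = F j) → (∀ j, k ≤ j → M'.int r j = M.int r j) →
      Runs JD I P M' τ (fun M'' => e.eval M'' = F k)) :
    Runs JD I (QMC.fillRow r v b P e) M (n * (τ + 3) + 2)
      (fun M' => (∀ j < n, M'.int r j = F j) ∧ ∀ j, n ≤ j → M'.int r j = M.int r j) := by
  refine (Runs.forLoop (τ := τ + 1)
    (fun k M' => (∀ j < k, M'.int r j = F j) ∧ ∀ j, k ≤ j → M'.int r j = M.int r j)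
    (by simp [Program.keepsReg, IntExpr.avoids, hv, hr]) hb (by simp [hr]) ?_).imp le_rfl
    (fun _ _ h => h.1)
  rintro k hk M' hs hvk ⟨hI, hI'⟩
  refine Runs.seq (h k hk M' hs hvk hI hI') fun M'' hs' he => Runs.setInt ?_
  have hvk' : M''.int 0 v = k := (hs'.reg 0 v hv).trans hvk
  simp only [IntExpr.eval, he, hvk']
  constructor
  · intro j hj
    rcases Nat.lt_succ_iff_lt_or_eq.1 hj with hj | rfl
    · simp [hr, hj.ne, hs'.row r hP, hI j hj]
    · simp [hr]
  · intro j hj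
    simp [hr, (show j ≠ k by omega), hs'.row r hP, hI' j (by omega)]

/-- The segments have length `N` in the table, and their first `n'` entries are filled. -/
theorem Runs.fillTab {r v w : ℕ} {b b' ix : IntExpr} {P : Program} {e : IntExpr} {M : Mem}
    {n n' N τ : ℕ} (F : ℕ → ℕ → ℕ) (hr : r ≠ 0) (hvw : v ≠ w) (hv : P.keepsReg 0 v = true)
    (hw : P.keepsReg 0 w = true) (hP : P.keepsRow r = true) (hN : n' ≤ N)
    (hb : ∀ M', SameOff (fillTab r v b w b' ix P e) M M' → b.eval M' = n)
    (hb' : ∀ M', SameOff (QMC.fillTab r v b w b' ix P e) M M' → b'.eval M' = n')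
    (hix : ∀ M', SameOff (QMC.fillTab r v b w b' ix P e) M M' → M'.int 0 v < n →
      ix.eval M' = M'.int 0 v * N)
    (h : ∀ i < n, ∀ j < n', ∀ M', SameOff (QMC.fillTab r v b w b' ix P e) M M' → M'.int 0 v = i →
      M'.int 0 w = j → Runs JD I P M' τ (fun M'' => e.eval M'' = F i j)) :
    Runs JD I (QMC.fillTab r v b w b' ix P e) M (n * (n' * (τ + 3) + 4) + 2)
      (fun M' => ∀ i < n, ∀ j < n', M'.int r (i * N + j) = F i j) := by
  set body : Program := .seq P (setA r (.add ix (iv w)) e)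
  have hW : (QMC.forLoop w b' body).Within (QMC.fillTab r v b w b' ix P e) :=
    Program.within_forLoop
  have hW' : P.Within (QMC.fillTab r v b w b' ix P e) :=
    (Program.within_seq_left.trans Program.within_forLoop).trans hW
  refine (Runs.forLoop (τ := n' * (τ + 3) + 2)
    (fun k M' => ∀ i < k, ∀ j < n', M'.int r (i * N + j) = F i j)
    (by simp [QMC.forLoop, Program.keepsReg, IntExpr.avoids, hv, hr, hvw.symm]) hb
    (by simp) ?_).imp le_rfl (fun _ _ h => h.1)
  intro i hi M₁ hs₁ hv₁ hI₁
  refine (Runs.forLoop (τ := τ + 1)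
    (fun k M' => (∀ i' < i, ∀ j < n', M'.int r (i' * N + j) = F i' j) ∧
      ∀ j < k, M'.int r (i * N + j) = F i j)
    (by simp [body, Program.keepsReg, IntExpr.avoids, hw, hr])
    (fun M' hs => hb' M' (hs₁.trans (hs.within hW))) ?_ ?_).imp le_rfl ?_
  · simpa [hr] using hI₁
  · rintro j hj M₂ hs₂ hw₂ ⟨hI₂, hI₂'⟩
    have hs₂' := hs₁.trans (hs₂.within hW)
    have hv₂ : M₂.int 0 v = i := by
      rw [hs₂.reg 0 v (by simp [QMC.forLoop, body, Program.keepsReg, IntExpr.avoids, hv, hr,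
        hvw.symm]), hv₁]
    refine Runs.seq (h i hi j hj M₂ hs₂' hv₂ hw₂) fun M₃ hs₃ he => Runs.setInt ?_
    have hv₃ : M₃.int 0 v = i := (hs₃.reg 0 v hv).trans hv₂
    have hw₃ : M₃.int 0 w = j := (hs₃.reg 0 w hw).trans hw₂
    have hix₃ : ix.eval M₃ = i * N := by
      rw [hix M₃ (hs₂'.trans (hs₃.within hW')) (by omega), hv₃]
    simp only [IntExpr.eval, he, hw₃, hix₃]
    have hlt : ∀ i' < i, ∀ j' < n', i' * N + j' ≠ i * N + j := by
      intro i' hi' j' hj'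
      have : (i' + 1) * N ≤ i * N := Nat.mul_le_mul_right N hi'
      rw [Nat.add_mul] at this
      omega
    constructor
    · intro i' hi' j' hj'
      simp [hr, hlt i' hi' j' hj', hs₃.row r hP, hI₂ i' hi' j' hj']
    · intro j' hj'
      rcases Nat.lt_succ_iff_lt_or_eq.1 hj' with hj' | rfl
      · simp [hr, hj'.ne, hs₃.row r hP, hI₂' j' hj']
      · simp [hr]
  · rintro M₂ - ⟨⟨h₂, h₂'⟩, -⟩ i' hi' j hj
    rcases Nat.lt_succ_iff_lt_or_eq.1 hi' with hi' | rfl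
    · simpa [hr] using h₂ i' hi' j hj
    · simpa [hr] using h₂' j hj

/-- The entries of a row may be computed from the rows before it. -/
theorem Runs.fillMat_rec {a v w : ℕ} {b b' : IntExpr} {P : Program} {e : CplxExpr} {M : Mem}
    {n n' τ : ℕ} (F : ℕ → ℕ → ℂ) (hvw : v ≠ w) (hv : P.keepsReg 0 v = true)
    (hw : P.keepsReg 0 w = true) (hP : P.keepsName a = true)
    (hb : ∀ M', SameOff (fillMat a v b w b' P e) M M' → b.eval M' = n)
    (hb' : ∀ M', SameOff (QMC.fillMat a v b w b' P e) M M' → b'.eval M' = n')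
    (h : ∀ i < n, ∀ j < n', ∀ M', SameOff (QMC.fillMat a v b w b' P e) M M' → M'.int 0 v = i →
      M'.int 0 w = j → (∀ i' < i, ∀ j' < n', M'.cplx a i' j' = F i' j') →
      Runs JD I P M' τ (fun M'' => e.eval M'' = F i j)) :
    Runs JD I (QMC.fillMat a v b w b' P e) M (n * (n' * (τ + 3) + 4) + 2)
      (fun M' => ∀ i < n, ∀ j < n', M'.cplx a i j = F i j) := by
  set body : Program := .seq P (setC a (iv v) (iv w) e)
  have hW : (QMC.forLoop w b' body).Within (QMC.fillMat a v b w b' P e) :=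
    Program.within_forLoop
  have hW' : P.Within (QMC.fillMat a v b w b' P e) :=
    (Program.within_seq_left.trans Program.within_forLoop).trans hW
  refine (Runs.forLoop (τ := n' * (τ + 3) + 2)
    (fun k M' => ∀ i < k, ∀ j < n', M'.cplx a i j = F i j)
    (by simp [QMC.forLoop, Program.keepsReg, IntExpr.avoids, hv, hvw.symm]) hb
    (by simp) ?_).imp le_rfl (fun _ _ h => h.1)
  intro i hi M₁ hs₁ hv₁ hI₁
  refine (Runs.forLoop (τ := τ + 1)
    (fun k M' => (∀ i' < i, ∀ j < n', M'.cplx a i' j = F i' j) ∧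
      ∀ j < k, M'.cplx a i j = F i j)
    (by simp [body, Program.keepsReg, hw])
    (fun M' hs => hb' M' (hs₁.trans (hs.within hW))) ?_ ?_).imp le_rfl ?_
  · simpa using hI₁
  · rintro j hj M₂ hs₂ hw₂ ⟨hI₂, hI₂'⟩
    have hs₂' := hs₁.trans (hs₂.within hW)
    have hv₂ : M₂.int 0 v = i := by
      rw [hs₂.reg 0 v (by simp [QMC.forLoop, body, Program.keepsReg, IntExpr.avoids, hv,
        hvw.symm]), hv₁]
    refine Runs.seq (h i hi j hj M₂ hs₂' hv₂ hw₂ hI₂) fun M₃ hs₃ he => Runs.setCplx ?_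
    have hv₃ : M₃.int 0 v = i := (hs₃.reg 0 v hv).trans hv₂
    have hw₃ : M₃.int 0 w = j := (hs₃.reg 0 w hw).trans hw₂
    simp only [IntExpr.eval, he, hw₃, hv₃]
    constructor
    · intro i' hi' j' hj'
      simp [hi'.ne, hs₃.name a hP, hI₂ i' hi' j' hj']
    · intro j' hj'
      rcases Nat.lt_succ_iff_lt_or_eq.1 hj' with hj' | rfl
      · simp [hj'.ne, hs₃.name a hP, hI₂' j' hj']
      · simp
  · rintro M₂ - ⟨⟨h₂, h₂'⟩, -⟩ i' hi' j hj
    rcases Nat.lt_succ_iff_lt_or_eq.1 hi' with hi' | rfl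
    · simpa using h₂ i' hi' j hj
    · simpa using h₂' j hj

theorem Runs.fillMat {a v w : ℕ} {b b' : IntExpr} {P : Program} {e : CplxExpr} {M : Mem}
    {n n' τ : ℕ} (F : ℕ → ℕ → ℂ) (hvw : v ≠ w) (hv : P.keepsReg 0 v = true)
    (hw : P.keepsReg 0 w = true) (hP : P.keepsName a = true)
    (hb : ∀ M', SameOff (fillMat a v b w b' P e) M M' → b.eval M' = n)
    (hb' : ∀ M', SameOff (QMC.fillMat a v b w b' P e) M M' → b'.eval M' = n')
    (h : ∀ i < n, ∀ j < n', ∀ M', SameOff (QMC.fillMat a v b w b' P e) M M' → M'.int 0 v = i →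
      M'.int 0 w = j → Runs JD I P M' τ (fun M'' => e.eval M'' = F i j)) :
    Runs JD I (QMC.fillMat a v b w b' P e) M (n * (n' * (τ + 3) + 4) + 2)
      (fun M' => ∀ i < n, ∀ j < n', M'.cplx a i j = F i j) :=
  Runs.fillMat_rec F hvw hv hw hP hb hb' fun i hi j hj M' hs hv hw _ => h i hi j hj M' hs hv hw

end Rules

/-! ### Truth values as integers -/

open Classical in
/-- The truth value of a proposition as a natural number. Connectives and comparisons of truth
values are expressed by addition and truncated subtraction, the operations of the machine. -/
def ind (p : Prop) : ℕ := if p then 1 else 0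

theorem ind_pos {p : Prop} (h : p) : ind p = 1 := if_pos h

theorem ind_neg {p : Prop} (h : ¬ p) : ind p = 0 := if_neg h

theorem ind_eq_one_iff {p : Prop} : ind p = 1 ↔ p := by
  by_cases h : p <;> simp [ind, h]

theorem ind_eq_zero_iff {p : Prop} : ind p = 0 ↔ ¬ p := by
  by_cases h : p <;> simp [ind, h]

theorem ind_congr {p q : Prop} (h : p ↔ q) : ind p = ind q := by rw [propext h]

theorem ind_le_one (p : Prop) : ind p ≤ 1 := by by_cases h : p <;> simp [ind, h]

theorem one_sub_ind (p : Prop) : 1 - ind p = ind (¬ p) := by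
  by_cases h : p <;> simp [ind, h]

theorem ind_and (p q : Prop) : ind p + ind q - 1 = ind (p ∧ q) := by
  by_cases h : p <;> by_cases h' : q <;> simp [ind, h, h']

theorem ind_or (p q : Prop) : 1 - (1 - (ind p + ind q)) = ind (p ∨ q) := by
  by_cases h : p <;> by_cases h' : q <;> simp [ind, h, h']

theorem ind_le (x y : ℕ) : 1 - (x - y) = ind (x ≤ y) := by
  by_cases h : x ≤ y
  · rw [ind_pos h]; omega
  · rw [ind_neg h]; omega

theorem ind_eq (x y : ℕ) : 1 - ((x - y) + (y - x)) = ind (x = y) := by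
  by_cases h : x = y
  · rw [ind_pos h]; omega
  · rw [ind_neg h]; omega

theorem sum_ind_eq_zero_iff (n : ℕ) (p : ℕ → Prop) :
    ∑ k ∈ Finset.range n, ind (p k) = 0 ↔ ∀ k < n, ¬ p k := by
  simp [Finset.sum_eq_zero_iff, ind_eq_zero_iff]

theorem ind_exists (n : ℕ) (p : ℕ → Prop) :
    1 - (1 - ∑ k ∈ Finset.range n, ind (p k)) = ind (∃ k < n, p k) := by
  by_cases h : ∃ k < n, p k
  · have : ∑ k ∈ Finset.range n, ind (p k) ≠ 0 := by
      rw [Ne, sum_ind_eq_zero_iff]; push Not; exact h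
    rw [ind_pos h]; omega
  · have : ∑ k ∈ Finset.range n, ind (p k) = 0 := by
      rw [sum_ind_eq_zero_iff]; push Not at h; exact h
    rw [ind_neg h, this]

namespace IntExpr

/-- Negation of a truth value. -/
abbrev not (x : IntExpr) : IntExpr := .sub (.const 1) x

/-- Conjunction of truth values. -/
abbrev and (x y : IntExpr) : IntExpr := .sub (.add x y) (.const 1)

/-- Disjunction of truth values. -/
abbrev or (x y : IntExpr) : IntExpr := .sub (.const 1) (.sub (.const 1) (.add x y))

/-- The truth value of `x ≤ y`. -/
abbrev le (x y : IntExpr) : IntExpr := .sub (.const 1) (.sub x y)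

/-- The truth value of `x = y`. -/
abbrev eq (x y : IntExpr) : IntExpr := .sub (.const 1) (.add (.sub x y) (.sub y x))

/-- The truth value of `x ≠ 0`. -/
abbrev pos (x : IntExpr) : IntExpr := .sub (.const 1) (.sub (.const 1) x)

end IntExpr

theorem ind_ind_eq (p q : Prop) : ind (ind p = ind q) = ind (p ↔ q) := by
  by_cases h : p <;> by_cases h' : q <;> simp [ind, h, h']

theorem one_sub_sum_ind (n : ℕ) (p : ℕ → Prop) :
    1 - ∑ k ∈ Finset.range n, ind (p k) = ind (∀ k < n, ¬ p k) := by
  by_cases h : ∀ k < n, ¬ p k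
  · rw [ind_pos h, (sum_ind_eq_zero_iff n p).2 h]
  · have : ∑ k ∈ Finset.range n, ind (p k) ≠ 0 := fun h' => h ((sum_ind_eq_zero_iff n p).1 h')
    rw [ind_neg h]; omega

theorem SameOff.readOp {P : Program} {M M' : Mem} (h : SameOff P M M') (n a : ℕ)
    (ha : P.keepsName a = true) : M'.readOp n a = M.readOp n a := by
  ext i j
  exact h.name a ha i j

theorem setInt_readOp (M : Mem) (a i v n b : ℕ) : (M.setInt a i v).readOp n b = M.readOp n b := rfl

namespace IntExpr

variable {M : Mem} {x y : IntExpr} {p q : Prop}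

theorem eval_not (hx : x.eval M = ind p) : (IntExpr.not x).eval M = ind (¬ p) := by
  simp only [IntExpr.eval, hx, one_sub_ind]

theorem eval_and (hx : x.eval M = ind p) (hy : y.eval M = ind q) :
    (IntExpr.and x y).eval M = ind (p ∧ q) := by
  simp only [IntExpr.eval, hx, hy, ind_and]

theorem eval_or (hx : x.eval M = ind p) (hy : y.eval M = ind q) :
    (IntExpr.or x y).eval M = ind (p ∨ q) := by
  simp only [IntExpr.eval, hx, hy, ind_or]

theorem eval_iff (hx : x.eval M = ind p) (hy : y.eval M = ind q) :
    (IntExpr.eq x y).eval M = ind (p ↔ q) := by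
  simp only [IntExpr.eval, hx, hy, ind_eq, ind_ind_eq]

theorem eval_eq {a b : ℕ} (hx : x.eval M = a) (hy : y.eval M = b) :
    (IntExpr.eq x y).eval M = ind (a = b) := by
  simp only [IntExpr.eval, hx, hy, ind_eq]

theorem eval_le {a b : ℕ} (hx : x.eval M = a) (hy : y.eval M = b) :
    (IntExpr.le x y).eval M = ind (a ≤ b) := by
  simp only [IntExpr.eval, hx, hy, ind_le]

end IntExpr

/-! ### Queries and segments of tables -/

/-- `for w < b do { P; row r at (ix + w) := e }`. -/
def fillSeg (r : ℕ) (ix : IntExpr) (w : ℕ) (b : IntExpr) (P : Program) (e : IntExpr) : Program :=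
  forLoop w b (.seq P (setA r (.add ix (iv w)) e))

section Rules

variable {JD : JordanProcedure} {d m : ℕ} {I : Instance d m}

theorem Runs.label {src q a i : IntExpr} {M : Mem} {Q : Mem → Prop}
    (h : Q (M.setInt (a.eval M) (i.eval M)
      (ind (∃ b : Fin m, (b : ℕ) = q.eval M ∧ b ∈ I.label (M.readOp d (src.eval M)))))) :
    Runs JD I (.label src q a i) M 1 Q :=
  ⟨1, _, .label M src q a i, le_rfl, by unfold ind at h; convert h⟩

theorem Runs.feasible {src pat a i : IntExpr} {M : Mem} {Q : Mem → Prop}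
    (h : Q (M.setInt (a.eval M) (i.eval M)
      (ind (∃ s ∈ I.nbhd (M.readOp d (src.eval M)), ∀ b : Fin m,
        (M.int (pat.eval M) b = 1 → b ∈ s) ∧ (M.int (pat.eval M) b = 2 → b ∉ s))))) :
    Runs JD I (.feasible src pat a i) M 1 Q :=
  ⟨1, _, .feasible M src pat a i, le_rfl, by unfold ind at h; convert h⟩

/-- Along with the table segment, a property `R` of an auxiliary row `q` is maintained. -/
theorem Runs.fillSeg {r w q : ℕ} {b ix : IntExpr} {P : Program} {e : IntExpr} {M : Mem}
    {n o τ : ℕ} (F : ℕ → ℕ) (R : (ℕ → ℕ) → Prop) (hq : q ≠ r ∧ q ≠ 0) (hr : r ≠ 0)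
    (hw : P.keepsReg 0 w = true) (hP : P.keepsRow r = true)
    (hb : ∀ M', SameOff (fillSeg r ix w b P e) M M' → b.eval M' = n)
    (hix : ∀ M', SameOff (QMC.fillSeg r ix w b P e) M M' → ix.eval M' = o) (hR : R (M.int q))
    (h : ∀ j < n, ∀ M', SameOff (QMC.fillSeg r ix w b P e) M M' → M'.int 0 w = j → R (M'.int q) →
      Runs JD I P M' τ (fun M'' => e.eval M'' = F j ∧ R (M''.int q))) :
    Runs JD I (QMC.fillSeg r ix w b P e) M (n * (τ + 3) + 2)
      (fun M' => (∀ j < n, M'.int r (o + j) = F j) ∧ (∀ j < o, M'.int r j = M.int r j) ∧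
        R (M'.int q)) := by
  have hW' : P.Within (QMC.fillSeg r ix w b P e) :=
    Program.within_seq_left.trans Program.within_forLoop
  have hset : ∀ (M' : Mem) (a i v : ℕ), q ≠ a → (M'.setInt a i v).int q = M'.int q := by
    intro M' a i v ha
    funext x
    simp [ha]
  refine (Runs.forLoop (τ := τ + 1)
    (fun k M' => (∀ j < k, M'.int r (o + j) = F j) ∧ (∀ j < o, M'.int r j = M.int r j) ∧
      R (M'.int q))
    (by simp [Program.keepsReg, IntExpr.avoids, hw, hr]) hb (by
      rw [hset _ _ _ _ hq.2]; simpa [hr] using hR) ?_).imp le_rfl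
    (fun _ _ h => h.1)
  rintro k hk M' hs hvk ⟨hI, hI', hRk⟩
  refine Runs.seq (h k hk M' hs hvk hRk) fun M'' hs' he => Runs.setInt ?_
  have hvk' : M''.int 0 w = k := (hs'.reg 0 w hw).trans hvk
  simp only [IntExpr.eval, he.1, hvk', hix M'' (hs.trans (hs'.within hW'))]
  refine ⟨?_, ?_, ?_⟩
  · intro j hj
    rcases Nat.lt_succ_iff_lt_or_eq.1 hj with hj | rfl
    · simp [hr, hj.ne, hs'.row r hP, hI j hj]
    · simp [hr]
  · intro j hj
    simp [hr, (show j ≠ o + k by omega), hs'.row r hP, hI' j (by omega)]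
  · rw [hset _ _ _ _ hq.2, hset _ _ _ _ hq.1]
    exact he.2

end Rules

/-! ### Tables of the model-checking procedure -/

/-- `N := 2 ^ s`. -/
def progN : Program := .seq (setS 5 (.const 1)) (forLoop 7 (iv 2) (setS 5 (.add (iv 5) (iv 5))))

/-- Row `6`: the halves of the numbers below `N`. -/
def progHalf : Program :=
  fillRow 6 7 (iv 5) (sumS 8 (iv 5) 10
    (.le (.add (.add (iv 8) (.const 1)) (.add (iv 8) (.const 1))) (iv 7))) (iv 10)

/-- Row `7`: the multiples of `N`. -/
def progMul : Program :=
  .seq (setS 10 (.const 0)) (forLoop 7 (.add (.add (iv 3) (iv 6)) (iv 5))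
    (.seq (setA 7 (iv 7) (iv 10)) (setS 10 (.add (iv 10) (iv 5)))))

/-- Row `9`: the binary digits. -/
def progBit : Program :=
  fillTab 9 7 (iv 2) 8 (iv 5) (ia 7 (iv 7))
    (.seq (setS 10 (iv 8)) (forLoop 11 (iv 7) (setS 10 (ia 6 (iv 10)))))
    (.sub (iv 10) (.add (ia 6 (iv 10)) (ia 6 (iv 10))))

section

variable {JD : JordanProcedure} {d m : ℕ} {I : Instance d m}

theorem runs_progN {M : Mem} {s : ℕ} (hs : M.int 0 2 = s) :
    Runs JD I progN M (1 + (s * 3 + 2)) (fun M' => M'.int 0 5 = 2 ^ s) := by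
  refine Runs.seq (Q := fun M' => M'.int 0 5 = 1) (Runs.setInt (by simp [IntExpr.eval]))
    fun M₁ h₁ hN => ?_
  refine Runs.imp (Runs.forLoop (n := s) (τ := 1) (fun k M' => M'.int 0 5 = 2 ^ k) rfl
    (fun M' h => (h.reg 0 2 rfl).trans ((h₁.reg 0 2 rfl).trans hs)) (by simpa using hN) ?_) le_rfl
    fun _ _ h => h.1
  intro k _ M' _ _ hI
  refine Runs.setInt ?_
  simp [IntExpr.eval, hI, pow_succ, mul_two]

/-- The machine cannot halve: `x / 2` is the number of `k` with `2 (k + 1) ≤ x`. -/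
theorem sum_half {N x : ℕ} (hx : x < N) :
    ∑ k ∈ Finset.range N, ind (k + 1 + (k + 1) ≤ x) = x / 2 := by
  classical
  have : ∀ k, ind (k + 1 + (k + 1) ≤ x) = if k < x / 2 then 1 else 0 := by
    intro k
    have h : k + 1 + (k + 1) ≤ x ↔ k < x / 2 := by omega
    by_cases h' : k < x / 2
    · rw [ind_pos (h.2 h'), if_pos h']
    · rw [ind_neg (fun h'' => h' (h.1 h'')), if_neg h']
  simp only [this, Finset.sum_boole]
  have : (Finset.range N).filter (fun k => k < x / 2) = Finset.range (x / 2) := by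
    ext k; simp; omega
  rw [this]
  simp

theorem runs_progHalf {M : Mem} {N : ℕ} (hN : M.int 0 5 = N) :
    Runs JD I progHalf M (N * (N * 3 + 3 + 3) + 2) (fun M' => ∀ x < N, M'.int 6 x = x / 2) := by
  refine Runs.imp (Runs.fillRow (fun x => x / 2) (by decide) rfl rfl
    (fun M' h => (h.reg 0 5 rfl).trans hN) ?_) le_rfl fun _ _ h => h.1
  intro x hx M₁ h₁ hx₁ _ _
  refine Runs.imp (Runs.sumS (n := N) (fun k => ind (k + 1 + (k + 1) ≤ x)) (by decide)
    (fun M' h => (h.reg 0 5 rfl).trans ((h₁.reg 0 5 rfl).trans hN)) ?_) le_rfl ?_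
  · intro k _ M₂ h₂ hk
    have : M₂.int 0 7 = x := (h₂.reg 0 7 rfl).trans hx₁
    simp only [IntExpr.eval, hk, this, ind_le]
  · intro M₂ _ h
    exact h.trans (sum_half hx)

theorem runs_progMul {M : Mem} {N L : ℕ} (hN : M.int 0 5 = N)
    (hL : M.int 0 3 + M.int 0 6 + N = L) :
    Runs JD I progMul M (1 + (L * 4 + 2)) (fun M' => ∀ x < L, M'.int 7 x = x * N) := by
  refine Runs.seq (Q := fun M' => M'.int 0 10 = 0) (Runs.setInt (by simp [IntExpr.eval]))
    fun M₁ h₁ h0 => ?_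
  refine Runs.imp (Runs.forLoop (n := L) (τ := 2) (fun k M' => M'.int 0 10 = k * N ∧
    ∀ x < k, M'.int 7 x = x * N) rfl (fun M' h => ?_) (by simpa using h0) ?_) le_rfl
    fun _ _ h => h.1.2
  · simp only [IntExpr.eval, h.reg 0 3 rfl, h.reg 0 6 rfl, h.reg 0 5 rfl, h₁.reg 0 3 rfl,
      h₁.reg 0 6 rfl, h₁.reg 0 5 rfl, hN, hL]
  · rintro k _ M' hs hk ⟨hI, hI'⟩
    have hN' : M'.int 0 5 = N := by rw [hs.reg 0 5 rfl, h₁.reg 0 5 rfl, hN]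
    refine Runs.seq (T := 1) (T' := 1) (Q := fun M'' => M''.int 7 k = k * N ∧
      ∀ x < k, M''.int 7 x = x * N) (Runs.setInt ?_) fun M₂ h₂ hQ => Runs.setInt ?_
    · refine ⟨by simp [IntExpr.eval, hk, hI], fun x hx => ?_⟩
      simp [IntExpr.eval, hk, hx.ne, hI' x hx]
    · have h5 : M₂.int 0 5 = N := (h₂.reg 0 5 rfl).trans hN'
      have h10 : M₂.int 0 10 = k * N := (h₂.reg 0 10 rfl).trans hI
      refine ⟨by simp [IntExpr.eval, h5, h10, Nat.add_mul], fun x hx => ?_⟩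
      rcases Nat.lt_succ_iff_lt_or_eq.1 hx with hx | rfl
      · simpa [IntExpr.eval] using hQ.2 x hx
      · simpa [IntExpr.eval] using hQ.1

theorem runs_progBit {M : Mem} {N s : ℕ} (hN : M.int 0 5 = N) (hs : M.int 0 2 = s)
    (hhalf : ∀ x < N, M.int 6 x = x / 2) (hmul : ∀ x < s, M.int 7 x = x * N) :
    Runs JD I progBit M (s * (N * (1 + (s * 3 + 2) + 3) + 4) + 2)
      (fun M' => ∀ i < s, ∀ T < N, M'.int 9 (i * N + T) = ind (T.testBit i = true)) := by
  refine (Runs.fillTab (N := N) (fun i T => ind (T.testBit i = true)) (by decide) (by decide) rfl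
    rfl rfl le_rfl (fun M' h => (h.reg 0 2 rfl).trans hs) (fun M' h => (h.reg 0 5 rfl).trans hN)
    (fun M' h hx => (h.row 7 rfl _).trans (hmul _ hx)) ?_)
  intro i hi T hT M₁ h₁ hi₁ hT₁
  refine Runs.seq (Q := fun M' => M'.int 0 10 = T) (Runs.setInt (by simp [IntExpr.eval, hT₁]))
    fun M₂ h₂ h10 => ?_
  refine Runs.imp (Runs.forLoop (n := i) (τ := 1) (fun k M' => M'.int 0 10 = T / 2 ^ k) rfl
      (fun M' h => (h.reg 0 7 rfl).trans ((h₂.reg 0 7 rfl).trans hi₁)) (by simpa using h10)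
      ?_) (by omega) ?_
  · intro k _ M₃ h₃ _ hI
    refine Runs.setInt ?_
    have hlt : T / 2 ^ k < N := (Nat.div_le_self _ _).trans_lt hT
    simp only [IntExpr.eval, hI, h₃.row 6 rfl, h₂.row 6 rfl, h₁.row 6 rfl, hhalf _ hlt]
    simp [pow_succ, Nat.div_div_eq_div_mul]
  · rintro M₃ h₃ ⟨hI, -⟩
    have hlt : T / 2 ^ i < N := (Nat.div_le_self _ _).trans_lt hT
    simp only [IntExpr.eval, hI, h₃.row 6 rfl, h₂.row 6 rfl, h₁.row 6 rfl, hhalf _ hlt]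
    rw [Nat.testBit_eq_decide_div_mod_eq]
    by_cases h : T / 2 ^ i % 2 = 1
    · rw [ind_pos (by simpa using h)]; omega
    · rw [ind_neg (by simpa using h)]; omega

end

/-! ### Local consistency of types -/

/-- Row `10`: the sizes of the subformulas. -/
def progSize : Program :=
  fillRow 10 13 (iv 2)
    (.ite (.intLe (.const 5) (ia 1 (iv 13))) (setS 10 (.const 1))
      (.ite (.intLe (ia 1 (iv 13)) (.const 0)) (setS 10 (.const 1))
        (.ite (.intLe (.const 1) (.or (.eq (ia 1 (iv 13)) (.const 2))
            (.eq (ia 1 (iv 13)) (.const 4))))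
          (setS 10 (.add (.add (.const 1) (ia 10 (.sub (iv 13) (.const 1))))
            (ia 10 (.sub (.sub (iv 13) (.const 1)) (ia 10 (.sub (iv 13) (.const 1)))))))
          (setS 10 (.add (.const 1) (ia 10 (.sub (iv 13) (.const 1)))))))) (iv 10)

/-- The bit at position `i` of the number in the scalar `T`, read from the table of bits. -/
def bitE (i : IntExpr) (T : ℕ) : IntExpr := ia 9 (.add (ia 7 i) (iv T))

/-- The position of the right, or only, child of the node in the scalar `13`. -/
def rightE : IntExpr := .sub (iv 13) (.const 1)

/-- The position of the left child of the node in the scalar `13`. -/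
def leftE : IntExpr := .sub rightE (ia 10 rightE)

/-- The truth value that the semantics dictates at the node in the scalar `13`, for the types in
the scalars `7` and `8`. -/
def expectedE : IntExpr :=
  .or (.eq (ia 1 (iv 13)) (.const 0))
    (.or (.and (.eq (ia 1 (iv 13)) (.const 1)) (.not (bitE rightE 7)))
  (.or (.and (.eq (ia 1 (iv 13)) (.const 2)) (.or (bitE leftE 7) (bitE rightE 7)))
  (.or (.and (.eq (ia 1 (iv 13)) (.const 3)) (bitE rightE 8))
  (.or (.and (.eq (ia 1 (iv 13)) (.const 4))
    (.or (bitE rightE 7) (.and (bitE leftE 7) (bitE (iv 13) 8))))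
  (.and (.le (.const 5) (ia 1 (iv 13))) (bitE (iv 13) 7))))))

/-- Row `11`: local consistency of pairs of types. -/
def progConsistent : Program :=
  fillTab 11 7 (iv 5) 8 (iv 5) (ia 7 (iv 7))
    (sumS 13 (iv 2) 10 (.not (.eq (bitE (iv 13) 7) expectedE))) (.not (iv 10))

section

variable {JD : JordanProcedure} {d m : ℕ} {I : Instance d m}

/-- The sizes of the subformulas can be computed from the postfix code, from left to right. -/
theorem Formula.nodeSize_eq (φ : Formula (Fin m)) {i : ℕ} (hi : i < φ.size) :
    (5 ≤ φ.code.getD i 0 → φ.nodeSize i = 1) ∧ (φ.code.getD i 0 = 0 → φ.nodeSize i = 1) ∧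
    (φ.code.getD i 0 = 2 ∨ φ.code.getD i 0 = 4 → 1 ≤ i ∧ φ.nodeSize (i - 1) < i ∧
      φ.nodeSize i = 1 + φ.nodeSize (i - 1) + φ.nodeSize (φ.leftChild i)) ∧
    (φ.code.getD i 0 = 1 ∨ φ.code.getD i 0 = 3 → 1 ≤ i ∧
      φ.nodeSize i = 1 + φ.nodeSize (i - 1)) := by
  rw [φ.getD_code hi]
  simp only [nodeSize]
  cases h : φ.nodeAt i with
  | tt => simp [head, size]
  | atom a => simp [head, size]; omega
  | neg χ =>
    obtain ⟨h1, h2⟩ := φ.nodeAt_neg hi h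
    simp only [h2, head, size]; omega
  | next χ =>
    obtain ⟨h1, h2⟩ := φ.nodeAt_next hi h
    simp only [h2, head, size]; omega
  | or ψ χ =>
    obtain ⟨h1, h2, h3⟩ := φ.nodeAt_or hi h
    simp only [h2, h3, head, size]; omega
  | _ ψ χ =>
    obtain ⟨h1, h2, h3⟩ := φ.nodeAt_until hi h
    simp only [h2, h3, head, size]; omega

theorem runs_progSize {M : Mem} {φ : Formula (Fin m)} (hs : M.int 0 2 = φ.size)
    (hcode : ∀ i < φ.size, M.int 1 i = φ.code.getD i 0) :
    Runs JD I progSize M (φ.size * (4 + 3) + 2)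
      (fun M' => ∀ i < φ.size, M'.int 10 i = φ.nodeSize i) := by
  refine Runs.imp (Runs.fillRow φ.nodeSize (by decide) rfl rfl
    (fun M' h => (h.reg 0 2 rfl).trans hs) ?_) le_rfl fun _ _ h => h.1
  intro i hi M₁ h₁ hi₁ hI _
  have hc : M₁.int 1 i = φ.code.getD i 0 := (h₁.row 1 rfl i).trans (hcode i hi)
  obtain ⟨h5, h0, h24, h13⟩ := φ.nodeSize_eq hi
  refine Runs.ite (fun h => ?_) fun h => Runs.ite (fun h' => ?_) fun h' =>
    Runs.ite (fun h'' => ?_) fun h'' => ?_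
  all_goals simp only [Test.Holds, IntExpr.eval, hi₁, hc, not_le] at h
  all_goals try simp only [Test.Holds, IntExpr.eval, hi₁, hc, not_le] at h'
  all_goals try simp only [Test.Holds, IntExpr.eval, hi₁, hc, not_le, ind_eq, ind_or] at h''
  · refine Runs.imp (Runs.setInt (Q := fun M' => M'.int 0 10 = φ.nodeSize i) ?_) (by omega)
      fun _ _ h => h
    simp [IntExpr.eval, h5 h]
  · refine Runs.imp (Runs.setInt (Q := fun M' => M'.int 0 10 = φ.nodeSize i) ?_) (by omega)
      fun _ _ h => h
    simp [IntExpr.eval, h0 (by omega)]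
  · have hor := ind_eq_one_iff.1 (le_antisymm (ind_le_one _) h'')
    obtain ⟨hi1, hlt, heq⟩ := h24 hor
    refine Runs.setInt ?_
    simp only [IntExpr.eval, hi₁, setInt_int, and_self, if_true]
    rw [hI (i - 1) (by omega), hI _ (by omega), heq]
    rfl
  · have hor := ind_eq_zero_iff.1 (Nat.lt_one_iff.1 h'')
    obtain ⟨hi1, heq⟩ := h13 (by omega)
    refine Runs.setInt ?_
    simp only [IntExpr.eval, hi₁, setInt_int, and_self, if_true]
    rw [hI (i - 1) (by omega), heq]

/-- The tables of multiples of `N`, of binary digits and of sizes of subformulas. -/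
structure BitTables (φ : Formula (Fin m)) (N L : ℕ) (M : Mem) : Prop where
  size : M.int 0 2 = φ.size
  code : ∀ i < φ.size, M.int 1 i = φ.code.getD i 0
  count : M.int 0 5 = N
  mul : ∀ x < L, M.int 7 x = x * N
  bit : ∀ i < φ.size, ∀ T < N, M.int 9 (i * N + T) = ind (T.testBit i = true)
  nodeSize : ∀ i < φ.size, M.int 10 i = φ.nodeSize i

theorem BitTables.transport {φ : Formula (Fin m)} {N L : ℕ} {M M' : Mem} (h : BitTables φ N L M)
    (hs : M'.int 0 2 = M.int 0 2) (hN : M'.int 0 5 = M.int 0 5) (h1 : ∀ i, M'.int 1 i = M.int 1 i)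
    (h7 : ∀ i, M'.int 7 i = M.int 7 i) (h9 : ∀ i, M'.int 9 i = M.int 9 i)
    (h10 : ∀ i, M'.int 10 i = M.int 10 i) : BitTables φ N L M' :=
  ⟨hs.trans h.size, fun i hi => (h1 i).trans (h.code i hi), hN.trans h.count,
    fun x hx => (h7 x).trans (h.mul x hx), fun i hi T hT => (h9 _).trans (h.bit i hi T hT),
    fun i hi => (h10 i).trans (h.nodeSize i hi)⟩

theorem BitTables.sameOff {φ : Formula (Fin m)} {N L : ℕ} {M M' : Mem} {P : Program}
    (h : BitTables φ N L M) (hP : SameOff P M M')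
    (hk : (P.keepsReg 0 2 && P.keepsReg 0 5 && P.keepsRow 1 && P.keepsRow 7 && P.keepsRow 9 &&
      P.keepsRow 10) = true) : BitTables φ N L M' := by
  simp only [Bool.and_eq_true] at hk
  exact h.transport (hP.reg 0 2 hk.1.1.1.1.1) (hP.reg 0 5 hk.1.1.1.1.2) (hP.row 1 hk.1.1.1.2)
    (hP.row 7 hk.1.1.2) (hP.row 9 hk.1.2) (hP.row 10 hk.2)

theorem BitTables.bitE {φ : Formula (Fin m)} {N L : ℕ} {M : Mem} (h : BitTables φ N L M)
    (hL : φ.size ≤ L) {e : IntExpr} {i : ℕ} (he : e.eval M = i) (hi : i < φ.size) {v T : ℕ}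
    (hv : M.int 0 v = T) (hT : T < N) : (bitE e v).eval M = ind (T.testBit i = true) := by
  simp only [QMC.bitE, IntExpr.eval, he, hv, h.mul i (by omega), h.bit i hi T hT]

theorem BitTables.expectedE {φ : Formula (Fin m)} {N L : ℕ} {M : Mem} (h : BitTables φ N L M)
    (hL : φ.size ≤ L) {i T T' : ℕ} (hi : i < φ.size) (h13 : M.int 0 13 = i)
    (h7 : M.int 0 7 = T) (hT : T < N) (h8 : M.int 0 8 = T') (hT' : T' < N) :
    expectedE.eval M = ind (φ.Expected (fun j => T.testBit j) (fun j => T'.testBit j) i) := by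
  have hr : rightE.eval M = i - 1 := by simp only [rightE, IntExpr.eval, h13]
  have hl : leftE.eval M = φ.leftChild i := by
    simp only [leftE, IntExpr.eval, hr, h.nodeSize (i - 1) (by omega)]; rfl
  have hl' : φ.leftChild i < φ.size := by simp only [Formula.leftChild]; omega
  have h13' : (iv 13).eval M = i := h13
  have hc : (ia 1 (iv 13)).eval M = φ.code.getD i 0 := by
    simp only [IntExpr.eval, h13, h.code i hi]
  have hbr := h.bitE hL hr (by omega) h7 hT
  have hbl := h.bitE hL hl hl' h7 hT
  exact IntExpr.eval_or (IntExpr.eval_eq hc rfl) (IntExpr.eval_or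
    (IntExpr.eval_and (IntExpr.eval_eq hc rfl) (IntExpr.eval_not hbr)) (IntExpr.eval_or
    (IntExpr.eval_and (IntExpr.eval_eq hc rfl) (IntExpr.eval_or hbl hbr)) (IntExpr.eval_or
    (IntExpr.eval_and (IntExpr.eval_eq hc rfl) (h.bitE hL hr (by omega) h8 hT')) (IntExpr.eval_or
    (IntExpr.eval_and (IntExpr.eval_eq hc rfl) (IntExpr.eval_or hbr
      (IntExpr.eval_and hbl (h.bitE hL h13' hi h8 hT'))))
    (IntExpr.eval_and (IntExpr.eval_le rfl hc) (h.bitE hL h13' hi h7 hT))))))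

theorem runs_progConsistent {M : Mem} {φ : Formula (Fin m)} {N L : ℕ} (h : BitTables φ N L M)
    (hL : φ.size ≤ L) (hNL : N ≤ L) :
    Runs JD I progConsistent M (N * (N * (φ.size * 3 + 3 + 3) + 4) + 2)
      (fun M' => ∀ T < N, ∀ T' < N, M'.int 11 (T * N + T') = ind (φ.Consistent T T')) := by
  refine Runs.fillTab (N := N) (fun T T' => ind (φ.Consistent T T')) (by decide) (by decide) rfl
    rfl rfl le_rfl (fun M' h' => (h'.reg 0 5 rfl).trans h.count)
      (fun M' h' => (h'.reg 0 5 rfl).trans h.count)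
    (fun M' h' hx => (h'.row 7 rfl _).trans (h.mul _ (hx.trans_le hNL))) ?_
  intro T hT T' hT' M₁ h₁ hv₁ hw₁
  have hB₁ := h.sameOff h₁ rfl
  refine Runs.imp (Runs.sumS (n := φ.size) (fun i => ind (¬ (T.testBit i ↔
      φ.Expected (fun j => T.testBit j) (fun j => T'.testBit j) i))) (by decide)
    (fun M' h => (h.reg 0 2 rfl).trans hB₁.size) ?_) le_rfl ?_
  · intro i hi M₂ h₂ hi₂
    have hB₂ := hB₁.sameOff h₂ rfl
    have h7 := (h₂.reg 0 7 rfl).trans hv₁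
    have h8 := (h₂.reg 0 8 rfl).trans hw₁
    exact IntExpr.eval_not (IntExpr.eval_iff
      (hB₂.bitE hL (show (iv 13).eval M₂ = i from hi₂) hi h7 hT)
      (hB₂.expectedE hL hi hi₂ h7 hT h8 hT'))
  · intro M₂ _ h
    simp only [IntExpr.eval, h, one_sub_sum_ind, not_not]
    rfl

end

/-! ### The types allowed at each time -/

/-- The set of letters that the truncated and approximated trajectory allows at time `n`. -/
def Instance.alphabet {d m : ℕ} (I : Instance d m) (D : JordanDecomposition I.chain.matrixRep)
    (K n : ℕ) : Set (Set (Fin m)) :=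
  if n < K then {I.label (I.chain.traj n)} else I.nbhd (I.chain.stable D n)

/-- The code of the node in the scalar `13`. -/
abbrev codeE : IntExpr := ia 1 (iv 13)

/-- Row `12`: the truth values of the atomic propositions in the state `7`. -/
def progLabels : Program :=
  forLoop 13 (iv 2) (.ite (.intLe (.const 5) codeE)
    (.label (.const 7) (.sub codeE (.const 5)) (.const 12) (iv 13)) skip)

/-- Row `13`, for the times before `K`: the types that agree with the label of the state. -/
def progTransient : Program :=
  forLoop 17 (iv 3) (.seq progLabels (.seq
    (fillSeg 13 (ia 7 (iv 17)) 7 (iv 5) (sumS 13 (iv 2) 10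
      (.and (.le (.const 5) codeE) (.not (.eq (bitE (iv 13) 7) (ia 12 (iv 13)))))) (.not (iv 10)))
    (.apply (.const 2) (.const 7) (.const 7))))

/-- Row `14`: the pattern that the type in the scalar `7` prescribes: `1` for an atomic proposition
that is to hold, `2` for one that is to fail. If an atomic proposition occurs at several nodes, the
last one counts; `progPeriodic` checks afterwards that all of them agree. -/
def progPattern : Program :=
  forLoop 13 (iv 2) (.ite (.intLe (.const 5) codeE)
    (setA 14 (.sub codeE (.const 5)) (.sub (.const 2) (bitE (iv 13) 7))) skip)

/-- Row `13`, for the times from `K` to `K + p`: the types that agree with the label of some state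
in the neighborhood. -/
def progPeriodic : Program :=
  forLoop 17 (iv 6) (.seq (.apply (.const 6) (.const 7) (.const 8)) (.seq
    (fillSeg 13 (ia 7 (.add (iv 3) (iv 17))) 7 (iv 5)
      (.seq progPattern (.seq (.feasible (.const 8) (.const 14) (.const 0) (.const 20))
        (sumS 13 (iv 2) 10 (.and (.le (.const 5) codeE)
          (.not (.eq (ia 14 (.sub codeE (.const 5))) (.sub (.const 2) (bitE (iv 13) 7))))))))
      (.and (iv 20) (.not (iv 10))))
    (.apply (.const 2) (.const 7) (.const 7))))

/-- Row `13`: the types that agree with some allowed letter. -/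
def progAlphabet : Program :=
  .seq (fillMat 7 7 (iv 0) 8 (iv 0) skip (ca 1 (iv 7) (iv 8))) (.seq progTransient progPeriodic)

section

variable {JD : JordanProcedure} {d m : ℕ} {I : Instance d m}

theorem BitTables.codeE {φ : Formula (Fin m)} {N L : ℕ} {M : Mem} (h : BitTables φ N L M) {i : ℕ}
    (hi : i < φ.size) (h13 : M.int 0 13 = i) : codeE.eval M = φ.code.getD i 0 := by
  simp only [IntExpr.eval, h13, h.code i hi]

theorem Formula.code_lt (φ : Formula (Fin m)) {i : ℕ} (hi : i < φ.size)
    (h : 5 ≤ φ.code.getD i 0) : φ.code.getD i 0 - 5 < m := by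
  rw [φ.getD_code hi] at h ⊢
  cases h' : φ.nodeAt i with
  | atom a => simp [Formula.head]
  | _ => simp [h', Formula.head] at h

theorem runs_progLabels {M : Mem} {N L : ℕ} (h : BitTables I.formula N L M) {ρ : Op d}
    (hρ : M.readOp d 7 = ρ) : Runs JD I progLabels M (I.formula.size * 4 + 2)
      (fun M' => ∀ i < I.formula.size, ∀ q : Fin m, I.formula.code.getD i 0 = 5 + q →
        M'.int 12 i = ind (q ∈ I.label ρ)) := by
  refine Runs.imp (Runs.forLoop (n := I.formula.size) (τ := 2) (fun k M' => ∀ i < k, ∀ q : Fin m,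
    I.formula.code.getD i 0 = 5 + q → M'.int 12 i = ind (q ∈ I.label ρ)) rfl
    (fun M' h' => (h'.reg 0 2 rfl).trans h.size) (by simp) ?_) le_rfl fun _ _ h => h.1
  intro k hk M₁ h₁ hk₁ hI
  have hc := (h.sameOff h₁ rfl).codeE hk hk₁
  have hρ₁ : M₁.readOp d 7 = ρ := (h₁.readOp d 7 rfl).trans hρ
  have hk' : IntExpr.eval M₁ (iv 13) = k := hk₁
  refine Runs.ite (fun h5 => Runs.label ?_) fun h5 => Runs.skip ?_
  · intro i hi q hq
    rcases Nat.lt_succ_iff_lt_or_eq.1 hi with hi | rfl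
    · simp only [IntExpr.eval, setInt_int, hk₁]
      simpa [hi.ne] using hI i hi q hq
    · simp only [IntExpr.eval] at hc
      simp only [IntExpr.eval, setInt_int, hk₁, hρ₁, and_self, if_true]
      simp only [show ¬ (12 = 0 ∧ i = 13) by simp, if_false]
      rw [hk₁] at hc
      refine ind_congr ⟨?_, fun h => ⟨q, by omega, h⟩⟩
      rintro ⟨b, hb, h⟩
      rwa [show q = b from Fin.ext (by omega)]
  · intro i hi q hq
    rcases Nat.lt_succ_iff_lt_or_eq.1 hi with hi | rfl
    · simpa using hI i hi q hq
    · simp only [Test.Holds, IntExpr.eval] at h5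
      simp only [IntExpr.eval] at hc
      omega

theorem runs_progTransient {M : Mem} {N L K : ℕ} (h : BitTables I.formula N L M)
    (hL : I.formula.size ≤ L) (hKL : K ≤ L) (hK : M.int 0 3 = K) (h7 : M.readOp d 7 = I.chain.init)
    (h2 : M.readOp (d * d) 2 = I.chain.matrixRep) :
    Runs JD I progTransient M
      (K * (I.formula.size * 4 + 2 + (N * (I.formula.size * 3 + 3 + 3) + 2 + 1) + 2) + 2)
      (fun M' => (∀ n < K, ∀ T < N, M'.int 13 (n * N + T) =
        ind (I.formula.AtomsAgree T (I.label (I.chain.traj n)))) ∧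
        M'.readOp d 7 = I.chain.traj K) := by
  refine Runs.imp (Runs.forLoop (n := K) (fun n M' => (∀ n' < n, ∀ T < N,
      M'.int 13 (n' * N + T) = ind (I.formula.AtomsAgree T (I.label (I.chain.traj n')))) ∧
      M'.readOp d 7 = I.chain.traj n) rfl
    (fun M' h' => (h'.reg 0 3 rfl).trans hK) ⟨by simp, h7⟩ ?_) le_rfl fun _ _ h => h.1
  rintro n hn M₁ h₁ hn₁ ⟨hI, hρ⟩
  have hB₁ := h.sameOff h₁ rfl
  refine Runs.seq (runs_progLabels hB₁ hρ) fun M₂ h₂ hlab => ?_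
  have hB₂ := hB₁.sameOff h₂ rfl
  refine Runs.seq (Runs.fillSeg (q := 1) (n := N) (o := n * N)
    (fun T => ind (I.formula.AtomsAgree T (I.label (I.chain.traj n)))) (fun _ => True) (by decide)
    (by decide) rfl rfl (fun M' h' => (hB₂.sameOff h' rfl).count) (fun M' h' => ?_) trivial ?_)
    fun M₃ h₃ hseg => ?_
  · simp only [IntExpr.eval, h'.reg 0 17 rfl, h₂.reg 0 17 rfl, hn₁, (hB₂.sameOff h' rfl).mul n
      (by omega)]
  · intro T hT M₃ h₃ hT₃ _
    have hB₃ := hB₂.sameOff h₃ rfl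
    refine Runs.imp (Runs.sumS (n := I.formula.size)
      (fun i => ind (5 ≤ I.formula.code.getD i 0 ∧ ¬ (T.testBit i = true ↔
        M₂.int 12 i = 1))) (by decide) (fun M' h' => (hB₃.sameOff h' rfl).size) ?_) le_rfl ?_
    · intro i hi M₄ h₄ hi₄
      have hB₄ := hB₃.sameOff h₄ rfl
      by_cases h5 : 5 ≤ I.formula.code.getD i 0
      · refine IntExpr.eval_and (IntExpr.eval_le rfl (hB₄.codeE hi hi₄)) (IntExpr.eval_not
          (IntExpr.eval_iff (hB₄.bitE hL (show (iv 13).eval M₄ = i from hi₄) hi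
            ((h₄.reg 0 7 rfl).trans hT₃) hT) ?_))
        have := hlab i hi ⟨_, I.formula.code_lt hi h5⟩ (by simp only; omega)
        simp only [IntExpr.eval, hi₄, h₄.row 12 rfl, h₃.row 12 rfl]
        rw [this, ind_eq_one_iff]
      · rw [ind_neg (fun h => h5 h.1)]
        have hle := IntExpr.eval_le (M := M₄) (x := .const 5) (a := 5) rfl (hB₄.codeE hi hi₄)
        rw [ind_neg h5] at hle
        have hbit := hB₄.bitE hL (show (iv 13).eval M₄ = i from hi₄) hi
            ((h₄.reg 0 7 rfl).trans hT₃) hT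
        have := ind_le_one (T.testBit i = true)
        simp only [IntExpr.eval] at hle hbit ⊢
        omega
    · intro M₄ _ h₄
      refine ⟨?_, trivial⟩
      simp only [IntExpr.eval, h₄, one_sub_sum_ind]
      refine ind_congr ⟨fun H i hi q hq => ?_, fun H i hi h5 => ?_⟩
      · have := H i hi
        rw [hlab i hi q hq, ind_eq_one_iff] at this
        by_contra hne
        exact this ⟨by omega, hne⟩
      · have hq : I.formula.code.getD i 0 = 5 + (⟨_, I.formula.code_lt hi h5.1⟩ : Fin m) := by
          have := h5.1; simp only; omega
        exact h5.2 ((H i hi _ hq).trans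
          ((Eq.congr_left (hlab i hi _ hq)).trans ind_eq_one_iff).symm)
  · refine Runs.apply ⟨fun n' hn' T hT => ?_, ?_⟩
    · simp only [setInt_int, writeOp_int]
      rw [if_neg (fun h => by simp at h)]
      rcases Nat.lt_succ_iff_lt_or_eq.1 hn' with hn' | rfl
      · have hlt : n' * N + T < n * N := by
          have : (n' + 1) * N ≤ n * N := Nat.mul_le_mul_right N hn'
          rw [Nat.add_mul] at this
          omega
        rw [hseg.2.1 _ hlt, h₂.row 13 rfl, hI n' hn' T hT]
      · exact hseg.1 T hT
    · rw [setInt_readOp]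
      simp only [IntExpr.eval, readOp_writeOp]
      rw [h₃.readOp d 7 rfl, h₂.readOp d 7 rfl, hρ, h₃.readOp (d * d) 2 rfl,
        h₂.readOp (d * d) 2 rfl,
        h₁.readOp (d * d) 2 rfl, h2, I.chain.traj_succ]

/-- Only entries at atomic propositions of the formula have been written. -/
def PatternOf (φ : Formula (Fin m)) (f : ℕ → ℕ) : Prop :=
  ∀ x, f x ≠ 0 → ∃ i < φ.size, φ.code.getD i 0 = 5 + x

/-- The pattern has, for every atomic proposition of the formula, the value prescribed by one of the
nodes where it occurs. -/
theorem runs_progPattern {M : Mem} {φ : Formula (Fin m)} {N L T : ℕ} (h : BitTables φ N L M)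
    (hL : φ.size ≤ L) (h7 : M.int 0 7 = T) (hT : T < N) (hP : PatternOf φ (M.int 14)) :
    Runs JD I progPattern M (φ.size * 4 + 2) (fun M' => PatternOf φ (M'.int 14) ∧
      ∀ i < φ.size, 5 ≤ φ.code.getD i 0 → ∃ i' < φ.size, φ.code.getD i' 0 = φ.code.getD i 0 ∧
        M'.int 14 (φ.code.getD i 0 - 5) = 2 - ind (T.testBit i' = true)) := by
  refine Runs.imp (Runs.forLoop (n := φ.size) (τ := 2) (fun k M' => PatternOf φ (M'.int 14) ∧
      ∀ i < k, 5 ≤ φ.code.getD i 0 → ∃ i' < φ.size, φ.code.getD i' 0 = φ.code.getD i 0 ∧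
        M'.int 14 (φ.code.getD i 0 - 5) = 2 - ind (T.testBit i' = true)) rfl
    (fun M' h' => (h'.reg 0 2 rfl).trans h.size) ⟨hP, by simp⟩ ?_) le_rfl fun _ _ h => h.1
  rintro k hk M₁ h₁ hk₁ ⟨hI, hI'⟩
  have hB₁ := h.sameOff h₁ rfl
  have hc := hB₁.codeE hk hk₁
  have hbit := hB₁.bitE hL (show (iv 13).eval M₁ = k from hk₁) hk ((h₁.reg 0 7 rfl).trans h7) hT
  refine Runs.ite (fun h5 => Runs.setInt ?_) fun h5 => Runs.skip ?_
  · simp only [Test.Holds, hc] at h5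
    simp only [IntExpr.eval] at h5
    have e1 : ((IntExpr.const 2).sub (bitE (iv 13) 7)).eval M₁ = 2 - ind (T.testBit k = true) := by
      rw [← hbit]; rfl
    have e2 : (codeE.sub (.const 5)).eval M₁ = φ.code.getD k 0 - 5 := by
      rw [← hc]; rfl
    rw [e1, e2]
    refine ⟨fun x hx => ?_, fun i hi h5' => ?_⟩
    · by_cases hxk : x = φ.code.getD k 0 - 5
      · exact ⟨k, hk, by omega⟩
      · refine hI x ?_
        simp only [setInt_int, IntExpr.eval] at hx
        rwa [if_neg (fun h => by simp at h), if_neg (fun h => hxk h.2)] at hx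
    · by_cases hik : φ.code.getD i 0 = φ.code.getD k 0
      · exact ⟨k, hk, hik.symm, by
          simp only [setInt_int, IntExpr.eval]
          rw [if_neg (fun h => by simp at h), if_pos ⟨trivial, by rw [hik]⟩]⟩
      · rcases Nat.lt_succ_iff_lt_or_eq.1 hi with hi | rfl
        · obtain ⟨i', hi', hc', hv⟩ := hI' i hi h5'
          refine ⟨i', hi', hc', ?_⟩
          have : φ.code.getD i 0 - 5 ≠ φ.code.getD k 0 - 5 := by omega
          simp only [IntExpr.eval, setInt_int, this]
          simpa using hv
        · exact absurd rfl hik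
  · simp only [Test.Holds, hc] at h5
    simp only [IntExpr.eval] at h5
    refine ⟨hI, fun i hi h5' => ?_⟩
    rcases Nat.lt_succ_iff_lt_or_eq.1 hi with hi | rfl
    · exact hI' i hi h5'
    · exact absurd h5' h5

/-- The feasibility query with the pattern of a type decides whether the type agrees with a letter
of the given set, provided that equal atomic propositions have equal values in the type. -/
theorem exists_atomsAgree_iff {φ : Formula (Fin m)} {T : ℕ} {f : ℕ → ℕ} {A : Set (Set (Fin m))}
    (hP : PatternOf φ f) (hf : ∀ i < φ.size, 5 ≤ φ.code.getD i 0 → ∃ i' < φ.size,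
      φ.code.getD i' 0 = φ.code.getD i 0 ∧
        f (φ.code.getD i 0 - 5) = 2 - ind (T.testBit i' = true)) :
    ((∃ s ∈ A, ∀ b : Fin m, (f b = 1 → b ∈ s) ∧ (f b = 2 → b ∉ s)) ∧
      ∀ i < φ.size, ¬ (5 ≤ φ.code.getD i 0 ∧
        ¬ f (φ.code.getD i 0 - 5) = 2 - ind (T.testBit i = true))) ↔
      ∃ a ∈ A, φ.AtomsAgree T a := by
  have hind : ∀ p : Prop, (2 - ind p = 1 ↔ p) ∧ (2 - ind p = 2 ↔ ¬ p) := by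
    intro p
    by_cases h : p <;> simp [ind, h]
  constructor
  · rintro ⟨⟨a, ha, hb⟩, hc⟩
    refine ⟨a, ha, fun i hi q hq => ?_⟩
    have h1 : f q = 2 - ind (T.testBit i = true) := by
      have := hc i hi
      rw [hq, Nat.add_sub_cancel_left] at this
      by_contra hne
      exact this ⟨by omega, hne⟩
    have := hb q
    rw [h1, (hind _).1, (hind _).2] at this
    exact ⟨this.1, fun hq => by_contra fun h => this.2 h hq⟩
  · rintro ⟨a, ha, hag⟩
    have key : ∀ i < φ.size, ∀ q : Fin m, φ.code.getD i 0 = 5 + q →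
        f q = 2 - ind (q ∈ a) := by
      intro i hi q hq
      obtain ⟨i', hi', hc', hv⟩ := hf i hi (by omega)
      rw [hq, Nat.add_sub_cancel_left] at hv
      rw [hv, ind_congr (hag i' hi' q (hc'.trans hq))]
    refine ⟨⟨a, ha, fun b => ?_⟩, fun i hi h => ?_⟩
    · by_cases h0 : f b = 0
      · simp [h0]
      · obtain ⟨i, hi, hc⟩ := hP b h0
        rw [key i hi b hc, (hind _).1, (hind _).2]
        exact ⟨id, id⟩
    · have hq : φ.code.getD i 0 = 5 + (⟨_, φ.code_lt hi h.1⟩ : Fin m) := by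
        have := h.1; simp only; omega
      have := key i hi _ hq
      rw [← ind_congr (hag i hi _ hq)] at this
      exact h.2 this

theorem runs_progPeriodic {M : Mem} {D : JordanDecomposition I.chain.matrixRep} {N L K p : ℕ}
    (h : BitTables I.formula N L M)
    (hL : I.formula.size ≤ L) (hKL : K + p ≤ L) (hK : M.int 0 3 = K) (hp : M.int 0 6 = p)
    (h7 : M.readOp d 7 = I.chain.traj K) (h2 : M.readOp (d * d) 2 = I.chain.matrixRep)
    (h6 : M.readOp (d * d) 6 = D.stabilizer) (hP : PatternOf I.formula (M.int 14)) :
    Runs JD I progPeriodic M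
      (p * (1 + (N * (I.formula.size * 4 + 2 + (1 + (I.formula.size * 3 + 3)) + 3) + 2 + 1) + 2) +
        2)
      (fun M' => (∀ n < K * N, M'.int 13 n = M.int 13 n) ∧ ∀ r < p, ∀ T < N,
        M'.int 13 ((K + r) * N + T) =
          ind (∃ a ∈ I.nbhd (I.chain.stable D (K + r)), I.formula.AtomsAgree T a)) := by
  refine Runs.imp (Runs.forLoop (n := p) (fun r M' => (∀ n < K * N, M'.int 13 n = M.int 13 n) ∧
      (∀ r' < r, ∀ T < N, M'.int 13 ((K + r') * N + T) =
          ind (∃ a ∈ I.nbhd (I.chain.stable D (K + r')), I.formula.AtomsAgree T a)) ∧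
      M'.readOp d 7 = I.chain.traj (K + r) ∧ PatternOf I.formula (M'.int 14)) rfl
    (fun M' h' => (h'.reg 0 6 rfl).trans hp) ⟨by simp, by simp, h7, hP⟩ ?_) le_rfl
    fun _ _ h => ⟨h.1.1, h.1.2.1⟩
  rintro r hr M₁ h₁ hr₁ ⟨hold, hI, hρ, hP₁⟩
  have hB₁ := h.sameOff h₁ rfl
  refine Runs.seq (Q := fun M' => M'.readOp d 8 = I.chain.stable D (K + r) ∧
    M'.int 14 = M₁.int 14) (Runs.apply ?_) fun M₂ h₂ hη => ?_
  · simp only [IntExpr.eval, readOp_writeOp]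
    rw [hρ, h₁.readOp (d * d) 6 rfl, h6]
    exact ⟨rfl, rfl⟩
  have hB₂ := hB₁.sameOff h₂ rfl
  refine Runs.seq (Runs.fillSeg (q := 14) (n := N) (o := (K + r) * N)
    (fun T => ind (∃ a ∈ I.nbhd (I.chain.stable D (K + r)), I.formula.AtomsAgree T a))
    (PatternOf I.formula) (by decide) (by decide) rfl rfl
    (fun M' h' => (hB₂.sameOff h' rfl).count) (fun M' h' => ?_) (by rw [hη.2]; exact hP₁) ?_)
    fun M₃ h₃ hseg => ?_
  · simp only [IntExpr.eval, h'.reg 0 17 rfl, h₂.reg 0 17 rfl, hr₁, h'.reg 0 3 rfl,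
      h₂.reg 0 3 rfl, h₁.reg 0 3 rfl, hK, (hB₂.sameOff h' rfl).mul (K + r) (by omega)]
  · intro T hT M₃ h₃ hT₃ hP₃
    have hB₃ := hB₂.sameOff h₃ rfl
    refine Runs.seq (runs_progPattern hB₃ hL hT₃ hT hP₃) fun M₄ h₄ hpat => ?_
    have hB₄ := hB₃.sameOff h₄ rfl
    have hη₄ : M₄.readOp d 8 = I.chain.stable D (K + r) := by
      rw [h₄.readOp d 8 rfl, h₃.readOp d 8 rfl, hη.1]
    refine Runs.seq (Q := fun M' => M'.int 0 20 = ind (∃ s ∈ I.nbhd (I.chain.stable D (K + r)),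
      ∀ b : Fin m, (M₄.int 14 b = 1 → b ∈ s) ∧ (M₄.int 14 b = 2 → b ∉ s))) (Runs.feasible ?_)
      fun M₅ h₅ hflag => ?_
    · simp only [IntExpr.eval, hη₄, setInt_int, and_self, if_true]
    have hB₅ := hB₄.sameOff h₅ rfl
    refine Runs.imp (Runs.sumS (n := I.formula.size)
      (fun i => ind (5 ≤ I.formula.code.getD i 0 ∧ ¬ M₄.int 14 (I.formula.code.getD i 0 - 5) =
        2 - ind (T.testBit i = true))) (by decide) (fun M' h' => (hB₅.sameOff h' rfl).size) ?_)
        le_rfl ?_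
    · intro i hi M₆ h₆ hi₆
      have hB₆ := hB₅.sameOff h₆ rfl
      have hT₆ : M₆.int 0 7 = T := by
        rw [h₆.reg 0 7 rfl, h₅.reg 0 7 rfl, h₄.reg 0 7 rfl, hT₃]
      have hc := hB₆.codeE hi hi₆
      have hbit := hB₆.bitE hL (show (iv 13).eval M₆ = i from hi₆) hi hT₆ hT
      refine IntExpr.eval_and (IntExpr.eval_le rfl hc) (IntExpr.eval_not (IntExpr.eval_eq ?_ ?_))
      · rw [show (ia 14 (codeE.sub (.const 5))).eval M₆ = M₆.int 14 (codeE.eval M₆ - 5) from rfl,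
          hc, h₆.row 14 rfl, h₅.row 14 rfl]
      · rw [← hbit]; rfl
    · intro M₆ h₆ hsum
      have h14 : M₆.int 14 = M₄.int 14 := by
        funext x; rw [h₆.row 14 rfl, h₅.row 14 rfl]
      refine ⟨?_, by rw [h14]; exact hpat.1⟩
      rw [← ind_congr (exists_atomsAgree_iff hpat.1 hpat.2)]
      refine IntExpr.eval_and ?_ ?_
      · rw [← hflag, ← h₆.reg 0 20 rfl]; rfl
      · simp only [IntExpr.eval, hsum, one_sub_sum_ind]
  · refine Runs.apply ⟨fun n hn => ?_, fun r' hr' T hT => ?_, ?_, ?_⟩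
    · simp only [setInt_int, writeOp_int]
      rw [if_neg (fun h => by simp at h), hseg.2.1 n
        (hn.trans_le (Nat.mul_le_mul_right N (Nat.le_add_right K r))), h₂.row 13 rfl, hold n hn]
    · simp only [setInt_int, writeOp_int]
      rw [if_neg (fun h => by simp at h)]
      rcases Nat.lt_succ_iff_lt_or_eq.1 hr' with hr' | rfl
      · have hlt : (K + r') * N + T < (K + r) * N := by
          have : (K + r' + 1) * N ≤ (K + r) * N := Nat.mul_le_mul_right N (by omega)
          rw [Nat.add_mul (K + r')] at this
          omega
        rw [hseg.2.1 _ hlt, h₂.row 13 rfl, hI r' hr' T hT]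
      · exact hseg.1 T hT
    · rw [setInt_readOp]
      simp only [IntExpr.eval, readOp_writeOp]
      rw [h₃.readOp d 7 rfl, h₂.readOp d 7 rfl, hρ, h₃.readOp (d * d) 2 rfl,
        h₂.readOp (d * d) 2 rfl,
        h₁.readOp (d * d) 2 rfl, h2, ← I.chain.traj_succ]
      rfl
    · intro x hx
      refine hseg.2.2 x ?_
      simpa [writeOp_int] using hx

theorem runs_progAlphabet {M : Mem} {D : JordanDecomposition I.chain.matrixRep} {N L K p : ℕ}
    (h : BitTables I.formula N L M) (hd : M.int 0 0 = d)
    (hL : I.formula.size ≤ L) (hKL : K + p ≤ L) (hK : M.int 0 3 = K) (hp : M.int 0 6 = p)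
    (h1 : M.readOp d 1 = I.chain.init) (h2 : M.readOp (d * d) 2 = I.chain.matrixRep)
    (h6 : M.readOp (d * d) 6 = D.stabilizer) (hP : PatternOf I.formula (M.int 14)) :
    Runs JD I progAlphabet M (d * (d * (1 + 3) + 4) + 2 +
      (K * (I.formula.size * 4 + 2 + (N * (I.formula.size * 3 + 3 + 3) + 2 + 1) + 2) + 2 +
      (p * (1 + (N * (I.formula.size * 4 + 2 + (1 + (I.formula.size * 3 + 3)) + 3) + 2 + 1) + 2) +
        2)))
      (fun M' => ∀ n < K + p, ∀ T < N, M'.int 13 (n * N + T) =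
        ind (∃ a ∈ I.alphabet D K n, I.formula.AtomsAgree T a)) := by
  refine Runs.seq (Runs.fillMat (n := d) (n' := d) (τ := 1) (fun i j => M.cplx 1 i j)
    (by decide) rfl
    rfl rfl (fun M' h' => (h'.reg 0 0 rfl).trans hd) (fun M' h' => (h'.reg 0 0 rfl).trans hd) ?_)
    fun M₁ h₁ hcopy => ?_
  · intro i _ j _ M' h' hi hj
    refine Runs.skip ?_
    simp [CplxExpr.eval, IntExpr.eval, hi, hj, h'.name 1 rfl]
  have hB₁ := h.sameOff h₁ rfl
  refine Runs.seq (runs_progTransient hB₁ hL (by omega) ((h₁.reg 0 3 rfl).trans hK) ?_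
    ((h₁.readOp (d * d) 2 rfl).trans h2)) fun M₂ h₂ htr => ?_
  · rw [← h1]; ext i j; exact hcopy i i.2 j j.2
  have hB₂ := hB₁.sameOff h₂ rfl
  have h14 : M₂.int 14 = M.int 14 := by
    funext x; rw [h₂.row 14 rfl, h₁.row 14 rfl]
  refine Runs.imp (runs_progPeriodic (D := D) hB₂ hL hKL
    (by rw [h₂.reg 0 3 rfl, h₁.reg 0 3 rfl, hK]) (by rw [h₂.reg 0 6 rfl, h₁.reg 0 6 rfl, hp])
    htr.2 (by rw [h₂.readOp _ 2 rfl, h₁.readOp _ 2 rfl, h2])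
    (by rw [h₂.readOp _ 6 rfl, h₁.readOp _ 6 rfl, h6]) (by rw [h14]; exact hP)) le_rfl ?_
  rintro M₃ h₃ ⟨hold, hnew⟩ n hn T hT
  by_cases hnK : n < K
  · have hlt : n * N + T < K * N := by
      have : (n + 1) * N ≤ K * N := Nat.mul_le_mul_right N hnK
      rw [Nat.add_mul n] at this
      omega
    rw [hold _ hlt, htr.1 n hnK T hT]
    simp [Instance.alphabet, hnK]
  · obtain ⟨r, rfl⟩ : ∃ r, n = K + r := ⟨n - K, by omega⟩
    rw [hnew r (by omega) T hT]
    simp [Instance.alphabet]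

end

/-! ### Backward reachability in the graph of the types -/

/-- The type in the scalar `7` is fulfilled at the node in the scalar `13`. -/
def fulfilledE : IntExpr :=
  .or (.not (.eq codeE (.const 4))) (.or (.not (bitE (iv 13) 7)) (bitE rightE 7))

/-- The types in the scalars `7` and `8` are locally consistent. -/
abbrev consistentE : IntExpr := ia 11 (.add (ia 7 (iv 7)) (iv 8))

/-- The type in the scalar `7` agrees with a letter allowed at the time in the scalar `12`. -/
abbrev allowedE : IntExpr := ia 13 (.add (ia 7 (iv 12)) (iv 7))

/-- One step backwards in time: rows `15` and `16` hold the vertices from which there is a path,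
and a path through the fulfilled set. -/
def progSweep : Program :=
  .seq (fillRow 17 7 (iv 5) (sumS 8 (iv 5) 10 (.and consistentE (ia 15 (iv 8))))
    (.and allowedE (.pos (iv 10)))) (.seq
  (fillRow 18 7 (iv 5) (sumS 8 (iv 5) 10
    (.and consistentE (.or (ia 16 (iv 8)) (.and fulfilledE (ia 15 (iv 8))))))
    (.and allowedE (.pos (iv 10)))) (.seq
  (fillRow 15 7 (iv 5) skip (ia 17 (iv 7))) (fillRow 16 7 (iv 5) skip (ia 18 (iv 7)))))

/-- As many steps backwards as `cnt` says, starting from the time `base`. -/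
def progSweeps (cnt base : IntExpr) : Program :=
  forLoop 17 cnt (.seq (setS 12 (.sub base (.add (iv 17) (.const 1)))) progSweep)

section

variable {JD : JordanProcedure} {d m : ℕ} {I : Instance d m}

/-- The first `N` entries of the integer row `r` are the truth values of `Y`. -/
def Row (M : Mem) (r N : ℕ) (Y : ℕ → Prop) : Prop := ∀ T < N, M.int r T = ind (Y T)

theorem Row.sameOff {M M' : Mem} {r N : ℕ} {Y : ℕ → Prop} {P : Program} (h : Row M r N Y)
    (hP : SameOff P M M') (hk : P.keepsRow r = true) : Row M' r N Y :=
  fun T hT => (hP.row r hk T).trans (h T hT)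

theorem Row.congr {M : Mem} {r N : ℕ} {Y Y' : ℕ → Prop} (h : Row M r N Y)
    (hY : ∀ T < N, (Y T ↔ Y' T)) : Row M r N Y' :=
  fun T hT => (h T hT).trans (ind_congr (hY T hT))

/-- All tables that the sweeps consult: `A n` are the types allowed at time `n`. -/
structure GraphTables (φ : Formula (Fin m)) (A : ℕ → ℕ → Prop) (N L B : ℕ) (M : Mem) : Prop where
  bits : BitTables φ N L M
  consistent : ∀ T < N, ∀ T' < N, M.int 11 (T * N + T') = ind (φ.Consistent T T')
  allowed : ∀ n < B, ∀ T < N, M.int 13 (n * N + T) = ind (A n T)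
  size_le : φ.size ≤ L
  count_le : N ≤ L
  horizon_le : B ≤ L

theorem GraphTables.sameOff {φ : Formula (Fin m)} {A : ℕ → ℕ → Prop} {N L B : ℕ} {M M' : Mem}
    {P : Program} (h : GraphTables φ A N L B M) (hP : SameOff P M M')
    (hk : (P.keepsReg 0 2 && P.keepsReg 0 5 && P.keepsRow 1 && P.keepsRow 7 && P.keepsRow 9 &&
      P.keepsRow 10 && (P.keepsRow 11 && P.keepsRow 13)) = true) :
    GraphTables φ A N L B M' := by
  obtain ⟨hk, hk'⟩ := Bool.and_eq_true_iff.1 hk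
  obtain ⟨h11, h13⟩ := Bool.and_eq_true_iff.1 hk'
  exact ⟨h.bits.sameOff hP hk, fun T hT T' hT' => (hP.row 11 h11 _).trans
    (h.consistent T hT T' hT'), fun n hn T hT => (hP.row 13 h13 _).trans (h.allowed n hn T hT),
    h.size_le, h.count_le, h.horizon_le⟩

/-- The edges at time `n` of the graph described by the tables. -/
def tableGraph (φ : Formula (Fin m)) (A : ℕ → ℕ → Prop) (n T T' : ℕ) : Prop :=
  A n T ∧ φ.Consistent T T'

theorem IntExpr.eval_exists {M : Mem} {x : IntExpr} {n : ℕ} {p : ℕ → Prop}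
    (h : x.eval M = ∑ k ∈ Finset.range n, ind (p k)) :
    (IntExpr.pos x).eval M = ind (∃ k < n, p k) := by
  simp only [IntExpr.eval, h, ind_exists]

theorem runs_copyRow {M : Mem} {r q N : ℕ} {Y : ℕ → Prop} (h : M.int 0 5 = N) (hr : r ≠ 0)
    (hq : Row M q N Y) (hqr : q ≠ r) (hq0 : q ≠ 0) :
    Runs JD I (fillRow r 7 (iv 5) skip (ia q (iv 7))) M (N * (1 + 3) + 2)
      (fun M' => Row M' r N Y) := by
  refine Runs.imp (Runs.fillRow (n := N) (fun T => ind (Y T)) hr rfl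
    (by simp [skip, Program.keepsRow, IntExpr.avoids, hr.symm]) (fun M' h' => ?_) ?_) le_rfl
    fun _ _ h => h.1
  · exact (h'.reg 0 5 (by simp [fillRow, forLoop, skip, Program.keepsReg, IntExpr.avoids,
    hr])).trans h
  · intro T hT M₁ h₁ hT₁ _ _
    refine Runs.skip ?_
    have hrow : M₁.int q T = ind (Y T) := by
      rw [h₁.row q (by simp [fillRow, forLoop, skip, Program.keepsRow, IntExpr.avoids, hqr.symm,
        hq0.symm]), hq T hT]
    simp [IntExpr.eval, hT₁, hrow, hq0]

theorem GraphTables.fulfilledE {φ : Formula (Fin m)} {A : ℕ → ℕ → Prop} {N L B : ℕ} {M : Mem}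
    (h : GraphTables φ A N L B M) {i T : ℕ} (h13 : M.int 0 13 = i) (hi : i < φ.size)
    (h7 : M.int 0 7 = T) (hT : T < N) : fulfilledE.eval M = ind (φ.Fulfilled i T) := by
  have hr : rightE.eval M = i - 1 := by simp only [rightE, IntExpr.eval, h13]
  refine (IntExpr.eval_or (IntExpr.eval_not (IntExpr.eval_eq (h.bits.codeE hi h13) rfl))
    (IntExpr.eval_or (IntExpr.eval_not (h.bits.bitE h.size_le
    (show (iv 13).eval M = i from h13) hi h7 hT))
      (h.bits.bitE h.size_le hr (by omega) h7 hT))).trans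
    (ind_congr ?_)
  simp only [Formula.Fulfilled]
  tauto

theorem GraphTables.consistentE {φ : Formula (Fin m)} {A : ℕ → ℕ → Prop} {N L B : ℕ} {M : Mem}
    (h : GraphTables φ A N L B M) {T T' : ℕ} (h7 : M.int 0 7 = T) (hT : T < N) (h8 : M.int 0 8 = T')
    (hT' : T' < N) : consistentE.eval M = ind (φ.Consistent T T') := by
  simp only [IntExpr.eval, h7, h8, h.bits.mul T (hT.trans_le h.count_le),
    h.consistent T hT T' hT']

theorem GraphTables.allowedE {φ : Formula (Fin m)} {A : ℕ → ℕ → Prop} {N L B : ℕ} {M : Mem}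
    (h : GraphTables φ A N L B M) {T n : ℕ} (h7 : M.int 0 7 = T) (hT : T < N) (h12 : M.int 0 12 = n)
    (hn : n < B) : allowedE.eval M = ind (A n T) := by
  simp only [IntExpr.eval, h7, h12, h.bits.mul n (hn.trans_le h.horizon_le), h.allowed n hn T hT]

/-- A bound for the number of steps of a sweep. -/
def sweepTime (N : ℕ) : ℕ :=
  N * (N * 3 + 3 + 3) + 2 + (N * (N * 3 + 3 + 3) + 2 + (N * (1 + 3) + 2 + (N * (1 + 3) + 2)))

theorem runs_progSweep {M : Mem} {φ : Formula (Fin m)} {A : ℕ → ℕ → Prop} {N L B n i : ℕ}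
    {Y₀ Y₁ : ℕ → Prop} (h : GraphTables φ A N L B M) (hn : n < B) (h12 : M.int 0 12 = n)
    (hi : i < φ.size) (h13 : M.int 0 13 = i) (hY₀ : Row M 15 N Y₀) (hY₁ : Row M 16 N Y₁) :
    Runs JD I progSweep M (sweepTime N) (fun M' =>
      Row M' 15 N (fun T => ∃ T' < N, tableGraph φ A n T T' ∧ Y₀ T') ∧
      Row M' 16 N (fun T => ∃ T' < N,
        tableGraph φ A n T T' ∧ (Y₁ T' ∨ φ.Fulfilled i T ∧ Y₀ T'))) := by
  refine Runs.seq (Q := fun M' => Row M' 17 N (fun T => ∃ T' < N, tableGraph φ A n T T' ∧ Y₀ T'))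
    (Runs.imp (Runs.fillRow (n := N) (τ := N * 3 + 3)
      (fun T => ind (∃ T' < N, tableGraph φ A n T T' ∧ Y₀ T')) (by decide) rfl rfl
      (fun M' h' => (h.sameOff h' rfl).bits.count) ?_) le_rfl fun _ _ h => h.1) fun M₁ h₁ hZ₀ =>
    Runs.seq (Q := fun M' => Row M' 18 N (fun T => ∃ T' < N, tableGraph φ A n T T' ∧
        (Y₁ T' ∨ φ.Fulfilled i T ∧ Y₀ T')))
    (Runs.imp (Runs.fillRow (n := N) (τ := N * 3 + 3)
      (fun T => ind (∃ T' < N, tableGraph φ A n T T' ∧ (Y₁ T' ∨ φ.Fulfilled i T ∧ Y₀ T')))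
      (by decide) rfl rfl
      (fun M' h' => ((h.sameOff h₁ rfl).sameOff h' rfl).bits.count) ?_) le_rfl fun _ _ h => h.1)
      fun M₂ h₂ hZ₁ => ?_
  · intro T hT M₁ h₁ hT₁ _ _
    have hG₁ := h.sameOff h₁ rfl
    refine Runs.imp (Runs.sumS (n := N) (fun T' => ind (φ.Consistent T T' ∧ Y₀ T')) (by decide)
      (fun M' h' => (hG₁.sameOff h' rfl).bits.count) ?_) le_rfl fun M₂ h₂ hsum => ?_
    · intro T' hT' M₂ h₂ hT₂
      refine IntExpr.eval_and ((hG₁.sameOff h₂ rfl).consistentE ((h₂.reg 0 7 rfl).trans hT₁) hT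
        hT₂ hT') ?_
      simp only [IntExpr.eval, hT₂, h₂.row 15 rfl, h₁.row 15 rfl, hY₀ T' hT']
    · refine (IntExpr.eval_and ((hG₁.sameOff h₂ rfl).allowedE ((h₂.reg 0 7 rfl).trans hT₁) hT
        ((h₂.reg 0 12 rfl).trans ((h₁.reg 0 12 rfl).trans h12)) hn)
        (IntExpr.eval_exists (x := iv 10) hsum)).trans (ind_congr ?_)
      exact ⟨fun ⟨a, k, hk, c, y⟩ => ⟨k, hk, ⟨a, c⟩, y⟩, fun ⟨k, hk, ⟨a, c⟩, y⟩ => ⟨a, k, hk, c, y⟩⟩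
  · have hG₀ := h.sameOff h₁ rfl
    have hY₀ := hY₀.sameOff h₁ rfl
    have hY₁ := hY₁.sameOff h₁ rfl
    have h12 := (h₁.reg 0 12 rfl).trans h12
    have h13 := (h₁.reg 0 13 rfl).trans h13
    intro T hT M₁ h₁ hT₁ _ _
    have hG₁ := hG₀.sameOff h₁ rfl
    refine Runs.imp (Runs.sumS (n := N) (fun T' => ind (φ.Consistent T T' ∧
        (Y₁ T' ∨ φ.Fulfilled i T ∧ Y₀ T'))) (by decide)
      (fun M' h' => (hG₁.sameOff h' rfl).bits.count) ?_) le_rfl fun M₂ h₂ hsum => ?_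
    · intro T' hT' M₂ h₂ hT₂
      refine IntExpr.eval_and ((hG₁.sameOff h₂ rfl).consistentE ((h₂.reg 0 7 rfl).trans hT₁) hT
        hT₂ hT') (IntExpr.eval_or ?_ (IntExpr.eval_and ((hG₁.sameOff h₂ rfl).fulfilledE
        ((h₂.reg 0 13 rfl).trans ((h₁.reg 0 13 rfl).trans h13)) hi ((h₂.reg 0 7 rfl).trans hT₁) hT)
        ?_))
      · simp only [IntExpr.eval, hT₂, h₂.row 16 rfl, h₁.row 16 rfl, hY₁ T' hT']
      · simp only [IntExpr.eval, hT₂, h₂.row 15 rfl, h₁.row 15 rfl, hY₀ T' hT']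
    · refine (IntExpr.eval_and ((hG₁.sameOff h₂ rfl).allowedE ((h₂.reg 0 7 rfl).trans hT₁) hT
        ((h₂.reg 0 12 rfl).trans ((h₁.reg 0 12 rfl).trans h12)) hn)
        (IntExpr.eval_exists (x := iv 10) hsum)).trans (ind_congr ?_)
      exact ⟨fun ⟨a, k, hk, c, y⟩ => ⟨k, hk, ⟨a, c⟩, y⟩, fun ⟨k, hk, ⟨a, c⟩, y⟩ => ⟨a, k, hk, c, y⟩⟩
  · have hN₂ : M₂.int 0 5 = N := ((h.sameOff h₁ rfl).sameOff h₂ rfl).bits.count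
    refine Runs.seq (runs_copyRow hN₂ (by decide) (hZ₀.sameOff h₂ rfl) (by decide) (by decide))
      fun M₃ h₃ hZ₀ => ?_
    refine Runs.imp (runs_copyRow ((h₃.reg 0 5 rfl).trans hN₂) (by decide) (hZ₁.sameOff h₃ rfl)
      (by decide) (by decide)) le_rfl fun M₄ h₄ hZ₁ => ⟨hZ₀.sameOff h₄ rfl, hZ₁⟩

theorem runs_progSweeps {M : Mem} {cnt base : IntExpr} {φ : Formula (Fin m)} {A : ℕ → ℕ → Prop}
    {N L B i c b l : ℕ}
    {Y : ℕ → Prop} (h : GraphTables φ A N L B M) (hb : b ≤ B) (hc : c ≤ b)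
    (hcnt : ∀ M', SameOff (progSweeps cnt base) M M' → cnt.eval M' = c)
    (hbase : ∀ M', SameOff (progSweeps cnt base) M M' → base.eval M' = b)
    (hi : i < φ.size) (h13 : M.int 0 13 = i)
    (hY₀ : Row M 15 N (Path (tableGraph φ A) N b l Y))
    (hY₁ : Row M 16 N (FPath (tableGraph φ A) (φ.Fulfilled i) N b l Y)) :
    Runs JD I (progSweeps cnt base) M (c * (1 + sweepTime N + 2) + 2) (fun M' =>
      Row M' 15 N (Path (tableGraph φ A) N (b - c) (c + l) Y) ∧
      Row M' 16 N (FPath (tableGraph φ A) (φ.Fulfilled i) N (b - c) (c + l) Y)) := by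
  have hk : ∀ M', SameOff (progSweeps cnt base) M M' → GraphTables φ A N L B M' ∧
      M'.int 0 13 = i := fun M' h' => ⟨h.sameOff h' rfl, (h'.reg 0 13 rfl).trans h13⟩
  refine Runs.imp (Runs.forLoop (n := c) (fun r M' =>
      Row M' 15 N (Path (tableGraph φ A) N (b - r) (r + l) Y) ∧
      Row M' 16 N (FPath (tableGraph φ A) (φ.Fulfilled i) N (b - r) (r + l) Y)) rfl
    hcnt ?_ ?_) le_rfl fun _ _ h => h.1
  · simpa [Row] using ⟨hY₀, hY₁⟩
  rintro r hr M₁ h₁ hr₁ ⟨hI₀, hI₁⟩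
  obtain ⟨hG₁, h13₁⟩ := hk M₁ h₁
  refine Runs.seq (Q := fun M' => M'.int 0 12 = b - (r + 1)) (Runs.setInt ?_) fun M₂ h₂ h12 => ?_
  · simp only [IntExpr.eval, hbase M₁ h₁, hr₁, setInt_int, and_self, if_true]
  refine Runs.imp (runs_progSweep (hG₁.sameOff h₂ rfl) (by omega) h12 hi
    ((h₂.reg 0 13 rfl).trans h13₁) (hI₀.sameOff h₂ rfl) (hI₁.sameOff h₂ rfl)) le_rfl ?_
  rintro M₃ - ⟨h0, h1⟩
  have hbr : b - (r + 1) + 1 = b - r := by omega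
  constructor
  · have : ∀ T, (∃ T' < N, tableGraph φ A (b - (r + 1)) T T' ∧
        Path (tableGraph φ A) N (b - r) (r + l) Y T') ↔
        Path (tableGraph φ A) N (b - (r + 1)) (r + 1 + l) Y T := by
      intro T
      rw [show r + 1 + l = r + l + 1 by omega, Path, hbr]
    have h0 := h0.congr fun T _ => this T
    intro T hT
    simpa using h0 T hT
  · have : ∀ T, (∃ T' < N, tableGraph φ A (b - (r + 1)) T T' ∧
        (FPath (tableGraph φ A) (φ.Fulfilled i) N (b - r) (r + l) Y T' ∨ φ.Fulfilled i T ∧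
        Path (tableGraph φ A) N (b - r) (r + l) Y T')) ↔
        FPath (tableGraph φ A) (φ.Fulfilled i) N (b - (r + 1)) (r + 1 + l) Y T := by
      intro T
      rw [show r + 1 + l = r + l + 1 by omega, FPath, hbr]
    have h1 := h1.congr fun T _ => this T
    intro T hT
    simpa using h1 T hT

end

/-! ### Recurrent types and fair paths -/

/-- One more period backwards, from the time `K + p` to the time `K`. -/
abbrev progPeriod : Program := progSweeps (iv 6) (.add (iv 3) (iv 6))

/-- Row `19`: the recurrent types. For the type in the scalar `14` and each node, closed paths of
at most `2 N` periods are searched. -/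
def progRecurrent : Program :=
  fillRow 19 14 (iv 5) (.seq (setS 22 (.const 1)) (forLoop 13 (iv 2)
    (.seq (fillRow 15 7 (iv 5) skip (.eq (iv 7) (iv 14)))
      (.seq (fillRow 16 7 (iv 5) skip (.const 0))
    (.seq (setS 15 (.const 0)) (.seq
      (forLoop 16 (iv 18) (.seq progPeriod (setS 15 (.or (iv 15) (ia 16 (iv 14))))))
      (setS 22 (.and (iv 22) (iv 15))))))))) (iv 22)

/-- Row `15`: the types from which, at time `0`, a fair path starts. -/
def progFair : Program :=
  .seq (setS 13 (.const 0)) (.seq (fillRow 15 7 (iv 5) skip (ia 19 (iv 7)))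
  (.seq (fillRow 16 7 (iv 5) skip (.const 0)) (.seq (fillRow 20 7 (iv 5) skip (ia 19 (iv 7)))
  (.seq (forLoop 16 (iv 18) (.seq progPeriod
    (fillRow 20 7 (iv 5) skip (.or (ia 20 (iv 7)) (ia 15 (iv 7))))))
  (.seq (fillRow 15 7 (iv 5) skip (ia 20 (iv 7))) (.seq (fillRow 16 7 (iv 5) skip (.const 0))
    (progSweeps (iv 3) (iv 3))))))))

/-- The answer, from the values of the formula in the types in row `15`: `0` if none of them
contains the root, `1` if all words satisfy the formula, `2` if both cases occur. -/
def progAnswer : Program :=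
  .seq (sumS 7 (iv 5) 10 (.and (ia 15 (iv 7)) (bitE (.sub (iv 2) (.const 1)) 7)))
  (.seq (sumS 7 (iv 5) 11 (.and (ia 15 (iv 7)) (.not (bitE (.sub (iv 2) (.const 1)) 7))))
  (setS 0 (.add (.pos (iv 10)) (.and (.pos (iv 10)) (.pos (iv 11))))))

section

variable {JD : JordanProcedure} {d m : ℕ} {I : Instance d m}

theorem IntExpr.eval_const (M : Mem) (c : ℕ) : (IntExpr.const c).eval M = c := rfl

theorem runs_fillSimple {M : Mem} {r N : ℕ} {e : IntExpr} {Y : ℕ → Prop} (h : M.int 0 5 = N)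
    (hr : r ≠ 0) (he : ∀ T < N, ∀ M', SameOff (fillRow r 7 (iv 5) skip e) M M' → M'.int 0 7 = T →
      M'.int r T = M.int r T → e.eval M' = ind (Y T)) :
    Runs JD I (fillRow r 7 (iv 5) skip e) M (N * (1 + 3) + 2) (fun M' => Row M' r N Y) := by
  have hW : skip.Within (fillRow r 7 (iv 5) skip e) :=
    Program.within_seq_left.trans Program.within_forLoop
  refine Runs.imp (Runs.fillRow (n := N) (fun T => ind (Y T)) hr rfl
    (by simp [skip, Program.keepsRow, IntExpr.avoids, hr.symm]) (fun M' h' => ?_) ?_) le_rfl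
    fun _ _ h => h.1
  · exact (h'.reg 0 5 (by simp [fillRow, forLoop, skip, Program.keepsReg, IntExpr.avoids,
    hr])).trans h
  · intro T hT M₁ h₁ hT₁ _ hrow
    refine ⟨1, _, .setInt M₁ _ _ _, le_rfl, he T hT _ (h₁.trans ?_) (by simp [IntExpr.eval, hT₁])
      (by simp [IntExpr.eval, hr, hrow T le_rfl])⟩
    exact (sameOff_setInt M₁ _ _ _ _).within hW

/-- The parameters of the search: the first time `K` of the periodic part and its period `p`. -/
structure SearchState (φ : Formula (Fin m)) (A : ℕ → ℕ → Prop) (N L K p : ℕ) (M : Mem) : Prop where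
  tables : GraphTables φ A N L (K + p) M
  start : M.int 0 3 = K
  period : M.int 0 6 = p
  rounds : M.int 0 18 = 2 * N

theorem SearchState.sameOff {φ : Formula (Fin m)} {A : ℕ → ℕ → Prop} {N L K p : ℕ} {M M' : Mem}
    {P : Program} (h : SearchState φ A N L K p M) (hP : SameOff P M M')
    (hk : (P.keepsReg 0 2 && P.keepsReg 0 5 && P.keepsRow 1 && P.keepsRow 7 && P.keepsRow 9 &&
      P.keepsRow 10 && (P.keepsRow 11 && P.keepsRow 13) &&
      (P.keepsReg 0 3 && P.keepsReg 0 6 && P.keepsReg 0 18)) = true) :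
    SearchState φ A N L K p M' := by
  obtain ⟨hk, hk'⟩ := Bool.and_eq_true_iff.1 hk
  obtain ⟨hk', h18⟩ := Bool.and_eq_true_iff.1 hk'
  obtain ⟨h3, h6⟩ := Bool.and_eq_true_iff.1 hk'
  exact ⟨h.tables.sameOff hP hk, (hP.reg 0 3 h3).trans h.start, (hP.reg 0 6 h6).trans h.period,
    (hP.reg 0 18 h18).trans h.rounds⟩

theorem runs_progPeriod {M : Mem} {φ : Formula (Fin m)} {A : ℕ → ℕ → Prop}
    {N L K p i j : ℕ} {Y : ℕ → Prop} (h : SearchState φ A N L K p M)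
    (hper : ∀ n, K ≤ n → tableGraph φ A (n + p) = tableGraph φ A n)
    (hi : i < φ.size) (h13 : M.int 0 13 = i)
    (hY₀ : Row M 15 N (Path (tableGraph φ A) N K (j * p) Y))
    (hY₁ : Row M 16 N (FPath (tableGraph φ A) (φ.Fulfilled i) N K (j * p) Y)) :
    Runs JD I progPeriod M (p * (1 + sweepTime N + 2) + 2) (fun M' =>
      Row M' 15 N (Path (tableGraph φ A) N K ((j + 1) * p) Y) ∧
      Row M' 16 N (FPath (tableGraph φ A) (φ.Fulfilled i) N K ((j + 1) * p) Y)) := by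
  refine Runs.imp (runs_progSweeps (c := p) (b := K + p) (l := j * p) (Y := Y) h.tables le_rfl
    (by omega) (fun M' h' => (h.sameOff h' rfl).period) (fun M' h' => ?_) hi h13
    (hY₀.congr fun T _ => (path_periodic hper le_rfl).symm)
    (hY₁.congr fun T _ => (fPath_periodic hper le_rfl).symm)) le_rfl ?_
  · simp only [IntExpr.eval, (h.sameOff h' rfl).period, (h.sameOff h' rfl).start]
  · rintro M' - ⟨h0, h1⟩
    rw [Nat.add_sub_cancel, show p + j * p = (j + 1) * p by ring] at h0 h1
    exact ⟨h0, h1⟩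

theorem exists_le_succ_iff {j a : ℕ} {p : ℕ → Prop} (ha : a ≤ j + 1) :
    (∃ j', a ≤ j' ∧ j' ≤ j + 1 ∧ p j') ↔ (∃ j', a ≤ j' ∧ j' ≤ j ∧ p j') ∨ p (j + 1) := by
  constructor
  · rintro ⟨j', h1, h2, h⟩
    rcases Nat.le_succ_iff.1 h2 with h2 | rfl
    · exact Or.inl ⟨j', h1, h2, h⟩
    · exact Or.inr h
  · rintro (⟨j', h1, h2, h⟩ | h)
    · exact ⟨j', h1, by omega, h⟩
    · exact ⟨j + 1, ha, le_rfl, h⟩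

/-- A bound for the number of steps of a search through `2 N` periods. -/
def searchTime (N p : ℕ) : ℕ := 2 * N * (p * (1 + sweepTime N + 2) + 2 + 1 + 2) + 2

theorem runs_progRecurrent {M : Mem} {φ : Formula (Fin m)} {A : ℕ → ℕ → Prop}
    {N L K p : ℕ} (h : SearchState φ A N L K p M)
    (hper : ∀ n, K ≤ n → tableGraph φ A (n + p) = tableGraph φ A n) :
    Runs JD I progRecurrent M (N * (1 + (φ.size * (N * (1 + 3) + 2 + (N * (1 + 3) + 2 +
        (1 + (searchTime N p + 1))) + 2) + 2) + 3) + 2)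
      (fun M' => Row M' 19 N (Recurrent (tableGraph φ A) φ.Fulfilled N φ.size K p)) := by
  refine Runs.imp (Runs.fillRow (n := N)
    (fun T => ind (Recurrent (tableGraph φ A) φ.Fulfilled N φ.size K p T))
    (by decide) rfl rfl (fun M' h' => (h.sameOff h' rfl).tables.bits.count) ?_) le_rfl
    fun _ _ h => h.1
  intro T hT M₁ h₁ hT₁ _ _
  have hS₁ := h.sameOff h₁ rfl
  refine Runs.seq (Q := fun M' => M'.int 0 22 = 1) (Runs.setInt rfl) fun M₂ h₂ h22 => ?_
  have hS₂ := hS₁.sameOff h₂ rfl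
  have hT₂ := (h₂.reg 0 14 rfl).trans hT₁
  refine Runs.imp (Runs.forLoop (n := φ.size) (fun k M' => M'.int 0 22 =
    ind (Recurrent (tableGraph φ A) φ.Fulfilled N k K p T)) rfl
    (fun M' h' => (hS₂.sameOff h' rfl).tables.bits.size) ?_ ?_) le_rfl fun _ _ h => h.1
  · rw [ind_pos (by simp [Recurrent])]
    simpa using h22
  intro i hi M₃ h₃ hi₃ hI
  have hS₃ := hS₂.sameOff h₃ rfl
  have hT₃ := (h₃.reg 0 14 rfl).trans hT₂
  refine Runs.seq (runs_fillSimple (Y := fun U => U = T) hS₃.tables.bits.count (by decide) ?_)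
    fun M₄ h₄ hY₀ => Runs.seq (runs_fillSimple (Y := fun _ => False)
      (hS₃.sameOff h₄ rfl).tables.bits.count (by decide) ?_) fun M₅ h₅ hY₁ =>
      Runs.seq (Q := fun M' => M'.int 0 15 = 0) (Runs.setInt rfl) fun M₆ h₆ h15 => ?_
  · intro U _ M' h' h7 _
    exact IntExpr.eval_eq h7 ((h'.reg 0 14 rfl).trans hT₃)
  · intro U _ M' _ _ _
    exact (ind_neg id).symm
  have hS₆ := ((hS₃.sameOff h₄ rfl).sameOff h₅ rfl).sameOff h₆ rfl
  have hT₆ : M₆.int 0 14 = T := by rw [h₆.reg 0 14 rfl, h₅.reg 0 14 rfl, h₄.reg 0 14 rfl, hT₃]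
  have hi₆ : M₆.int 0 13 = i := by rw [h₆.reg 0 13 rfl, h₅.reg 0 13 rfl, h₄.reg 0 13 rfl, hi₃]
  have h22₆ : M₆.int 0 22 = ind (Recurrent (tableGraph φ A) φ.Fulfilled N i K p T) := by
    rw [h₆.reg 0 22 rfl, h₅.reg 0 22 rfl, h₄.reg 0 22 rfl, hI]
  refine Runs.seq (Q := fun M' => M'.int 0 15 = ind (∃ j, 1 ≤ j ∧ j ≤ 2 * N ∧
      FPath (tableGraph φ A) (φ.Fulfilled i) N K (j * p) (fun U => U = T) T))
    (Runs.imp (Runs.forLoop (n := 2 * N) (τ := p * (1 + sweepTime N + 2) + 2 + 1)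
    (fun j M' => Row M' 15 N (Path (tableGraph φ A) N K (j * p) (fun U => U = T)) ∧
      Row M' 16 N (FPath (tableGraph φ A) (φ.Fulfilled i) N K (j * p) (fun U => U = T)) ∧
      M'.int 0 15 = ind (∃ j', 1 ≤ j' ∧ j' ≤ j ∧
        FPath (tableGraph φ A) (φ.Fulfilled i) N K (j' * p) (fun U => U = T) T)) rfl
    (fun M' h' => (hS₆.sameOff h' rfl).rounds) ⟨?_, ?_, ?_⟩ ?_) le_rfl fun _ _ h => h.1.2.2)
    fun M₇ h₇ hfin => Runs.setInt ?_
  · have := (hY₀.sameOff h₅ rfl).sameOff h₆ rfl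
    rw [Nat.zero_mul]
    intro U hU
    simpa [Path] using this U hU
  · have := hY₁.sameOff h₆ rfl
    rw [Nat.zero_mul]
    intro U hU
    simpa [FPath] using this U hU
  · rw [ind_neg (by rintro ⟨j, h1, h2, -⟩; omega)]
    simpa using h15
  · rintro j _ M₇ h₇ _ ⟨hR₀, hR₁, hit⟩
    have hS₇ := hS₆.sameOff h₇ rfl
    refine Runs.seq (runs_progPeriod hS₇ hper hi ((h₇.reg 0 13 rfl).trans hi₆) hR₀ hR₁)
      fun M₈ h₈ hP => Runs.setInt ?_
    refine ⟨?_, ?_, ?_⟩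
    · intro U hU
      simpa [IntExpr.eval] using hP.1 U hU
    · intro U hU
      simpa [IntExpr.eval] using hP.2 U hU
    · have h14 : M₈.int 0 14 = T := (h₈.reg 0 14 rfl).trans ((h₇.reg 0 14 rfl).trans hT₆)
      have h16 : (ia 16 (iv 14)).eval M₈ = ind (FPath (tableGraph φ A) (φ.Fulfilled i) N K
          ((j + 1) * p) (fun U => U = T) T) := by
        simp only [IntExpr.eval, h14]; exact hP.2 T hT
      have hor := IntExpr.eval_or (M := M₈) (x := iv 15) ((h₈.reg 0 15 rfl).trans hit) h16
      rw [← ind_congr (exists_le_succ_iff (j := j) (a := 1) (by omega))] at hor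
      simpa [IntExpr.eval_const] using hor
  · have h22₇ := (h₇.reg 0 22 rfl).trans h22₆
    have hand := IntExpr.eval_and (M := M₇) (x := iv 22) (y := iv 15) h22₇ hfin
    have : (Recurrent (tableGraph φ A) φ.Fulfilled N i K p T ∧ (∃ j, 1 ≤ j ∧ j ≤ 2 * N ∧
      FPath (tableGraph φ A) (φ.Fulfilled i) N K (j * p) (fun U => U = T) T)) ↔
        Recurrent (tableGraph φ A) φ.Fulfilled N (i + 1) K p T := by
      simp only [Recurrent]
      constructor
      · rintro ⟨h, h'⟩ i' hi'
        rcases Nat.lt_succ_iff_lt_or_eq.1 hi' with hi' | rfl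
        · exact h i' hi'
        · exact h'
      · intro h
        exact ⟨fun i' hi' => h i' (by omega), h i (by omega)⟩
    rw [ind_congr this] at hand
    simpa [IntExpr.eval_const] using hand

theorem runs_progFair {M : Mem} {φ : Formula (Fin m)} {A : ℕ → ℕ → Prop}
    {N L K p : ℕ} (h : SearchState φ A N L K p M) (hp : 0 < p)
    (hper : ∀ n, K ≤ n → tableGraph φ A (n + p) = tableGraph φ A n)
    (hrec : Row M 19 N (Recurrent (tableGraph φ A) φ.Fulfilled N φ.size K p)) :
    Runs JD I progFair M (1 + (N * (1 + 3) + 2 + (N * (1 + 3) + 2 + (N * (1 + 3) + 2 +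
        (2 * N * (p * (1 + sweepTime N + 2) + 2 + (N * (1 + 3) + 2) + 2) + 2 + (N * (1 + 3) + 2 +
        (N * (1 + 3) + 2 + (K * (1 + sweepTime N + 2) + 2))))))))
      (fun M' => Row M' 15 N (FairFrom (tableGraph φ A) φ.Fulfilled N φ.size 0)) := by
  set G := Recurrent (tableGraph φ A) φ.Fulfilled N φ.size K p with hG
  have hs := φ.size_pos
  refine Runs.seq (Q := fun M' => M'.int 0 13 = 0) (Runs.setInt rfl) fun M₁ h₁ h13₁ => ?_
  have hS₁ := h.sameOff h₁ rfl
  have hG₁ := hrec.sameOff h₁ rfl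
  refine Runs.seq (runs_copyRow hS₁.tables.bits.count (by decide) hG₁ (by decide) (by decide))
    fun M₂ h₂ hY₀ => ?_
  have hS₂ := hS₁.sameOff h₂ rfl
  have hG₂ := hG₁.sameOff h₂ rfl
  refine Runs.seq (runs_fillSimple (Y := fun _ => False) hS₂.tables.bits.count (by decide)
    fun U _ M' _ _ _ => (ind_neg id).symm) fun M₃ h₃ hY₁ => ?_
  have hS₃ := hS₂.sameOff h₃ rfl
  have hG₃ := hG₂.sameOff h₃ rfl
  have hY₀₃ := hY₀.sameOff h₃ rfl
  refine Runs.seq (runs_copyRow hS₃.tables.bits.count (by decide) hG₃ (by decide) (by decide))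
    fun M₄ h₄ hW => ?_
  have hS₄ := hS₃.sameOff h₄ rfl
  have h13₄ : M₄.int 0 13 = 0 := by rw [h₄.reg 0 13 rfl, h₃.reg 0 13 rfl, h₂.reg 0 13 rfl, h13₁]
  refine Runs.seq (Q := fun M' => Row M' 20 N (fun T => ∃ j, 0 ≤ j ∧ j ≤ 2 * N ∧
      Path (tableGraph φ A) N K (j * p) G T))
    (Runs.imp (Runs.forLoop (n := 2 * N)
    (fun j M' => Row M' 15 N (Path (tableGraph φ A) N K (j * p) G) ∧
      Row M' 16 N (FPath (tableGraph φ A) (φ.Fulfilled 0) N K (j * p) G) ∧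
      Row M' 20 N (fun T => ∃ j', 0 ≤ j' ∧ j' ≤ j ∧ Path (tableGraph φ A) N K (j' * p) G T)) rfl
    (fun M' h' => (hS₄.sameOff h' rfl).rounds) ⟨?_, ?_, ?_⟩ ?_) le_rfl fun _ _ h => h.1.2.2)
    fun M₅ h₅ hW' => ?_
  · have := hY₀₃.sameOff h₄ rfl
    rw [Nat.zero_mul]
    intro U hU
    simpa [Path] using this U hU
  · have := hY₁.sameOff h₄ rfl
    rw [Nat.zero_mul]
    intro U hU
    simpa [FPath] using this U hU
  · have : Row M₄ 20 N (fun T => ∃ j', 0 ≤ j' ∧ j' ≤ 0 ∧ Path (tableGraph φ A) N K (j' * p) G T) :=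
      hW.congr fun T _ => by simp [Path]
    intro U hU
    simpa using this U hU
  · rintro j _ M₅ h₅ _ ⟨hR₀, hR₁, hWj⟩
    have hS₅ := hS₄.sameOff h₅ rfl
    refine Runs.seq (runs_progPeriod hS₅ hper hs ((h₅.reg 0 13 rfl).trans h13₄) hR₀ hR₁)
      fun M₆ h₆ hP => ?_
    have hW₆ := hWj.sameOff h₆ rfl
    have hS₆ := hS₅.sameOff h₆ rfl
    refine Runs.imp (runs_fillSimple (Y := fun T => (∃ j', 0 ≤ j' ∧ j' ≤ j ∧
        Path (tableGraph φ A) N K (j' * p) G T) ∨ Path (tableGraph φ A) N K ((j + 1) * p) G T)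
        hS₆.tables.bits.count (by decide) ?_) le_rfl ?_
    · intro T hT M' h' h7 hrow
      refine IntExpr.eval_or ?_ ?_
      · simp only [IntExpr.eval, h7, hrow]
        exact hW₆ T hT
      · simp only [IntExpr.eval, h7, h'.row 15 rfl]
        exact hP.1 T hT
    · intro M₇ h₇ hQ
      have h15 := hP.1.sameOff h₇ rfl
      have h16 := hP.2.sameOff h₇ rfl
      have h20 := hQ.congr fun T _ => (exists_le_succ_iff (j := j) (a := 0) (by omega)).symm
      refine ⟨fun U hU => ?_, fun U hU => ?_, fun U hU => ?_⟩
      · simpa using h15 U hU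
      · simpa using h16 U hU
      · have := h20 U hU
        simpa only [setInt_int, show ¬ (20 = 0 ∧ U = 16) by simp, if_false] using this
  · have hS₅ := hS₄.sameOff h₅ rfl
    refine Runs.seq (runs_copyRow hS₅.tables.bits.count (by decide) hW' (by decide) (by decide))
      fun M₆ h₆ hZ₀ => ?_
    have hS₆ := hS₅.sameOff h₆ rfl
    refine Runs.seq (runs_fillSimple (Y := fun _ => False) hS₆.tables.bits.count (by decide)
      fun U _ M' _ _ _ => (ind_neg id).symm) fun M₇ h₇ hZ₁ => ?_
    have hS₇ := hS₆.sameOff h₇ rfl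
    refine Runs.imp (runs_progSweeps (c := K) (b := K) (l := 0) (i := 0)
      (Y := fun T => ∃ j, 0 ≤ j ∧ j ≤ 2 * N ∧ Path (tableGraph φ A) N K (j * p) G T) hS₇.tables
      (by omega) le_rfl (fun M' h' => (hS₇.sameOff h' rfl).start)
      (fun M' h' => (hS₇.sameOff h' rfl).start) hs ?_ (hZ₀.sameOff h₇ rfl) hZ₁) le_rfl ?_
    · rw [h₇.reg 0 13 rfl, h₆.reg 0 13 rfl, h₅.reg 0 13 rfl, h13₄]
    · rintro M₈ - ⟨hfin, -⟩
      refine hfin.congr fun T hT => ?_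
      rw [fairFrom_iff_path (l := K) hT, Nat.sub_self, Nat.zero_add, Nat.add_zero]
      refine ⟨path_mono (fun U hU hU' => ?_) hT, path_mono (fun U hU hU' => ?_) hT⟩
      · rw [fairFrom_iff_recurrent hper hp hs hU]
        simpa using hU'
      · rw [fairFrom_iff_recurrent hper hp hs hU] at hU'
        simpa using hU'

theorem runs_progAnswer {M : Mem} {φ : Formula (Fin m)} {N L : ℕ} {Y : ℕ → Prop}
    (h : BitTables φ N L M) (hL : φ.size ≤ L) (hY : Row M 15 N Y) :
    Runs JD I progAnswer M (N * 3 + 3 + (N * 3 + 3 + 1)) (fun M' => M'.int 0 0 =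
      ind (∃ T < N, Y T ∧ T.testBit (φ.size - 1) = true) +
        ind ((∃ T < N, Y T ∧ T.testBit (φ.size - 1) = true) ∧
          ∃ T < N, Y T ∧ ¬ T.testBit (φ.size - 1) = true)) := by
  have hs := φ.size_pos
  have hroot : ∀ M', BitTables φ N L M' → (IntExpr.sub (iv 2) (.const 1)).eval M' = φ.size - 1 := by
    intro M' h'
    simp only [IntExpr.eval, h'.size]
  refine Runs.seq (Runs.sumS (n := N) (fun T => ind (Y T ∧ T.testBit (φ.size - 1) = true))
    (by decide) (fun M' h' => (h.sameOff h' rfl).count) ?_) fun M₁ h₁ hsum₁ =>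
    Runs.seq (Runs.sumS (n := N) (fun T => ind (Y T ∧ ¬ T.testBit (φ.size - 1) = true))
    (by decide) (fun M' h' => ((h.sameOff h₁ rfl).sameOff h' rfl).count) ?_) fun M₂ h₂ hsum₂ =>
    Runs.setInt ?_
  · intro T hT M₁ h₁ hT₁
    have hB₁ := h.sameOff h₁ rfl
    refine IntExpr.eval_and ?_ (hB₁.bitE hL (hroot _ hB₁) (by omega) hT₁ hT)
    simp only [IntExpr.eval, hT₁]
    exact hY.sameOff h₁ rfl T hT
  · intro T hT M₂ h₂ hT₂
    have hB₂ := (h.sameOff h₁ rfl).sameOff h₂ rfl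
    refine IntExpr.eval_and ?_ (IntExpr.eval_not (hB₂.bitE hL (hroot _ hB₂) (by omega) hT₂ hT))
    simp only [IntExpr.eval, hT₂]
    exact (hY.sameOff h₁ rfl).sameOff h₂ rfl T hT
  · have e1 := IntExpr.eval_exists (x := iv 10) (M := M₂) ((h₂.reg 0 10 rfl).trans hsum₁)
    have e2 := IntExpr.eval_exists (x := iv 11) (M := M₂) hsum₂
    have e3 := IntExpr.eval_and e1 e2
    rw [setInt_int, if_pos ⟨rfl, rfl⟩, ← e1, ← e3]
    rfl

end

/-! ### The decision procedure -/

/-- The decision procedure for a given truncation number and period. -/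
def progDecide : Program :=
  .seq progN (.seq progHalf (.seq progMul (.seq progBit (.seq progSize (.seq progConsistent
    (.seq progAlphabet (.seq (setS 18 (.add (iv 5) (iv 5))) (.seq progRecurrent
      (.seq progFair progAnswer)))))))))

section

variable {JD : JordanProcedure} {d m : ℕ} {I : Instance d m}

theorem Instance.mem_nbhdLanguage_iff (D : JordanDecomposition I.chain.matrixRep)
    (hG : I.chain.PeriodicallyStable) {K : ℕ} {ξ : ℕ → Set (Fin m)} :
    ξ ∈ I.nbhdLanguage D K ↔ ∀ n, ξ n ∈ I.alphabet D K n := by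
  simp only [nbhdLanguage, alphabet, Set.mem_ofPred_eq, I.stableState_mod D hG]
  constructor
  · rintro ⟨h, h'⟩ n
    split_ifs with hn
    · exact h n hn
    · exact h' n (not_lt.1 hn)
  · intro h
    refine ⟨fun n hn => ?_, fun n hn => ?_⟩
    · simpa [hn] using h n
    · simpa [not_lt.2 hn] using h n

theorem Instance.Admissible.traj_mem {D : JordanDecomposition I.chain.matrixRep} {K : ℕ}
    (h : I.Admissible D K) : (fun n => I.label (I.chain.traj n)) ∈ I.nbhdLanguage D K :=
  ⟨fun _ _ => rfl, h.2⟩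

theorem Instance.modelsBelow_iff (D : JordanDecomposition I.chain.matrixRep)
    (hG : I.chain.PeriodicallyStable) (K : ℕ) : I.ModelsBelow D K ↔
    ∃ T < 2 ^ I.formula.size, FairFrom (I.formula.typeGraph (I.alphabet D K)) I.formula.Fulfilled
      (2 ^ I.formula.size) I.formula.size 0 T ∧ T.testBit (I.formula.size - 1) = true := by
  have h := I.formula.exists_word_iff (I.alphabet D K) True
  simp only [iff_true] at h
  refine Iff.trans ?_ (h.trans (exists_congr fun T => and_congr_right fun _ => and_comm))
  refine exists_congr fun ξ => ?_
  rw [Set.mem_inter_iff, I.mem_nbhdLanguage_iff D hG]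
  rfl

theorem Instance.modelsAbove_iff (D : JordanDecomposition I.chain.matrixRep)
    (hG : I.chain.PeriodicallyStable) (K : ℕ) : I.ModelsAbove D K ↔
    ¬ ∃ T < 2 ^ I.formula.size, FairFrom (I.formula.typeGraph (I.alphabet D K)) I.formula.Fulfilled
      (2 ^ I.formula.size) I.formula.size 0 T ∧ ¬ T.testBit (I.formula.size - 1) = true := by
  have h := I.formula.exists_word_iff (I.alphabet D K) False
  simp only [iff_false] at h
  rw [← h.trans (exists_congr fun T => and_congr_right fun _ => and_comm)]
  simp only [ModelsAbove, Set.subset_def, I.mem_nbhdLanguage_iff D hG]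
  push Not
  rfl

/-- What the decision procedure expects in the memory. -/
structure Prepared (I : Instance d m) (D : JordanDecomposition I.chain.matrixRep) (K : ℕ)
    (M : Mem) : Prop where
  dim : M.int 0 0 = d
  size : M.int 0 2 = I.formula.size
  start : M.int 0 3 = K
  period : M.int 0 6 = I.chain.period
  code : ∀ i < I.formula.size, M.int 1 i = I.formula.code.getD i 0
  pattern : ∀ x, M.int 14 x = 0
  init : M.readOp d 1 = I.chain.init
  rep : M.readOp (d * d) 2 = I.chain.matrixRep
  stabilizer : M.readOp (d * d) 6 = D.stabilizer

theorem Prepared.sameOff {D : JordanDecomposition I.chain.matrixRep} {K : ℕ} {M M' : Mem}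
    {P : Program} (h : Prepared I D K M) (hP : SameOff P M M')
    (hk : (P.keepsReg 0 0 && (P.keepsReg 0 2 &&
      (P.keepsReg 0 3 && (P.keepsReg 0 6 && (P.keepsRow 1 &&
      (P.keepsRow 14 && (P.keepsName 1 && (P.keepsName 2 && P.keepsName 6)))))))) = true) :
    Prepared I D K M' := by
  simp only [Bool.and_eq_true] at hk
  obtain ⟨h0, h2, h3, h6, r1, r14, n1, n2, n6⟩ := hk
  exact ⟨(hP.reg _ _ h0).trans h.dim, (hP.reg _ _ h2).trans h.size, (hP.reg _ _ h3).trans h.start,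
    (hP.reg _ _ h6).trans h.period, fun i hi => (hP.row _ r1 i).trans (h.code i hi),
    fun x => (hP.row _ r14 x).trans (h.pattern x), (hP.readOp _ _ n1).trans h.init,
    (hP.readOp _ _ n2).trans h.rep, (hP.readOp _ _ n6).trans h.stabilizer⟩

/-- The number of steps of the decision procedure, with bounds substituted for the parameters. -/
def decideTime (s N L K p d : ℕ) : ℕ :=
  1 + (s * 3 + 2) + (N * (N * 3 + 3 + 3) + 2 + (1 + (L * 4 + 2) +
    (s * (N * (1 + (s * 3 + 2) + 3) + 4) + 2 + (s * (4 + 3) + 2 +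
    (N * (N * (s * 3 + 3 + 3) + 4) + 2 + (d * (d * (1 + 3) + 4) + 2 +
      (K * (s * 4 + 2 + (N * (s * 3 + 3 + 3) + 2 + 1) + 2) + 2 +
      (p * (1 + (N * (s * 4 + 2 + (1 + (s * 3 + 3)) + 3) + 2 + 1) + 2) + 2)) +
    (1 + (N * (1 + (s * (N * (1 + 3) + 2 + (N * (1 + 3) + 2 +
        (1 + (searchTime N p + 1))) + 2) + 2) + 3) + 2 +
    (1 + (N * (1 + 3) + 2 + (N * (1 + 3) + 2 + (N * (1 + 3) + 2 +
        (2 * N * (p * (1 + sweepTime N + 2) + 2 + (N * (1 + 3) + 2) + 2) + 2 + (N * (1 + 3) + 2 +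
        (N * (1 + 3) + 2 + (K * (1 + sweepTime N + 2) + 2))))))) +
    (N * 3 + 3 + (N * 3 + 3 + 1)))))))))))

theorem runs_progDecide {M : Mem} {D : JordanDecomposition I.chain.matrixRep} {K : ℕ}
    (hG : I.chain.PeriodicallyStable) (h : Prepared I D K M) :
    Runs JD I progDecide M (decideTime I.formula.size (2 ^ I.formula.size)
      (K + I.chain.period + 2 ^ I.formula.size) K I.chain.period d) (fun M' =>
        M'.int 0 0 = ind (I.ModelsBelow D K) + ind (I.ModelsBelow D K ∧ ¬ I.ModelsAbove D K)) := by
  set φ := I.formula with hφ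
  set N := 2 ^ φ.size with hN
  set p := I.chain.period with hp
  have hsN : φ.size < N := Nat.lt_two_pow_self
  have hL : φ.size ≤ K + p + N := by omega
  have hp0 := (Chain.period_spec D hG).1
  refine Runs.seq (runs_progN h.size) fun M₁ h₁ hN₁ => ?_
  have hP₁ := h.sameOff h₁ rfl
  refine Runs.seq (runs_progHalf hN₁) fun M₂ h₂ hhalf => ?_
  have hP₂ := hP₁.sameOff h₂ rfl
  have hN₂ := (h₂.reg 0 5 rfl).trans hN₁
  refine Runs.seq (runs_progMul hN₂ (L := K + p + N) (by rw [hP₂.start, hP₂.period]))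
    fun M₃ h₃ hmul => ?_
  have hP₃ := hP₂.sameOff h₃ rfl
  have hN₃ := (h₃.reg 0 5 rfl).trans hN₂
  refine Runs.seq (runs_progBit hN₃ hP₃.size (fun x hx => (h₃.row 6 rfl x).trans (hhalf x hx))
    fun x hx => hmul x (by omega)) fun M₄ h₄ hbit => ?_
  have hP₄ := hP₃.sameOff h₄ rfl
  have hN₄ := (h₄.reg 0 5 rfl).trans hN₃
  refine Runs.seq (runs_progSize hP₄.size hP₄.code) fun M₅ h₅ hsize => ?_
  have hP₅ := hP₄.sameOff h₅ rfl
  have hB₅ : BitTables φ N (K + p + N) M₅ := ⟨hP₅.size, hP₅.code, (h₅.reg 0 5 rfl).trans hN₄,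
    fun x hx => by rw [h₅.row 7 rfl, h₄.row 7 rfl, hmul x hx],
    fun i hi T hT => by rw [h₅.row 9 rfl, hbit i hi T hT], hsize⟩
  refine Runs.seq (runs_progConsistent hB₅ hL (by omega)) fun M₆ h₆ hcons => ?_
  have hP₆ := hP₅.sameOff h₆ rfl
  have hB₆ := hB₅.sameOff h₆ rfl
  refine Runs.seq (runs_progAlphabet (D := D) hB₆ hP₆.dim hL (by omega) hP₆.start hP₆.period
    hP₆.init hP₆.rep hP₆.stabilizer (fun x hx => absurd (hP₆.pattern x) hx)) fun M₇ h₇ halph => ?_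
  have hB₇ := hB₆.sameOff h₇ rfl
  refine Runs.seq (Q := fun M' => M'.int 0 18 = 2 * N) (Runs.setInt ?_) fun M₈ h₈ h18 => ?_
  · simp [IntExpr.eval, hB₇.count, two_mul]
  have hS : SearchState φ (fun n T => ∃ a ∈ I.alphabet D K n, φ.AtomsAgree T a) N (K + p + N) K p
      M₈ := by
    refine ⟨⟨hB₇.sameOff h₈ rfl, fun T hT T' hT' => ?_, fun n hn T hT => ?_,
      hL, by omega, by omega⟩,
      ?_, ?_, h18⟩
    · rw [h₈.row 11 rfl, h₇.row 11 rfl, hcons T hT T' hT']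
    · rw [h₈.row 13 rfl, halph n hn T hT]
    · rw [h₈.reg 0 3 rfl, h₇.reg 0 3 rfl, hP₆.start]
    · rw [h₈.reg 0 6 rfl, h₇.reg 0 6 rfl, hP₆.period]
  have hper : ∀ n, K ≤ n →
      tableGraph φ (fun n T => ∃ a ∈ I.alphabet D K n, φ.AtomsAgree T a) (n + p) =
      tableGraph φ (fun n T => ∃ a ∈ I.alphabet D K n, φ.AtomsAgree T a) n := by
    intro n hn
    have : I.alphabet D K (n + p) = I.alphabet D K n := by
      simp only [Instance.alphabet, if_neg (not_lt.2 hn), if_neg (show ¬ n + p < K by omega)]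
      rw [hp, Chain.stable_add_period D hG]
    funext T T'
    simp only [tableGraph, this]
  refine Runs.seq (runs_progRecurrent hS hper) fun M₉ h₉ hrec => ?_
  have hS₉ := hS.sameOff h₉ rfl
  refine Runs.seq (runs_progFair hS₉ hp0 hper hrec) fun M₁₀ h₁₀ hfair => ?_
  refine Runs.imp (runs_progAnswer (hS₉.sameOff h₁₀ rfl).tables.bits hL hfair) le_rfl
    fun M₁₁ _ hans => ?_
  rw [hans, I.modelsBelow_iff D hG, I.modelsAbove_iff D hG, not_not]
  rfl

theorem decideTime_le {s N K p d : ℕ} (hs : s ≤ N) (hN : 1 ≤ N) (hX : 1 ≤ K + p) :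
    decideTime s N (K + p + N) K p d ≤ 500 * (N ^ 6 * (K + p)) + 8 * d ^ 2 := by
  obtain ⟨X, hX'⟩ : ∃ X, K + p = X := ⟨_, rfl⟩
  have hK : K ≤ X := by omega
  have hp : p ≤ X := by omega
  rw [hX'] at hX ⊢
  have h1 : decideTime s N (X + N) K p d ≤ decideTime N N (X + N) X X d := by
    unfold decideTime searchTime
    gcongr
  refine h1.trans ?_
  clear h1 hX' hK hp hs
  obtain ⟨n, rfl⟩ : ∃ n, N = n + 1 := ⟨N - 1, by omega⟩
  obtain ⟨x, rfl⟩ : ∃ x, X = x + 1 := ⟨X - 1, by omega⟩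
  have hd : d * (d * (1 + 3) + 4) ≤ 8 * d ^ 2 := by
    have := Nat.le_self_pow two_ne_zero d
    nlinarith
  unfold decideTime searchTime sweepTime
  generalize d * (d * (1 + 3) + 4) = u at *
  ring_nf
  omega

/-- The answer of the decision procedure is correct. -/
theorem solvedBy_of_exec {D : JordanDecomposition I.chain.matrixRep} {K : ℕ}
    (h : I.Admissible D K) {M : Mem} (hM : M.int 0 0 =
      ind (I.ModelsBelow D K) + ind (I.ModelsBelow D K ∧ ¬ I.ModelsAbove D K)) :
    ∃ v : Verdict, Answers M v ∧ (v ≠ .false ↔ I.ModelsBelow D K) ∧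
      (v = .true ↔ I.ModelsAbove D K) ∧ (v = .false → ¬ I.Models) ∧ (v = .true → I.Models) := by
  have hmem := h.traj_mem
  by_cases hb : I.ModelsBelow D K
  · have hm' : I.ModelsAbove D K → I.Models := fun ha => ha hmem
    by_cases ha : I.ModelsAbove D K
    · refine ⟨.true, ?_, by simp [hb], by simp [ha], by simp, fun _ => hm' ha⟩
      simp [Answers, Verdict.toNat, hM, ind, hb, ha]
    · refine ⟨.unknown, ?_, by simp [hb], by simp [ha], by simp, by simp⟩
      simp [Answers, Verdict.toNat, hM, ind, hb, ha]
  · have hn : ¬ I.Models := fun hm => hb ⟨_, hmem, hm⟩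
    have ha : ¬ I.ModelsAbove D K := fun ha => hn (ha hmem)
    refine ⟨.false, ?_, by simp [hb], by simp [ha], fun _ => hn, by simp⟩
    simp [Answers, Verdict.toNat, hM, ind, hb]

end

/-! ### The matrix representation -/

/-- `int 0 4 := d ^ 2`. -/
def progDim : Program := sumS 7 (iv 0) 4 (iv 0)

/-- Row `2`: the multiples of `d`. Rows `3` and `4`: quotients and remainders modulo `d` of
the numbers below `d ^ 2`. -/
def progIndex : Program :=
  .seq (fillRow 2 7 (iv 0) (sumS 8 (iv 7) 10 (iv 0)) (iv 10))
  (.seq (fillTab 3 7 (iv 0) 8 (iv 0) (ia 2 (iv 7)) skip (iv 7))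
    (fillTab 4 7 (iv 0) 8 (iv 0) (ia 2 (iv 7)) skip (iv 8)))

/-- The contribution of the Kraus operator in the scalar `9` to the entry in row `7` and column `8`
of the matrix representation. -/
def krausE : CplxExpr :=
  .mul (.get (.add (iv 9) (.const 2)) (ia 3 (iv 7)) (ia 3 (iv 8)))
    (.conj (.get (.add (iv 9) (.const 2)) (ia 4 (iv 7)) (ia 4 (iv 8))))

/-- The matrix representation is accumulated under the name `0`, one row below the precision, since
all other names may be occupied by Kraus operators. -/
def progAccumulate : Program :=
  forLoop 9 (iv 1) (forLoop 7 (iv 4) (forLoop 8 (iv 4)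
    (setC 0 (.add (iv 7) (.const 1)) (iv 8)
      (.add (ca 0 (.add (iv 7) (.const 1)) (iv 8)) krausE))))

/-- Name `2`: the matrix representation of the super-operator. -/
def progRep : Program :=
  .seq progAccumulate (fillMat 2 7 (iv 4) 8 (iv 4) skip (ca 0 (.add (iv 7) (.const 1)) (iv 8)))

section

variable {JD : JordanProcedure} {d m : ℕ} {I : Instance d m}

theorem runs_progDim {M : Mem} (hd : M.int 0 0 = d) :
    Runs JD I progDim M (d * 3 + 3) (fun M' => M'.int 0 4 = d * d) := by
  refine Runs.imp (Runs.sumS (n := d) (fun _ => d) (by decide)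
    (fun M' h => (h.reg 0 0 rfl).trans hd) fun k _ M' h _ => (h.reg 0 0 rfl).trans hd) le_rfl
    fun M' _ h => ?_
  simpa using h

/-- The tables of multiples of `d` and of quotients and remainders modulo `d`: the entry with index
`x` of a vectorized operator is the entry `(x / d, x % d)` of the operator. -/
structure IndexTables (d : ℕ) (M : Mem) : Prop where
  dim : M.int 0 0 = d
  square : M.int 0 4 = d * d
  mul : ∀ k < d, M.int 2 k = k * d
  div : ∀ x < d * d, M.int 3 x = x / d
  mod : ∀ x < d * d, M.int 4 x = x % d

theorem IndexTables.sameOff {M M' : Mem} {P : Program} (h : IndexTables d M) (hP : SameOff P M M')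
    (hk : (P.keepsReg 0 0 && (P.keepsReg 0 4 && (P.keepsRow 2 && (P.keepsRow 3 && P.keepsRow 4)))) =
      true) :
    IndexTables d M' := by
  simp only [Bool.and_eq_true] at hk
  obtain ⟨h0, h4, r2, r3, r4⟩ := hk
  exact ⟨(hP.reg _ _ h0).trans h.dim, (hP.reg _ _ h4).trans h.square,
    fun k hk => (hP.row _ r2 k).trans (h.mul k hk),
    fun x hx => (hP.row _ r3 x).trans (h.div x hx), fun x hx => (hP.row _ r4 x).trans (h.mod x hx)⟩

theorem runs_progIndex {M : Mem} (hd : M.int 0 0 = d) (hD : M.int 0 4 = d * d) :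
    Runs JD I progIndex M (d * (d * 3 + 3 + 3) + 2 + (d * (d * (1 + 3) + 4) + 2 +
      (d * (d * (1 + 3) + 4) + 2))) (IndexTables d) := by
  refine Runs.seq (Q := fun M' => ∀ k < d, M'.int 2 k = k * d) (Runs.imp (Runs.fillRow (n := d)
    (τ := d * 3 + 3) (fun k => k * d) (by decide) rfl rfl (fun M' h => (h.reg 0 0 rfl).trans hd) ?_)
    le_rfl fun _ _ h => h.1) fun M₁ h₁ hmul => ?_
  · intro k hk M₁ h₁ hk₁ _ _
    refine Runs.imp (Runs.sumS (n := k) (fun _ => d) (by decide)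
      (fun M' h => (h.reg 0 7 rfl).trans hk₁)
      fun _ _ M' h _ => (h.reg 0 0 rfl).trans ((h₁.reg 0 0 rfl).trans hd)) (by omega) fun M' _ h =>
        ?_
    simpa [IntExpr.eval] using h
  have hd₁ := (h₁.reg 0 0 rfl).trans hd
  refine Runs.seq (Runs.fillTab (N := d) (τ := 1) (fun i _ => i) (by decide) (by decide) rfl
    rfl rfl le_rfl (fun M' h => (h.reg 0 0 rfl).trans hd₁) (fun M' h => (h.reg 0 0 rfl).trans hd₁)
    (fun M' h hx => (h.row 2 rfl _).trans (hmul _ hx)) fun i _ j _ M' _ hi _ => Runs.skip ?_)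
    fun M₂ h₂ hdiv => ?_
  · simpa [IntExpr.eval] using hi
  have hd₂ := (h₂.reg 0 0 rfl).trans hd₁
  refine Runs.imp (Runs.fillTab (N := d) (τ := 1) (fun _ j => j) (by decide) (by decide) rfl
    rfl rfl le_rfl (fun M' h => (h.reg 0 0 rfl).trans hd₂) (fun M' h => (h.reg 0 0 rfl).trans hd₂)
    (fun M' h hx => (h.row 2 rfl _).trans ((h₂.row 2 rfl _).trans (hmul _ hx)))
    fun i _ j _ M' _ _ hj => Runs.skip ?_) le_rfl fun M₃ h₃ hmod => ?_
  · simpa [IntExpr.eval] using hj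
  have key : ∀ x < d * d, x / d < d ∧ x % d < d ∧ x = x / d * d + x % d := fun x hx => by
    have h0 : 0 < d := Nat.pos_of_ne_zero fun h => by simp [h] at hx
    exact ⟨(Nat.div_lt_iff_lt_mul h0).2 hx, Nat.mod_lt _ h0, by rw [Nat.div_add_mod']⟩
  refine ⟨(h₃.reg 0 0 rfl).trans hd₂, ?_, fun k hk => ?_, fun x hx => ?_, fun x hx => ?_⟩
  · rw [h₃.reg 0 4 rfl, h₂.reg 0 4 rfl, h₁.reg 0 4 rfl, hD]
  · rw [h₃.row 2 rfl, h₂.row 2 rfl, hmul k hk]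
  · obtain ⟨h1, h2, h3⟩ := key x hx
    have := hdiv _ h1 _ h2
    rwa [← h3, ← h₃.row 3 rfl] at this
  · obtain ⟨h1, h2, h3⟩ := key x hx
    have := hmod _ h1 _ h2
    rwa [← h3] at this

theorem runs_progAccumulate {M : Mem} (h : IndexTables d M) {r : ℕ} (hr : M.int 0 1 = r) :
    Runs JD I progAccumulate M (r * (d * d * (d * d * (1 + 2) + 2 + 2) + 2 + 2) + 2) (fun M' =>
      M'.cplx 0 0 0 = M.cplx 0 0 0 ∧ ∀ x < d * d, ∀ y < d * d, M'.cplx 0 (x + 1) y =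
        M.cplx 0 (x + 1) y + ∑ k ∈ Finset.range r, M.cplx (k + 2) (x / d) (y / d) *
          star (M.cplx (k + 2) (x % d) (y % d))) := by
  set t : ℕ → ℕ → ℕ → ℂ := fun k x y => M.cplx (k + 2) (x / d) (y / d) *
          star (M.cplx (k + 2) (x % d) (y % d)) with ht
  set f : ℕ → ℕ → ℕ → ℂ := fun k x y => M.cplx 0 (x + 1) y + ∑ k ∈ Finset.range k, t k x y with hf
  have hsucc : ∀ k x y, f (k + 1) x y = f k x y + t k x y := fun k x y => by
    simp only [hf, Finset.sum_range_succ, add_assoc]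
  refine Runs.imp (Runs.forLoop (n := r) (fun k M' => M'.cplx 0 0 0 = M.cplx 0 0 0 ∧
    ∀ x < d * d, ∀ y < d * d, M'.cplx 0 (x + 1) y = f k x y) rfl
    (fun M' h' => (h'.reg 0 1 rfl).trans hr) ⟨rfl, by simp [hf]⟩ ?_) le_rfl fun _ _ h => h.1
  rintro k hk M₁ h₁ hk₁ ⟨hε₁, hI₁⟩
  have hT₁ := h.sameOff h₁ rfl
  refine Runs.imp (Runs.forLoop (n := d * d) (fun x₀ M' => M'.cplx 0 0 0 = M.cplx 0 0 0 ∧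
    ∀ x < d * d, ∀ y < d * d, M'.cplx 0 (x + 1) y = if x < x₀ then f (k + 1) x y else f k x y) rfl
    (fun M' h' => (hT₁.sameOff h' rfl).square) ⟨hε₁, by simpa using hI₁⟩ ?_) le_rfl ?_
  · rintro x₀ hx₀ M₂ h₂ hx₂ ⟨hε₂, hI₂⟩
    have hT₂ := hT₁.sameOff h₂ rfl
    refine Runs.imp (Runs.forLoop (n := d * d) (fun y₀ M' => M'.cplx 0 0 0 = M.cplx 0 0 0 ∧
      ∀ x < d * d, ∀ y < d * d, M'.cplx 0 (x + 1) y =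
        if x < x₀ ∨ x = x₀ ∧ y < y₀ then f (k + 1) x y else f k x y) rfl
      (fun M' h' => (hT₂.sameOff h' rfl).square) ⟨hε₂, by simpa using hI₂⟩ ?_) le_rfl ?_
    · rintro y₀ hy₀ M₃ h₃ hy₃ ⟨hε₃, hI₃⟩
      have hT₃ := hT₂.sameOff h₃ rfl
      have h9 : M₃.int 0 9 = k := (h₃.reg 0 9 rfl).trans ((h₂.reg 0 9 rfl).trans hk₁)
      have h7 : M₃.int 0 7 = x₀ := (h₃.reg 0 7 rfl).trans hx₂
      have hname : ∀ i j, M₃.cplx (k + 2) i j = M.cplx (k + 2) i j := fun i j => by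
        rw [h₃.name (k + 2) (by simp [forLoop, Program.keepsName, IntExpr.avoids]),
          h₂.name (k + 2) (by simp [forLoop, Program.keepsName, IntExpr.avoids]),
          h₁.name (k + 2) (by simp [forLoop, Program.keepsName, IntExpr.avoids])]
      have hterm : krausE.eval M₃ = t k x₀ y₀ := by
        simp only [krausE, CplxExpr.eval, IntExpr.eval, h9, h7, hy₃, hT₃.div x₀ hx₀,
          hT₃.div y₀ hy₀, hT₃.mod x₀ hx₀, hT₃.mod y₀ hy₀, hname, ht]
      have hcur := hI₃ x₀ hx₀ y₀ hy₀
      simp only [lt_irrefl, and_false, or_false, if_false] at hcur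
      refine Runs.setCplx ⟨?_, fun x hx y hy => ?_⟩
      · simpa [IntExpr.eval] using hε₃
      · simp only [IntExpr.eval, CplxExpr.eval, h7, hy₃, setInt_cplx, setCplx_cplx, hterm, hcur,
          ← hsucc]
        by_cases hxy : x = x₀ ∧ y = y₀
        · obtain ⟨rfl, rfl⟩ := hxy
          simp
        · rw [if_neg (by omega), hI₃ x hx y hy]
          refine if_congr ?_ rfl rfl
          omega
    · rintro M₃ - ⟨⟨hε, hI⟩, -⟩
      refine ⟨hε, fun x hx y hy => ?_⟩
      rw [setInt_cplx, hI x hx y hy]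
      refine if_congr ?_ rfl rfl
      omega
  · rintro M₂ - ⟨⟨hε, hI⟩, -⟩
    refine ⟨hε, fun x hx y hy => ?_⟩
    rw [setInt_cplx, hI x hx y hy, if_pos hx]

theorem runs_progRep {M : Mem} (h : IndexTables d M) (hr : M.int 0 1 = I.chain.numKraus)
    (h0 : ∀ x y, M.cplx 0 (x + 1) y = 0)
    (hk : ∀ k : Fin I.chain.numKraus, ∀ i j : Fin d, M.cplx (k + 2) i j = I.chain.kraus k i j) :
    Runs JD I progRep M (I.chain.numKraus * (d * d * (d * d * (1 + 2) + 2 + 2) + 2 + 2) + 2 +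
      (d * d * (d * d * (1 + 3) + 4) + 2))
      (fun M' => M'.cplx 0 0 0 = M.cplx 0 0 0 ∧ M'.readOp (d * d) 2 = I.chain.matrixRep) := by
  refine Runs.seq (runs_progAccumulate h hr) fun M₁ h₁ hacc => ?_
  have hT₁ := h.sameOff h₁ rfl
  refine Runs.imp (Runs.fillMat (n := d * d) (n' := d * d) (τ := 1)
    (fun x y => M₁.cplx 0 (x + 1) y) (by decide) rfl rfl rfl
    (fun M' h' => (hT₁.sameOff h' rfl).square)
      (fun M' h' => (hT₁.sameOff h' rfl).square) ?_) le_rfl ?_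
  · intro x _ y _ M' h' hx hy
    refine Runs.skip ?_
    simp [CplxExpr.eval, IntExpr.eval, hx, hy, h'.name 0 rfl]
  · intro M₂ h₂ hcopy
    refine ⟨(h₂.name 0 rfl 0 0).trans hacc.1, ?_⟩
    ext x y
    have hx := hcopy x x.2 y y.2
    rw [hacc.2 x x.2 y y.2, h0, zero_add] at hx
    refine hx.trans ?_
    simp only [Chain.matrixRep, submatrix_apply, Matrix.sum_apply, kroneckerMap_apply,
      Matrix.map_apply]
    rw [Finset.sum_range]
    refine Finset.sum_congr rfl fun k _ => ?_
    have e := fun i j : Fin d => hk k i j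
    rw [← e, ← e]
    rfl

end

/-! ### The stabilizer and the period -/

/-- Row `5`: the flags of the eigenvalues of modulus one. -/
def progFlags : Program :=
  fillRow 5 7 (iv 4) (.ite (.reLe (.ofInt (.const 1))
    (.mul (ca 4 (iv 7) (iv 7)) (.conj (ca 4 (iv 7) (iv 7))))) (setS 10 (.const 1))
    (setS 10 (.const 0))) (iv 10)

/-- Name `6`: the stabilizer. -/
def progStabilizer : Program :=
  fillMat 6 7 (iv 4) 8 (iv 4) (sumC 9 (iv 4) 30 (.mul (.mul (ca 3 (iv 7) (iv 9))
    (.ofInt (ia 5 (iv 9)))) (ca 5 (iv 9) (iv 8)))) (ca 30 (.const 0) (.const 0))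

/-- Name `11`, row `0`: the peripheral coordinates `c` of the initial state. -/
def progCoords : Program :=
  fillMat 11 7 (.const 1) 8 (iv 4) (sumC 9 (iv 4) 30 (.mul (ca 5 (iv 8) (iv 9))
    (ca 1 (ia 3 (iv 9)) (ia 4 (iv 9))))) (.mul (.ofInt (ia 5 (iv 8))) (ca 30 (.const 0) (.const 0)))

/-- Name `9`, row `0`: the functional `ρ ↦ ∑ z, c_z^* (S⁻¹ ρ)_z`. -/
def progFunctional : Program :=
  fillMat 9 7 (.const 1) 8 (iv 4) (sumC 9 (iv 4) 30 (.mul (.conj (ca 11 (.const 0) (iv 9)))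
    (ca 5 (iv 9) (iv 8)))) (ca 30 (.const 0) (.const 0))

/-- Name `12`: the maximal value `∑ z, |c_z|²` of the functional. -/
def progTarget : Program :=
  sumC 9 (iv 4) 12 (.mul (.conj (ca 11 (.const 0) (iv 9))) (ca 11 (.const 0) (iv 9)))

/-- `int 0 6 := p`: the trajectory is followed until the functional is maximal. -/
def progFindPeriod : Program :=
  .seq (fillMat 7 7 (iv 0) 8 (iv 0) skip (ca 1 (iv 7) (iv 8))) (.seq (setS 6 (.const 0))
  (.seq (setS 20 (.const 0)) (.while (.intLe (iv 20) (.const 0))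
    (.seq (setS 6 (.add (iv 6) (.const 1))) (.seq (.apply (.const 2) (.const 7) (.const 7))
    (.seq (.apply (.const 9) (.const 7) (.const 10))
    (.ite (.reLe (ca 12 (.const 0) (.const 0)) (ca 10 (.const 0) (.const 0)))
      (setS 20 (.const 1)) skip)))))))

section

variable {JD : JordanProcedure} {d m : ℕ} {I : Instance d m}

theorem Runs.jordan {n src dst : IntExpr} {M : Mem} {N : ℕ} {A : Op N} (hn : n.eval M = N)
    (hA : M.readOp N (src.eval M) = A) : Runs JD I (.jordan n src dst) M (N ^ 4 + 1) (fun M' =>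
      M'.readOp N (dst.eval M) = (JD N A).S ∧ M'.readOp N (dst.eval M + 1) = (JD N A).J ∧
        M'.readOp N (dst.eval M + 2) = (JD N A).S⁻¹) := by
  subst hn
  subst hA
  refine ⟨_, _, .jordan M n src dst, le_rfl, ?_, ?_, readOp_writeOp _ _ _⟩
  · ext i j
    rw [Mem.readOp, of_apply, writeOp_cplx_ne _ (by omega), writeOp_cplx_ne _ (by omega),
      writeOp_cplx_fin]
  · ext i j
    rw [Mem.readOp, of_apply, writeOp_cplx_ne _ (by omega), writeOp_cplx_fin]

/-- The memory holds the initial state, the matrix representation and its Jordan decomposition. -/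
structure Decomposed (I : Instance d m) (D : JordanDecomposition I.chain.matrixRep) (M : Mem) :
    Prop where
  index : IndexTables d M
  init : M.readOp d 1 = I.chain.init
  rep : M.readOp (d * d) 2 = I.chain.matrixRep
  S : M.readOp (d * d) 3 = D.S
  J : M.readOp (d * d) 4 = D.J
  inv : M.readOp (d * d) 5 = D.S⁻¹

theorem Decomposed.sameOff {D : JordanDecomposition I.chain.matrixRep} {M M' : Mem}
    {P : Program} (h : Decomposed I D M) (hP : SameOff P M M')
    (hk : (P.keepsReg 0 0 && (P.keepsReg 0 4 && (P.keepsRow 2 && (P.keepsRow 3 && P.keepsRow 4)))) =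
      true)
    (hk' : (P.keepsName 1 && (P.keepsName 2 && (P.keepsName 3 && (P.keepsName 4 &&
      P.keepsName 5)))) = true) : Decomposed I D M' := by
  simp only [Bool.and_eq_true] at hk'
  obtain ⟨h1, h2, h3, h4, h5⟩ := hk'
  exact ⟨h.index.sameOff hP hk, (hP.readOp _ _ h1).trans h.init, (hP.readOp _ _ h2).trans h.rep,
    (hP.readOp _ _ h3).trans h.S, (hP.readOp _ _ h4).trans h.J, (hP.readOp _ _ h5).trans h.inv⟩

theorem cplx_eq_of_readOp {M : Mem} {n a : ℕ} {A : Op n} (h : M.readOp n a = A) (i j : Fin n) :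
    M.cplx a i j = A i j := by
  rw [← h]; rfl

variable {D : JordanDecomposition I.chain.matrixRep}

theorem cast_ind_eq_peripheral (z : Fin (d * d)) :
    ((ind (‖D.J z z‖ = 1) : ℕ) : ℂ) = D.peripheral z := by
  by_cases h : ‖D.J z z‖ = 1 <;> simp [ind, JordanDecomposition.peripheral, h]

theorem runs_progFlags {M : Mem} (h : Decomposed I D M) :
    Runs JD I progFlags M (d * d * (2 + 3) + 2)
      (fun M' => ∀ z : Fin (d * d), M'.int 5 z = ind (‖D.J z z‖ = 1)) := by
  refine Runs.imp (Runs.fillRow (n := d * d) (τ := 2)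
    (fun z => ind (1 ≤ (M.cplx 4 z z * star (M.cplx 4 z z)).re)) (by decide) rfl rfl
    (fun M' h' => (h.sameOff h' rfl rfl).index.square) ?_) le_rfl fun M' _ h' z => ?_
  · intro z hz M₁ h₁ hz₁ _ _
    have h4 := h₁.name 4 rfl z z
    refine Runs.ite (fun ht => Runs.setInt ?_) fun ht => Runs.setInt ?_
    · rw [ind_pos]
      · simp [IntExpr.eval]
      · simpa [Test.Holds, CplxExpr.eval, IntExpr.eval, hz₁, h4] using ht
    · rw [ind_neg]
      · simp [IntExpr.eval]
      · simpa [Test.Holds, CplxExpr.eval, IntExpr.eval, hz₁, h4] using ht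
  · rw [h'.1 z z.2, cplx_eq_of_readOp h.J]
    refine ind_congr ?_
    have hre : (D.J z z * star (D.J z z)).re = ‖D.J z z‖ ^ 2 := by
      rw [← Complex.normSq_eq_norm_sq, ← Complex.ofReal_re (Complex.normSq _), ← Complex.mul_conj]
      rfl
    rw [hre]
    have := (I.chain.powerBounded D).le_one z
    constructor
    · intro h1
      nlinarith [norm_nonneg (D.J z z)]
    · intro h1
      rw [h1]; norm_num

theorem runs_progStabilizer {M : Mem} (h : Decomposed I D M)
    (h5 : ∀ z : Fin (d * d), M.int 5 z = ind (‖D.J z z‖ = 1)) :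
    Runs JD I progStabilizer M (d * d * (d * d * (d * d * 3 + 3 + 3) + 4) + 2)
      (fun M' => M'.readOp (d * d) 6 = D.stabilizer) := by
  refine Runs.imp (Runs.fillMat (n := d * d) (n' := d * d) (τ := d * d * 3 + 3)
    (fun x y => ∑ z ∈ Finset.range (d * d), M.cplx 3 x z * (M.int 5 z : ℕ) * M.cplx 5 z y)
    (by decide) rfl rfl rfl (fun M' h' => (h.sameOff h' rfl rfl).index.square)
    (fun M' h' => (h.sameOff h' rfl rfl).index.square) ?_) le_rfl fun M' _ h' => ?_
  · intro x _ y _ M₁ h₁ hx hy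
    have hD₁ := h.sameOff h₁ rfl rfl
    refine Runs.imp (Runs.sumC (n := d * d) (fun z => M.cplx 3 x z * (M.int 5 z : ℕ) * M.cplx 5 z y)
      (fun M' h' => (hD₁.sameOff h' rfl rfl).index.square) ?_) le_rfl fun _ _ h => h
    intro z _ M₂ h₂ hz
    simp only [CplxExpr.eval, IntExpr.eval, hz, h₂.reg 0 7 rfl, h₂.reg 0 8 rfl, hx, hy,
      h₂.name 3 rfl, h₁.name 3 rfl, h₂.name 5 rfl, h₁.name 5 rfl, h₂.row 5 rfl, h₁.row 5 rfl]
  · ext x y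
    refine (h' x x.2 y y.2).trans ?_
    rw [D.stabilizer_eq, mul_apply, Finset.sum_range]
    refine Finset.sum_congr rfl fun z _ => ?_
    rw [mul_diagonal, cplx_eq_of_readOp h.S, cplx_eq_of_readOp h.inv, h5,
      cast_ind_eq_peripheral]

theorem vectorize_eq_cplx {M : Mem} {a : ℕ} {ρ : Op d} (h : M.readOp d a = ρ) (z : Fin (d * d)) :
    vectorize ρ z = M.cplx a (z / d : ℕ) (z % d : ℕ) := by
  rw [← h]; rfl

theorem runs_progCoords {M : Mem} (h : Decomposed I D M)
    (h5 : ∀ z : Fin (d * d), M.int 5 z = ind (‖D.J z z‖ = 1)) :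
    Runs JD I progCoords M (1 * (d * d * (d * d * 3 + 3 + 3) + 4) + 2)
      (fun M' => ∀ z : Fin (d * d), M'.cplx 11 0 z = I.chain.peripheralCoord D z) := by
  refine Runs.imp (Runs.fillMat (n := 1) (n' := d * d) (τ := d * d * 3 + 3)
    (fun _ z => (M.int 5 z : ℕ) * ∑ y ∈ Finset.range (d * d), M.cplx 5 z y *
      M.cplx 1 (y / d) (y % d))
    (by decide) rfl rfl rfl (fun _ _ => rfl)
    (fun M' h' => (h.sameOff h' rfl rfl).index.square) ?_) le_rfl fun M' _ h' z => ?_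
  · intro x _ z hz M₁ h₁ hx hz₁
    have hD₁ := h.sameOff h₁ rfl rfl
    refine Runs.imp (Runs.sumC (n := d * d) (fun y => M.cplx 5 z y * M.cplx 1 (y / d) (y % d))
      (fun M' h' => (hD₁.sameOff h' rfl rfl).index.square) ?_) le_rfl fun M₂ h₂ hsum => ?_
    · intro y hy M₂ h₂ hy₂
      have hT := (hD₁.sameOff h₂ rfl rfl).index
      simp only [CplxExpr.eval, IntExpr.eval, hy₂, h₂.reg 0 8 rfl, hz₁, hT.div y hy, hT.mod y hy,
        h₂.name 5 rfl, h₁.name 5 rfl, h₂.name 1 rfl, h₁.name 1 rfl]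
    · simp only [CplxExpr.eval, IntExpr.eval, hsum, h₂.reg 0 8 rfl, hz₁, h₂.row 5 rfl, h₁.row 5 rfl]
  · refine (h' 0 one_pos z z.2).trans ?_
    simp only [Chain.peripheralCoord]
    rw [h5, cast_ind_eq_peripheral, mulVec, dotProduct, Finset.sum_range]
    congr 1
    refine Finset.sum_congr rfl fun y _ => ?_
    rw [cplx_eq_of_readOp h.inv, vectorize_eq_cplx h.init]

theorem runs_progFunctional {M : Mem} (h : Decomposed I D M)
    (hc : ∀ z : Fin (d * d), M.cplx 11 0 z = I.chain.peripheralCoord D z) :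
    Runs JD I progFunctional M (1 * (d * d * (d * d * 3 + 3 + 3) + 4) + 2)
      (fun M' => ∀ y : Fin (d * d), M'.cplx 9 0 y =
        ∑ z, star (I.chain.peripheralCoord D z) * D.S⁻¹ z y) := by
  refine Runs.imp (Runs.fillMat (n := 1) (n' := d * d) (τ := d * d * 3 + 3)
    (fun _ y => ∑ z ∈ Finset.range (d * d), star (M.cplx 11 0 z) * M.cplx 5 z y)
    (by decide) rfl rfl rfl (fun _ _ => rfl)
    (fun M' h' => (h.sameOff h' rfl rfl).index.square) ?_) le_rfl fun M' _ h' y => ?_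
  · intro x _ y _ M₁ h₁ hx hy₁
    have hD₁ := h.sameOff h₁ rfl rfl
    refine Runs.imp (Runs.sumC (n := d * d) (fun z => star (M.cplx 11 0 z) * M.cplx 5 z y)
      (fun M' h' => (hD₁.sameOff h' rfl rfl).index.square) ?_) le_rfl fun _ _ h => h
    intro z _ M₂ h₂ hz
    simp only [CplxExpr.eval, IntExpr.eval, hz, h₂.reg 0 8 rfl, hy₁,
      h₂.name 5 rfl, h₁.name 5 rfl, h₂.name 11 rfl, h₁.name 11 rfl]
  · refine (h' 0 one_pos y y.2).trans ?_
    rw [Finset.sum_range]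
    refine Finset.sum_congr rfl fun z _ => ?_
    rw [cplx_eq_of_readOp h.inv, hc]

theorem runs_progTarget {M : Mem} (h : Decomposed I D M)
    (hc : ∀ z : Fin (d * d), M.cplx 11 0 z = I.chain.peripheralCoord D z) :
    Runs JD I progTarget M (d * d * 3 + 3) (fun M' => M'.cplx 12 0 0 =
        ∑ z, star (I.chain.peripheralCoord D z) * I.chain.peripheralCoord D z) := by
  refine Runs.imp (Runs.sumC (n := d * d) (fun z => star (M.cplx 11 0 z) * M.cplx 11 0 z)
      (fun M' h' => (h.sameOff h' rfl rfl).index.square) ?_) le_rfl fun M' _ h' => ?_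
  · intro z _ M₂ h₂ hz
    simp only [CplxExpr.eval, IntExpr.eval, hz, h₂.name 11 rfl]
  · rw [h', Finset.sum_range]
    refine Finset.sum_congr rfl fun z _ => ?_
    rw [hc]

theorem runs_progFindPeriod {M : Mem} (hG : I.chain.PeriodicallyStable) (h : Decomposed I D M)
    (h9 : ∀ y : Fin (d * d), M.cplx 9 0 y =
      ∑ z, star (I.chain.peripheralCoord D z) * D.S⁻¹ z y)
    (h12 : M.cplx 12 0 0 =
      ∑ z, star (I.chain.peripheralCoord D z) * I.chain.peripheralCoord D z) :
    Runs JD I progFindPeriod M (d * (d * (1 + 3) + 4) + 2 + (1 + (1 + (I.chain.period * 6 + 1))))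
      (fun M' => M'.int 0 6 = I.chain.period) := by
  have hd := I.chain.dim_pos
  have hspec := Chain.period_spec D hG
  refine Runs.seq (Runs.fillMat (n := d) (n' := d) (τ := 1) (fun i j => M.cplx 1 i j)
    (by decide) rfl
    rfl rfl (fun M' h' => (h.sameOff h' rfl rfl).index.dim)
    (fun M' h' => (h.sameOff h' rfl rfl).index.dim) ?_) fun M₁ h₁ hcopy => ?_
  · intro i _ j _ M' h' hi hj
    refine Runs.skip ?_
    simp [CplxExpr.eval, IntExpr.eval, hi, hj, h'.name 1 rfl]
  have h7₁ : M₁.readOp d 7 = I.chain.traj 0 := by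
    refine Eq.trans ?_ h.init
    ext i j; exact hcopy i i.2 j j.2
  refine Runs.seq (Q := fun M' => M'.int 0 6 = 0) (Runs.setInt rfl) fun M₂ h₂ h6 =>
    Runs.seq (Q := fun M' => M'.int 0 20 = 0) (Runs.setInt rfl) fun M₃ h₃ h20 => ?_
  have hmem : ∀ {P : Program} {M M' : Mem}, SameOff P M M' → P.keepsName 2 && (P.keepsName 9 &&
      P.keepsName 12) → M.readOp (d * d) 2 = I.chain.matrixRep ∧ (∀ y : Fin (d * d), M.cplx 9 0 y =
      ∑ z, star (I.chain.peripheralCoord D z) * D.S⁻¹ z y) ∧ M.cplx 12 0 0 =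
      ∑ z, star (I.chain.peripheralCoord D z) * I.chain.peripheralCoord D z →
      M'.readOp (d * d) 2 = I.chain.matrixRep ∧ (∀ y : Fin (d * d), M'.cplx 9 0 y =
      ∑ z, star (I.chain.peripheralCoord D z) * D.S⁻¹ z y) ∧ M'.cplx 12 0 0 =
      ∑ z, star (I.chain.peripheralCoord D z) * I.chain.peripheralCoord D z := by
    rintro P M M' hP hk ⟨e2, e9, e12⟩
    simp only [Bool.and_eq_true] at hk
    exact ⟨(hP.readOp _ _ hk.1).trans e2, fun y => (hP.name _ hk.2.1 _ _).trans (e9 y),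
      (hP.name _ hk.2.2 _ _).trans e12⟩
  have hm₃ := hmem h₃ rfl (hmem h₂ rfl (hmem h₁ rfl ⟨h.rep, h9, h12⟩))
  refine Runs.imp (Runs.while (fun M' => (M'.readOp (d * d) 2 = I.chain.matrixRep ∧
      (∀ y : Fin (d * d), M'.cplx 9 0 y =
      ∑ z, star (I.chain.peripheralCoord D z) * D.S⁻¹ z y) ∧ M'.cplx 12 0 0 =
      ∑ z, star (I.chain.peripheralCoord D z) * I.chain.peripheralCoord D z) ∧
      M'.readOp d 7 = I.chain.traj (M'.int 0 6) ∧ M'.int 0 6 ≤ I.chain.period ∧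
      ((M'.int 0 20 = 0 ∧ M'.int 0 6 < I.chain.period) ∨
        (M'.int 0 20 = 1 ∧ M'.int 0 6 = I.chain.period)))
    (fun M' => (I.chain.period - M'.int 0 6) * 6) (Q := fun M' => M'.int 0 6 = I.chain.period)
    ?_ ?_ ⟨hm₃, ?_, ?_, ?_⟩) ?_ fun _ _ h => h
  · rintro M' ⟨-, -, -, h | h⟩ hb
    · simp [Test.Holds, IntExpr.eval, h.1] at hb
    · exact h.2
  · rintro M' ⟨hm, hρ, hle, h | h⟩ hb
    swap
    · simp [Test.Holds, IntExpr.eval, h.1] at hb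
    obtain ⟨k, hk⟩ : ∃ k, M'.int 0 6 = k := ⟨_, rfl⟩
    rw [hk] at hρ hle h
    refine ⟨1 + (1 + (1 + (1 + 1))), Runs.seq (Q := fun M'' => M''.int 0 6 = k + 1 ∧
      M''.int 0 20 = 0 ∧ M''.readOp d 7 = I.chain.traj k) (Runs.setInt ?_) fun N₁ n₁ hN₁ =>
      Runs.seq (Q := fun M'' => M''.int 0 6 = k + 1 ∧ M''.int 0 20 = 0 ∧
        M''.readOp d 7 = I.chain.traj (k + 1)) (Runs.apply ?_) fun N₂ n₂ hN₂ =>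
      Runs.seq (Q := fun M'' => M''.int 0 6 = k + 1 ∧ M''.int 0 20 = 0 ∧
        M''.readOp d 7 = I.chain.traj (k + 1) ∧ M''.cplx 10 0 0 =
        ∑ z, star (I.chain.peripheralCoord D z) * (D.S⁻¹ *ᵥ vectorize (I.chain.traj (k + 1))) z)
        (Runs.apply ?_) fun N₃ n₃ hN₃ => ?_⟩
    · simp only [IntExpr.eval, hk]
      exact ⟨rfl, h.1, hρ⟩
    · have hm₁ := hmem n₁ rfl hm
      refine ⟨hN₁.1, hN₁.2.1, ?_⟩
      simp only [IntExpr.eval, readOp_writeOp]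
      rw [hm₁.1, hN₁.2.2, I.chain.traj_succ]
    · have hm₂ := hmem n₂ rfl (hmem n₁ rfl hm)
      refine ⟨hN₂.1, hN₂.2.1, ?_, ?_⟩
      · rw [← hN₂.2.2]
        ext i j
        exact writeOp_cplx_ne N₂ (show (7 : ℕ) ≠ 10 by decide)
          (applyRep (N₂.readOp (d * d) 9) (N₂.readOp d 7)) _ _
      · have h0 := writeOp_cplx_fin N₂ 10 (applyRep (N₂.readOp (d * d) 9) (N₂.readOp d 7))
          ⟨0, hd⟩ ⟨0, hd⟩
        refine h0.trans ?_
        rw [hN₂.2.2, applyRep, unvectorize, of_apply, mulVec, dotProduct]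
        have hx : (finProdFinEquiv ((⟨0, hd⟩ : Fin d), (⟨0, hd⟩ : Fin d)) : ℕ) = 0 := by
          simp [finProdFinEquiv]
        have e : ∀ y, N₂.readOp (d * d) 9 (finProdFinEquiv (⟨0, hd⟩, ⟨0, hd⟩)) y =
            ∑ z, star (I.chain.peripheralCoord D z) * D.S⁻¹ z y := by
          intro y
          rw [← hm₂.2.1 y, Mem.readOp, of_apply, hx]
        simp only [e, Finset.sum_mul, mulVec, dotProduct, Finset.mul_sum]
        rw [Finset.sum_comm]
        simp only [mul_assoc]
    · have hm₃ := hmem n₃ rfl (hmem n₂ rfl (hmem n₁ rfl hm))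
      have hpot : (I.chain.period - (k + 1)) * 6 + (1 + (1 + (1 + (1 + 1)))) + 1 ≤
          (I.chain.period - M'.int 0 6) * 6 := by
        rw [hk]; omega
      refine Runs.ite (fun ht => Runs.setInt ?_) fun ht => Runs.skip ?_
      all_goals
        simp only [Test.Holds, CplxExpr.eval, IntExpr.eval, hm₃.2.2, hN₃.2.2.2] at ht
        rw [← Chain.stable_eq_iff_functional] at ht
      · have hle' := Chain.period_le D (Nat.succ_pos k) ht
        have heq : k + 1 = I.chain.period := by omega
        refine ⟨⟨hm₃, ?_, ?_, Or.inr ⟨rfl, ?_⟩⟩, ?_⟩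
        all_goals simp only [IntExpr.eval, setInt_int, setInt_readOp, hN₃.1,
          Nat.reduceEqDiff, and_false, if_false]
        · exact hN₃.2.2.1
        · omega
        · exact heq
        · exact hpot
      · have hne : k + 1 ≠ I.chain.period := fun h => ht (h ▸ hspec.2)
        refine ⟨⟨hm₃, ?_, ?_, Or.inl ⟨?_, ?_⟩⟩, ?_⟩
        all_goals simp only [setInt_int, setInt_readOp, hN₃.1, hN₃.2.1,
          Nat.reduceEqDiff, and_false, if_false]
        · exact hN₃.2.2.1
        · omega
        · omega
        · exact hpot
  · rw [h₃.reg 0 6 rfl, h6, h₃.readOp d 7 rfl, h₂.readOp d 7 rfl, h7₁]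
  · rw [h₃.reg 0 6 rfl, h6]; omega
  · rw [h₃.reg 0 6 rfl, h6]; exact Or.inl ⟨h20, hspec.1⟩
  · omega

end

/-! ### The analysis of the quantum Markov chain -/

/-- The part of the program that depends on the quantum Markov chain only. -/
def progPrepare : Program :=
  .seq progDim (.seq progIndex (.seq progRep (.seq (.jordan (iv 4) (.const 2) (.const 3))
    (.seq progFlags (.seq progStabilizer (.seq progCoords (.seq progFunctional
      (.seq progTarget progFindPeriod))))))))

section

variable {JD : JordanProcedure} {d m : ℕ} {I : Instance d m}

/-- The number of steps of the analysis of the quantum Markov chain, for `r` Kraus operators and the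
period `p`. -/
def prepareTime (d r p : ℕ) : ℕ :=
  d * 3 + 3 + (d * (d * 3 + 3 + 3) + 2 + (d * (d * (1 + 3) + 4) + 2 + (d * (d * (1 + 3) + 4) + 2)) +
    (r * (d * d * (d * d * (1 + 2) + 2 + 2) + 2 + 2) + 2 + (d * d * (d * d * (1 + 3) + 4) + 2) +
    ((d * d) ^ 4 + 1 + (d * d * (2 + 3) + 2 + (d * d * (d * d * (d * d * 3 + 3 + 3) + 4) + 2 +
    (1 * (d * d * (d * d * 3 + 3 + 3) + 4) + 2 + (1 * (d * d * (d * d * 3 + 3 + 3) + 4) + 2 +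
    (d * d * 3 + 3 + (d * (d * (1 + 3) + 4) + 2 + (1 + (1 + (p * 6 + 1))))))))))))

theorem prepareTime_le {d r p : ℕ} (hd : 0 < d) (hr : r ≤ d ^ 2) :
    prepareTime d r p ≤ 200 * d ^ 8 + 6 * p := by
  have h1 : prepareTime d r p ≤ prepareTime d (d ^ 2) p := by
    unfold prepareTime
    gcongr
  refine h1.trans ?_
  obtain ⟨e, rfl⟩ : ∃ e, d = e + 1 := ⟨d - 1, by omega⟩
  unfold prepareTime
  ring_nf
  omega

theorem Instance.input_cplx (K : ℕ) {a : ℕ} (ha : a ≠ 0) (i j : Fin d) :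
    (I.input K).cplx a i j = if a = 1 then I.chain.init i j
        else if h' : a - 2 < I.chain.numKraus then I.chain.kraus ⟨a - 2, h'⟩ i j else 0 := by
  simp [Instance.input, ha]

/-- What the preparation leaves in the memory. -/
structure Analysed (I : Instance d m) (D : JordanDecomposition I.chain.matrixRep) (M : Mem) :
    Prop where
  decomposed : Decomposed I D M
  flags : ∀ z : Fin (d * d), M.int 5 z = ind (‖D.J z z‖ = 1)
  precision : M.cplx 0 0 0 = I.ε

theorem runs_progPrepare (hG : I.chain.PeriodicallyStable) (K : ℕ) :
    Runs JD I progPrepare (I.input K) (prepareTime d I.chain.numKraus I.chain.period) (fun M' =>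
      Prepared I (JD _ I.chain.matrixRep) K M' ∧ Analysed I (JD _ I.chain.matrixRep) M') := by
  set M := I.input K with hM
  set D := JD _ I.chain.matrixRep with hD
  refine Runs.imp (Q := fun M' => M'.int 0 6 = I.chain.period ∧
    M'.readOp (d * d) 6 = D.stabilizer ∧ Analysed I D M') ?_ le_rfl ?_
  swap
  · rintro M' h ⟨h6, hs, hA⟩
    refine ⟨⟨hA.decomposed.index.dim, ?_, ?_, h6, fun i _ => ?_, fun x => ?_, hA.decomposed.init,
      hA.decomposed.rep, hs⟩, hA⟩
    · rw [h.reg 0 2 rfl]; rfl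
    · rw [h.reg 0 3 rfl]; rfl
    · rw [h.row 1 rfl]; rfl
    · rw [h.row 14 rfl]; rfl
  have hd₀ : M.int 0 0 = d := rfl
  have hinit₀ : M.readOp d 1 = I.chain.init := by
    ext i j
    exact (I.input_cplx K one_ne_zero i j).trans (if_pos rfl)
  refine Runs.seq (runs_progDim hd₀) fun M₁ h₁ hdim => ?_
  refine Runs.seq (runs_progIndex ((h₁.reg 0 0 rfl).trans hd₀) hdim) fun M₂ h₂ hT₂ => ?_
  have hname : ∀ a i j, M₂.cplx a i j = M.cplx a i j := fun a i j => by
    rw [h₂.name a (by simp [progIndex, fillRow, fillTab, sumS, forLoop, skip, Program.keepsName]),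
      h₁.name a (by simp [progDim, sumS, forLoop, Program.keepsName])]
  refine Runs.seq (runs_progRep hT₂ ?_ (fun x y => ?_) fun k i j => ?_) fun M₃ h₃ hrep => ?_
  · rw [h₂.reg 0 1 rfl, h₁.reg 0 1 rfl]; rfl
  · rw [hname]
    simp [hM, Instance.input]
  · rw [hname, I.input_cplx K (by omega), if_neg (by omega)]
    simp
  have hT₃ := hT₂.sameOff h₃ rfl
  have hε₃ : M₃.cplx 0 0 0 = I.ε := by
    rw [hrep.1, hname]
    simp [hM, Instance.input]
  have hi₃ : M₃.readOp d 1 = I.chain.init := by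
    rw [h₃.readOp d 1 rfl, ← hinit₀]
    ext i j
    exact hname _ _ _
  refine Runs.seq (Runs.jordan (N := d * d) (A := I.chain.matrixRep) hT₃.square hrep.2)
    fun M₄ h₄ hJ => ?_
  have hD₄ : Decomposed I D M₄ := ⟨hT₃.sameOff h₄ rfl, (h₄.readOp d 1 rfl).trans hi₃,
    (h₄.readOp _ 2 rfl).trans hrep.2, hJ.1, hJ.2.1, hJ.2.2⟩
  refine Runs.seq (runs_progFlags hD₄) fun M₅ h₅ hf₅ => ?_
  have hD₅ := hD₄.sameOff h₅ rfl rfl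
  refine Runs.seq (runs_progStabilizer hD₅ hf₅) fun M₆ h₆ hst => ?_
  have hD₆ := hD₅.sameOff h₆ rfl rfl
  have hf₆ : ∀ z : Fin (d * d), M₆.int 5 z = ind (‖D.J z z‖ = 1) := fun z =>
    (h₆.row 5 rfl z).trans (hf₅ z)
  refine Runs.seq (runs_progCoords hD₆ hf₆) fun M₇ h₇ hc₇ => ?_
  have hD₇ := hD₆.sameOff h₇ rfl rfl
  refine Runs.seq (runs_progFunctional hD₇ hc₇) fun M₈ h₈ hfun => ?_
  have hD₈ := hD₇.sameOff h₈ rfl rfl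
  have hc₈ : ∀ z : Fin (d * d), M₈.cplx 11 0 z = I.chain.peripheralCoord D z := fun z =>
    (h₈.name 11 rfl 0 z).trans (hc₇ z)
  refine Runs.seq (runs_progTarget hD₈ hc₈) fun M₉ h₉ htar => ?_
  have hD₉ := hD₈.sameOff h₉ rfl rfl
  refine Runs.imp (runs_progFindPeriod hG hD₉ (fun y => (h₉.name 9 rfl 0 y).trans (hfun y)) htar)
    le_rfl fun M' h' hper => ⟨hper, ?_, hD₉.sameOff h' rfl rfl, fun z => ?_, ?_⟩
  · rw [h'.readOp _ 6 rfl, h₉.readOp _ 6 rfl, h₈.readOp _ 6 rfl, h₇.readOp _ 6 rfl, hst]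
  · rw [h'.row 5 rfl, h₉.row 5 rfl, h₈.row 5 rfl, h₇.row 5 rfl, hf₆]
  · rw [h'.name 0 rfl, h₉.name 0 rfl, h₈.name 0 rfl, h₇.name 0 rfl, h₆.name 0 rfl, h₅.name 0 rfl,
      h₄.name 0 rfl, hε₃]

end

/-! ### The squared norms of the powers and their recurrence -/

/-- `cplx dst 0 0 := ‖src‖²`. -/
def progNormSq (src dst : ℕ) : Program :=
  .seq (fillMat 31 7 (iv 4) 8 (.const 1) (sumC 9 (iv 4) 30 (.mul (ca src (iv 7) (iv 9))
    (.conj (ca src (iv 7) (iv 9))))) (ca 30 (.const 0) (.const 0)))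
    (sumC 7 (iv 4) dst (ca 31 (iv 7) (.const 0)))

/-- Name `13`: the decaying part `J_<`. -/
def progDecaying : Program :=
  fillMat 13 7 (iv 4) 8 (iv 4) skip (.mul (.ofInt (.sub (.const 1) (ia 5 (iv 7))))
    (ca 4 (iv 7) (iv 8)))

/-- Name `16`: the squared norms of the powers of `J_<` below `2 d ^ 2`; the current power is kept
under the name `14`. -/
def progPowers : Program :=
  .seq (fillMat 14 7 (iv 4) 8 (iv 4) skip (.ofInt (.eq (iv 7) (iv 8))))
    (forLoop 16 (iv 21) (.seq (progNormSq 14 34) (.seq (setC 16 (iv 16) (.const 0)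
      (ca 34 (.const 0) (.const 0))) (.seq (fillMat 15 7 (iv 4) 8 (iv 4)
        (sumC 9 (iv 4) 30 (.mul (ca 14 (iv 7) (iv 9)) (ca 13 (iv 9) (iv 8))))
          (ca 30 (.const 0) (.const 0)))
        (fillMat 14 7 (iv 4) 8 (iv 4) skip (ca 15 (iv 7) (iv 8)))))))

/-- `|J z z|²`, for `z` one less than the scalar `7`. -/
def rootE : CplxExpr :=
  .mul (ca 13 (.sub (iv 7) (.const 1)) (.sub (iv 7) (.const 1)))
    (.conj (ca 13 (.sub (iv 7) (.const 1)) (.sub (iv 7) (.const 1))))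

/-- Name `17`: the row `i` holds the coefficients of the product of the first `i` factors
`(X - |J z z|²)²`. -/
def progPoly : Program :=
  fillMat 17 7 (.add (iv 4) (.const 1)) 8 (iv 21)
    (.ite (.intLe (.const 1) (iv 7))
      (setC 30 (.const 0) (.const 0) (.add (.sub
        (.mul (.ofInt (.pos (.sub (iv 8) (.const 1))))
          (ca 17 (.sub (iv 7) (.const 1)) (.sub (iv 8) (.const 2))))
        (.mul (.mul (.ofInt (.const 2)) rootE) (.mul (.ofInt (.pos (iv 8)))
          (ca 17 (.sub (iv 7) (.const 1)) (.sub (iv 8) (.const 1))))))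
        (.mul (.mul rootE rootE) (ca 17 (.sub (iv 7) (.const 1)) (iv 8)))))
      (setC 30 (.const 0) (.const 0) (.ofInt (.eq (iv 8) (.const 0)))))
    (ca 30 (.const 0) (.const 0))

/-- The coefficient of the recurrence with the number in the scalar `8`. -/
def recE : CplxExpr := .sub (.ofInt (.const 0)) (ca 17 (iv 4) (iv 8))

/-- Name `19`: the coefficients of the iterated recurrence; name `20`: their second half, from the
column `d ^ 2` on. -/
def progRecurrence : Program :=
  .seq (fillMat 19 7 (iv 4) 8 (iv 21)
    (.ite (.intLe (.const 1) (iv 7))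
      (setC 30 (.const 0) (.const 0) (.add
        (.mul (.ofInt (.pos (iv 8))) (ca 19 (.sub (iv 7) (.const 1)) (.sub (iv 8) (.const 1))))
        (.mul (ca 19 (.sub (iv 7) (.const 1)) (.sub (iv 21) (.const 1))) recE)))
      (setC 30 (.const 0) (.const 0) recE))
    (ca 30 (.const 0) (.const 0)))
  (fillMat 20 7 (iv 4) 8 (iv 4) skip (ca 19 (iv 7) (.add (iv 4) (iv 8))))

section

variable {JD : JordanProcedure} {d m : ℕ} {I : Instance d m}

theorem runs_progNormSq {M : Mem} {n src dst : ℕ} {A : Op n} (hn : M.int 0 4 = n)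
    (hA : M.readOp n src = A) (h30 : src ≠ 30) (h31 : src ≠ 31) (hdst : dst ≠ 31) :
    Runs JD I (progNormSq src dst) M (n * (1 * (n * 3 + 3 + 3) + 4) + 2 + (n * 3 + 3))
      (fun M' => M'.cplx dst 0 0 = ((hsNorm A ^ 2 : ℝ) : ℂ)) := by
  refine Runs.seq (Runs.fillMat (n := n) (n' := 1) (τ := n * 3 + 3) (fun x _ =>
    ∑ z ∈ Finset.range n, M.cplx src x z * star (M.cplx src x z)) (by decide) rfl rfl rfl
    (fun M' h' => (h'.reg 0 4 rfl).trans hn) (fun _ _ => rfl) ?_) fun M₁ h₁ hrow => ?_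
  · intro x _ y _ M₁ h₁ hx _
    have hsrc : ∀ i j, M₁.cplx src i j = M.cplx src i j := fun i j =>
      h₁.name src (by simp [fillMat, sumC, forLoop, Program.keepsName, IntExpr.avoids,
        h30.symm, h31.symm]) i j
    refine Runs.imp (Runs.sumC (n := n) (fun z => M.cplx src x z * star (M.cplx src x z))
      (fun M' h' => (h'.reg 0 4 rfl).trans ((h₁.reg 0 4 rfl).trans hn)) ?_) le_rfl fun _ _ h => h
    intro z _ M₂ h₂ hz
    have hsrc₂ : ∀ i j, M₂.cplx src i j = M.cplx src i j := fun i j =>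
      (h₂.name src (by simp [sumC, forLoop, Program.keepsName, IntExpr.avoids,
        h30.symm]) i j).trans (hsrc i j)
    simp only [CplxExpr.eval, IntExpr.eval, hz, h₂.reg 0 7 rfl, hx, hsrc₂]
  · refine Runs.imp (Runs.sumC (n := n) (fun x => ∑ z ∈ Finset.range n, M.cplx src x z *
      star (M.cplx src x z)) (fun M' h' => (h'.reg 0 4 (by
        simp [sumC, forLoop, Program.keepsReg, IntExpr.avoids])).trans
        ((h₁.reg 0 4 rfl).trans hn)) ?_) le_rfl fun M' _ h' => ?_
    · intro x hx M₂ h₂ hx₂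
      have h31₂ := h₂.name 31 (by simp [sumC, forLoop, Program.keepsName, IntExpr.avoids, hdst]) x 0
      simp only [CplxExpr.eval, IntExpr.eval, hx₂, h31₂, hrow x hx 0 one_pos]
    · rw [h', hsNorm_sq, Finset.sum_range]
      push_cast
      refine Finset.sum_congr rfl fun i _ => ?_
      rw [Finset.sum_range]
      refine Finset.sum_congr rfl fun j _ => ?_
      rw [cplx_eq_of_readOp hA, Complex.star_def, Complex.mul_conj']

theorem runs_progDecaying {M : Mem} {D : JordanDecomposition I.chain.matrixRep}
    (h : Analysed I D M) :
    Runs JD I progDecaying M (d * d * (d * d * (1 + 3) + 4) + 2)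
      (fun M' => M'.readOp (d * d) 13 = D.decayingPart) := by
  have hT := h.decomposed
  refine Runs.imp (Runs.fillMat (n := d * d) (n' := d * d) (τ := 1)
    (fun x y => ((1 - M.int 5 x : ℕ) : ℂ) * M.cplx 4 x y) (by decide) rfl rfl rfl
    (fun M' h' => (hT.sameOff h' rfl rfl).index.square)
    (fun M' h' => (hT.sameOff h' rfl rfl).index.square) ?_) le_rfl fun M' _ h' => ?_
  · intro x _ y _ M₁ h₁ hx hy
    refine Runs.skip ?_
    simp [CplxExpr.eval, IntExpr.eval, hx, hy, h₁.name 4 rfl, h₁.row 5 rfl]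
  · ext x y
    refine (h' x x.2 y y.2).trans ?_
    rw [h.flags, one_sub_ind, cplx_eq_of_readOp hT.J, JordanDecomposition.decayingPart, of_apply]
    have hle := (I.chain.powerBounded D).le_one x
    by_cases h1 : ‖D.J x x‖ = 1
    · rw [ind_neg (not_not.2 h1), if_neg (by rw [h1]; exact lt_irrefl _)]; simp
    · rw [ind_pos h1, if_pos (lt_of_le_of_ne hle h1)]; simp

theorem runs_progPowers {M : Mem} {n : ℕ} {J : Op n} (hn : M.int 0 4 = n)
    (hn2 : M.int 0 21 = 2 * n) (hJ : M.readOp n 13 = J) :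
    Runs JD I progPowers M (n * (n * (1 + 3) + 4) + 2 +
      (2 * n * ((n * (1 * (n * 3 + 3 + 3) + 4) + 2 +
      (n * 3 + 3) + (1 + (n * (n * (n * 3 + 3 + 3) + 4) + 2 + (n * (n * (1 + 3) + 4) + 2)))) + 2) +
        2))
      (fun M' => ∀ k < 2 * n, M'.cplx 16 k 0 = sqNorm J k) := by
  refine Runs.seq (Runs.fillMat (n := n) (n' := n) (τ := 1)
    (fun x y => ((ind (x = y) : ℕ) : ℂ)) (by decide) rfl rfl rfl
    (fun M' h' => (h'.reg 0 4 rfl).trans hn) (fun M' h' => (h'.reg 0 4 rfl).trans hn) ?_)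
    fun M₁ h₁ hid => ?_
  · intro x _ y _ M₁ h₁ hx hy
    refine Runs.skip ?_
    rw [CplxExpr.eval, IntExpr.eval_eq (a := x) (b := y)]
    · simpa [IntExpr.eval] using hx
    · simpa [IntExpr.eval] using hy
  have hn₁ := (h₁.reg 0 4 rfl).trans hn
  have hJ₁ := (h₁.readOp n 13 rfl).trans hJ
  refine Runs.imp (Runs.forLoop (n := 2 * n) (fun k M' => M'.readOp n 14 = J ^ k ∧
    ∀ i < k, M'.cplx 16 i 0 = sqNorm J i) rfl
    (fun M' h' => (h'.reg 0 21 rfl).trans ((h₁.reg 0 21 rfl).trans hn2)) ⟨?_, by simp⟩ ?_) le_rfl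
    fun M' _ h' => h'.1.2
  · rw [setInt_readOp]
    ext x y
    refine (hid x x.2 y y.2).trans ?_
    by_cases hxy : x = y
    · subst hxy; simp [ind]
    · rw [ind_neg (fun h => hxy (Fin.ext h))]; simp [one_apply_ne hxy]
  · rintro k hk M₂ h₂ hk₂ ⟨hpow, hf⟩
    have hn₂ := (h₂.reg 0 4 rfl).trans hn₁
    have hJ₂ := (h₂.readOp n 13 rfl).trans hJ₁
    refine Runs.seq (runs_progNormSq hn₂ hpow (by decide) (by decide) (by decide)) fun M₃ h₃ hsq =>
      ?_
    refine Runs.seq (Q := fun M' => ∀ i < k + 1, M'.cplx 16 i 0 = sqNorm J i) (Runs.setCplx ?_)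
      fun M₄ h₄ hf₄ => ?_
    · intro i hi
      have hk₃ : M₃.int 0 16 = k := (h₃.reg 0 16 rfl).trans hk₂
      simp only [IntExpr.eval, CplxExpr.eval, setCplx_cplx, hk₃, hsq, true_and, and_true]
      rcases Nat.lt_succ_iff_lt_or_eq.1 hi with hi | rfl
      · rw [if_neg hi.ne, h₃.name 16 rfl, hf i hi]
      · rw [if_pos rfl, sqNorm_eq]
    have hn₄ : M₄.int 0 4 = n := (h₄.reg 0 4 rfl).trans ((h₃.reg 0 4 rfl).trans hn₂)
    have hp₄ : M₄.readOp n 14 = J ^ k :=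
      (h₄.readOp n 14 rfl).trans ((h₃.readOp n 14 rfl).trans hpow)
    have hJ₄ : M₄.readOp n 13 = J :=
      (h₄.readOp n 13 rfl).trans ((h₃.readOp n 13 rfl).trans hJ₂)
    refine Runs.seq (Runs.fillMat (n := n) (n' := n) (τ := n * 3 + 3)
      (fun x y => ∑ z ∈ Finset.range n, M₄.cplx 14 x z * M₄.cplx 13 z y)
      (by decide) rfl rfl rfl (fun M' h' => (h'.reg 0 4 rfl).trans hn₄)
      (fun M' h' => (h'.reg 0 4 rfl).trans hn₄) ?_) fun M₅ h₅ hprod => ?_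
    · intro x _ y _ M₅ h₅ hx hy
      refine Runs.imp (Runs.sumC (n := n) (fun z => M₄.cplx 14 x z * M₄.cplx 13 z y)
        (fun M' h' => (h'.reg 0 4 rfl).trans ((h₅.reg 0 4 rfl).trans hn₄)) ?_) le_rfl fun _ _ h => h
      intro z _ M₆ h₆ hz
      simp only [CplxExpr.eval, IntExpr.eval, hz, h₆.reg 0 7 rfl, h₆.reg 0 8 rfl, hx, hy,
        h₆.name 14 rfl, h₅.name 14 rfl, h₆.name 13 rfl, h₅.name 13 rfl]
    have hn₅ := (h₅.reg 0 4 rfl).trans hn₄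
    refine Runs.imp (Runs.fillMat (n := n) (n' := n) (τ := 1)
      (fun x y => M₅.cplx 15 x y) (by decide) rfl rfl rfl (fun M' h' => (h'.reg 0 4 rfl).trans hn₅)
      (fun M' h' => (h'.reg 0 4 rfl).trans hn₅) ?_) le_rfl fun M₆ h₆ hcopy => ⟨?_, ?_⟩
    · intro x _ y _ M₆ h₆ hx hy
      refine Runs.skip ?_
      simp [CplxExpr.eval, IntExpr.eval, hx, hy, h₆.name 15 rfl]
    · rw [setInt_readOp]
      ext x y
      refine (hcopy x x.2 y y.2).trans ((hprod x x.2 y y.2).trans ?_)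
      rw [pow_succ, mul_apply, Finset.sum_range]
      refine Finset.sum_congr rfl fun z _ => ?_
      rw [cplx_eq_of_readOp hp₄, cplx_eq_of_readOp hJ₄]
    · intro i hi
      rw [setInt_cplx, h₆.name 16 rfl, h₅.name 16 rfl, hf₄ i hi]

section Coefficients

open Polynomial

theorem coeff_mul_X_sub_C_sq (q : ℂ[X]) (z : ℂ) (j : ℕ) : (q * (X - C z) ^ 2).coeff j =
    (if 2 ≤ j then q.coeff (j - 2) else 0) - 2 * z * (if 1 ≤ j then q.coeff (j - 1) else 0) +
      z * z * q.coeff j := by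
  have h : q * (X - C z) ^ 2 = q * X ^ 2 - C (2 * z) * (q * X) + C (z * z) * q := by
    simp only [map_mul, map_ofNat]; ring
  rw [h, coeff_add, coeff_sub, coeff_C_mul, coeff_C_mul, coeff_mul_X_pow']
  congr 3
  rcases j with _ | j
  · simp
  · simp

theorem runs_progPoly {M : Mem} {n : ℕ} {J : Op n} (hn : M.int 0 4 = n)
    (hn2 : M.int 0 21 = 2 * n) (hJ : M.readOp n 13 = J) :
    Runs JD I progPoly M ((n + 1) * (2 * n * (2 + 3) + 4) + 2)
      (fun M' => ∀ j < 2 * n, M'.cplx 17 n j = (normPoly J).coeff j) := by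
  set μ : ℕ → ℂ := fun z => M.cplx 13 z z * star (M.cplx 13 z z) with hμ
  set q : ℕ → ℂ[X] := fun i => ∏ z ∈ Finset.range i, (X - C (μ z)) ^ 2 with hq
  refine Runs.imp (Runs.fillMat_rec (n := n + 1) (n' := 2 * n) (τ := 2)
    (fun i j => (q i).coeff j) (by decide) rfl rfl rfl
    (fun M' h' => congrArg (· + 1) ((h'.reg 0 4 rfl).trans hn))
    (fun M' h' => (h'.reg 0 21 rfl).trans hn2) ?_) le_rfl fun M' _ h' j hj => ?_
  · intro i hi j hj M₁ h₁ hi₁ hj₁ hrec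
    refine Runs.ite (fun ht => Runs.setCplx ?_) fun ht => Runs.setCplx ?_
    all_goals simp only [Test.Holds, IntExpr.eval, hi₁] at ht
    · obtain ⟨i, rfl⟩ : ∃ i', i = i' + 1 := ⟨i - 1, by omega⟩
      have hr : rootE.eval M₁ = μ i := by
        simp [rootE, CplxExpr.eval, IntExpr.eval, hi₁, h₁.name 13 rfl, hμ]
      have hrec' := hrec i (Nat.lt_succ_self i)
      simp only [CplxExpr.eval, IntExpr.eval, setCplx_cplx, hr, hi₁, hj₁, and_self, if_true,
        Nat.add_sub_cancel, hrec' _ hj, hrec' (j - 1) (by omega), hrec' (j - 2) (by omega)]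
      rw [show q (i + 1) = q i * (X - C (μ i)) ^ 2 from Finset.prod_range_succ _ _,
        coeff_mul_X_sub_C_sq]
      rcases j with _ | _ | j <;> simp
    · obtain rfl : i = 0 := by omega
      simp only [CplxExpr.eval, setCplx_cplx, IntExpr.eval, and_self, if_true, hj₁, ind_eq]
      by_cases h0 : j = 0
      · simp [hq, h0, ind]
      · simp [hq, h0, ind, coeff_one]
  · rw [h' n (Nat.lt_succ_self n) j hj]
    refine congrArg (coeff · j) ?_
    change ∏ z ∈ Finset.range n, (X - C (μ z)) ^ 2 = _
    rw [normPoly, Finset.prod_range]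
    refine Finset.prod_congr rfl fun z _ => ?_
    rw [hμ]
    simp only
    rw [cplx_eq_of_readOp hJ]

end Coefficients

theorem runs_progRecurrence {M : Mem} {n : ℕ} {c : ℕ → ℂ} (hn : M.int 0 4 = n)
    (hn2 : M.int 0 21 = 2 * n) (hc : ∀ j < 2 * n, M.cplx 17 n j = c j) :
    Runs JD I progRecurrence M (n * (2 * n * (2 + 3) + 4) + 2 + (n * (n * (1 + 3) + 4) + 2))
      (fun M' => (∀ i < n, ∀ j < n, M'.cplx 19 i j = recCoeff (2 * n) (fun j => -c j) i j) ∧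
        ∀ i < n, ∀ j < n, M'.cplx 20 i j = recCoeff (2 * n) (fun j => -c j) i (n + j)) := by
  refine Runs.seq (Runs.fillMat_rec (n := n) (n' := 2 * n) (τ := 2)
    (fun i j => recCoeff (2 * n) (fun j => -c j) i j) (by decide) rfl rfl rfl
    (fun M' h' => (h'.reg 0 4 rfl).trans hn)
    (fun M' h' => (h'.reg 0 21 rfl).trans hn2) ?_) fun M₁ h₁ h19 => ?_
  · intro i hi j hj M₁ h₁ hi₁ hj₁ hrec
    have hr : recE.eval M₁ = -c j := by
      simp [recE, CplxExpr.eval, IntExpr.eval, hj₁, h₁.reg 0 4 rfl, hn, h₁.name 17 rfl, hc j hj]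
    refine Runs.ite (fun ht => Runs.setCplx ?_) fun ht => Runs.setCplx ?_
    all_goals simp only [Test.Holds, IntExpr.eval, hi₁] at ht
    · obtain ⟨i, rfl⟩ : ∃ i', i = i' + 1 := ⟨i - 1, by omega⟩
      have hrec' := hrec i (Nat.lt_succ_self i)
      simp only [CplxExpr.eval, IntExpr.eval, setCplx_cplx, hr, hi₁, hj₁, and_self, if_true,
        Nat.add_sub_cancel, h₁.reg 0 21 rfl, hn2, hrec' (2 * n - 1) (by omega),
        hrec' (j - 1) (by omega), recCoeff]
      rcases j with _ | j <;> simp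
    · obtain rfl : i = 0 := by omega
      simp only [CplxExpr.eval, setCplx_cplx, IntExpr.eval, and_self, if_true, hr, recCoeff]
  · have hn₁ := (h₁.reg 0 4 rfl).trans hn
    refine Runs.imp (Runs.fillMat (n := n) (n' := n) (τ := 1)
      (fun i j => recCoeff (2 * n) (fun j => -c j) i (n + j)) (by decide) rfl rfl rfl
      (fun M' h' => (h'.reg 0 4 rfl).trans hn₁)
      (fun M' h' => (h'.reg 0 4 rfl).trans hn₁) ?_) le_rfl fun M' h' h20 =>
        ⟨fun i hi j hj => (h'.name 19 rfl i j).trans (h19 i hi j (by omega)), h20⟩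
    intro i hi j hj M₂ h₂ hi₂ hj₂
    refine Runs.skip ?_
    simp [CplxExpr.eval, IntExpr.eval, hi₂, hj₂, h₂.reg 0 4 rfl, hn₁, h₂.name 19 rfl,
      h19 i hi (n + j) (by omega)]

end

/-! ### The next squared norms -/

/-- The next `d ^ 2` squared norms: the recurrence is applied to the last `2 d ^ 2` of them, read as
two operators. -/
def progBatch : Program :=
  .seq (fillMat 23 7 (iv 0) 8 (iv 0) skip
    (ca 16 (.add (.sub (iv 24) (iv 21)) (.add (ia 2 (iv 7)) (iv 8))) (.const 0)))
  (.seq (fillMat 24 7 (iv 0) 8 (iv 0) skip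
    (ca 16 (.add (.sub (iv 24) (iv 4)) (.add (ia 2 (iv 7)) (iv 8))) (.const 0)))
  (.seq (.apply (.const 19) (.const 23) (.const 25))
    (.seq (.apply (.const 20) (.const 24) (.const 26))
  (.seq (forLoop 7 (iv 4) (setC 16 (.add (iv 24) (iv 7)) (.const 0)
    (.add (ca 25 (ia 3 (iv 7)) (ia 4 (iv 7))) (ca 26 (ia 3 (iv 7)) (ia 4 (iv 7))))))
    (setS 24 (.add (iv 24) (iv 4)))))))

/-- The square of the decay bound for the exponent in the scalar `23`. -/
def boundE : CplxExpr :=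
  .mul (.mul (ca 32 (.const 0) (.const 0)) (ca 33 (.const 0) (.const 0))) (ca 16 (iv 23) (.const 0))

/-- One step of the search: the candidate in the scalar `3` is replaced by `s + 1` if the decay
bound for the exponent `s`, in the scalar `23`, is not small. -/
def progScanStep : Program :=
  .seq (.ite (.intLe (iv 24) (iv 23)) progBatch skip)
  (.seq (.ite (.reLe (.mul (ca 0 (.const 0) (.const 0)) (ca 0 (.const 0) (.const 0))) boundE)
      (setS 3 (.add (iv 23) (.const 1)))
      (.ite (.reLe (.ofInt (.const 1)) boundE) (setS 3 (.add (iv 23) (.const 1))) skip))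
    (setS 23 (.add (iv 23) (.const 1))))

/-- The search for the truncation number: the next exponent `s` is examined until `s` is at least
twice the candidate. -/
def progScan : Program :=
  .while (.intLe (.add (iv 23) (.const 1)) (.add (iv 3) (iv 3))) progScanStep

/-- The tables for the search. -/
def progSetup : Program :=
  .seq progDecaying (.seq (setS 21 (.add (iv 4) (iv 4))) (.seq progPowers (.seq progPoly
    (.seq progRecurrence (.seq (progNormSq 3 32) (.seq (progNormSq 5 33)
      (.seq (setS 23 (.const 1)) (.seq (setS 3 (.const 1)) (setS 24 (iv 21))))))))))

/-- `int 0 3 := K^ε`. -/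
def progTruncation : Program := .seq progSetup progScan

section

variable {JD : JordanProcedure} {d m : ℕ} {I : Instance d m}
  {D : JordanDecomposition I.chain.matrixRep}

/-- The constant part of the memory during the search. -/
structure ScanTables (I : Instance d m) (D : JordanDecomposition I.chain.matrixRep) (M : Mem) :
    Prop where
  index : IndexTables d M
  order : M.int 0 21 = 2 * (d * d)
  low : ∀ i < d * d, ∀ j < d * d,
    M.cplx 19 i j = recCoeff (2 * (d * d)) (fun j => -(normPoly D.decayingPart).coeff j) i j
  high : ∀ i < d * d, ∀ j < d * d, M.cplx 20 i j =
    recCoeff (2 * (d * d)) (fun j => -(normPoly D.decayingPart).coeff j) i (d * d + j)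
  precision : M.cplx 0 0 0 = I.ε
  left : M.cplx 32 0 0 = ((hsNorm D.S ^ 2 : ℝ) : ℂ)
  right : M.cplx 33 0 0 = ((hsNorm D.S⁻¹ ^ 2 : ℝ) : ℂ)

theorem ScanTables.sameOff {M M' : Mem} {P : Program} (h : ScanTables I D M) (hP : SameOff P M M')
    (hk : (P.keepsReg 0 0 && (P.keepsReg 0 4 && (P.keepsRow 2 && (P.keepsRow 3 && P.keepsRow 4)))) =
      true)
    (hk' : (P.keepsReg 0 21 && (P.keepsName 19 && (P.keepsName 20 && (P.keepsName 0 &&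
      (P.keepsName 32 && P.keepsName 33))))) = true) : ScanTables I D M' := by
  simp only [Bool.and_eq_true] at hk'
  obtain ⟨h21, h19, h20, h0, h32, h33⟩ := hk'
  exact ⟨h.index.sameOff hP hk, (hP.reg _ _ h21).trans h.order,
    fun i hi j hj => (hP.name _ h19 i j).trans (h.low i hi j hj),
    fun i hi j hj => (hP.name _ h20 i j).trans (h.high i hi j hj),
    (hP.name _ h0 0 0).trans h.precision, (hP.name _ h32 0 0).trans h.left,
    (hP.name _ h33 0 0).trans h.right⟩

theorem applyRep_div_mod {M : Mem} {a b c : ℕ} {M' : Mem}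
    (h : M'.readOp d c = applyRep (M.readOp (d * d) a) (M.readOp d b)) {x : ℕ} (hx : x < d * d) :
    M'.cplx c (x / d) (x % d) =
      ∑ y ∈ Finset.range (d * d), M.cplx a x y * M.cplx b (y / d) (y % d) := by
  have h1 := congrFun (congrArg vectorize h) ⟨x, hx⟩
  rw [vectorize_applyRep, vectorize_eq_cplx rfl] at h1
  rw [h1, mulVec, dotProduct, Finset.sum_range]
  rfl

theorem runs_progBatch {M : Mem} {H : ℕ} (h : ScanTables I D M) (hH : M.int 0 24 = H)
    (h2 : 2 * (d * d) ≤ H) (hf : ∀ k < H, M.cplx 16 k 0 = sqNorm D.decayingPart k) :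
    Runs JD I progBatch M (28 * (d * d)) (fun M' => M'.int 0 24 = H + d * d ∧
      ∀ k < H + d * d, M'.cplx 16 k 0 = sqNorm D.decayingPart k) := by
  have hd := I.chain.dim_pos
  set f := sqNorm D.decayingPart with hf_def
  set r : ℕ → ℂ := fun j => -(normPoly D.decayingPart).coeff j with hr
  have hsq : ∀ i < d, ∀ j < d, i * d + j < d * d := fun i hi j hj => by
    have : (i + 1) * d ≤ d * d := Nat.mul_le_mul_right d hi
    rw [Nat.add_mul] at this; omega
  have hdm : ∀ x < d * d, x / d < d ∧ x % d < d ∧ x / d * d + x % d = x := fun x hx =>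
    ⟨(Nat.div_lt_iff_lt_mul hd).2 hx, Nat.mod_lt _ hd, Nat.div_add_mod' x d⟩
  have htime : d * (d * (1 + 3) + 4) + 2 + (d * (d * (1 + 3) + 4) + 2 + (1 + (1 +
      (d * d * (1 + 2) + 2 + 1)))) ≤ 28 * (d * d) := by
    nlinarith
  refine Runs.imp (Q := fun M' => M'.int 0 24 = H + d * d ∧
      ∀ k < H + d * d, M'.cplx 16 k 0 = f k) ?_ htime fun _ _ h => h
  refine Runs.seq (Runs.fillMat (n := d) (n' := d) (τ := 1)
    (fun i j => f (H - 2 * (d * d) + (i * d + j))) (by decide) rfl rfl rfl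
    (fun M' h' => (h.sameOff h' rfl rfl).index.dim)
    (fun M' h' => (h.sameOff h' rfl rfl).index.dim) ?_) fun M₁ h₁ h23 => ?_
  · intro i hi j hj M₁ h₁ hi₁ hj₁
    have hs := h.sameOff h₁ rfl rfl
    have := hsq i hi j hj
    refine Runs.skip ?_
    simp only [CplxExpr.eval, IntExpr.eval, setInt_int, setInt_cplx, Nat.reduceEqDiff, and_false,
      OfNat.ofNat_ne_zero, false_and, if_false, hi₁, hj₁, h₁.reg 0 24 rfl, hH, hs.order,
      hs.index.mul i hi, h₁.name 16 rfl]
    exact hf _ (by omega)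
  have hs₁ := h.sameOff h₁ rfl rfl
  refine Runs.seq (Runs.fillMat (n := d) (n' := d) (τ := 1)
    (fun i j => f (H - d * d + (i * d + j))) (by decide) rfl rfl rfl
    (fun M' h' => (hs₁.sameOff h' rfl rfl).index.dim)
    (fun M' h' => (hs₁.sameOff h' rfl rfl).index.dim) ?_) fun M₂ h₂ h24 => ?_
  · intro i hi j hj M₂ h₂ hi₂ hj₂
    have hs := hs₁.sameOff h₂ rfl rfl
    have := hsq i hi j hj
    refine Runs.skip ?_
    simp only [CplxExpr.eval, IntExpr.eval, setInt_int, setInt_cplx, Nat.reduceEqDiff, and_false,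
      OfNat.ofNat_ne_zero, false_and, if_false, hi₂, hj₂, h₂.reg 0 24 rfl, h₁.reg 0 24 rfl, hH,
      hs.index.square, hs.index.mul i hi, h₂.name 16 rfl, h₁.name 16 rfl]
    exact hf _ (by omega)
  have hs₂ := hs₁.sameOff h₂ rfl rfl
  refine Runs.seq (Q := fun M' => M'.readOp d 25 =
    applyRep (M₂.readOp (d * d) 19) (M₂.readOp d 23)) (Runs.apply (readOp_writeOp _ _ _))
    fun M₃ h₃ h25 => ?_
  have hs₃ := hs₂.sameOff h₃ rfl rfl
  refine Runs.seq (Q := fun M' => M'.readOp d 26 =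
    applyRep (M₃.readOp (d * d) 20) (M₃.readOp d 24)) (Runs.apply (readOp_writeOp _ _ _))
    fun M₄ h₄ h26 => ?_
  have hs₄ := hs₃.sameOff h₄ rfl rfl
  have hval : ∀ x < d * d, M₄.cplx 25 (x / d) (x % d) + M₄.cplx 26 (x / d) (x % d) = f (H + x) := by
    intro x hx
    have hrec := recCoeff_spec (N := 2 * (d * d)) (by positivity) (r := r) (x := f)
      (fun k => D.isJordanForm_decayingPart.sqNorm_recurrence k) x (H - 2 * (d * d))
    rw [show H - 2 * (d * d) + 2 * (d * d) + x = H + x by omega] at hrec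
    rw [hrec, two_mul (d * d), Finset.sum_range_add, ← two_mul, h₄.name 25 rfl,
      applyRep_div_mod h25 hx, applyRep_div_mod h26 hx]
    congr 1
    · refine Finset.sum_congr rfl fun y hy => ?_
      have hy := Finset.mem_range.1 hy
      obtain ⟨e1, e2, e3⟩ := hdm y hy
      rw [hs₂.low x hx y hy, h₂.name 23 rfl, h23 _ e1 _ e2, e3]
    · refine Finset.sum_congr rfl fun y hy => ?_
      have hy := Finset.mem_range.1 hy
      obtain ⟨e1, e2, e3⟩ := hdm y hy
      rw [hs₃.high x hx y hy, h₃.name 24 rfl, h24 _ e1 _ e2, e3]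
      congr 2
      omega
  have hH₄ : M₄.int 0 24 = H := by
    rw [h₄.reg 0 24 rfl, h₃.reg 0 24 rfl, h₂.reg 0 24 rfl, h₁.reg 0 24 rfl, hH]
  refine Runs.seq (Runs.forLoop (n := d * d) (τ := 1)
    (fun x M' => ∀ k < H + x, M'.cplx 16 k 0 = f k) rfl
    (fun M' h' => (hs₄.sameOff h' rfl rfl).index.square) ?_ ?_) fun M₅ h₅ hf₅ => Runs.setInt ?_
  · intro k hk
    rw [setInt_cplx, h₄.name 16 rfl, h₃.name 16 rfl, h₂.name 16 rfl, h₁.name 16 rfl]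
    exact hf k hk
  · intro x hx M₅ h₅ hx₅ hI
    have hs₅ := hs₄.sameOff h₅ rfl rfl
    refine Runs.setCplx fun k hk => ?_
    simp only [IntExpr.eval, CplxExpr.eval, setInt_cplx, setCplx_cplx, h₅.reg 0 24 rfl, hH₄, hx₅,
      true_and, and_true, hs₅.index.div x hx, hs₅.index.mod x hx, h₅.name 25 rfl, h₅.name 26 rfl,
      hval x hx]
    by_cases hkx : k = H + x
    · rw [if_pos hkx, hkx]
    · rw [if_neg hkx, hI k (by omega)]
  · refine ⟨?_, fun k hk => hf₅.1 k hk⟩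
    simp [IntExpr.eval, h₅.reg 0 24 rfl, hH₄, (hs₄.sameOff h₅ rfl rfl).index.square]

end

/-! ### The search for the truncation number -/

section

variable {JD : JordanProcedure} {d m : ℕ} {I : Instance d m}
  {D : JordanDecomposition I.chain.matrixRep}

theorem eval_boundE {M : Mem} (h : ScanTables I D M) {s : ℕ} (hs : M.int 0 23 = s)
    (hf : M.cplx 16 s 0 = sqNorm D.decayingPart s) :
    boundE.eval M = ((D.decayBound s ^ 2 : ℝ) : ℂ) := by
  simp only [boundE, CplxExpr.eval, IntExpr.eval, hs, h.left, h.right, hf, sqNorm_eq,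
    JordanDecomposition.decayBound, mul_pow]
  push_cast
  ring

/-- The state of the search: the squared norms are known below `H`, the exponents below `s`
have been examined, and `K` is the candidate. -/
structure ScanState (I : Instance d m) (D : JordanDecomposition I.chain.matrixRep) (M : Mem)
    (H s K : ℕ) : Prop where
  tables : ScanTables I D M
  known : M.int 0 24 = H
  next : M.int 0 23 = s
  candidate : M.int 0 3 = K
  two_le : 2 * (d * d) ≤ H
  norms : ∀ k < H, M.cplx 16 k 0 = sqNorm D.decayingPart k
  pos : 0 < K
  le_next : K ≤ s
  next_le : s ≤ H
  le_truncation : K ≤ D.truncation I.ε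
  small : ∀ k, K ≤ k → k < s → D.decayBound k < min I.ε 1

/-- A step takes constant time, except that all known squared norms may be used up; then the next
`d ^ 2` of them are computed, at a cost of `28` for each. -/
theorem runs_progScanStep {M : Mem} {H s K : ℕ} (h : ScanState I D M H s K) :
    ∃ H' T, (H' = H ∧ T = 8 ∨ H = s ∧ H' = H + d * d ∧ T = 28 * (d * d) + 8) ∧
      Runs JD I progScanStep M T (fun M' => ∃ K', ScanState I D M' H' (s + 1) K') := by
  have hfirst : ∃ H' T, (H' = H ∧ T = 4 ∨ H = s ∧ H' = H + d * d ∧ T = 28 * (d * d) + 4) ∧ s < H' ∧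
      Runs JD I (.ite (.intLe (iv 24) (iv 23)) progBatch skip) M T (fun M' =>
        ScanState I D M' H' s K) := by
    by_cases hHs : H ≤ s
    · have hHs' : H = s := le_antisymm hHs h.next_le
      have hd : 0 < d * d := Nat.mul_pos I.chain.dim_pos I.chain.dim_pos
      refine ⟨H + d * d, 28 * (d * d) + 4, Or.inr ⟨hHs', rfl, rfl⟩, by omega, ?_⟩
      refine Runs.imp (Runs.ite (fun _ =>
        Runs.imp (runs_progBatch h.tables h.known h.two_le h.norms)
        le_rfl fun M' h' hM' => ?_) fun ht => absurd ?_ ht) (by omega) fun _ _ h => h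
      · exact ⟨h.tables.sameOff h' rfl rfl, hM'.1, (h'.reg 0 23 rfl).trans h.next,
          (h'.reg 0 3 rfl).trans h.candidate, by have := h.two_le; omega, hM'.2, h.pos, h.le_next,
          by omega, h.le_truncation, h.small⟩
      · simpa [Test.Holds, IntExpr.eval, h.known, h.next] using hHs
    · refine ⟨H, 4, Or.inl ⟨rfl, rfl⟩, by omega, ?_⟩
      refine Runs.imp (T := 2) (Runs.ite (fun ht => absurd ?_ hHs) fun _ => Runs.imp
        (Runs.skip (Q := fun _ => True) trivial) le_rfl fun M' h' _ => ?_) (by omega) fun _ _ h => h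
      · simpa [Test.Holds, IntExpr.eval, h.known, h.next] using ht
      · exact ⟨h.tables.sameOff h' rfl rfl, (h'.reg 0 24 rfl).trans h.known,
          (h'.reg 0 23 rfl).trans h.next, (h'.reg 0 3 rfl).trans h.candidate, h.two_le,
          fun k hk => (h'.name 16 rfl k 0).trans (h.norms k hk), h.pos, h.le_next, h.next_le,
          h.le_truncation, h.small⟩
  obtain ⟨H', T, hcase, hsH, hrun⟩ := hfirst
  refine ⟨H', T + 4, by omega, ?_⟩
  refine Runs.seq (T' := 4) hrun fun M₁ h₁ hS => ?_
  have hε := I.ε_pos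
  have hb := D.decayBound_nonneg s
  have hval := eval_boundE hS.tables hS.next (hS.norms s hsH)
  -- The remaining part either keeps the candidate, if the bound is small, or moves it past `s`.
  have hkeep : ∀ M', SameOff (.seq (.ite (.reLe (.mul (ca 0 (.const 0) (.const 0))
      (ca 0 (.const 0) (.const 0))) boundE) (setS 3 (.add (iv 23) (.const 1)))
      (.ite (.reLe (.ofInt (.const 1)) boundE) (setS 3 (.add (iv 23) (.const 1))) skip))
    (setS 23 (.add (iv 23) (.const 1)))) M₁ M' → ∀ K', M'.int 0 3 = K' → M'.int 0 23 = s + 1 →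
      (K' = K ∧ D.decayBound s < min I.ε 1 ∨ K' = s + 1 ∧ min I.ε 1 ≤ D.decayBound s) →
      ScanState I D M' H' (s + 1) K' := by
    intro M' h' K' hK' hs' hc
    refine ⟨hS.tables.sameOff h' rfl rfl, (h'.reg 0 24 rfl).trans hS.known, hs', hK', hS.two_le,
      fun k hk => (h'.name 16 rfl k 0).trans (hS.norms k hk), ?_, ?_, by omega, ?_, ?_⟩
    · have := hS.pos; omega
    · have := hS.le_next; omega
    · rcases hc with ⟨rfl, -⟩ | ⟨rfl, hc⟩
      · exact hS.le_truncation
      · by_contra hlt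
        exact absurd ((D.truncation_spec hε).2 s (by omega)) (not_lt.2 hc)
    · intro k hk hk'
      rcases hc with ⟨rfl, hc⟩ | ⟨rfl, hc⟩
      · rcases Nat.lt_succ_iff_lt_or_eq.1 hk' with h1 | rfl
        · exact hS.small k hk h1
        · exact hc
      · omega
  refine Runs.imp (Q := fun M' => M'.int 0 23 = s + 1 ∧
    (M'.int 0 3 = K ∧ D.decayBound s < min I.ε 1 ∨ M'.int 0 3 = s + 1 ∧
      min I.ε 1 ≤ D.decayBound s)) (Runs.seq (T := 3) (T' := 1) (Q := fun M' =>
    (M'.int 0 3 = K ∧ D.decayBound s < min I.ε 1 ∨ M'.int 0 3 = s + 1 ∧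
      min I.ε 1 ≤ D.decayBound s)) (Runs.imp (T := 2 + 1)
        (Runs.ite (fun ht => ?_) fun ht => ?_) le_rfl
      fun _ _ h => h) fun M₂ h₂ hM₂ => Runs.setInt ⟨?_, ?_⟩) le_rfl
      fun M' h' hM' => ⟨_, hkeep M' h' _ rfl hM'.1 hM'.2⟩
  · refine Runs.imp (Runs.setInt (Q := fun M' => M'.int 0 3 = s + 1) ?_) (by omega)
      fun M' _ h' => Or.inr ⟨h', ?_⟩
    · simp [IntExpr.eval, hS.next]
    · simp only [Test.Holds, CplxExpr.eval, IntExpr.eval, hval, hS.tables.precision] at ht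
      rw [← Complex.ofReal_mul, Complex.ofReal_re, Complex.ofReal_re] at ht
      exact (min_le_left _ _).trans (by nlinarith)
  · refine Runs.ite (fun ht' => ?_) fun ht' => ?_
    · refine Runs.imp (Runs.setInt (Q := fun M' => M'.int 0 3 = s + 1) ?_) le_rfl
        fun M' _ h' => Or.inr ⟨h', ?_⟩
      · simp [IntExpr.eval, hS.next]
      · simp only [Test.Holds, CplxExpr.eval, IntExpr.eval, hval] at ht'
        rw [Nat.cast_one, Complex.one_re, Complex.ofReal_re] at ht'
        exact (min_le_right _ _).trans (by nlinarith)
    · refine Runs.imp (Runs.skip (Q := fun M' => M'.int 0 3 = K) ?_) le_rfl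
        fun M' _ h' => Or.inl ⟨h', ?_⟩
      · simpa using hS.candidate
      · simp only [Test.Holds, CplxExpr.eval, IntExpr.eval, hval, hS.tables.precision] at ht ht'
        rw [← Complex.ofReal_mul, Complex.ofReal_re, Complex.ofReal_re] at ht
        rw [Nat.cast_one, Complex.one_re, Complex.ofReal_re] at ht'
        rw [lt_min_iff]
        constructor <;> nlinarith
  · have : M₂.int 0 23 = s := (h₂.reg 0 23 rfl).trans hS.next
    simp [IntExpr.eval, this]
  · simp only [setInt_int, IntExpr.eval, Nat.reduceEqDiff, and_false, if_false]
    exact hM₂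

/-- The potential pays `9` for each exponent below `2 K^ε` and `28` for each squared norm that may
still be computed; these are at most `2 K^ε`, since new ones are computed only if `H = s`. -/
theorem runs_progScan {M : Mem} (h : ScanState I D M (2 * (d * d)) 1 1) :
    Runs JD I progScan M (80 * D.truncation I.ε + 1) (fun M' =>
      M'.int 0 3 = D.truncation I.ε) := by
  set t := D.truncation I.ε with ht
  have ht0 := (D.truncation_spec I.ε_pos).1
  refine Runs.imp (Runs.while (fun M' => ∃ H s K, ScanState I D M' H s K ∧ s ≤ 2 * t)
    (fun M' => (2 * t - M'.int 0 23) * 7 + (2 * t - M'.int 0 23) * 2 +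
      (2 * t + 2 * (d * d) - M'.int 0 24) * 28)
    (Q := fun M' => M'.int 0 3 = t) ?_ ?_ ⟨_, _, _, h, by omega⟩) ?_ fun _ _ h => h
  · rintro M' ⟨H, s, K, hS, -⟩ hb
    simp only [Test.Holds, IntExpr.eval, hS.next, hS.candidate] at hb
    rw [hS.candidate]
    refine le_antisymm hS.le_truncation (Nat.sInf_le ⟨hS.pos, ?_⟩)
    exact D.decayBound_lt_of_window (Nat.mul_pos I.chain.dim_pos I.chain.dim_pos) hS.pos
      fun k hk hk' => hS.small k hk (by omega)
  · rintro M' ⟨H, s, K, hS, hs⟩ hb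
    simp only [Test.Holds, IntExpr.eval, hS.next, hS.candidate] at hb
    have hK := hS.le_truncation
    obtain ⟨H', T, hcase, hrun⟩ := runs_progScanStep (JD := JD) hS
    refine ⟨T, Runs.imp hrun le_rfl fun M'' _ ⟨K', hS'⟩ => ⟨⟨_, _, _, hS', by omega⟩, ?_⟩⟩
    rw [hS'.next, hS'.known, hS.next, hS.known]
    have := hS.two_le
    rcases hcase with ⟨rfl, rfl⟩ | ⟨rfl, rfl, rfl⟩
    · omega
    · omega
  · rw [h.next, h.known]
    omega

/-- The number of steps of the preparation of the search, for `n = d ^ 2`. -/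
def setupTime (n : ℕ) : ℕ :=
  n * (n * (1 + 3) + 4) + 2 + (1 +
    (n * (n * (1 + 3) + 4) + 2 + (2 * n * ((n * (1 * (n * 3 + 3 + 3) + 4)
    + 2 + (n * 3 + 3) + (1 + (n * (n * (n * 3 + 3 + 3) + 4) + 2 + (n * (n * (1 + 3) + 4) + 2)))) +
      2) + 2)
    + ((n + 1) * (2 * n * (2 + 3) + 4) + 2 +
      (n * (2 * n * (2 + 3) + 4) + 2 + (n * (n * (1 + 3) + 4) + 2)
    + (n * (1 * (n * 3 + 3 + 3) + 4) + 2 + (n * 3 + 3) + (n * (1 * (n * 3 + 3 + 3) + 4) + 2 +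
      (n * 3 + 3) + (1 + (1 + 1))))))))

theorem setupTime_le (hd : 0 < d) : setupTime (d * d) ≤ 300 * d ^ 8 := by
  obtain ⟨e, rfl⟩ : ∃ e, d = e + 1 := ⟨d - 1, by omega⟩
  unfold setupTime
  ring_nf
  omega

theorem runs_progSetup {M : Mem} (h : Analysed I D M) :
    Runs JD I progSetup M (setupTime (d * d)) (fun M' => ScanState I D M' (2 * (d * d)) 1 1) := by
  have hd := I.chain.dim_pos
  have hn := h.decomposed.index.square
  refine Runs.seq (runs_progDecaying h) fun M₁ h₁ h13 => ?_
  have hn₁ := (h₁.reg 0 4 rfl).trans hn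
  refine Runs.seq (Q := fun M' => M'.int 0 21 = 2 * (d * d)) (Runs.setInt ?_) fun M₂ h₂ h21 => ?_
  · simp [IntExpr.eval, hn₁, two_mul]
  have hn₂ := (h₂.reg 0 4 rfl).trans hn₁
  have h13₂ := (h₂.readOp (d * d) 13 rfl).trans h13
  refine Runs.seq (runs_progPowers hn₂ h21 h13₂) fun M₃ h₃ hf => ?_
  have hn₃ := (h₃.reg 0 4 rfl).trans hn₂
  have h21₃ := (h₃.reg 0 21 rfl).trans h21
  refine Runs.seq (runs_progPoly hn₃ h21₃ ((h₃.readOp (d * d) 13 rfl).trans h13₂))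
    fun M₄ h₄ hpoly => ?_
  have hn₄ := (h₄.reg 0 4 rfl).trans hn₃
  have h21₄ := (h₄.reg 0 21 rfl).trans h21₃
  refine Runs.seq (runs_progRecurrence hn₄ h21₄ hpoly) fun M₅ h₅ hrec => ?_
  have hn₅ := (h₅.reg 0 4 rfl).trans hn₄
  have hD₅ : Analysed I D M₅ := by
    have hD := ((((h.decomposed.sameOff h₁ rfl rfl).sameOff h₂ rfl rfl).sameOff h₃ rfl rfl).sameOff
      h₄ rfl rfl).sameOff h₅ rfl rfl
    refine ⟨hD, fun z => ?_, ?_⟩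
    · rw [h₅.row 5 rfl, h₄.row 5 rfl, h₃.row 5 rfl, h₂.row 5 rfl, h₁.row 5 rfl, h.flags]
    · rw [h₅.name 0 rfl, h₄.name 0 rfl, h₃.name 0 rfl, h₂.name 0 rfl, h₁.name 0 rfl, h.precision]
  refine Runs.seq (runs_progNormSq hn₅ hD₅.decomposed.S (by decide) (by decide) (by decide))
    fun M₆ h₆ hleft => ?_
  have hD₆ := hD₅.decomposed.sameOff h₆ rfl rfl
  refine Runs.seq (runs_progNormSq hD₆.index.square hD₆.inv (by decide) (by decide) (by decide))
    fun M₇ h₇ hright => ?_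
  have hD₇ := hD₆.sameOff h₇ rfl rfl
  have hT₇ : ScanTables I D M₇ := ⟨hD₇.index,
    by rw [h₇.reg 0 21 rfl, h₆.reg 0 21 rfl, h₅.reg 0 21 rfl, h21₄],
    fun i hi j hj => by rw [h₇.name 19 rfl, h₆.name 19 rfl, hrec.1 i hi j hj],
    fun i hi j hj => by rw [h₇.name 20 rfl, h₆.name 20 rfl, hrec.2 i hi j hj],
    by rw [h₇.name 0 rfl, h₆.name 0 rfl, hD₅.precision],
    by rw [h₇.name 32 rfl, hleft], hright⟩
  refine Runs.seq (Q := fun M' => M'.int 0 23 = 1) (Runs.setInt rfl) fun M₈ h₈ h23 =>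
    Runs.seq (Q := fun M' => M'.int 0 3 = 1) (Runs.setInt rfl) fun M₉ h₉ h3 => ?_
  refine Runs.imp (Runs.setInt (Q := fun M' => M'.int 0 24 = 2 * (d * d)) ?_) le_rfl
    fun M' h' h24 => ?_
  · simp [IntExpr.eval, h₉.reg 0 21 rfl, h₈.reg 0 21 rfl, hT₇.order]
  · refine ⟨((hT₇.sameOff h₈ rfl rfl).sameOff h₉ rfl rfl).sameOff h' rfl rfl, h24, ?_, ?_, le_rfl,
      fun k hk => ?_, one_pos, le_rfl, ?_, (D.truncation_spec I.ε_pos).1, ?_⟩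
    · rw [h'.reg 0 23 rfl, h₉.reg 0 23 rfl, h23]
    · rw [h'.reg 0 3 rfl, h3]
    · rw [h'.name 16 rfl, h₉.name 16 rfl, h₈.name 16 rfl, h₇.name 16 rfl, h₆.name 16 rfl,
        h₅.name 16 rfl, h₄.name 16 rfl, hf k hk]
    · have := Nat.mul_pos hd hd; omega
    · intro k hk hk'; omega

theorem runs_progTruncation {M : Mem} {K : ℕ} (h : Analysed I D M) (hP : Prepared I D K M) :
    Runs JD I progTruncation M (setupTime (d * d) + (80 * D.truncation I.ε + 1))
      (Prepared I D (D.truncation I.ε)) := by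
  refine Runs.imp (Q := fun M' => M'.int 0 3 = D.truncation I.ε)
    (Runs.seq (runs_progSetup h) fun M₁ _ hS => runs_progScan hS) le_rfl fun M' h' h3 => ?_
  exact ⟨(h'.reg 0 0 rfl).trans hP.dim, (h'.reg 0 2 rfl).trans hP.size, h3,
    (h'.reg 0 6 rfl).trans hP.period, fun i hi => (h'.row 1 rfl i).trans (hP.code i hi),
    fun x => (h'.row 14 rfl x).trans (hP.pattern x), (h'.readOp d 1 rfl).trans hP.init,
    (h'.readOp _ 2 rfl).trans hP.rep, (h'.readOp _ 6 rfl).trans hP.stabilizer⟩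

/-- The total number of steps for a truncation number that is searched for; without the search it is
smaller. The constant `1000` is generous: the exponent of `2 ^ s` is `6`, and the coefficients of
`K + p` and of `d ^ 8` are at most `600`. -/
theorem totalTime_le (s K p : ℕ) (hd : 0 < d) {r : ℕ} (hr : r ≤ d ^ 2) (hp : 0 < p) :
    prepareTime d r p + (setupTime (d * d) + (80 * K + 1) +
      decideTime s (2 ^ s) (K + p + 2 ^ s) K p d) ≤ 1000 * (2 ^ (1000 * s) * (K + p) + d ^ 8) := by
  have h1 := prepareTime_le (p := p) hd hr
  have h2 := setupTime_le hd
  have h3 := decideTime_le (s := s) (N := 2 ^ s) (K := K) (p := p) (d := d)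
    Nat.lt_two_pow_self.le Nat.one_le_two_pow (by omega)
  have h4 : (2 ^ s) ^ 6 ≤ 2 ^ (1000 * s) := by
    rw [← pow_mul]
    exact Nat.pow_le_pow_right two_pos (by omega)
  have h5 : d ^ 2 ≤ d ^ 8 := Nat.pow_le_pow_right hd (by norm_num)
  have h6 : (2 ^ s) ^ 6 * (K + p) ≤ 2 ^ (1000 * s) * (K + p) := Nat.mul_le_mul_right _ h4
  have h7 : 1 * (K + p) ≤ 2 ^ (1000 * s) * (K + p) := Nat.mul_le_mul_right _ Nat.one_le_two_pow
  generalize 2 ^ (1000 * s) * (K + p) = y at *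
  generalize (2 ^ s) ^ 6 * (K + p) = x at *
  generalize d ^ 8 = e at *
  generalize d ^ 2 = e' at *
  omega

end

end

end QMC

theorem mainTheorem6 :
    ∃ (P Q : QMC.Program) (c : ℕ),
      ∀ (JD : QMC.JordanProcedure) {d m : ℕ} (I : QMC.Instance d m),
        I.chain.PeriodicallyStable →
        (I.Admissible (JD _ I.chain.matrixRep) ((JD _ I.chain.matrixRep).truncation I.ε) ∧
          I.SolvedBy JD P (I.input 0) ((JD _ I.chain.matrixRep).truncation I.ε)
            (c * (2 ^ (c * I.formula.size) *
              ((JD _ I.chain.matrixRep).truncation I.ε + I.chain.period) + d ^ 8))) ∧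
        ∀ K : ℕ, I.Admissible (JD _ I.chain.matrixRep) K →
          I.SolvedBy JD Q (I.input K) K
            (c * (2 ^ (c * I.formula.size) * (K + I.chain.period) + d ^ 8)) := by
  refine ⟨.seq QMC.progPrepare (.seq QMC.progTruncation QMC.progDecide),
    .seq QMC.progPrepare QMC.progDecide, 1000, fun JD d m I hG => ?_⟩
  have hd := I.chain.dim_pos
  have hp := (QMC.Chain.period_spec (JD _ I.chain.matrixRep) hG).1
  have hadm := I.admissible_truncation (JD _ I.chain.matrixRep) hG
  refine ⟨⟨hadm, ?_⟩, fun K hK => ?_⟩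
  · obtain ⟨t, M, hE, ht, hM⟩ := QMC.Runs.seq (QMC.runs_progPrepare (JD := JD) hG 0)
      fun M₁ _ h₁ => QMC.Runs.seq (QMC.runs_progTruncation h₁.2 h₁.1)
        fun M₂ _ h₂ => QMC.runs_progDecide hG h₂
    obtain ⟨v, hv, h⟩ := QMC.solvedBy_of_exec hadm hM
    exact ⟨t, M, v, hE, hv, ht.trans (QMC.totalTime_le _ _ _ hd I.chain.numKraus_le hp), h⟩
  · obtain ⟨t, M, hE, ht, hM⟩ := QMC.Runs.seq (QMC.runs_progPrepare (JD := JD) hG K)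
      fun M₁ _ h₁ => QMC.runs_progDecide hG h₁.1
    obtain ⟨v, hv, h⟩ := QMC.solvedBy_of_exec hK hM
    have := QMC.totalTime_le (d := d) I.formula.size K I.chain.period hd I.chain.numKraus_le hp
    exact ⟨t, M, v, hE, hv, by omega, h⟩
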